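/- **Setting.** Let $d\ge 1$, $T>0$, $\alpha\in(1,2]$, $\beta\in\big(\tfrac{2-2\alpha}{3},\tfrac{1-\alpha}{2}\big]$, $\theta\in\big(\tfrac{2-\beta}{2},\beta+\alpha\big)$ and $\epsilon>0$. Let $\nu$ be a finite, non-zero, symmetric measure on the unit sphere $S\subset\mathbb R^d$ whose support spans $\mathbb R^d$, put $\psi(z)=\int_S|\langle z,\xi\rangle|^\alpha\,\nu(d\xi)$, and let $P_t\varphi=\mathcal F^{-1}(e^{-t\psi}\hat\varphi)=\rho_t*\varphi$ with $\rho_t=\mathcal F^{-1}e^{-t\psi}$, extended to Besov distributions block by block (here $\hat\varphi(y)=\int\varphi(x)e^{-2\pi i\langle x,y\rangle}dx$). Put $J^Tv(t)=\int_t^TP_{r-t}v(r)\,dr$. Let $(p_j)_{j\ge-1}$ be a smooth dyadic partition of unity: $p_{-1},p_0\ge0$ are smooth and radial, $\operatorname{supp}p_{-1}\subset\{|x|\le R\}$, $\operatorname{supp}p_0\subset\{a\le|x|\le b\}$ with $a>0$, $R<2a$, $b<4a$, $p_j=p_0(2^{-j}\cdot)$ for $j\ge0$, and $\sum_{j\ge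 -1}p_j=1$. Let $\Delta_ju=\mathcal F^{-1}(p_j\mathcal Fu)$, $\|u\|_\gamma=\sup_{j\ge-1}2^{j\gamma}\|\Delta_ju\|_{L^\infty}$, and let $\mathscr C^\gamma$ be the space of Schwartz distributions with $\|u\|_\gamma<\infty$ and $2^{j\gamma}\|\Delta_ju\|_{L^\infty}\to0$ as $j\to\infty$. Let $C_T\mathscr C^\gamma=C([0,T],\mathscr C^\gamma)$ with the supremum norm, and let $C_T^{\rho}L^\infty$ be the space of $\rho$-Hölder maps $[0,T]\to L^\infty$ with norm $\sup_{s<t}\|u(t)-u(s)\|_{L^\infty}(t-s)^{-\rho}+\sup_t\|u(t)\|_{L^\infty}$. Write $u\prec v=\sum_j\sum_{i\le j-2}\Delta_iu\,\Delta_jv$, $u\succ v=v\prec u$, $u\odot v=\sum_{|i-j|\le1}\Delta_iu\,\Delta_jv$, $uv=u\prec v+u\succ v+u\odot v$, and let $\mathcal R(f,g,h)=(f\prec g)\odot h-f(g\odot h)$, extended continuously from smooth functions, that is $\mathcal R(f,g,h)=\sum_{|i-j|\le1}\big(\Delta_i(f\prec g)-f\Delta_ig\big)\Delta_jh$. *Enhanced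 drifts.* $\mathcal X^\beta$ is the closure of $\{(\eta,(J^T(\partial_j\eta^i)\odot\eta^j)_{i,j\le d}):\eta\in C([0,T],C_b^\infty(\mathbb R^d,\mathbb R^d))\}$ in $C([0,T],(\mathscr C^\beta)^d)\times C([0,T],(\mathscr C^{2\beta+\alpha-1})^{d\times d})$. Its elements are written $\mathcal V=(\mathcal V_1,\mathcal V_2)$. *Paracontrolled distributions.* $\mathcal D^\theta(\mathcal V_1)$ is the set of pairs $(u,u')$ with $u\in C_T\mathscr C^\theta\cap C_T^{\theta/\alpha}L^\infty$, $u'\in (C_T\mathscr C^{\theta-1})^d$ and $u^\sharp:=u-\sum_iu'^{,i}\prec J^T(\mathcal V_1^i)\in C_T\mathscr C^{2\theta-1}$. For such a pair put $U^{\sharp,j}=\partial_ju^\sharp+\sum_i\partial_ju'^{,i}\prec J^T(\mathcal V_1^i)$ and $$\nabla u\cdot\mathcal V=\sum_j\big(\partial_ju\prec\mathcal V_1^j+\partial_ju\succ\mathcal V_1^j\big)+\sum_{i,j}u'^{,i}\mathcal V_2^{i,j}+\sum_{i,j}\mathcal R\big(u'^{,i},J^T(\partial_j\mathcal V_1^i),\mathcal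 V_1^j\big)+\sum_jU^{\sharp,j}\odot\mathcal V_1^j .$$ *Solutions.* The right-hand side $f$ is either an element of $C_T\mathscr C^\epsilon$ or one of the components $\mathcal V_1^j$, $1\le j\le d$ of the drift (the two kinds are kept apart: the domain is a disjoint union). Given $u^T\in\mathscr C^{2\theta-1}$, $\mathcal V\in\mathcal X^\beta$ and such an $f$, a solution of the Kolmogorov backward equation $\partial_tu=\mathcal L u-\mathcal V\cdot\nabla u+f$, $u(T)=u^T$ (where $-\mathcal L$ generates $(P_t)$) is a function $u$ for which there is $u'$ with $(u,u')\in\mathcal D^\theta(\mathcal V_1)$ such that for all $t\in[0,T]$ $$u(t)=P_{T-t}u^T-J^T(f)(t)+J^T(\nabla u\cdot\mathcal V)(t),$$ and $u'=\nabla u$ if $f\in C_T\mathscr C^\epsilon$, $u'=\nabla u-e_j$ if $f=\mathcal V_1^j$. **Theorem.** For all such data $(u^T,\mathcal V,f)$ there is exactly one solution $u$ on $[0,T]$, and the solution map $$(u^T,\mathcal V,f)\in\mathscr C^{2\theta-1}\times\mathcal X^\beta\times\big(C_T\mathscr C^\epsilon\sqcup\{\mathcal V_1^1,\dots,\mathcal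 V_1^d\}\big)\longmapsto u\in C_T\mathscr C^\theta\cap C_T^{\theta/\alpha}L^\infty,$$ the target being equipped with the sum of the two norms, is locally Lipschitz continuous, in the sense that it is Lipschitz on bounded sets of data: for every $R$ there is $K$ such that, whenever $u,v$ are the solutions for data $(u^T,\mathcal V,f)$, $(v^T,\mathcal W,g)$ with $f,g\in C_T\mathscr C^\epsilon$ and all norms of the data at most $R$, $$\|u-v\|_{C_T\mathscr C^\theta}+\|u-v\|_{C_T^{\theta/\alpha}L^\infty}\le K\big(\|u^T-v^T\|_{2\theta-1}+\|\mathcal V-\mathcal W\|_{\mathcal X^\beta}+\|f-g\|_{C_T\mathscr C^\epsilon}\big),$$ and likewise, for each $j$, for $f=\mathcal V_1^j$, $g=\mathcal W_1^j$, with the term $\|f-g\|$ omitted. -/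

import Mathlib

open MeasureTheory Filter Topology Set
open scoped ENNReal NNReal SchwartzMap FourierTransform LineDeriv ContDiff

noncomputable section

namespace RoughKolmogorov

/-- The state space `ℝ^d` with its Euclidean norm. -/
abbrev Space (d : ℕ) : Type := EuclideanSpace ℝ (Fin d)

/-- Schwartz distributions on `ℝ^d`. -/
abbrev Distr (d : ℕ) : Type := 𝓢'(Space d, ℂ)

/-! ### Distributions given by their values on test functions -/

/-- The Schwartz distribution `φ ↦ F φ`, if this map is a Schwartz distribution (and `0`
otherwise). -/
def ofPairing {d : ℕ} (F : 𝓢(Space d, ℂ) → ℂ) : Distr d :=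
  open Classical in
  if h : ∃ w : Distr d, ∀ φ : 𝓢(Space d, ℂ), w φ = F φ then h.choose else 0

theorem ofPairing_apply {d : ℕ} {F : 𝓢(Space d, ℂ) → ℂ}
    (h : ∃ w : Distr d, ∀ φ : 𝓢(Space d, ℂ), w φ = F φ) (φ : 𝓢(Space d, ℂ)) :
    ofPairing F φ = F φ := by
  unfold ofPairing
  rw [dif_pos h]
  exact h.choose_spec φ

/-- The distribution `φ ↦ ∫ φ g` given by a function `g`. -/
def ofFun {d : ℕ} (g : Space d → ℂ) : Distr d :=
  ofPairing fun φ => ∫ x, φ x * g x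

/-- The function representing a distribution that lies in `L^∞` (and `0` for a distribution that
does not); it is unique up to null sets. -/
def toFun {d : ℕ} (u : Distr d) : Space d → ℂ :=
  open Classical in
  if h : ∃ g : Lp ℂ ⊤ (volume : Measure (Space d)), Lp.toTemperedDistribution g = u
  then (h.choose : Space d → ℂ) else 0

/-- The `L^∞` norm of a distribution, `∞` if the distribution is not in `L^∞`. -/
def linftyNorm {d : ℕ} (u : Distr d) : ℝ≥0∞ :=
  ⨅ (g : Lp ℂ ⊤ (volume : Measure (Space d))) (_ : Lp.toTemperedDistribution g = u), ‖g‖ₑ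

/-- The partial derivative `∂_i u` in the sense of distributions. -/
def partialD {d : ℕ} (i : Fin d) (u : Distr d) : Distr d :=
  ∂_{(EuclideanSpace.single i 1 : Space d)} u

/-! ### Littlewood–Paley theory -/

/-- A smooth dyadic partition of unity: `low` is `p_{-1}` and `ann` is `p_0`.  The ball and the
annulus that carry them are such that the dilated annuli `2^i 𝒜` and `2^j 𝒜` are disjoint for
`|i - j| > 1`, and the ball is disjoint from `2^j 𝒜` for `j ≥ 1`. -/
structure DyadicPartition (d : ℕ) where
  low : Space d → ℝ
  ann : Space d → ℝ
  low_smooth : ContDiff ℝ ∞ low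
  ann_smooth : ContDiff ℝ ∞ ann
  low_nonneg : ∀ x, 0 ≤ low x
  ann_nonneg : ∀ x, 0 ≤ ann x
  low_radial : ∀ x y, ‖x‖ = ‖y‖ → low x = low y
  ann_radial : ∀ x y, ‖x‖ = ‖y‖ → ann x = ann y
  supports : ∃ R a b : ℝ, 0 < a ∧ R < 2 * a ∧ b < 4 * a ∧
    tsupport low ⊆ {x | ‖x‖ ≤ R} ∧ tsupport ann ⊆ {x | a ≤ ‖x‖ ∧ ‖x‖ ≤ b}
  sum_eq_one : ∀ x, HasSum (fun j : ℕ => ann (((2 : ℝ) ^ j)⁻¹ • x)) (1 - low x)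

variable {d : ℕ}

/-- The function `p_{n-1}`: the index is shifted by one, so that it runs through `ℕ`. -/
def DyadicPartition.p (χ : DyadicPartition d) : ℕ → Space d → ℝ
  | 0 => χ.low
  | j + 1 => fun x => χ.ann (((2 : ℝ) ^ j)⁻¹ • x)

/-- The Littlewood–Paley block `Δ_{n-1} u = 𝓕⁻¹ (p_{n-1} 𝓕 u)`. -/
def block (χ : DyadicPartition d) (n : ℕ) (u : Distr d) : Distr d :=
  TemperedDistribution.fourierMultiplierCLM ℂ (fun x => (χ.p n x : ℂ)) u

/-- The block `Δ_{n-1} u` as a function (for `u` in a Besov space it is bounded). -/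
def blockFun (χ : DyadicPartition d) (n : ℕ) (u : Distr d) : Space d → ℂ :=
  toFun (block χ n u)

/-- The weight `2^{(n-1)θ}` of the block with index `n - 1`. -/
def weight (θ : ℝ) (n : ℕ) : ℝ≥0∞ := ENNReal.ofReal ((2 : ℝ) ^ (((n : ℝ) - 1) * θ))

/-- The norm of `B^θ_{∞,∞}`. -/
def besovNorm (χ : DyadicPartition d) (θ : ℝ) (u : Distr d) : ℝ≥0∞ :=
  ⨆ n : ℕ, weight θ n * linftyNorm (block χ n u)

/-- The space `𝒞^θ`: the elements of `B^θ_{∞,∞}` with `2^{jθ} ‖Δ_j u‖_∞ → 0`. -/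
def MemC (χ : DyadicPartition d) (θ : ℝ) (u : Distr d) : Prop :=
  besovNorm χ θ u < ⊤ ∧
    Tendsto (fun n : ℕ => weight θ n * linftyNorm (block χ n u)) atTop (𝓝 0)

/-- The paraproduct `u ≺ v = ∑_j S_{j-1} u Δ_j v`, `S_{j-1} u = ∑_{i ≤ j-2} Δ_i u`;
moreover `u ≻ v = v ≺ u`. -/
def para (χ : DyadicPartition d) (u v : Distr d) : Distr d :=
  ofPairing fun φ => ∑' n : ℕ,
    ∫ x, φ x * ((∑ m ∈ Finset.range (n - 1), blockFun χ m u x) * blockFun χ n v x)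

/-- The resonant product `u ⊙ v = ∑_{|i-j| ≤ 1} Δ_i u Δ_j v`. -/
def reso (χ : DyadicPartition d) (u v : Distr d) : Distr d :=
  ofPairing fun φ => ∑' n : ℕ,
    ∫ x, φ x * ((∑ m ∈ Finset.Icc (n - 1) (n + 1), blockFun χ m u x) * blockFun χ n v x)

/-- The product `u v = u ≺ v + u ≻ v + u ⊙ v`. -/
def bonyProd (χ : DyadicPartition d) (u v : Distr d) : Distr d :=
  para χ u v + para χ v u + reso χ u v

/-- The commutator `ℛ(f, g, h) = (f ≺ g) ⊙ h - f (g ⊙ h)`.  Each of the two terms may be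
ill defined when the sum of the regularities of `g` and `h` is not positive; `ℛ` is then the
continuous extension from smooth functions, which is given by taking the difference block by block:
`∑_{|i-j| ≤ 1} (Δ_i (f ≺ g) - f Δ_i g) Δ_j h`, with a bounded function `f`. -/
def comm (χ : DyadicPartition d) (f g h : Distr d) : Distr d :=
  ofPairing fun φ => ∑' n : ℕ,
    ∫ x, φ x * ((∑ m ∈ Finset.Icc (n - 1) (n + 1),
      (blockFun χ m (para χ f g) x - toFun f x * blockFun χ m g x)) * blockFun χ n h x)

/-! ### Functions of time with values in a space of distributions -/

/-- `u ∈ C_T 𝒞^θ = C([0,T], 𝒞^θ)`. -/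
def MemCT (χ : DyadicPartition d) (T θ : ℝ) (u : ℝ → Distr d) : Prop :=
  (∀ t ∈ Icc 0 T, MemC χ θ (u t)) ∧
    ∀ t ∈ Icc 0 T, Tendsto (fun s => besovNorm χ θ (u s - u t)) (𝓝[Icc 0 T] t) (𝓝 0)

/-- The norm of `C_T 𝒞^θ`. -/
def normCT (χ : DyadicPartition d) (T θ : ℝ) (u : ℝ → Distr d) : ℝ≥0∞ :=
  ⨆ t ∈ Icc 0 T, besovNorm χ θ (u t)

/-- The norm of `C_T^ρ L^∞ = C^ρ([0,T], L^∞)`; this space consists of the `u` with finite norm. -/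
def normHolder (T ρ : ℝ) (u : ℝ → Distr d) : ℝ≥0∞ :=
  (⨆ s ∈ Icc 0 T, ⨆ t ∈ Ioc s T, linftyNorm (u t - u s) / ENNReal.ofReal ((t - s) ^ ρ)) +
    ⨆ t ∈ Icc 0 T, linftyNorm (u t)

/-! ### The stable semigroup -/

/-- `ψ(z) = ∫_S |⟨z, ξ⟩|^α ν(dξ)`. -/
def symbol (α : ℝ) (ν : Measure (Metric.sphere (0 : Space d) 1)) (z : Space d) : ℝ :=
  ∫ ξ, |inner ℝ z (ξ : Space d)| ^ α ∂ν

/-- The transition density `ρ_t = 𝓕⁻¹ (e^{-tψ})`, `t > 0`. -/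
def density (α : ℝ) (ν : Measure (Metric.sphere (0 : Space d) 1)) (t : ℝ) : Space d → ℂ :=
  𝓕⁻ fun z : Space d => (Real.exp (-t * symbol α ν z) : ℂ)

/-- The semigroup `P_t`, `t ≥ 0`.  For `t > 0` it is convolution with `ρ_t`; on a distribution in a
Besov space, of any regularity, this convolution is taken on each (bounded) Littlewood–Paley
block. -/
def semigroup (χ : DyadicPartition d) (α : ℝ) (ν : Measure (Metric.sphere (0 : Space d) 1))
    (t : ℝ) (u : Distr d) : Distr d :=
  open Classical in
  if t = 0 then u else
    ofPairing fun φ => ∑' n : ℕ,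
      ∫ x, φ x * ∫ y, density α ν t y * blockFun χ n u (x - y)

/-- `J^T v (t) = ∫_t^T P_{r-t} v(r) dr`. -/
def J (χ : DyadicPartition d) (α : ℝ) (ν : Measure (Metric.sphere (0 : Space d) 1))
    (T : ℝ) (v : ℝ → Distr d) (t : ℝ) : Distr d :=
  ofPairing fun φ => ∫ r in t..T, semigroup χ α ν (r - t) (v r) φ

/-! ### Enhanced drifts -/

/-- A pair `(𝒱₁, 𝒱₂)` of a vector field and a matrix field, depending on time. -/
structure DriftPair (d : ℕ) where
  fst : Fin d → ℝ → Distr d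
  snd : Fin d → Fin d → ℝ → Distr d

instance : Sub (DriftPair d) where
  sub V W := ⟨fun i t => V.fst i t - W.fst i t, fun i j t => V.snd i j t - W.snd i j t⟩

/-- The norm of `C_T 𝒞^β_{ℝ^d} × C_T 𝒞^{2β+α-1}_{ℝ^{d²}}`. -/
def driftNorm (χ : DyadicPartition d) (α T β : ℝ) (V : DriftPair d) : ℝ≥0∞ :=
  (⨆ i, normCT χ T β (V.fst i)) + ⨆ i, ⨆ j, normCT χ T (2 * β + α - 1) (V.snd i j)

/-- `η ∈ C_T C_b^∞(ℝ^d, ℝ^d)`. -/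
def MemCTSmooth (T : ℝ) (η : ℝ → Space d → Space d) : Prop :=
  (∀ t ∈ Icc 0 T, ContDiff ℝ ∞ (η t) ∧
    ∀ k : ℕ, ∃ C : ℝ, ∀ x, ‖iteratedFDeriv ℝ k (η t) x‖ ≤ C) ∧
  ∀ t ∈ Icc 0 T, ∀ k : ℕ, ∀ δ > 0, ∀ᶠ s in 𝓝[Icc 0 T] t,
    ∀ x, ‖iteratedFDeriv ℝ k (η s) x - iteratedFDeriv ℝ k (η t) x‖ ≤ δ

/-- The canonical lift `𝒦(η) = (η, (J^T(∂_j η^i) ⊙ η^j)_{i,j})`. -/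
def lift (χ : DyadicPartition d) (α : ℝ) (ν : Measure (Metric.sphere (0 : Space d) 1))
    (T : ℝ) (η : ℝ → Space d → Space d) : DriftPair d :=
  let H : Fin d → ℝ → Distr d := fun i t => ofFun fun x => ((η t x i : ℝ) : ℂ)
  { fst := H
    snd := fun i j t => reso χ (J χ α ν T (fun r => partialD j (H i r)) t) (H j t) }

/-- `𝒱 ∈ 𝒳^β`, in the rough regime: the closure of the canonical lifts of smooth drifts in
`C_T 𝒞^β_{ℝ^d} × C_T 𝒞^{2β+α-1}_{ℝ^{d²}}`. -/
def MemX (χ : DyadicPartition d) (α : ℝ) (ν : Measure (Metric.sphere (0 : Space d) 1))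
    (T β : ℝ) (V : DriftPair d) : Prop :=
  (∀ i, MemCT χ T β (V.fst i)) ∧ (∀ i j, MemCT χ T (2 * β + α - 1) (V.snd i j)) ∧
    ∀ δ : ℝ≥0∞, 0 < δ → ∃ η : ℝ → Space d → Space d,
      MemCTSmooth T η ∧ driftNorm χ α T β (V - lift χ α ν T η) < δ

/-! ### Paracontrolled distributions and the fixed point map -/

/-- `u^♯ = u - u' ≺ J^T(V)`. -/
def sharp (χ : DyadicPartition d) (α : ℝ) (ν : Measure (Metric.sphere (0 : Space d) 1))
    (T : ℝ) (V : Fin d → ℝ → Distr d) (u : ℝ → Distr d) (u' : Fin d → ℝ → Distr d)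
    (t : ℝ) : Distr d :=
  u t - ∑ i, para χ (u' i t) (J χ α ν T (V i) t)

/-- `(u, u') ∈ 𝒟^θ_{T,T}(V)`: the pair is paracontrolled by `J^T(V)` on `[0,T]`. -/
structure Paracontrolled (χ : DyadicPartition d) (α : ℝ)
    (ν : Measure (Metric.sphere (0 : Space d) 1)) (T θ : ℝ) (V : Fin d → ℝ → Distr d)
    (u : ℝ → Distr d) (u' : Fin d → ℝ → Distr d) : Prop where
  mem : MemCT χ T θ u
  holder : normHolder T (θ / α) u < ⊤
  mem_deriv : ∀ i, MemCT χ T (θ - 1) (u' i)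
  mem_sharp : MemCT χ T (2 * θ - 1) (sharp χ α ν T V u u')

/-- `U^{♯,j} = ∂_j u^♯ + ∑_i ∂_j u'^i ≺ J^T(V^i)`. -/
def gradSharp (χ : DyadicPartition d) (α : ℝ) (ν : Measure (Metric.sphere (0 : Space d) 1))
    (T : ℝ) (V : Fin d → ℝ → Distr d) (u : ℝ → Distr d) (u' : Fin d → ℝ → Distr d)
    (j : Fin d) (t : ℝ) : Distr d :=
  partialD j (sharp χ α ν T V u u' t) +
    ∑ i, para χ (partialD j (u' i t)) (J χ α ν T (V i) t)

/-- The resonant product `∇u ⊙ 𝒱` of a paracontrolled distribution and an enhanced drift. -/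
def gradReso (χ : DyadicPartition d) (α : ℝ) (ν : Measure (Metric.sphere (0 : Space d) 1))
    (T : ℝ) (V : DriftPair d) (u : ℝ → Distr d) (u' : Fin d → ℝ → Distr d) (t : ℝ) : Distr d :=
  (∑ i, ∑ j, bonyProd χ (u' i t) (V.snd i j t)) +
    (∑ i, ∑ j, comm χ (u' i t) (J χ α ν T (fun r => partialD j (V.fst i r)) t) (V.fst j t)) +
    ∑ j, reso χ (gradSharp χ α ν T V.fst u u' j t) (V.fst j t)

/-- The product `∇u · 𝒱 = ∇u ≺ 𝒱₁ + ∇u ≻ 𝒱₁ + ∇u ⊙ 𝒱`. -/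
def gradProd (χ : DyadicPartition d) (α : ℝ) (ν : Measure (Metric.sphere (0 : Space d) 1))
    (T : ℝ) (V : DriftPair d) (u : ℝ → Distr d) (u' : Fin d → ℝ → Distr d) (t : ℝ) : Distr d :=
  (∑ j, para χ (partialD j (u t)) (V.fst j t)) + (∑ j, para χ (V.fst j t) (partialD j (u t))) +
    gradReso χ α ν T V u u' t

/-- The right-hand side of the equation: either a given `f`, or a component `𝒱₁^j` of the drift.
The two kinds are kept apart, because they lead to different paracontrolled derivatives (and, if
`𝒱₂` is not the canonical resonant product, to different solutions). -/
inductive Source (d : ℕ) where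
  | field (f : ℝ → Distr d)
  | drift (j : Fin d)

/-- The right-hand side as a function of time with values in the distributions. -/
def Source.path (V : DriftPair d) : Source d → ℝ → Distr d
  | .field f => f
  | .drift j => V.fst j

/-- The admissible right-hand sides: `C_T 𝒞^ε` and the components of the drift. -/
def Source.Admissible (χ : DyadicPartition d) (T ε : ℝ) : Source d → Prop
  | .field f => MemCT χ T ε f
  | .drift _ => True

/-- The first component `-J^T(f) + J^T(∇u · 𝒱) + P_{T-t} u^T` of the fixed point map. -/
def fixedPointMap (χ : DyadicPartition d) (α : ℝ)
    (ν : Measure (Metric.sphere (0 : Space d) 1)) (T : ℝ) (uT : Distr d) (V : DriftPair d)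
    (F : Source d) (u : ℝ → Distr d) (u' : Fin d → ℝ → Distr d) (t : ℝ) : Distr d :=
  -J χ α ν T (F.path V) t + J χ α ν T (gradProd χ α ν T V u u') t + semigroup χ α ν (T - t) uT

/-- The second component of the fixed point map: `∇u`, or `∇u - e_j` if the right-hand side is
`𝒱₁^j`. -/
def fixedPointMapDeriv (F : Source d) (u : ℝ → Distr d) (i : Fin d) (t : ℝ) : Distr d :=
  match F with
  | .field _ => partialD i (u t)
  | .drift j => partialD i (u t) - ofFun fun _ => if i = j then 1 else 0

/-- `u` is a (paracontrolled, mild) solution of `(∂_t - ℒ + 𝒱·∇) u = f`, `u(T) = u^T` on `[0,T]`: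
with a suitable `u'`, it is a fixed point in `𝒟^θ_{T,T}(𝒱₁)`. -/
def IsSolution (χ : DyadicPartition d) (α : ℝ)
    (ν : Measure (Metric.sphere (0 : Space d) 1)) (T θ : ℝ) (uT : Distr d) (V : DriftPair d)
    (F : Source d) (u : ℝ → Distr d) : Prop :=
  ∃ u' : Fin d → ℝ → Distr d, Paracontrolled χ α ν T θ V.fst u u' ∧
    ∀ t ∈ Icc 0 T, u t = fixedPointMap χ α ν T uT V F u u' t ∧
      ∀ i, u' i t = fixedPointMapDeriv F u i t

/-- The norm of `C_T 𝒞^θ ∩ C_T^{θ/α} L^∞`, the sum of the two norms. -/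
def solutionNorm (χ : DyadicPartition d) (α T θ : ℝ) (u : ℝ → Distr d) : ℝ≥0∞ :=
  normCT χ T θ u + normHolder T (θ / α) u

end RoughKolmogorov

end

open RoughKolmogorov

noncomputable section

namespace RoughKolmogorov

open scoped Real
open Real (exp cos norm_of_nonneg rpow_nonneg rpow_add fourier_eq rpow_one rpow_neg rpow_mul
  mul_rpow rpow_le_rpow_of_exponent_le rpow_natCast exp_add exp_pos cos_le_one zero_rpow)
open Finset (sum_congr sum_sub_distrib sum_le_sum mul_sum sum_mul sum_insert sum_const sum_nonneg
  sum_le_card_nsmul single_le_sum)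
open TemperedDistribution (fourierMultiplierCLM_apply_apply)
open SchwartzMap (smulLeftCLM fourier_coe smulLeftCLM_apply_apply)
open FourierTransform (fourier_fourierInv_eq)
open ContinuousLinearMap (intervalIntegral_comp_comm)
open BoundedContinuousFunction (coe_sum coe_ofNormedAddCommGroup)
open Complex (norm_real ofRealCLM)
open ENNReal (toReal_ofReal toReal_nonneg)

section

variable {d : ℕ}

/-- The unit sphere. -/
abbrev Sphere (d : ℕ) : Set (Space d) := Metric.sphere 0 1

/-- The index `α` lies in `(1, 2]` and the support of `ν` spans the space. -/
class Stable (α : outParam ℝ) (ν : Measure (Sphere d)) : Prop where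
  index : α ∈ Ioc 1 2
  spans : Submodule.span ℝ (Subtype.val '' ν.support) = ⊤

/-! ### Convolution operators on bounded continuous functions -/

/-- Bounded continuous functions on `ℝ^d`. -/
abbrev Bdd (d : ℕ) : Type := BoundedContinuousFunction (Space d) ℂ

/-- Sequences of bounded functions. -/
abbrev BSeq (d : ℕ) : Type := ℕ → Bdd d

/-- Paths of sequences of bounded functions. -/
abbrev BPath (d : ℕ) : Type := ℝ → ℕ → Bdd d

variable {f g k l m n : Space d → ℂ} {A A' B B' δ : ℝ} {F G : Bdd d}

theorem integrable_kernel_mul (hk : Integrable k) (f : Bdd d) (x : Space d) :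
    Integrable fun y => k y * f (x - y) :=
  hk.mul_bdd (c := ‖f‖) (f.continuous.comp (by fun_prop)).aestronglyMeasurable
    (.of_forall fun y => f.norm_coe_le_norm _)

theorem continuous_conv (hk : Integrable k) (f : Bdd d) :
    Continuous fun x => ∫ y, k y * f (x - y) := by
  have := BddAbove.continuous_convolution_right_of_integrable (μ := volume)
    (ContinuousLinearMap.mul ℂ ℂ) (f := k) (g := f)
    ⟨‖f‖, by rintro _ ⟨x, rfl⟩; exact f.norm_coe_le_norm x⟩ hk f.continuous
  exact this

theorem norm_conv_le (hk : Integrable k) (f : Bdd d) (x : Space d) :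
    ‖∫ y, k y * f (x - y)‖ ≤ (∫ y, ‖k y‖) * ‖f‖ := by
  rw [← integral_mul_const]
  refine norm_integral_le_of_norm_le (hk.norm.mul_const _) (.of_forall fun y => ?_)
  rw [norm_mul]
  exact mul_le_mul_of_nonneg_left (f.norm_coe_le_norm _) (norm_nonneg _)

/-- Convolution with an integrable kernel, as an operator on bounded continuous functions. -/
def convCLM (k : Space d → ℂ) (hk : Integrable k) : Bdd d →L[ℂ] Bdd d :=
  LinearMap.mkContinuous
    { toFun := fun f => BoundedContinuousFunction.ofNormedAddCommGroup _ (continuous_conv hk f)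
        ((∫ y, ‖k y‖) * ‖f‖) (norm_conv_le hk f)
      map_add' := fun f g => by
        ext x
        simp only [coe_ofNormedAddCommGroup,
          BoundedContinuousFunction.coe_add, Pi.add_apply, mul_add]
        exact integral_add (integrable_kernel_mul hk f x) (integrable_kernel_mul hk g x)
      map_smul' := fun c f => by
        ext x
        simp only [coe_ofNormedAddCommGroup,
          BoundedContinuousFunction.coe_smul, smul_eq_mul, RingHom.id_apply]
        rw [← integral_const_mul]
        congr 1
        ext y
        ring }
    (∫ y, ‖k y‖) fun f => by
      refine (BoundedContinuousFunction.norm_le (by positivity)).2 fun x => ?_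
      exact norm_conv_le hk f x

theorem convCLM_apply (k : Space d → ℂ) (hk : Integrable k) (f : Bdd d) (x : Space d) :
    convCLM k hk f x = ∫ y, k y * f (x - y) := rfl

theorem norm_convCLM_le (k : Space d → ℂ) (hk : Integrable k) (f : Bdd d) :
    ‖convCLM k hk f‖ ≤ (∫ y, ‖k y‖) * ‖f‖ :=
  (BoundedContinuousFunction.norm_le (by positivity)).2 (norm_conv_le hk f)

theorem integral_fourier_mul_eq_of_integrable (hf : Integrable f) (hg : Integrable g) :
    ∫ ξ, 𝓕 f ξ * g ξ = ∫ x, f x * 𝓕 g x := by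
  have := VectorFourier.integral_bilin_fourierIntegral_eq_flip (ContinuousLinearMap.mul ℂ ℂ)
    (L := innerₗ (Space d)) (μ := volume) (ν := volume) Real.continuous_fourierChar
    continuous_inner hf hg
  rw [flip_innerₗ] at this
  exact this

theorem ae_eq_of_integral_schwartz_eq (hf : LocallyIntegrable f) (hg : LocallyIntegrable g)
    (h : ∀ φ : 𝓢(Space d, ℂ), HasCompactSupport φ → ∫ x, φ x * f x = ∫ x, φ x * g x) :
    f =ᵐ[volume] g := by
  have key : ∀ᵐ x, (f - g) x = 0 := by
    refine ae_eq_zero_of_integral_contDiff_smul_eq_zero (hf.sub hg) fun φ hφ hc => ?_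
    have hc' : HasCompactSupport (fun x => (φ x : ℂ)) := hc.comp_left (g := Complex.ofReal) rfl
    have hs' : ContDiff ℝ ∞ (fun x => (φ x : ℂ)) := ofRealCLM.contDiff.comp hφ
    have := h (hc'.toSchwartzMap hs') hc'
    have e : ∀ x, hc'.toSchwartzMap hs' x = (φ x : ℂ) := fun x => rfl
    simp only [e] at this
    have i1 : Integrable fun x => φ x • f x :=
      hf.integrable_smul_left_of_hasCompactSupport hφ.continuous hc
    have i2 : Integrable fun x => φ x • g x :=
      hg.integrable_smul_left_of_hasCompactSupport hφ.continuous hc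
    simp only [Pi.sub_apply, smul_sub]
    rw [integral_sub i1 i2]
    simpa [sub_eq_zero, Complex.real_smul] using this
  filter_upwards [key] with x hx
  simpa [sub_eq_zero] using hx

theorem ae_eq_of_fourier_eq (hk : Integrable k) (hl : Integrable l) (h : 𝓕 k = 𝓕 l) :
    k =ᵐ[volume] l := by
  refine ae_eq_of_integral_schwartz_eq hk.locallyIntegrable hl.locallyIntegrable fun φ _ => ?_
  have key : ∀ m : Space d → ℂ, Integrable m → ∫ x, φ x * m x = ∫ ξ, 𝓕 m ξ * (𝓕⁻ φ : 𝓢(Space d, ℂ)) ξ := by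
    intro m hm
    rw [integral_fourier_mul_eq_of_integrable hm (𝓕⁻ φ : 𝓢(Space d, ℂ)).integrable]
    congr 1
    ext x
    have : 𝓕 (⇑(𝓕⁻ φ : 𝓢(Space d, ℂ))) = φ := by rw [← fourier_coe, fourier_fourierInv_eq]
    rw [this, mul_comm]
  rw [key k hk, key l hl, h]

/-- The Fourier multiplier `m`, acting on bounded continuous functions, if `m` is the Fourier
transform of an integrable kernel (and `0` otherwise). -/
def Op (m : Space d → ℂ) : Bdd d →L[ℂ] Bdd d :=
  open Classical in
  if h : ∃ k : Space d → ℂ, Integrable k ∧ 𝓕 k = m then convCLM h.choose h.choose_spec.1 else 0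

theorem Op_eq (hk : Integrable k) (hm : 𝓕 k = m) : Op m = convCLM k hk := by
  have h : ∃ k : Space d → ℂ, Integrable k ∧ 𝓕 k = m := ⟨k, hk, hm⟩
  unfold Op
  rw [dif_pos h]
  have ae := ae_eq_of_fourier_eq h.choose_spec.1 hk (h.choose_spec.2.trans hm.symm)
  ext f x
  rw [convCLM_apply, convCLM_apply]
  refine integral_congr_ae ?_
  filter_upwards [ae] with y hy
  rw [hy]

/-- `m` is the Fourier transform of a kernel `k` with `∫ |k| ≤ A` and `∫ |y| |k(y)| dy ≤ B`. -/
def Ker (m : Space d → ℂ) (A B : ℝ) : Prop :=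
  ∃ k : Space d → ℂ, Integrable k ∧ Integrable (fun y => ‖y‖ * ‖k y‖) ∧ 𝓕 k = m ∧
    ∫ y, ‖k y‖ ≤ A ∧ ∫ y, ‖y‖ * ‖k y‖ ≤ B

theorem Ker.mono (h : Ker m A B) (hA : A ≤ A') (hB : B ≤ B') : Ker m A' B' := by
  obtain ⟨k, h1, h2, h3, h4, h5⟩ := h
  exact ⟨k, h1, h2, h3, h4.trans hA, h5.trans hB⟩

theorem Ker.nonneg_left (h : Ker m A B) : 0 ≤ A := by
  obtain ⟨k, h1, h2, h3, h4, h5⟩ := h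
  exact le_trans (by positivity) h4

theorem Ker.nonneg_right (h : Ker m A B) : 0 ≤ B := by
  obtain ⟨k, h1, h2, h3, h4, h5⟩ := h
  exact le_trans (by positivity) h5

theorem Ker.norm_Op_le (h : Ker m A B) (f : Bdd d) : ‖Op m f‖ ≤ A * ‖f‖ := by
  obtain ⟨k, h1, h2, h3, h4, h5⟩ := h
  rw [Op_eq h1 h3]
  exact (norm_convCLM_le k h1 f).trans (by gcongr)

theorem Ker.norm_le (h : Ker m A B) (z : Space d) : ‖m z‖ ≤ A := by
  obtain ⟨k, h1, h2, h3, h4, h5⟩ := h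
  rw [← h3]
  refine le_trans ?_ h4
  exact VectorFourier.norm_fourierIntegral_le_integral_norm _ _ _ _ _

theorem fourier_add_of_integrable (hk : Integrable k) (hl : Integrable l) :
    𝓕 (k + l) = 𝓕 k + 𝓕 l := by
  exact (VectorFourier.fourierIntegral_add Real.continuous_fourierChar
    (by exact continuous_inner) hk hl)

theorem Ker.add (h : Ker m A B) (h' : Ker n A' B') : Ker (m + n) (A + A') (B + B') := by
  obtain ⟨k, h1, h2, h3, h4, h5⟩ := h
  obtain ⟨l, l1, l2, l3, l4, l5⟩ := h'
  have i2 : Integrable fun y => ‖y‖ * ‖(k + l) y‖ := by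
    refine (h2.add l2).mono (by fun_prop) (.of_forall fun y => ?_)
    simp only [Pi.add_apply, norm_mul, norm_norm]
    rw [norm_of_nonneg (by positivity), ← mul_add]
    gcongr
    exact norm_add_le _ _
  refine ⟨k + l, h1.add l1, i2, ?_, ?_, ?_⟩
  · rw [fourier_add_of_integrable h1 l1, h3, l3]
  · refine le_trans ?_ (add_le_add h4 l4)
    rw [← integral_add h1.norm l1.norm]
    exact integral_mono (h1.add l1).norm (h1.norm.add l1.norm) fun y => norm_add_le _ _
  · refine le_trans ?_ (add_le_add h5 l5)
    rw [← integral_add h2 l2]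
    refine integral_mono i2 (h2.add l2) fun y => ?_
    simp only [Pi.add_apply]
    rw [← mul_add]
    gcongr
    exact norm_add_le _ _

theorem Ker.smul (h : Ker m A B) (c : ℂ) : Ker (c • m) (‖c‖ * A) (‖c‖ * B) := by
  obtain ⟨k, h1, h2, h3, h4, h5⟩ := h
  have e : (fun y => ‖y‖ * ‖(c • k) y‖) = fun y => ‖c‖ * (‖y‖ * ‖k y‖) := by
    ext y
    simp only [Pi.smul_apply, smul_eq_mul, norm_mul]
    ring
  refine ⟨c • k, h1.smul c, ?_, ?_, ?_, ?_⟩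
  · rw [e]; exact h2.const_mul _
  · rw [← h3]
    exact VectorFourier.fourierIntegral_const_smul _ _ _ _ _
  · simp only [Pi.smul_apply, norm_smul]
    rw [integral_const_mul]
    gcongr
  · rw [e, integral_const_mul]
    gcongr

theorem Ker.neg (h : Ker m A B) : Ker (-m) A B := by simpa using h.smul (-1)

theorem Ker.sub (h : Ker m A B) (h' : Ker n A' B') : Ker (m - n) (A + A') (B + B') := by
  rw [sub_eq_add_neg]
  exact h.add h'.neg

theorem Ker.mul (h : Ker m A B) (h' : Ker n A' B') : Ker (m * n) (A * A') (A * B' + B * A') := by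
  obtain ⟨k, h1, h2, h3, h4, h5⟩ := h
  obtain ⟨l, l1, l2, l3, l4, l5⟩ := h'
  set c : Space d → ℂ := convolution k l (ContinuousLinearMap.mul ℂ ℂ) volume with hc
  have hci : Integrable c := h1.integrable_convolution _ l1
  -- the real convolutions that dominate
  have cnv : ∀ a b : Space d → ℝ, Integrable a → Integrable b →
      Integrable (fun x => ∫ y, a y * b (x - y)) ∧
      ∫ x, ∫ y, a y * b (x - y) = (∫ y, a y) * ∫ y, b y := by
    intro a b ha hb
    refine ⟨ha.integrable_convolution (ContinuousLinearMap.mul ℝ ℝ) hb, ?_⟩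
    have := integral_convolution (ContinuousLinearMap.mul ℝ ℝ) ha hb (μ := volume) (ν := volume)
    exact this
  have exi : ∀ a b : Space d → ℝ, Integrable a → Integrable b →
      ∀ᵐ x, Integrable (fun y => a y * b (x - y)) := by
    intro a b ha hb
    exact ha.ae_convolution_exists (ContinuousLinearMap.mul ℝ ℝ) hb (μ := volume) (ν := volume)
  obtain ⟨i0, e0⟩ := cnv _ _ h1.norm l1.norm
  obtain ⟨i1, e1⟩ := cnv _ _ h2 l1.norm
  obtain ⟨i2, e2⟩ := cnv _ _ h1.norm l2
  have b0 : ∀ x, ‖c x‖ ≤ ∫ y, ‖k y‖ * ‖l (x - y)‖ := by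
    intro x
    refine (norm_integral_le_integral_norm _).trans_eq ?_
    simp
  have b1 : ∀ᵐ x, ‖x‖ * ‖c x‖ ≤
      (∫ y, ‖y‖ * ‖k y‖ * ‖l (x - y)‖) + ∫ y, ‖k y‖ * (‖x - y‖ * ‖l (x - y)‖) := by
    filter_upwards [exi _ _ h1.norm l1.norm, exi _ _ h2 l1.norm, exi _ _ h1.norm l2] with x q0 q1 q2
    refine (mul_le_mul_of_nonneg_left (b0 x) (norm_nonneg x)).trans ?_
    rw [← integral_const_mul, ← integral_add q1 q2]
    refine integral_mono (q0.const_mul _) (q1.add q2) fun y => ?_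
    have : ‖x‖ ≤ ‖y‖ + ‖x - y‖ := by
      calc ‖x‖ = ‖y + (x - y)‖ := by congr 1; abel
        _ ≤ _ := norm_add_le _ _
    have p : 0 ≤ ‖k y‖ * ‖l (x - y)‖ := by positivity
    nlinarith
  have hmeas : AEStronglyMeasurable (fun y => ‖y‖ * ‖c y‖) volume :=
    continuous_norm.aestronglyMeasurable.mul hci.aestronglyMeasurable.norm
  refine ⟨c, hci, ?_, ?_, ?_, ?_⟩
  · refine (i1.add i2).mono' hmeas ?_
    filter_upwards [b1] with x hx
    rw [norm_of_nonneg (by positivity)]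
    exact hx
  · ext ξ
    rw [hc, Real.fourier_mul_convolution_eq h1 l1, h3, l3]
    rfl
  · calc ∫ x, ‖c x‖ ≤ ∫ x, ∫ y, ‖k y‖ * ‖l (x - y)‖ := integral_mono hci.norm i0 b0
      _ = (∫ y, ‖k y‖) * ∫ y, ‖l y‖ := e0
      _ ≤ A * A' := by gcongr; exact le_trans (by positivity) h4
  · calc ∫ x, ‖x‖ * ‖c x‖
        ≤ ∫ x, ((∫ y, ‖y‖ * ‖k y‖ * ‖l (x - y)‖) + ∫ y, ‖k y‖ * (‖x - y‖ * ‖l (x - y)‖)) := by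
          refine integral_mono_ae ?_ (i1.add i2) b1
          refine (i1.add i2).mono' hmeas ?_
          filter_upwards [b1] with x hx
          rw [norm_of_nonneg (by positivity)]
          exact hx
      _ = (∫ y, ‖y‖ * ‖k y‖) * (∫ y, ‖l y‖) + (∫ y, ‖k y‖) * ∫ y, ‖y‖ * ‖l y‖ := by
          rw [integral_add i1 i2, e1, e2]
      _ ≤ B * A' + A * B' := by
          have hA : 0 ≤ A := le_trans (by positivity) h4
          have hB : 0 ≤ B := le_trans (by positivity) h5
          gcongr
      _ = A * B' + B * A' := by ring

theorem Op_mul (h : Ker m A B) (h' : Ker n A' B') (f : Bdd d) : Op (m * n) f = Op m (Op n f) := by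
  obtain ⟨k, h1, h2, h3, h4, h5⟩ := h
  obtain ⟨l, l1, l2, l3, l4, l5⟩ := h'
  set c : Space d → ℂ := convolution k l (ContinuousLinearMap.mul ℂ ℂ) volume with hc
  have hci : Integrable c := h1.integrable_convolution _ l1
  have hcf : 𝓕 c = m * n := by
    ext ξ
    rw [hc, Real.fourier_mul_convolution_eq h1 l1, h3, l3]
    rfl
  rw [Op_eq hci hcf, Op_eq h1 h3, Op_eq l1 l3]
  ext x
  rw [convCLM_apply, convCLM_apply]
  have key := convolution_assoc (μ := volume) (ν := volume) (f := k) (g := l) (k := f) (x₀ := x)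
    (ContinuousLinearMap.mul ℂ ℂ) (ContinuousLinearMap.mul ℂ ℂ) (ContinuousLinearMap.mul ℂ ℂ)
    (ContinuousLinearMap.mul ℂ ℂ) (by intro a b c; simp [mul_assoc])
    h1.aestronglyMeasurable l1.aestronglyMeasurable f.continuous.aestronglyMeasurable
    (h1.ae_convolution_exists _ l1) ?_ ?_
  · exact key
  · refine .of_forall fun y => ?_
    have := (integrable_kernel_mul l1 f y).norm
    simpa [ConvolutionExistsAt] using this
  · have hcont : Continuous (convolution (fun x => ‖l x‖) (fun x => ‖f x‖)
        (ContinuousLinearMap.mul ℝ ℝ) volume) := by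
      refine BddAbove.continuous_convolution_right_of_integrable _
        ⟨‖f‖, ?_⟩ l1.norm f.continuous.norm
      rintro _ ⟨x, rfl⟩
      simpa using f.norm_coe_le_norm x
    have hb : ∀ y, ‖convolution (fun x => ‖l x‖) (fun x => ‖f x‖)
        (ContinuousLinearMap.mul ℝ ℝ) volume y‖ ≤ (∫ y, ‖l y‖) * ‖f‖ := by
      intro y
      rw [← integral_mul_const]
      refine norm_integral_le_of_norm_le (l1.norm.mul_const _) (.of_forall fun z => ?_)
      simp only [ContinuousLinearMap.mul_apply', norm_mul, norm_norm]
      gcongr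
      exact f.norm_coe_le_norm _
    refine h1.norm.mul_bdd (c := (∫ y, ‖l y‖) * ‖f‖) ?_ (.of_forall fun y => hb _)
    exact (hcont.comp (by fun_prop)).aestronglyMeasurable

theorem Ker.Op_add (h : Ker m A B) (h' : Ker n A' B') (f : Bdd d) :
    Op (m + n) f = Op m f + Op n f := by
  obtain ⟨k, h1, h2, h3, h4, h5⟩ := h
  obtain ⟨l, l1, l2, l3, l4, l5⟩ := h'
  rw [Op_eq (h1.add l1) (by rw [fourier_add_of_integrable h1 l1, h3, l3]), Op_eq h1 h3,
    Op_eq l1 l3]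
  ext x
  simp only [convCLM_apply, BoundedContinuousFunction.coe_add, Pi.add_apply, add_mul]
  exact integral_add (integrable_kernel_mul h1 f x) (integrable_kernel_mul l1 f x)

theorem Ker.zero : Ker (0 : Space d → ℂ) 0 0 := by
  refine ⟨0, integrable_zero _ _ _, by simp, ?_, by simp, by simp⟩
  ext ξ
  simp [fourier_eq]

theorem Op_zero (f : Bdd d) : Op (0 : Space d → ℂ) f = 0 := by
  have := (Ker.zero (d := d)).norm_Op_le f
  simpa using this

theorem Ker.finset_sum {ι : Type*} (s : Finset ι) {m : ι → Space d → ℂ} {A B : ι → ℝ}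
    (h : ∀ i ∈ s, Ker (m i) (A i) (B i)) : Ker (∑ i ∈ s, m i) (∑ i ∈ s, A i) (∑ i ∈ s, B i) := by
  classical
  induction s using Finset.induction_on with
  | empty => simpa using Ker.zero
  | insert a s ha ih =>
    rw [sum_insert ha, sum_insert ha, sum_insert ha]
    exact (h a (by simp)).add (ih fun i hi => h i (by simp [hi]))

theorem Op_finset_sum {ι : Type*} (s : Finset ι) {m : ι → Space d → ℂ} {A B : ι → ℝ}
    (h : ∀ i ∈ s, Ker (m i) (A i) (B i)) (f : Bdd d) :
    Op (∑ i ∈ s, m i) f = ∑ i ∈ s, Op (m i) f := by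
  classical
  induction s using Finset.induction_on with
  | empty => simpa using Op_zero f
  | insert a s ha ih =>
    have h' : ∀ i ∈ s, Ker (m i) (A i) (B i) := fun i hi => h i (by simp [hi])
    rw [sum_insert ha, sum_insert ha, (h a (by simp)).Op_add (Ker.finset_sum s h'),
      ih h']

/-- The commutator of a multiplier and the multiplication with a Lipschitz function. -/
theorem Ker.norm_Op_mul_sub_le {L : ℝ} (h : Ker m A B) (hL : 0 ≤ L)
    (hF : ∀ x y, ‖F x - F y‖ ≤ L * ‖x - y‖) : ‖Op m (F * G) - F * Op m G‖ ≤ B * L * ‖G‖ := by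
  obtain ⟨k, h1, h2, h3, h4, h5⟩ := h
  rw [Op_eq h1 h3]
  have hB : 0 ≤ B := le_trans (by positivity) h5
  refine (BoundedContinuousFunction.norm_le (by positivity)).2 fun x => ?_
  simp only [BoundedContinuousFunction.coe_sub, BoundedContinuousFunction.coe_mul,
    Pi.sub_apply, Pi.mul_apply, convCLM_apply]
  rw [← integral_const_mul, ← integral_sub]
  · calc _ ≤ ∫ y, L * ‖G‖ * (‖y‖ * ‖k y‖) := by
          refine norm_integral_le_of_norm_le (h2.const_mul _) (.of_forall fun y => ?_)
          have e : k y * (F (x - y) * G (x - y)) - F x * (k y * G (x - y)) =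
            k y * ((F (x - y) - F x) * G (x - y)) := by ring
          rw [e, norm_mul, norm_mul]
          have := hF (x - y) x
          rw [sub_sub_cancel_left, norm_neg] at this
          calc _ ≤ ‖k y‖ * ((L * ‖y‖) * ‖G‖) := by
                gcongr
                exact G.norm_coe_le_norm _
            _ = _ := by ring
      _ = L * ‖G‖ * ∫ y, ‖y‖ * ‖k y‖ := integral_const_mul _ _
      _ ≤ L * ‖G‖ * B := by gcongr
      _ = B * L * ‖G‖ := by ring
  · exact integrable_kernel_mul h1 (F * G) x
  · exact (integrable_kernel_mul h1 G x).const_mul _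

theorem Op_const (h : Ker m A B) (c : ℂ) :
    Op m (BoundedContinuousFunction.const _ c) = BoundedContinuousFunction.const _ (m 0 * c) := by
  obtain ⟨k, h1, h2, h3, h4, h5⟩ := h
  rw [Op_eq h1 h3, ← h3]
  ext x
  simp only [convCLM_apply, BoundedContinuousFunction.const_apply]
  rw [integral_mul_const, fourier_eq]
  simp

theorem Ker.modulate (h : Ker m A B) (η : Space d) : Ker (fun ξ => m (ξ + η)) A B := by
  obtain ⟨k, h1, h2, h3, h4, h5⟩ := h
  have e : ∀ y, ‖𝐞 (-inner ℝ y η) • k y‖ = ‖k y‖ := fun y => by simp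
  refine ⟨fun y => 𝐞 (-inner ℝ y η) • k y, (Real.fourierIntegral_convergent_iff η).2 h1, ?_, ?_,
    ?_, ?_⟩
  · simpa only [e] using h2
  · ext ξ
    rw [← h3, fourier_eq, fourier_eq]
    congr 1
    ext y
    rw [smul_smul, ← AddChar.map_add_eq_mul, inner_add_right, neg_add]
  · simpa only [e] using h4
  · simpa only [e] using h5

/-- A Fourier multiplier annihilates a product if it vanishes on the sum of the frequencies. -/
theorem Op_mul_eq_zero {p q₁ q₂ : Space d → ℂ} {A₁ B₁ A₂ B₂ : ℝ} (hp : Ker p A B)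
    (hq₁ : Ker q₁ A₁ B₁) (hq₂ : Ker q₂ A₂ B₂) (hF : Op q₁ F = F) (hG : Op q₂ G = G)
    (h0 : ∀ ξ η, p (ξ + η) * q₁ ξ * q₂ η = 0) : Op p (F * G) = 0 := by
  obtain ⟨k, h1, h2, h3, h4, h5⟩ := id hp
  ext x
  set h : Space d → ℂ := fun y => k y * F (x - y) with hh
  have hi : Integrable h := integrable_kernel_mul h1 F x
  have hker : Ker (𝓕 h) (∫ y, ‖h y‖) (∫ y, ‖y‖ * ‖h y‖) := by
    refine ⟨h, hi, ?_, rfl, le_rfl, le_rfl⟩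
    refine (h2.mul_const ‖F‖).mono' (by fun_prop) (.of_forall fun y => ?_)
    rw [norm_of_nonneg (by positivity), hh, norm_mul, mul_assoc]
    gcongr
    exact F.norm_coe_le_norm _
  have hz : 𝓕 h * q₂ = 0 := by
    ext η
    rcases eq_or_ne (q₂ η) 0 with hη | hη
    · simp [hη]
    have hm := hp.modulate η
    have e1 : 𝓕 h η = Op (fun ξ => p (ξ + η)) F x := by
      have hk' : Integrable fun y => 𝐞 (-inner ℝ y η) • k y :=
        (Real.fourierIntegral_convergent_iff η).2 h1
      have hf' : 𝓕 (fun y => 𝐞 (-inner ℝ y η) • k y) = fun ξ => p (ξ + η) := by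
        ext ξ
        rw [← h3, fourier_eq, fourier_eq]
        congr 1
        ext y
        rw [smul_smul, ← AddChar.map_add_eq_mul, inner_add_right, neg_add]
      rw [Op_eq hk' hf', convCLM_apply, fourier_eq]
      congr 1
      ext y
      rw [hh]
      simp only [Circle.smul_def, smul_eq_mul]
      ring
    have e2 : (fun ξ => p (ξ + η)) * q₁ = 0 := by
      ext ξ
      have := h0 ξ η
      simpa [hη] using this
    have e3 : Op (fun ξ => p (ξ + η)) F = 0 := by rw [← hF, ← Op_mul hm hq₁, e2, Op_zero]
    rw [Pi.mul_apply, e1, e3]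
    simp
  have e4 : Op p (F * G) x = Op (𝓕 h) G x := by
    rw [Op_eq h1 h3, Op_eq hi rfl, convCLM_apply, convCLM_apply]
    congr 1
    ext y
    simp [hh, mul_assoc]
  rw [e4, ← hG, ← Op_mul hker hq₂, hz, Op_zero]

theorem integral_comp_inv_smul {F : Type*} [NormedAddCommGroup F] [NormedSpace ℝ F] (hδ : 0 < δ)
    (f : Space d → F) : ∫ y, f (δ⁻¹ • y) = (δ ^ Module.finrank ℝ (Space d) : ℝ) • ∫ y, f y := by
  rw [Measure.integral_comp_smul]
  congr 1
  rw [inv_pow, inv_inv, abs_of_pos (by positivity)]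

/-- The kernel of a dilated multiplier. -/
def dilKer (δ : ℝ) (k : Space d → ℂ) (y : Space d) : ℂ :=
  ((δ ^ Module.finrank ℝ (Space d))⁻¹ : ℝ) * k (δ⁻¹ • y)

theorem integrable_dilKer (hδ : 0 < δ) (hk : Integrable k) : Integrable (dilKer δ k) :=
  ((integrable_comp_smul_iff volume k (inv_pos.2 hδ).ne').2 hk).const_mul _

theorem norm_dilKer (hδ : 0 < δ) (k : Space d → ℂ) (y : Space d) :
    ‖dilKer δ k y‖ = (δ ^ Module.finrank ℝ (Space d))⁻¹ * ‖k (δ⁻¹ • y)‖ := by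
  rw [dilKer, norm_mul, norm_real, norm_of_nonneg (by positivity)]

theorem fourier_dilKer (hδ : 0 < δ) (k : Space d → ℂ) : 𝓕 (dilKer δ k) = fun z => 𝓕 k (δ • z) := by
  ext z
  rw [fourier_eq, fourier_eq]
  have hpos : (0 : ℝ) < δ ^ Module.finrank ℝ (Space d) := by positivity
  have := integral_comp_inv_smul hδ (fun y => 𝐞 (-inner ℝ y (δ • z)) • k y)
  have e : ∀ y : Space d, inner ℝ (δ⁻¹ • y) (δ • z) = inner ℝ y z := fun y => by
    rw [real_inner_smul_left, real_inner_smul_right, ← mul_assoc, inv_mul_cancel₀ hδ.ne', one_mul]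
  simp only [e] at this
  have e2 : ∀ v : Space d, 𝐞 (-inner ℝ v z) • dilKer δ k v =
      ((δ ^ Module.finrank ℝ (Space d))⁻¹ : ℝ) • (𝐞 (-inner ℝ v z) • k (δ⁻¹ • v)) := fun v => by
    simp only [dilKer, Circle.smul_def, smul_eq_mul, Complex.real_smul]
    ring
  simp only [e2]
  rw [integral_smul, this, smul_smul, inv_mul_cancel₀ hpos.ne', one_smul]

theorem Ker.dilate (h : Ker m A B) (hδ : 0 < δ) : Ker (fun z => m (δ • z)) A (δ * B) := by
  obtain ⟨k, h1, h2, h3, h4, h5⟩ := h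
  have hpos : (0 : ℝ) < δ ^ Module.finrank ℝ (Space d) := by positivity
  have e1 : ∀ y, ‖y‖ * ‖dilKer δ k y‖ =
      (δ ^ Module.finrank ℝ (Space d))⁻¹ * δ * (‖δ⁻¹ • y‖ * ‖k (δ⁻¹ • y)‖) := by
    intro y
    rw [norm_dilKer hδ, norm_smul, norm_of_nonneg (by positivity)]
    field_simp
  refine ⟨dilKer δ k, integrable_dilKer hδ h1, ?_, by rw [fourier_dilKer hδ, h3], ?_, ?_⟩
  · simp only [e1]
    exact ((integrable_comp_smul_iff volume (fun y => ‖y‖ * ‖k y‖)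
      (inv_pos.2 hδ).ne').2 h2).const_mul _
  · simp only [norm_dilKer hδ]
    rw [integral_const_mul, integral_comp_inv_smul hδ (fun y => ‖k y‖), smul_eq_mul, ← mul_assoc,
      inv_mul_cancel₀ hpos.ne', one_mul]
    exact h4
  · simp only [e1]
    rw [integral_const_mul, integral_comp_inv_smul hδ (fun y => ‖y‖ * ‖k y‖), smul_eq_mul]
    calc _ = δ * ∫ y, ‖y‖ * ‖k y‖ := by field_simp
      _ ≤ _ := by gcongr

theorem exists_ker_schwartz (m : 𝓢(Space d, ℂ)) : ∃ A B, Ker m A B := by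
  refine ⟨_, _, (𝓕⁻ m : 𝓢(Space d, ℂ)), (𝓕⁻ m : 𝓢(Space d, ℂ)).integrable, ?_, ?_, le_rfl, le_rfl⟩
  · simpa using (𝓕⁻ m : 𝓢(Space d, ℂ)).integrable_pow_mul volume 1
  · rw [← fourier_coe, fourier_fourierInv_eq]

theorem exists_ker_of_hasCompactSupport (h : HasCompactSupport m) (hs : ContDiff ℝ ∞ m) :
    ∃ A B, Ker m A B :=
  exists_ker_schwartz (h.toSchwartzMap hs)

/-! ### Translations of Schwartz kernels -/

theorem SchwartzMap.integral_norm_translate_sub_le (k : 𝓢(Space d, ℂ)) (h : Space d) :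
    ∫ y, ‖k (y + h) - k y‖ ≤ (∫ y, ‖fderiv ℝ k y‖) * ‖h‖ := by
  have hD : Integrable (fun y => ‖fderiv ℝ k y‖) :=
    (SchwartzMap.fderivCLM ℝ (Space d) ℂ k).integrable.norm
  have hDc : Continuous (fderiv ℝ k) := (k.smooth 1).continuous_fderiv one_ne_zero
  have pt : ∀ y, ‖k (y + h) - k y‖ₑ ≤ ∫⁻ t in Icc (0:ℝ) 1, ‖fderiv ℝ k (y + t • h)‖ₑ * ‖h‖ₑ := by
    intro y
    have hd : ∀ t : ℝ, HasDerivAt (fun t : ℝ => k (y + t • h)) (fderiv ℝ k (y + t • h) h) t := by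
      intro t
      have h1 : HasDerivAt (fun t : ℝ => y + t • h) h t := by
        simpa using ((hasDerivAt_id t).smul_const h).const_add y
      exact (k.differentiable _).hasFDerivAt.comp_hasDerivAt t h1
    have hcont : Continuous fun t : ℝ => fderiv ℝ k (y + t • h) h := by fun_prop
    have := intervalIntegral.integral_eq_sub_of_hasDerivAt (a := 0) (b := 1)
      (fun t _ => hd t) (hcont.intervalIntegrable _ _)
    simp only [one_smul, zero_smul, add_zero] at this
    rw [← this, intervalIntegral.integral_of_le zero_le_one, ← integral_Icc_eq_integral_Ioc]
    refine (enorm_integral_le_lintegral_enorm _).trans (lintegral_mono fun t => ?_)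
    exact ContinuousLinearMap.le_opENorm _ _
  have hInt : Integrable fun y => k (y + h) - k y :=
    (k.integrable.comp_add_right h).sub k.integrable
  have key : ∫⁻ y, ‖k (y + h) - k y‖ₑ ≤ (∫⁻ y, ‖fderiv ℝ k y‖ₑ) * ‖h‖ₑ := by
    calc _ ≤ ∫⁻ y, ∫⁻ t in Icc (0:ℝ) 1, ‖fderiv ℝ k (y + t • h)‖ₑ * ‖h‖ₑ := lintegral_mono pt
      _ = ∫⁻ t in Icc (0:ℝ) 1, ∫⁻ y, ‖fderiv ℝ k (y + t • h)‖ₑ * ‖h‖ₑ := by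
          refine lintegral_lintegral_swap ?_
          refine Measurable.aemeasurable ?_
          refine Measurable.mul_const ?_ _
          exact (hDc.comp (by fun_prop)).measurable.enorm
      _ = ∫⁻ t in Icc (0:ℝ) 1, (∫⁻ y, ‖fderiv ℝ k y‖ₑ) * ‖h‖ₑ := by
          congr 1
          ext t
          have hm : Measurable fun y => ‖fderiv ℝ k (y + t • h)‖ₑ :=
            (hDc.comp (by fun_prop : Continuous fun y => y + t • h)).measurable.enorm
          rw [lintegral_mul_const _ hm]
          rw [lintegral_add_right_eq_self (fun y => ‖fderiv ℝ k y‖ₑ) (t • h)]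
      _ = _ := by simp
  have f1 : ∫⁻ y, ‖fderiv ℝ k y‖ₑ ≠ ⊤ := by
    have := hD.2
    simp only [HasFiniteIntegral, enorm_norm] at this
    exact this.ne
  rw [integral_norm_eq_lintegral_enorm hInt.aestronglyMeasurable]
  refine (ENNReal.toReal_mono (ENNReal.mul_ne_top f1 enorm_ne_top) key).trans_eq ?_
  rw [ENNReal.toReal_mul, toReal_enorm, integral_norm_eq_lintegral_enorm
    hDc.aestronglyMeasurable]

/-- `m` is a multiplier that maps bounded functions to Lipschitz functions. -/
def LipMul (m : Space d → ℂ) (L : ℝ) : Prop :=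
  ∀ (f : Bdd d) (x y : Space d), ‖Op m f x - Op m f y‖ ≤ L * ‖f‖ * ‖x - y‖

theorem exists_lipMul_dilate (m : 𝓢(Space d, ℂ)) : ∃ L, 0 ≤ L ∧ ∀ δ : ℝ, 0 < δ →
    LipMul (fun z => m (δ • z)) (L * δ⁻¹) := by
  set k : 𝓢(Space d, ℂ) := 𝓕⁻ m with hk
  set L := ∫ y, ‖fderiv ℝ k y‖
  refine ⟨L, integral_nonneg fun _ => norm_nonneg _, fun δ hδ f x x' => ?_⟩
  have hpos : (0 : ℝ) < δ ^ Module.finrank ℝ (Space d) := by positivity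
  set k' : Space d → ℂ := dilKer δ k with hk'
  have hi : Integrable k' := integrable_dilKer hδ k.integrable
  have hf : 𝓕 k' = fun z => m (δ • z) := by
    rw [hk', fourier_dilKer hδ, ← fourier_coe, hk,
      fourier_fourierInv_eq]
  rw [Op_eq hi hf, convCLM_apply, convCLM_apply]
  have e1 : ∫ y, k' y * f (x - y) = ∫ y, k' (y + (x - x')) * f (x' - y) := by
    rw [← integral_add_right_eq_self (fun y => k' y * f (x - y)) (x - x')]
    congr 1
    ext y
    congr 2
    abel
  rw [e1, ← integral_sub]
  · simp only [← sub_mul]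
    have tr : ∫ y, ‖k' (y + (x - x')) - k' y‖ ≤ L * (δ⁻¹ * ‖x - x'‖) := by
      have := integral_comp_inv_smul hδ (fun y => ‖k (y + δ⁻¹ • (x - x')) - k y‖)
      have t2 := SchwartzMap.integral_norm_translate_sub_le k (δ⁻¹ • (x - x'))
      rw [norm_smul, norm_of_nonneg (by positivity : (0:ℝ) ≤ δ⁻¹)] at t2
      calc ∫ y, ‖k' (y + (x - x')) - k' y‖
          = ∫ y, (δ ^ Module.finrank ℝ (Space d))⁻¹ *
              ‖k (δ⁻¹ • y + δ⁻¹ • (x - x')) - k (δ⁻¹ • y)‖ := by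
            congr 1
            ext y
            rw [hk', dilKer, dilKer, ← mul_sub, norm_mul, norm_real,
              norm_of_nonneg (by positivity), smul_add]
        _ = (δ ^ Module.finrank ℝ (Space d))⁻¹ * (δ ^ Module.finrank ℝ (Space d) *
              ∫ y, ‖k (y + δ⁻¹ • (x - x')) - k y‖) := by
            rw [integral_const_mul, this, smul_eq_mul]
        _ = ∫ y, ‖k (y + δ⁻¹ • (x - x')) - k y‖ := by field_simp
        _ ≤ _ := t2
    have it : Integrable fun y => k' (y + (x - x')) - k' y := (hi.comp_add_right (x - x')).sub hi
    calc _ ≤ ∫ y, ‖k' (y + (x - x')) - k' y‖ * ‖f‖ := by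
          refine norm_integral_le_of_norm_le (it.norm.mul_const _)
            (.of_forall fun y => ?_)
          rw [norm_mul]
          gcongr
          exact f.norm_coe_le_norm _
      _ = (∫ y, ‖k' (y + (x - x')) - k' y‖) * ‖f‖ := integral_mul_const _ _
      _ ≤ L * (δ⁻¹ * ‖x - x'‖) * ‖f‖ := by gcongr
      _ = _ := by ring
  · exact integrable_kernel_mul (hi.comp_add_right (x - x')) f x'
  · exact integrable_kernel_mul hi f x'

end

section

variable {d : ℕ}
variable {c : Space d → ℂ} {a b : ℝ}

/-! ### Series of kernels, and multiplication of a multiplier with a characteristic function -/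

theorem integrable_tsum_of_summable {F : ℕ → Space d → ℂ} (hF : ∀ i, Integrable (F i)) {a : ℕ → ℝ}
    (ha : ∀ i, ∫ x, ‖F i x‖ ≤ a i) (hs : Summable a) :
    Integrable (fun x => ∑' i, F i x) ∧ ∫ x, ‖∑' i, F i x‖ ≤ ∑' i, a i ∧ ∀ᵐ x, Summable fun i =>
      ‖F i x‖ := by
  have hs' : Summable fun i => ∫ x, ‖F i x‖ :=
    Summable.of_nonneg_of_le (fun i => integral_nonneg fun _ => norm_nonneg _) ha hs
  have hfin : ∑' i, ∫⁻ x, ‖F i x‖ₑ ≠ ⊤ := by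
    have : ∀ i, ∫⁻ x, ‖F i x‖ₑ = ENNReal.ofReal (∫ x, ‖F i x‖) := fun i => by
      rw [ofReal_integral_norm_eq_lintegral_enorm (hF i)]
    simp only [this]
    exact hs'.tsum_ofReal_ne_top
  have hae : ∀ᵐ x, Summable fun i => ‖F i x‖ := by
    have h1 : ∫⁻ x, ∑' i, ‖F i x‖ₑ ≠ ⊤ := by
      rw [lintegral_tsum fun i => (hF i).aestronglyMeasurable.enorm]
      exact hfin
    have h2 := ae_lt_top' (AEMeasurable.tsum fun i => (hF i).aestronglyMeasurable.enorm) h1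
    filter_upwards [h2] with x hx
    have := ENNReal.summable_toReal hx.ne
    simpa using this
  have hmeas : AEStronglyMeasurable (fun x => ∑' i, F i x) volume := by
    refine aestronglyMeasurable_of_tendsto_ae atTop
      (f := fun n x => ∑ i ∈ Finset.range n, F i x) (fun n => ?_) ?_
    · exact Finset.aestronglyMeasurable_fun_sum _ fun i _ => (hF i).aestronglyMeasurable
    · filter_upwards [hae] with x hx
      exact hx.of_norm.hasSum.tendsto_sum_nat
  have hle : ∫⁻ x, ‖∑' i, F i x‖ₑ ≤ ∑' i, ∫⁻ x, ‖F i x‖ₑ := by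
    rw [← lintegral_tsum fun i => (hF i).aestronglyMeasurable.enorm]
    exact lintegral_mono fun x => enorm_tsum_le_tsum_enorm
  have hInt : Integrable (fun x => ∑' i, F i x) := ⟨hmeas, hle.trans_lt hfin.lt_top⟩
  refine ⟨hInt, ?_, hae⟩
  rw [integral_norm_eq_lintegral_enorm hmeas]
  refine (ENNReal.toReal_mono hfin hle).trans ?_
  rw [ENNReal.tsum_toReal_eq fun i => (hF i).2.ne]
  refine Summable.tsum_le_tsum (fun i => ?_) ?_ hs
  · rw [← integral_norm_eq_lintegral_enorm (hF i).aestronglyMeasurable]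
    exact ha i
  · refine hs'.congr fun i => ?_
    rw [integral_norm_eq_lintegral_enorm (hF i).aestronglyMeasurable]

theorem Ker.tsum {m : ℕ → Space d → ℂ} {A B : ℕ → ℝ} (h : ∀ i, Ker (m i) (A i) (B i))
    (hA : Summable A) (hB : Summable B) : Ker (fun z => ∑' i, m i z) (∑' i, A i) (∑' i, B i) := by
  choose k h1 h2 h3 h4 h5 using h
  obtain ⟨i1, i2, i3⟩ := integrable_tsum_of_summable h1 h4 hA
  have w1 : ∀ i, Integrable fun y => ((‖y‖ : ℝ) : ℂ) * k i y := by
    intro i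
    refine (h2 i).mono ?_ (.of_forall fun y => by simp)
    exact (Continuous.aestronglyMeasurable (by fun_prop)).mul (h1 i).aestronglyMeasurable
  have w2 : ∀ i, ∫ y, ‖((‖y‖ : ℝ) : ℂ) * k i y‖ ≤ B i := by
    intro i
    simpa using h5 i
  obtain ⟨j1, j2, j3⟩ := integrable_tsum_of_summable w1 w2 hB
  have e : ∀ y, ‖∑' i, ((‖y‖ : ℝ) : ℂ) * k i y‖ = ‖y‖ * ‖∑' i, k i y‖ := by
    intro y
    rw [tsum_mul_left, norm_mul]
    simp
  refine ⟨fun y => ∑' i, k i y, i1, ?_, ?_, i2, ?_⟩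
  · simpa only [e] using j1.norm
  · ext z
    rw [fourier_eq]
    have hh : ∀ i, Integrable fun v => 𝐞 (-inner ℝ v z) • k i v :=
      fun i => (Real.fourierIntegral_convergent_iff z).2 (h1 i)
    have := (hasSum_integral_of_summable_integral_norm hh ?_).tsum_eq
    · have e2 : ∀ v, 𝐞 (-inner ℝ v z) • ∑' i, k i v = ∑' i, 𝐞 (-inner ℝ v z) • k i v := by
        intro v
        simp only [Circle.smul_def, smul_eq_mul]
        rw [tsum_mul_left]
      simp only [e2]
      rw [← this]
      congr 1
      ext i
      rw [← h3 i, fourier_eq]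
    · simp only [Circle.norm_smul]
      exact Summable.of_nonneg_of_le (fun i => by positivity) h4 hA
  · simpa only [e] using j2

/-- Multiplication with `c` preserves the multipliers that have an integrable kernel. -/
def Mult (c : Space d → ℂ) (a b : ℝ) : Prop :=
  0 ≤ a ∧ 0 ≤ b ∧ ∀ m A B, Ker m A B → Ker (m * c) (a * A) (a * B + b * A)

theorem Ker.toMult (h : Ker c a b) : Mult c a b := by
  refine ⟨h.nonneg_left, h.nonneg_right, fun m A B hm => ?_⟩
  exact (hm.mul h).mono (by linarith [mul_comm A a]) (by linarith [mul_comm A b, mul_comm B a])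

theorem Mult.add {c' : Space d → ℂ} {a' b' : ℝ} (h : Mult c a b) (h' : Mult c' a' b') :
    Mult (c + c') (a + a') (b + b') := by
  refine ⟨add_nonneg h.1 h'.1, add_nonneg h.2.1 h'.2.1, fun m A B hm => ?_⟩
  rw [mul_add]
  exact ((h.2.2 m A B hm).add (h'.2.2 m A B hm)).mono (by linarith) (by linarith)

theorem Mult.smul (h : Mult c a b) (r : ℂ) : Mult (r • c) (‖r‖ * a) (‖r‖ * b) := by
  refine ⟨mul_nonneg (norm_nonneg _) h.1, mul_nonneg (norm_nonneg _) h.2.1, fun m A B hm => ?_⟩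
  rw [mul_smul_comm]
  exact ((h.2.2 m A B hm).smul r).mono (by linarith) (by linarith)

theorem Mult.const (r : ℂ) : Mult (fun _ : Space d => r) ‖r‖ 0 := by
  refine ⟨norm_nonneg _, le_rfl, fun m A B hm => ?_⟩
  have : m * (fun _ => r) = r • m := by
    ext z
    simp [mul_comm]
  rw [this]
  exact (hm.smul r).mono le_rfl (by simp)

theorem Mult.pow (h : Mult c a b) (n : ℕ) : Mult (c ^ n) (a ^ n) (n * a ^ (n - 1) * b) := by
  have ha := h.1
  have hb := h.2.1
  induction n with
  | zero =>
    have := Mult.const (d := d) 1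
    simp only [norm_one] at this
    simpa using! this
  | succ n ih =>
    refine ⟨by positivity, by positivity, fun m A B hm => ?_⟩
    rw [pow_succ, ← mul_assoc]
    refine (h.2.2 _ _ _ (ih.2.2 m A B hm)).mono ?_ ?_
    · rw [pow_succ]; linarith
    · have e : (n : ℝ) * a ^ (n - 1) * a = n * a ^ n := by
        rcases n with _ | n
        · simp
        · simp [pow_succ, mul_assoc]
      have : a * (a ^ n * B + n * a ^ (n - 1) * b * A) + b * (a ^ n * A) =
        a ^ (n + 1) * B + ((n * a ^ (n - 1) * a) * b * A + b * a ^ n * A) := by ring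
      rw [this, e]
      simp only [Nat.add_sub_cancel, Nat.cast_add, Nat.cast_one]
      apply le_of_eq
      ring

/-- The exponential series. -/
theorem Mult.exp_sub_one (h : Mult c a b) :
    Mult (fun z => Complex.exp (c z) - 1) (Real.exp a - 1) (b * Real.exp a) := by
  have ha := h.1
  have hb := h.2.1
  refine ⟨by linarith [Real.one_le_exp ha], by positivity, fun m A B hm => ?_⟩
  have hA : 0 ≤ A := hm.nonneg_left
  have hB : 0 ≤ B := hm.nonneg_right
  have key : ∀ n : ℕ, Ker (fun z => m z * (c z ^ (n + 1) / ((n + 1).factorial : ℂ)))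
      (a ^ (n + 1) / ((n + 1).factorial : ℝ) * A)
      (a ^ (n + 1) / ((n + 1).factorial : ℝ) * B + a ^ n / (n.factorial : ℝ) * (b * A)) := by
    intro n
    have := ((h.pow (n + 1)).2.2 m A B hm).smul ((((n + 1).factorial : ℝ)⁻¹ : ℝ) : ℂ)
    have e : ((((n + 1).factorial : ℝ)⁻¹ : ℝ) : ℂ) • (m * c ^ (n + 1)) =
        fun z => m z * (c z ^ (n + 1) / ((n + 1).factorial : ℂ)) := by
      ext z
      simp only [Pi.smul_apply, Pi.mul_apply, Pi.pow_apply, smul_eq_mul]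
      push_cast
      ring
    rw [e] at this
    rw [norm_real, norm_of_nonneg (by positivity)] at this
    refine this.mono (le_of_eq (by ring)) (le_of_eq ?_)
    have hf : ((n + 1).factorial : ℝ) = (n + 1) * n.factorial := by
      rw [Nat.factorial_succ]; push_cast; ring
    have hn : (n.factorial : ℝ) ≠ 0 := by positivity
    have hn1 : (n : ℝ) + 1 ≠ 0 := by positivity
    rw [hf]
    simp only [Nat.add_sub_cancel, Nat.cast_add, Nat.cast_one]
    field_simp
  have s0 : HasSum (fun n : ℕ => a ^ n / (n.factorial : ℝ)) (Real.exp a) := by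
    rw [Real.exp_eq_exp_ℝ]
    exact NormedSpace.expSeries_div_hasSum_exp a
  have s1 : HasSum (fun n : ℕ => a ^ (n + 1) / ((n + 1).factorial : ℝ)) (Real.exp a - 1) := by
    have := (hasSum_nat_add_iff' 1).2 s0
    simpa using this
  have hsA := s1.mul_right A
  have hsB := (s1.mul_right B).add (s0.mul_right (b * A))
  have := Ker.tsum key hsA.summable hsB.summable
  rw [hsA.tsum_eq, hsB.tsum_eq] at this
  have e : (fun z => ∑' n : ℕ, m z * (c z ^ (n + 1) / ((n + 1).factorial : ℂ))) =
      m * fun z => Complex.exp (c z) - 1 := by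
    ext z
    have s2 : HasSum (fun n : ℕ => c z ^ n / (n.factorial : ℂ)) (Complex.exp (c z)) := by
      rw [Complex.exp_eq_exp_ℂ]
      exact NormedSpace.expSeries_div_hasSum_exp (c z)
    have s3 := (hasSum_nat_add_iff' 1).2 s2
    simp only [Finset.range_one, Finset.sum_singleton, pow_zero, Nat.factorial_zero, Nat.cast_one,
      div_one] at s3
    rw [(s3.mul_left (m z)).tsum_eq]
    rfl
  rw [e] at this
  exact this.mono le_rfl (le_of_eq (by ring))

theorem Mult.exp (h : Mult c a b) :
    Mult (fun z => Complex.exp (c z)) (Real.exp a) (b * Real.exp a) := by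
  have h1 := h.exp_sub_one.add (Mult.const (d := d) 1)
  have e : (fun z => Complex.exp (c z) - 1) + (fun _ => (1:ℂ)) = fun z => Complex.exp (c z) := by
    ext z
    simp
  rw [e] at h1
  simpa using h1

/-- The characteristic function of a finite measure with a first moment. -/
theorem Mult.charFun (M : Measure (Space d)) [IsFiniteMeasure M]
    (hM : Integrable (fun w : Space d => ‖w‖) M) (hb : ∫ w, ‖w‖ ∂M ≤ b) :
    Mult (fun z => ∫ w, (𝐞 (-inner ℝ w z) : ℂ) ∂M) (M.real univ) b := by
  refine ⟨measureReal_nonneg, le_trans (by positivity) hb, fun m A B hm => ?_⟩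
  obtain ⟨k, h1, h2, h3, h4, h5⟩ := hm
  have one : Integrable (fun _ : Space d => (1 : ℝ)) M := integrable_const _
  have onec : Integrable (fun _ : Space d => (1 : ℂ)) M := integrable_const _
  have hp : Integrable (fun p : Space d × Space d => k (p.1 - p.2)) (volume.prod M) := by
    simpa using onec.convolution_integrand (ContinuousLinearMap.mul ℂ ℂ) h1 (μ := volume)
  have hp1 : Integrable (fun p : Space d × Space d => ‖p.1 - p.2‖ * ‖k (p.1 - p.2)‖)
      (volume.prod M) := by
    simpa using one.convolution_integrand (ContinuousLinearMap.mul ℝ ℝ) h2 (μ := volume)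
  have hp2 : Integrable (fun p : Space d × Space d => ‖p.2‖ * ‖k (p.1 - p.2)‖)
      (volume.prod M) := by
    simpa using hM.convolution_integrand (ContinuousLinearMap.mul ℝ ℝ) h1.norm (μ := volume)
  set l : Space d → ℂ := fun y => ∫ w, k (y - w) ∂M with hl
  have hli : Integrable l := hp.integral_prod_left
  have tr : ∀ (g : Space d → ℝ) (w : Space d), ∫ y, g (y - w) = ∫ y, g y :=
    fun g w => integral_sub_right_eq_self g w
  have n0 : ∫ y, ∫ w, ‖k (y - w)‖ ∂M = M.real univ * ∫ y, ‖k y‖ := by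
    rw [integral_integral_swap hp.norm]
    simp only [tr (fun y => ‖k y‖), integral_const, smul_eq_mul]
  have n1 : ∫ y, ∫ w, ‖y - w‖ * ‖k (y - w)‖ ∂M = M.real univ * ∫ y, ‖y‖ * ‖k y‖ := by
    rw [integral_integral_swap hp1]
    simp only [tr (fun y => ‖y‖ * ‖k y‖), integral_const, smul_eq_mul]
  have n2 : ∫ y, ∫ w, ‖w‖ * ‖k (y - w)‖ ∂M = (∫ w, ‖w‖ ∂M) * ∫ y, ‖k y‖ := by
    rw [integral_integral_swap hp2]
    simp only [integral_const_mul, tr (fun y => ‖k y‖)]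
    rw [integral_mul_const]
  have bd0 : ∀ y, ‖l y‖ ≤ ∫ w, ‖k (y - w)‖ ∂M := fun y => norm_integral_le_integral_norm _
  have bd1 : ∀ᵐ y, ‖y‖ * ‖l y‖ ≤
      (∫ w, ‖y - w‖ * ‖k (y - w)‖ ∂M) + ∫ w, ‖w‖ * ‖k (y - w)‖ ∂M := by
    filter_upwards [hp.prod_right_ae, hp1.prod_right_ae, hp2.prod_right_ae] with y q0 q1 q2
    refine (mul_le_mul_of_nonneg_left (bd0 y) (norm_nonneg y)).trans ?_
    rw [← integral_const_mul, ← integral_add q1 q2]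
    refine integral_mono (q0.norm.const_mul _) (q1.add q2) fun w => ?_
    have : ‖y‖ ≤ ‖y - w‖ + ‖w‖ := by
      calc ‖y‖ = ‖(y - w) + w‖ := by congr 1; abel
        _ ≤ _ := norm_add_le _ _
    have p : 0 ≤ ‖k (y - w)‖ := by positivity
    nlinarith
  have hmeas : AEStronglyMeasurable (fun y => ‖y‖ * ‖l y‖) volume :=
    continuous_norm.aestronglyMeasurable.mul hli.aestronglyMeasurable.norm
  have hInt : Integrable fun y => ‖y‖ * ‖l y‖ := by
    refine (hp1.integral_prod_left.add hp2.integral_prod_left).mono' hmeas ?_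
    filter_upwards [bd1] with y hy
    rw [norm_of_nonneg (by positivity)]
    exact hy
  refine ⟨l, hli, hInt, ?_, ?_, ?_⟩
  · ext z
    rw [fourier_eq]
    have e1 : ∀ y, 𝐞 (-inner ℝ y z) • l y = ∫ w, 𝐞 (-inner ℝ y z) • k (y - w) ∂M := by
      intro y
      simp only [hl, Circle.smul_def, smul_eq_mul]
      rw [integral_const_mul]
    simp only [e1]
    rw [integral_integral_swap]
    · have e2 : ∀ w, ∫ y, 𝐞 (-inner ℝ y z) • k (y - w) = (𝐞 (-inner ℝ w z) : ℂ) * m z := by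
        intro w
        rw [← h3, fourier_eq, ← integral_const_mul,
          ← integral_sub_right_eq_self (fun y => (𝐞 (-inner ℝ w z) : ℂ) * _) w]
        congr 1
        ext y
        simp only [Circle.smul_def, smul_eq_mul]
        rw [← mul_assoc, ← Circle.coe_mul, ← AddChar.map_add_eq_mul, ← neg_add, ← inner_add_left,
          add_sub_cancel]
      simp only [e2]
      rw [integral_mul_const, Pi.mul_apply, mul_comm]
    · refine hp.norm.mono ?_ (.of_forall fun p => by simp [Function.uncurry])
      have : Continuous fun p : Space d × Space d => ((𝐞 (-inner ℝ p.1 z) : Circle) : ℂ) := by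
        fun_prop
      exact this.aestronglyMeasurable.mul hp.aestronglyMeasurable
  · calc ∫ y, ‖l y‖ ≤ ∫ y, ∫ w, ‖k (y - w)‖ ∂M :=
          integral_mono hli.norm hp.norm.integral_prod_left bd0
      _ = M.real univ * ∫ y, ‖k y‖ := n0
      _ ≤ _ := by gcongr
  · calc ∫ y, ‖y‖ * ‖l y‖
        ≤ ∫ y, ((∫ w, ‖y - w‖ * ‖k (y - w)‖ ∂M) + ∫ w, ‖w‖ * ‖k (y - w)‖ ∂M) :=
          integral_mono_ae hInt (hp1.integral_prod_left.add hp2.integral_prod_left) bd1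
      _ = M.real univ * (∫ y, ‖y‖ * ‖k y‖) + (∫ w, ‖w‖ ∂M) * ∫ y, ‖k y‖ := by
          rw [integral_add hp1.integral_prod_left hp2.integral_prod_left, n1, n2]
      _ ≤ _ := by
          have hB : 0 ≤ B := le_trans (by positivity) h5
          have hb' : 0 ≤ b := le_trans (by positivity) hb
          gcongr

end

section

variable {d : ℕ}
variable {α : ℝ}

/-! ### The symbol of the stable semigroup -/

theorem one_sub_cos_eq (u : ℝ) : 1 - cos u = u ^ 2 * ∫ s in (0 : ℝ)..1, (1 - s) * cos (s * u) := by
  rcases eq_or_ne u 0 with rfl | hu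
  · simp
  have h : ∀ s ∈ uIcc (0 : ℝ) 1, HasDerivAt
      (fun s : ℝ => (1 - s) * (Real.sin (s * u) / u) - cos (s * u) / u ^ 2)
      ((1 - s) * cos (s * u)) s := by
    intro s _
    have h1 : HasDerivAt (fun s : ℝ => s * u) u s := by simpa using (hasDerivAt_id s).mul_const u
    have h2 := ((hasDerivAt_id s).const_sub 1).mul (h1.sin.div_const u)
    have h3 := h2.sub (h1.cos.div_const (u ^ 2))
    refine h3.congr_deriv ?_
    field_simp
    simp only [id]
    ring
  rw [intervalIntegral.integral_eq_sub_of_hasDerivAt h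
    (Continuous.intervalIntegrable (by fun_prop) _ _)]
  field_simp
  simp
  ring

theorem one_sub_cos_le (u : ℝ) : 1 - cos u ≤ u ^ 2 / 2 := by
  linarith [Real.one_sub_sq_div_two_le_cos (x := u)]

theorem integrableOn_levy (hα : 1 < α) (hα2 : α < 2) (x : ℝ) :
    IntegrableOn (fun r : ℝ => (1 - cos (2 * π * r * x)) * r ^ (-1 - α)) (Ioc 0 1) ∧
      IntegrableOn (fun r : ℝ => (1 - cos (2 * π * r * x)) * r ^ (-1 - α)) (Ioi 1) := by
  have hm : ∀ s : Set ℝ, AEStronglyMeasurable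
      (fun r : ℝ => (1 - cos (2 * π * r * x)) * r ^ (-1 - α)) (volume.restrict s) := by
    intro s
    exact Measurable.aestronglyMeasurable (by fun_prop)
  constructor
  · have h1 : IntegrableOn (fun r : ℝ => r ^ (1 - α)) (Ioc 0 1) := by
      have := intervalIntegral.intervalIntegrable_rpow' (a := 0) (b := 1) (r := 1 - α) (by linarith)
      rwa [intervalIntegrable_iff_integrableOn_Ioc_of_le zero_le_one] at this
    refine (h1.const_mul ((2 * π * x) ^ 2 / 2)).mono' (hm _) ?_
    filter_upwards [ae_restrict_mem measurableSet_Ioc] with r hr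
    have hr0 : 0 < r := hr.1
    rw [norm_mul, norm_of_nonneg (rpow_nonneg hr0.le _),
      norm_of_nonneg (by linarith [cos_le_one (2 * π * r * x)])]
    have e : r ^ (1 - α) = r ^ (2 : ℕ) * r ^ (-1 - α) := by
      rw [← rpow_natCast, ← rpow_add hr0]
      congr 1
      norm_num
      ring
    rw [e]
    have := one_sub_cos_le (2 * π * r * x)
    have hp := rpow_nonneg hr0.le (-1 - α)
    calc _ ≤ (2 * π * r * x) ^ 2 / 2 * r ^ (-1 - α) := by gcongr
      _ = _ := by ring
  · have h1 : IntegrableOn (fun r : ℝ => r ^ (-1 - α)) (Ioi 1) :=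
      integrableOn_Ioi_rpow_of_lt (by linarith) one_pos
    refine (h1.const_mul 2).mono' (hm _) ?_
    filter_upwards [ae_restrict_mem measurableSet_Ioi] with r hr
    have hr0 : 0 < r := one_pos.trans hr
    rw [norm_mul, norm_of_nonneg (rpow_nonneg hr0.le _),
      norm_of_nonneg (by linarith [cos_le_one (2 * π * r * x)])]
    have hp := rpow_nonneg hr0.le (-1 - α)
    have := Real.neg_one_le_cos (2 * π * r * x)
    gcongr
    linarith

theorem exists_levy_constant (hα : 1 < α) (hα2 : α < 2) : ∃ I : ℝ, 0 < I ∧ ∀ x : ℝ, |x| ^ α * I =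
    ∫ r in Ioi 0, (1 - cos (2 * π * r * x)) * r ^ (-1 - α) := by
  refine ⟨∫ r in Ioi 0, (1 - cos (2 * π * r * 1)) * r ^ (-1 - α), ?_, fun x => ?_⟩
  · have hInt : IntegrableOn
        (fun r : ℝ => (1 - cos (2 * π * r * 1)) * r ^ (-1 - α)) (Ioi 0) := by
      rw [← Ioc_union_Ioi_eq_Ioi zero_le_one]
      exact (integrableOn_levy hα hα2 1).1.union (integrableOn_levy hα hα2 1).2
    rw [setIntegral_pos_iff_support_of_nonneg_ae _ hInt]
    · have : Ioo (0 : ℝ) 1 ⊆ Function.support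
          (fun r : ℝ => (1 - cos (2 * π * r * 1)) * r ^ (-1 - α)) ∩ Ioi 0 := by
        intro r hr
        refine ⟨mul_ne_zero ?_ (Real.rpow_pos_of_pos hr.1 _).ne', hr.1⟩
        rw [mul_one, sub_ne_zero]
        intro h
        rw [eq_comm, Real.cos_eq_one_iff] at h
        obtain ⟨n, hn⟩ := h
        have h2 : (n : ℝ) = r := by
          have := Real.pi_pos
          have : (2 * π) * (n : ℝ) = 2 * π * r := by linarith
          exact mul_left_cancel₀ (by positivity) this
        have h3 := hr.1
        have h4 := hr.2
        rw [← h2] at h3 h4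
        norm_cast at h3 h4
        omega
      refine lt_of_lt_of_le ?_ (measure_mono this)
      simp
    · filter_upwards [ae_restrict_mem measurableSet_Ioi] with r hr
      have hr0 : 0 < r := hr
      exact mul_nonneg (by linarith [cos_le_one (2 * π * r * 1)])
        (rpow_nonneg hr0.le _)
  · rcases eq_or_ne x 0 with rfl | hx
    · simp [zero_rpow (by linarith : α ≠ 0)]
    have hx' : 0 < |x| := abs_pos.2 hx
    have h := integral_comp_mul_left_Ioi
      (fun r : ℝ => (1 - cos (2 * π * r * 1)) * r ^ (-1 - α)) 0 hx'
    rw [mul_zero] at h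
    have e : ∫ r in Ioi 0, (1 - cos (2 * π * (|x| * r) * 1)) * (|x| * r) ^ (-1 - α) =
        |x| ^ (-1 - α) *
          ∫ r in Ioi 0, (1 - cos (2 * π * r * x)) * r ^ (-1 - α) := by
      rw [← integral_const_mul]
      refine setIntegral_congr_fun measurableSet_Ioi fun r hr => ?_
      have hr0 : 0 < r := hr
      have hc : cos (2 * π * (|x| * r) * 1) = cos (2 * π * r * x) := by
        rcases abs_choice x with h | h <;> rw [h]
        · congr 1; ring
        · rw [← Real.cos_neg]; congr 1; ring
      simp only [hc]
      rw [mul_rpow hx'.le hr0.le]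
      ring
    rw [e] at h
    have h3 : |x| ^ α * (|x|⁻¹ * |x| ^ (-α + 1)) = 1 := by
      rw [← Real.rpow_neg_one, ← rpow_add hx', ← rpow_add hx']
      ring_nf
      simp
    have h4 : |x| ^ (1 + α) * |x| ^ (-1 - α) = 1 := by
      rw [← rpow_add hx']
      ring_nf
      simp
    have h5 : |x| ^ (1 + α) * |x|⁻¹ = |x| ^ α := by
      rw [← Real.rpow_neg_one, ← rpow_add hx']
      ring_nf
    have h6 := congrArg (fun t => |x| ^ (1 + α) * t) h
    simp only [smul_eq_mul] at h6
    rw [← mul_assoc, h4, one_mul, ← mul_assoc, h5] at h6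
    exact h6.symm

/-- The Lévy–Khintchine representation of `|x|^α`, with the small jumps in second order form. -/
theorem exists_levy_measures (hα : α ∈ Ioc (1 : ℝ) 2) : ∃ Λ μ : Measure ℝ, IsFiniteMeasure Λ ∧
    IsFiniteMeasure μ ∧ (∀ᵐ y ∂Λ, |y| ≤ 1) ∧ Integrable (fun y : ℝ => y) μ ∧ ∀ x : ℝ, |x| ^ α =
    x ^ 2 * (∫ y, cos (2 * π * y * x) ∂Λ) + ∫ y, (1 - cos (2 * π * y * x)) ∂μ := by
  rcases hα.2.lt_or_eq with hα2 | rfl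
  swap
  · refine ⟨Measure.dirac 0, 0, inferInstance, inferInstance, ?_, integrable_zero_measure, fun x => ?_⟩
    · rw [ae_dirac_iff (measurableSet_le (by fun_prop) (by fun_prop))]
      simp
    · simp
  have hα1 := hα.1
  obtain ⟨I, hI, hx⟩ := exists_levy_constant hα1 hα2
  have i1 : IntegrableOn (fun r : ℝ => r ^ (1 - α)) (Ioc 0 1) := by
    have := intervalIntegral.intervalIntegrable_rpow' (a := 0) (b := 1) (r := 1 - α) (by linarith)
    rwa [intervalIntegrable_iff_integrableOn_Ioc_of_le zero_le_one] at this
  have i2 : IntegrableOn (fun s : ℝ => 1 - s) (Ioc 0 1) := by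
    have : IntervalIntegrable (fun s : ℝ => 1 - s) volume 0 1 :=
      Continuous.intervalIntegrable (by fun_prop) _ _
    rwa [intervalIntegrable_iff_integrableOn_Ioc_of_le zero_le_one] at this
  have i3 : IntegrableOn (fun r : ℝ => I⁻¹ * r ^ (-1 - α)) (Ioi 1) :=
    (integrableOn_Ioi_rpow_of_lt (by linarith) one_pos).const_mul _
  set c : ℝ := (2 * π) ^ 2 / I with hc
  have hc0 : 0 < c := by positivity
  set ρ : Measure ℝ := (volume.restrict (Ioc 0 1)).withDensity
    (fun r => ENNReal.ofReal (c * r ^ (1 - α))) with hρ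
  set τ : Measure ℝ := (volume.restrict (Ioc 0 1)).withDensity
    (fun s => ENNReal.ofReal (1 - s)) with hτ
  set μ : Measure ℝ := (volume.restrict (Ioi 1)).withDensity
    (fun r => ENNReal.ofReal (I⁻¹ * r ^ (-1 - α))) with hμ
  have fρ : IsFiniteMeasure ρ := isFiniteMeasure_withDensity_ofReal (i1.const_mul c).2
  have fτ : IsFiniteMeasure τ := isFiniteMeasure_withDensity_ofReal i2.2
  have fμ : IsFiniteMeasure μ := isFiniteMeasure_withDensity_ofReal i3.2
  have aρ : ∀ᵐ r ∂ρ, r ∈ Ioc (0 : ℝ) 1 :=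
    (withDensity_absolutelyContinuous _ _).ae_le (ae_restrict_mem measurableSet_Ioc)
  have aτ : ∀ᵐ r ∂τ, r ∈ Ioc (0 : ℝ) 1 :=
    (withDensity_absolutelyContinuous _ _).ae_le (ae_restrict_mem measurableSet_Ioc)
  refine ⟨(ρ.prod τ).map (fun p => p.1 * p.2), μ, inferInstance, fμ, ?_, ?_, fun x => ?_⟩
  · rw [ae_map_iff (by fun_prop) (measurableSet_le (by fun_prop) (by fun_prop))]
    have h1 : ∀ᵐ p ∂(ρ.prod τ), p.1 ∈ Ioc (0 : ℝ) 1 := Measure.quasiMeasurePreserving_fst.ae aρ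
    have h2 : ∀ᵐ p ∂(ρ.prod τ), p.2 ∈ Ioc (0 : ℝ) 1 := Measure.quasiMeasurePreserving_snd.ae aτ
    filter_upwards [h1, h2] with p h1 h2
    rw [abs_mul, abs_of_pos h1.1, abs_of_pos h2.1]
    exact mul_le_one₀ h1.2 h2.1.le h2.2
  · rw [hμ, integrable_withDensity_iff_integrable_smul' (by fun_prop) (by simp)]
    have h1 : IntegrableOn (fun r : ℝ => r ^ (-α)) (Ioi 1) :=
      integrableOn_Ioi_rpow_of_lt (by linarith) one_pos
    refine (h1.const_mul I⁻¹).congr ?_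
    filter_upwards [ae_restrict_mem measurableSet_Ioi] with r hr
    have hr0 : 0 < r := one_pos.trans hr
    rw [toReal_ofReal (by positivity), smul_eq_mul, mul_assoc]
    congr 1
    rw [← Real.rpow_add_one hr0.ne']
    congr 1
    ring
  · have e1 : ∫ y, cos (2 * π * y * x) ∂((ρ.prod τ).map (fun p => p.1 * p.2)) =
        c * ∫ r in Ioc 0 1, r ^ (1 - α) *
          ∫ s in (0 : ℝ)..1, (1 - s) * cos (s * (2 * π * r * x)) := by
      rw [integral_map (by fun_prop) (by fun_prop), integral_prod, ← integral_const_mul, hρ,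
        integral_withDensity_eq_integral_toReal_smul (by fun_prop) (by simp)]
      · refine setIntegral_congr_fun measurableSet_Ioc fun r hr => ?_
        have hr0 : 0 < r := hr.1
        simp only [smul_eq_mul]
        rw [toReal_ofReal (by positivity), mul_assoc]
        congr 2
        rw [hτ, integral_withDensity_eq_integral_toReal_smul (by fun_prop) (by simp),
          intervalIntegral.integral_of_le zero_le_one]
        refine setIntegral_congr_fun measurableSet_Ioc fun s hs => ?_
        simp only [smul_eq_mul]
        rw [toReal_ofReal (by linarith [hs.2])]
        congr 2
        ring
      · refine Integrable.of_bound (C := 1) (Measurable.aestronglyMeasurable (by fun_prop)) ?_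
        exact .of_forall fun p => Real.abs_cos_le_one _
    have e2 : ∫ y, (1 - cos (2 * π * y * x)) ∂μ =
        I⁻¹ * ∫ r in Ioi 1, (1 - cos (2 * π * r * x)) * r ^ (-1 - α) := by
      rw [hμ, integral_withDensity_eq_integral_toReal_smul (by fun_prop) (by simp),
        ← integral_const_mul]
      refine setIntegral_congr_fun measurableSet_Ioi fun r hr => ?_
      have hr0 : 0 < r := one_pos.trans hr
      simp only [smul_eq_mul]
      rw [toReal_ofReal (by positivity)]
      ring
    have e3 : I⁻¹ * ∫ r in Ioc 0 1, (1 - cos (2 * π * r * x)) * r ^ (-1 - α) =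
        x ^ 2 * (c * ∫ r in Ioc 0 1, r ^ (1 - α) *
          ∫ s in (0 : ℝ)..1, (1 - s) * cos (s * (2 * π * r * x))) := by
      rw [← integral_const_mul, ← integral_const_mul, ← integral_const_mul]
      refine setIntegral_congr_fun measurableSet_Ioc fun r hr => ?_
      have hr0 : 0 < r := hr.1
      have e : r ^ (1 - α) = r ^ (2 : ℕ) * r ^ (-1 - α) := by
        rw [← rpow_natCast, ← rpow_add hr0]
        congr 1
        norm_num
        ring
      simp only [e]
      rw [one_sub_cos_eq, hc]
      field_simp
    rw [e1, e2, ← e3, ← mul_add, ← setIntegral_union (by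
      rw [disjoint_left]; intro r h1 h2; exact absurd h1.2 (not_le.2 h2)) measurableSet_Ioi
      (integrableOn_levy hα1 hα2 x).1 (integrableOn_levy hα1 hα2 x).2,
      Ioc_union_Ioi_eq_Ioi zero_le_one, ← hx x]
    field_simp

end

section

variable {d : ℕ}

theorem hasTemperateGrowth_fourierIntegral (N : Measure (Space d × Space d)) [IsFiniteMeasure N]
    (hN : ∀ᵐ v ∂N, ‖v‖ ≤ 1) {f : Space d × Space d → ℂ} (hf : Continuous f)
    (hf1 : ∀ v, ‖v‖ ≤ 1 → ‖f v‖ ≤ 1) :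
    (fun z : Space d => ∫ v, (𝐞 (-inner ℝ v.2 z) : ℂ) * f v ∂N).HasTemperateGrowth := by
  set L : (Space d × Space d) →L[ℝ] Space d →L[ℝ] ℝ :=
    (innerSL ℝ : Space d →L[ℝ] Space d →L[ℝ] ℝ).comp
      (ContinuousLinearMap.snd ℝ (Space d) (Space d)) with hL
  have e : (fun z : Space d => ∫ v, (𝐞 (-inner ℝ v.2 z) : ℂ) * f v ∂N) =
      VectorFourier.fourierIntegral 𝐞 N L.toLinearMap₁₂ f := by
    ext z
    rfl
  have hInt : ∀ n : ℕ, (n : ℕ∞) ≤ ⊤ → Integrable (fun v => ‖v‖ ^ n * ‖f v‖) N := by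
    intro n _
    refine Integrable.of_bound (C := 1) (Continuous.aestronglyMeasurable (by fun_prop)) ?_
    filter_upwards [hN] with v hv
    rw [norm_mul, norm_pow, norm_norm, norm_norm]
    exact mul_le_one₀ (pow_le_one₀ (norm_nonneg _) hv) (norm_nonneg _) (hf1 v hv)
  rw [e]
  refine ⟨VectorFourier.contDiff_fourierIntegral L hInt, fun n => ?_⟩
  refine ⟨0, (2 * π * ‖L‖) ^ n * N.real univ, fun z => ?_⟩
  rw [VectorFourier.iteratedFDeriv_fourierIntegral L hInt hf.aestronglyMeasurable le_top, pow_zero,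
    mul_one]
  refine (norm_integral_le_of_norm_le_const ?_)
  filter_upwards [hN] with v hv
  rw [Circle.norm_smul]
  refine (VectorFourier.norm_fourierPowSMulRight_le L f v n).trans ?_
  have h1 : ‖v‖ ^ n ≤ 1 := pow_le_one₀ (norm_nonneg _) hv
  have h2 := hf1 v hv
  have h3 : (0 : ℝ) ≤ (2 * π * ‖L‖) ^ n := by positivity
  calc _ ≤ (2 * π * ‖L‖) ^ n * 1 * 1 := by gcongr
    _ = _ := by ring

variable {α : ℝ} {ν : Measure (Sphere d)}

theorem integrable_symbol [IsFiniteMeasure ν] (hα : 0 ≤ α) (z : Space d) :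
    Integrable (fun ξ : Sphere d => |inner ℝ z (ξ : Space d)| ^ α) ν := by
  refine Integrable.of_bound (C := ‖z‖ ^ α) ?_ ?_
  · exact Measurable.aestronglyMeasurable (by fun_prop)
  · refine .of_forall fun ξ => ?_
    rw [norm_of_nonneg (by positivity)]
    refine Real.rpow_le_rpow (abs_nonneg _) ?_ hα
    refine (abs_real_inner_le_norm _ _).trans ?_
    rw [norm_eq_of_mem_sphere, mul_one]

theorem cos_eq_re (y x : ℝ) : cos (2 * π * y * x) = ((𝐞 (-(y * x)) : Circle) : ℂ).re := by
  rw [Real.fourierChar_apply, Complex.exp_ofReal_mul_I_re, ← Real.cos_neg]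
  congr 1
  ring

/-- The symbol is the sum of a smooth function and of a bounded function that is given by a finite
measure of large jumps. -/
theorem exists_symbol_decomposition (hα : α ∈ Ioc (1 : ℝ) 2) [IsFiniteMeasure ν] :
    ∃ (s : Space d → ℝ) (c : Space d → ℂ) (a b : ℝ), s.HasTemperateGrowth ∧ Mult c a b ∧
      (∀ z, ‖c z‖ ≤ a) ∧ ∀ z, (symbol α ν z : ℂ) = s z - c z := by
  obtain ⟨Λ, μ, hΛ, hμ, hΛ1, hμ1, hx⟩ := exists_levy_measures hα
  -- the jumps
  set N : Measure (Space d × Space d) := (ν.prod Λ).map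
    (fun p => ((p.1 : Space d), p.2 • (p.1 : Space d))) with hN
  have mN : Measurable (fun p : Sphere d × ℝ =>
      ((p.1 : Space d), p.2 • (p.1 : Space d))) := by fun_prop
  have hN1 : ∀ᵐ v ∂N, ‖v‖ ≤ 1 := by
    rw [hN, ae_map_iff mN.aemeasurable (measurableSet_le (by fun_prop) (by fun_prop))]
    have h2 : ∀ᵐ p ∂(ν.prod Λ), |p.2| ≤ 1 := Measure.quasiMeasurePreserving_snd.ae hΛ1
    filter_upwards [h2] with p hp
    rw [Prod.norm_mk, norm_smul, norm_eq_of_mem_sphere]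
    simpa using hp
  set M : Measure (Space d) := (ν.prod μ).map (fun p => p.2 • (p.1 : Space d)) with hM
  have mM : Measurable (fun p : Sphere d × ℝ => p.2 • (p.1 : Space d)) := by fun_prop
  have hM1 : Integrable (fun w : Space d => ‖w‖) M := by
    rw [hM, integrable_map_measure (by fun_prop) mM.aemeasurable]
    refine (hμ1.comp_snd ν).norm.congr ?_
    refine .of_forall fun p => ?_
    simp [norm_smul, norm_eq_of_mem_sphere]
  have hM2 : Integrable (fun w : Space d => ‖w‖) (M.map Neg.neg) := by
    rw [integrable_map_measure (by fun_prop) (by fun_prop)]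
    simpa [Function.comp_def] using hM1
  set F : Fin d → Fin d → Space d → ℝ := fun i j z =>
    (∫ v : Space d × Space d, (𝐞 (-inner ℝ v.2 z) : ℂ) * ((v.1 i : ℂ) * (v.1 j : ℂ)) ∂N).re with hF
  have tF : ∀ i j, (F i j).HasTemperateGrowth := by
    intro i j
    refine Function.HasTemperateGrowth.comp (g := Complex.reCLM) (Complex.reCLM.hasTemperateGrowth)
      (hasTemperateGrowth_fourierIntegral N hN1
        (f := fun v => ((v.1 i : ℂ) * (v.1 j : ℂ))) (by fun_prop) ?_)
    intro v hv
    rw [norm_mul, norm_real, norm_real]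
    have : ‖v.1‖ ≤ 1 := (norm_fst_le v).trans hv
    exact mul_le_one₀ ((PiLp.norm_apply_le _ i).trans this) (norm_nonneg _)
      ((PiLp.norm_apply_le _ j).trans this)
  set lam : ℝ := M.real univ with hlam
  set c1 : Space d → ℂ := fun z => ∫ w, (𝐞 (-inner ℝ w z) : ℂ) ∂M with hc1
  set c2 : Space d → ℂ := fun z => ∫ w, (𝐞 (-inner ℝ w z) : ℂ) ∂(M.map Neg.neg) with hc2
  have mc := (((Mult.charFun M hM1 le_rfl).add (Mult.charFun (M.map Neg.neg) hM2 le_rfl)).smul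
    (1 / 2 : ℂ)).add (Mult.const (d := d) (-(lam : ℂ)))
  have hneg : (M.map Neg.neg).real univ = lam := by
    rw [hlam, measureReal_def, measureReal_def, Measure.map_apply (by fun_prop) MeasurableSet.univ]
    simp
  have ec : ∀ z, ((1 / 2 : ℂ) • (c1 + c2) + fun _ => (-(lam : ℂ)) : Space d → ℂ) z =
      -((∫ w, (1 - cos (2 * π * inner ℝ w z)) ∂M : ℝ) : ℂ) := by
    intro z
    have i1 : ∀ M' : Measure (Space d), IsFiniteMeasure M' →
        Integrable (fun w : Space d => ((𝐞 (-inner ℝ w z) : Circle) : ℂ)) M' := by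
      intro M' _
      refine Integrable.of_bound (C := 1) (Continuous.aestronglyMeasurable (by fun_prop)) ?_
      exact .of_forall fun w => (Circle.norm_coe _).le
    have i2 : Integrable (fun w : Space d => ((𝐞 (-inner ℝ (-w) z) : Circle) : ℂ)) M := by
      refine Integrable.of_bound (C := 1) (Continuous.aestronglyMeasurable (by fun_prop)) ?_
      exact .of_forall fun w => (Circle.norm_coe _).le
    have i3 : Integrable (fun w : Space d => cos (2 * π * inner ℝ w z)) M := by
      refine Integrable.of_bound (C := 1) (Continuous.aestronglyMeasurable (by fun_prop)) ?_
      exact .of_forall fun w => Real.abs_cos_le_one _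
    have e2 : c2 z = ∫ w, ((𝐞 (-inner ℝ (-w) z) : Circle) : ℂ) ∂M := by
      rw [hc2]
      exact integral_map (by fun_prop) (Continuous.aestronglyMeasurable (by fun_prop))
    simp only [Pi.add_apply, Pi.smul_apply, smul_eq_mul]
    rw [integral_sub (integrable_const _) i3, integral_const, e2, hc1]
    simp only
    rw [← integral_add (i1 M inferInstance) i2, ← integral_const_mul, smul_eq_mul, mul_one, ← hlam]
    have e3 : ∀ w : Space d, (1 / 2 : ℂ) * (((𝐞 (-inner ℝ w z) : Circle) : ℂ) +
        ((𝐞 (-inner ℝ (-w) z) : Circle) : ℂ)) = ((cos (2 * π * inner ℝ w z) : ℝ) : ℂ) := by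
      intro w
      rw [Real.fourierChar_apply, Real.fourierChar_apply, inner_neg_left, Complex.ofReal_cos,
        Complex.cos]
      push_cast
      ring_nf
    simp only [e3]
    have e4 : ∫ w : Space d, ((cos (2 * π * inner ℝ w z) : ℝ) : ℂ) ∂M =
        ((∫ w : Space d, cos (2 * π * inner ℝ w z) ∂M : ℝ) : ℂ) := integral_ofReal
    rw [e4]
    push_cast
    ring
  refine ⟨fun z => ∑ i, ∑ j, z i * z j * F i j z, _, _, _, ?_, mc, ?_, ?_⟩
  · refine Function.HasTemperateGrowth.sum fun i _ => Function.HasTemperateGrowth.sum fun j _ => ?_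
    exact (((EuclideanSpace.proj i : Space d →L[ℝ] ℝ).hasTemperateGrowth.fun_mul
      (EuclideanSpace.proj j : Space d →L[ℝ] ℝ).hasTemperateGrowth).fun_mul (tF i j))
  · intro z
    have n1 : ∀ M' : Measure (Space d), IsFiniteMeasure M' →
        ‖∫ w : Space d, ((𝐞 (-inner ℝ w z) : Circle) : ℂ) ∂M'‖ ≤ M'.real univ := by
      intro M' _
      refine (norm_integral_le_of_norm_le_const (C := 1) ?_).trans (by simp)
      exact .of_forall fun w => (Circle.norm_coe _).le
    refine (norm_add_le _ _).trans ?_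
    refine add_le_add ?_ le_rfl
    rw [Pi.smul_apply, norm_smul]
    gcongr
    exact (norm_add_le _ _).trans (add_le_add (n1 _ inferInstance) (n1 _ inferInstance))
  · intro z
    rw [ec, sub_neg_eq_add, ← Complex.ofReal_add]
    congr 1
    have s1 : ∫ w, (1 - cos (2 * π * inner ℝ w z)) ∂M =
        ∫ ξ, ∫ y, (1 - cos (2 * π * y * inner ℝ z (ξ : Space d))) ∂μ ∂ν := by
      rw [hM, integral_map mM.aemeasurable (Continuous.aestronglyMeasurable (by fun_prop)),
        integral_prod]
      · refine integral_congr_ae (.of_forall fun ξ => ?_)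
        refine integral_congr_ae (.of_forall fun y => ?_)
        simp only [real_inner_smul_left]
        rw [real_inner_comm, mul_assoc (2 * π)]
      · refine Integrable.of_bound (C := 2) (Measurable.aestronglyMeasurable (by fun_prop)) ?_
        refine .of_forall fun w => ?_
        rw [Real.norm_eq_abs, abs_le]
        constructor <;> linarith [cos_le_one (2 * π * inner ℝ (w.2 • (w.1 : Space d)) z),
          Real.neg_one_le_cos (2 * π * inner ℝ (w.2 • (w.1 : Space d)) z)]
    have iF : ∀ i j, Integrable (fun v : Space d × Space d =>
        (𝐞 (-inner ℝ v.2 z) : ℂ) * ((v.1 i : ℂ) * (v.1 j : ℂ))) N := by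
      intro i j
      refine Integrable.of_bound (C := 1) (Continuous.aestronglyMeasurable (by fun_prop)) ?_
      filter_upwards [hN1] with v hv
      rw [norm_mul, norm_mul, norm_real, norm_real, Circle.norm_coe, one_mul]
      have : ‖v.1‖ ≤ 1 := (norm_fst_le v).trans hv
      exact mul_le_one₀ ((PiLp.norm_apply_le _ i).trans this) (norm_nonneg _)
        ((PiLp.norm_apply_le _ j).trans this)
    have s2 : ∑ i, ∑ j, z i * z j * F i j z =
        ∫ v, inner ℝ z v.1 ^ 2 * cos (2 * π * inner ℝ v.2 z) ∂N := by
      have : ∀ v : Space d × Space d, inner ℝ z v.1 ^ 2 * cos (2 * π * inner ℝ v.2 z) =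
          ∑ i, ∑ j, z i * z j *
            ((𝐞 (-inner ℝ v.2 z) : ℂ) * ((v.1 i : ℂ) * (v.1 j : ℂ))).re := by
        intro v
        have hc := cos_eq_re (inner ℝ v.2 z) 1
        rw [mul_one, mul_one] at hc
        rw [hc, sq, PiLp.inner_apply, Finset.sum_mul_sum, sum_mul]
        refine sum_congr rfl fun i _ => ?_
        rw [sum_mul]
        refine sum_congr rfl fun j _ => ?_
        rw [← Complex.ofReal_mul, Complex.re_mul_ofReal]
        simp
        ring
      simp only [this]
      rw [integral_finsetSum]
      · refine sum_congr rfl fun i _ => ?_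
        rw [integral_finsetSum]
        · refine sum_congr rfl fun j _ => ?_
          rw [integral_const_mul]
          congr 1
          exact (integral_re (iF i j)).symm
        · exact fun j _ => ((iF i j).re).const_mul _
      · exact fun i _ => integrable_finsetSum _ fun j _ => ((iF i j).re).const_mul _
    have i4 : Integrable (fun p : Sphere d × ℝ => inner ℝ z (p.1 : Space d) ^ 2 *
        cos (2 * π * inner ℝ (p.2 • (p.1 : Space d)) z)) (ν.prod Λ) := by
      refine Integrable.of_bound (C := ‖z‖ ^ 2) (Measurable.aestronglyMeasurable (by fun_prop)) ?_
      refine .of_forall fun p => ?_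
      rw [norm_mul, norm_pow, Real.norm_eq_abs]
      have h1 : |inner ℝ z (p.1 : Space d)| ≤ ‖z‖ := by
        refine (abs_real_inner_le_norm _ _).trans ?_
        rw [norm_eq_of_mem_sphere, mul_one]
      have h2 := Real.abs_cos_le_one (2 * π * inner ℝ (p.2 • (p.1 : Space d)) z)
      calc _ ≤ ‖z‖ ^ 2 * 1 := by gcongr; exact h2
        _ = _ := mul_one _
    have s3 : ∫ v, inner ℝ z v.1 ^ 2 * cos (2 * π * inner ℝ v.2 z) ∂N =
        ∫ ξ, inner ℝ z (ξ : Space d) ^ 2 *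
          ∫ y, cos (2 * π * y * inner ℝ z (ξ : Space d)) ∂Λ ∂ν := by
      rw [hN, integral_map mN.aemeasurable (Continuous.aestronglyMeasurable (by fun_prop)),
        integral_prod _ i4]
      refine integral_congr_ae (.of_forall fun ξ => ?_)
      simp only
      rw [← integral_const_mul]
      refine integral_congr_ae (.of_forall fun y => ?_)
      simp only [real_inner_smul_left]
      rw [real_inner_comm, mul_assoc (2 * π)]
    beta_reduce
    rw [s1, s2, s3, ← integral_add]
    · unfold symbol
      exact integral_congr_ae (.of_forall fun ξ => hx _)
    · refine i4.integral_prod_left.congr (.of_forall fun ξ => ?_)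
      simp only
      rw [← integral_const_mul]
      refine integral_congr_ae (.of_forall fun y => ?_)
      simp only [real_inner_smul_left]
      rw [real_inner_comm, mul_assoc (2 * π)]
    · refine Integrable.of_bound (C := 2 * μ.real univ) ?_ ?_
      · refine (StronglyMeasurable.integral_prod_right
          (f := fun ξ : Sphere d => fun y : ℝ =>
            (1 - cos (2 * π * y * inner ℝ z (ξ : Space d)))) ?_).aestronglyMeasurable
        exact Continuous.stronglyMeasurable (by fun_prop)
      · refine .of_forall fun ξ => ?_
        refine norm_integral_le_of_norm_le_const (.of_forall fun y => ?_)
        rw [Real.norm_eq_abs, abs_le]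
        constructor <;> linarith [cos_le_one (2 * π * y * inner ℝ z (ξ : Space d)),
          Real.neg_one_le_cos (2 * π * y * inner ℝ z (ξ : Space d))]

end

section

variable {d : ℕ} {α : ℝ} {ν : Measure (Sphere d)}
variable {c : ℝ} {q : Space d → ℂ}

/-- The symbol `e^{-tψ}` as a complex valued function. -/
def expSymbol (α : ℝ) (ν : Measure (Sphere d)) (t : ℝ) (z : Space d) : ℂ :=
  (exp (-t * symbol α ν z) : ℂ)

theorem symbol_nonneg (z : Space d) : 0 ≤ symbol α ν z := integral_nonneg fun _ => by positivity

theorem symbol_smul {δ : ℝ} (hδ : 0 ≤ δ) (z : Space d) :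
    symbol α ν (δ • z) = δ ^ α * symbol α ν z := by
  unfold symbol
  rw [← integral_const_mul]
  congr 1
  ext ξ
  rw [real_inner_smul_left, abs_mul, abs_of_nonneg hδ, mul_rpow hδ (abs_nonneg _)]

variable [IsFiniteMeasure ν] [Stable α ν]

theorem Stable.pos (ν : Measure (Sphere d)) [Stable α ν] : 0 < α :=
  one_pos.trans (Stable.index (ν := ν)).1

theorem continuous_symbol : Continuous (symbol α ν) := by
  have hα := Stable.pos ν
  rw [continuous_iff_continuousAt]
  intro z₀
  refine continuousAt_of_dominated (bound := fun _ => (‖z₀‖ + 1) ^ α) ?_ ?_ (integrable_const _) ?_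
  · exact .of_forall fun z => (integrable_symbol hα.le z).aestronglyMeasurable
  · filter_upwards [Metric.ball_mem_nhds z₀ one_pos] with z hz
    refine .of_forall fun ξ => ?_
    rw [norm_of_nonneg (by positivity)]
    refine Real.rpow_le_rpow (abs_nonneg _) ?_ hα.le
    refine (abs_real_inner_le_norm _ _).trans ?_
    rw [norm_eq_of_mem_sphere, mul_one]
    rw [mem_ball_iff_norm] at hz
    linarith [norm_sub_norm_le z z₀]
  · refine .of_forall fun ξ => ?_
    exact ((Continuous.abs (by fun_prop)).rpow_const fun _ => Or.inr hα.le).continuousAt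

theorem symbol_pos {z : Space d} (hz : z ≠ 0) : 0 < symbol α ν z := by
  have hα := Stable.pos ν
  refine lt_of_le_of_ne (symbol_nonneg z) fun h => hz ?_
  have h0 : (fun ξ : Sphere d => |inner ℝ z (ξ : Space d)| ^ α) =ᵐ[ν] 0 :=
    (integral_eq_zero_iff_of_nonneg (fun _ => by positivity) (integrable_symbol hα.le z)).1 h.symm
  have hopen : IsOpen {ξ : Sphere d | inner ℝ z (ξ : Space d) ≠ 0} :=
    isOpen_ne_fun (by fun_prop) continuous_const
  have hnull : ν {ξ : Sphere d | inner ℝ z (ξ : Space d) ≠ 0} = 0 := by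
    refine measure_mono_null ?_ h0
    intro ξ hξ h1
    have h2 : |inner ℝ z (ξ : Space d)| ^ α = 0 := h1
    rw [Real.rpow_eq_zero (abs_nonneg _) hα.ne'] at h2
    exact hξ (abs_eq_zero.1 h2)
  have hsub := Measure.subset_compl_support_of_isOpen hopen hnull
  have : z ∈ LinearMap.ker (innerSL ℝ z).toLinearMap := by
    refine (Stable.spans (ν := ν)).ge.trans (Submodule.span_le.2 ?_) Submodule.mem_top
    rintro _ ⟨ξ, hξ, rfl⟩
    by_contra hne
    exact hsub (a := ξ) hne hξ
  exact inner_self_eq_zero.1 (show inner ℝ z z = 0 from this)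

variable (ν) in
theorem exists_symbol_ge : ∃ c : ℝ, 0 < c ∧ ∀ z, c * ‖z‖ ^ α ≤ symbol α ν z := by
  have hα := Stable.pos ν
  have key : ∃ c : ℝ, 0 < c ∧ ∀ z ∈ Sphere d, c ≤ symbol α ν z := by
    rcases (Sphere d).eq_empty_or_nonempty with he | hne
    · exact ⟨1, one_pos, fun z hz => by rw [he] at hz; exact hz.elim⟩
    · obtain ⟨w, hw, hmin⟩ := (isCompact_sphere (0 : Space d) 1).exists_isMinOn hne
        (continuous_symbol (ν := ν)).continuousOn
      refine ⟨symbol α ν w, symbol_pos ?_, fun z hz => hmin hz⟩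
      rintro rfl
      simp at hw
  obtain ⟨c, hc, h⟩ := key
  refine ⟨c, hc, fun z => ?_⟩
  rcases eq_or_ne z 0 with rfl | hz
  · simp [zero_rpow hα.ne', symbol_nonneg]
  have hz' : 0 < ‖z‖ := norm_pos_iff.2 hz
  have e : symbol α ν z = ‖z‖ ^ α * symbol α ν (‖z‖⁻¹ • z) := by
    rw [← symbol_smul hz'.le, smul_smul, mul_inv_cancel₀ hz'.ne', one_smul]
  rw [e, mul_comm]
  gcongr
  refine h _ ?_
  rw [mem_sphere_zero_iff_norm, norm_smul, norm_inv, norm_norm, inv_mul_cancel₀ hz'.ne']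

theorem exists_one_add_pow_mul_exp_neg_le (hc : 0 < c) (k : ℕ) :
    ∃ C : ℝ, ∀ x : ℝ, 0 ≤ x → (1 + x) ^ k * exp (-(c * x)) ≤ C := by
  refine ⟨k.factorial / c ^ k * exp c, fun x hx => ?_⟩
  have h := Real.pow_div_factorial_le_exp (c * (1 + x)) (by positivity) k
  rw [div_le_iff₀ (by positivity), mul_pow] at h
  have e : exp (c * (1 + x)) = exp c * exp (c * x) := by rw [← exp_add]; ring_nf
  rw [e] at h
  rw [Real.exp_neg, ← div_eq_mul_inv, div_le_iff₀ (exp_pos _)]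
  have hck : 0 < c ^ k := by positivity
  rw [show (k.factorial / c ^ k * exp c * exp (c * x) : ℝ) =
    (exp c * exp (c * x) * k.factorial) / c ^ k by ring, le_div_iff₀ hck]
  linarith

theorem exists_schwartz_exp_neg {s : Space d → ℝ} (hs : s.HasTemperateGrowth) {C : ℝ} (hc : 0 < c)
    (h : ∀ z, c * ‖z‖ - C ≤ s z) : ∃ φ : 𝓢(Space d, ℂ), ∀ z, φ z = (exp (-s z) : ℂ) := by
  have hsm : ContDiff ℝ ∞ (fun z => exp (-s z)) := Real.contDiff_exp.comp hs.1.neg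
  have hdec : ∀ k n : ℕ, ∃ K : ℝ, ∀ z, ‖z‖ ^ k * ‖iteratedFDeriv ℝ n (fun z => exp (-s z)) z‖
      ≤ K := by
    intro k n
    obtain ⟨l, D, hD, hb⟩ := hs.neg.norm_iteratedFDeriv_le_uniform n
    obtain ⟨K, hK⟩ := exists_one_add_pow_mul_exp_neg_le hc (k + l * n)
    refine ⟨n.factorial * exp C * (1 + D) ^ n * K, fun z => ?_⟩
    have h1 : ‖iteratedFDeriv ℝ n (exp ∘ (-s)) z‖ ≤
        n.factorial * exp (-s z) * ((1 + D) * (1 + ‖z‖) ^ l) ^ n := by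
      refine norm_iteratedFDeriv_comp_le Real.contDiff_exp hs.1.neg (N := ∞) (mod_cast le_top) z
        (fun i _ => ?_) fun i hi hin => ?_
      · rw [norm_iteratedFDeriv_eq_norm_iteratedDeriv, iteratedDeriv_eq_iterate,
          Real.iter_deriv_exp, norm_of_nonneg (exp_pos _).le]
      · refine (hb i hin z).trans ?_
        have h1 : D * (1 + ‖z‖) ^ l ≤ (1 + D) * (1 + ‖z‖) ^ l := by gcongr; linarith
        refine h1.trans (le_self_pow₀ ?_ (by omega))
        exact one_le_mul_of_one_le_of_one_le (by linarith) (one_le_pow₀ (by simp))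
    have h2 : exp (-s z) ≤ exp C * exp (-(c * ‖z‖)) := by
      rw [← exp_add]
      exact Real.exp_le_exp.2 (by linarith [h z])
    have h3 : ‖z‖ ^ k ≤ (1 + ‖z‖) ^ k := by gcongr; linarith
    calc ‖z‖ ^ k * ‖iteratedFDeriv ℝ n (fun z => exp (-s z)) z‖
        ≤ (1 + ‖z‖) ^ k * (n.factorial * (exp C * exp (-(c * ‖z‖))) *
            ((1 + D) * (1 + ‖z‖) ^ l) ^ n) := by
          refine mul_le_mul h3 (h1.trans ?_) (norm_nonneg _) (by positivity)
          gcongr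
      _ = n.factorial * exp C * (1 + D) ^ n *
            ((1 + ‖z‖) ^ (k + l * n) * exp (-(c * ‖z‖))) := by
          rw [mul_pow, ← pow_mul, pow_add]
          ring
      _ ≤ _ := by
          gcongr
          exact hK _ (norm_nonneg _)
  set φ : 𝓢(Space d, ℝ) := ⟨fun z => exp (-s z), hsm, hdec⟩ with hφ
  refine ⟨SchwartzMap.postcompCLM ofRealCLM φ, fun z => ?_⟩
  rfl

/-- The multiplier `e^{-ψ}`. -/
theorem exists_ker_mul_exp_symbol {g : Space d → ℂ} (hg : g.HasTemperateGrowth) :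
    ∃ A B, Ker (fun z => g z * (exp (-symbol α ν z) : ℂ)) A B := by
  have hα := Stable.index (ν := ν)
  have hα0 : 0 < α := Stable.pos ν
  obtain ⟨s, c, a, b, hs, hc, hca, hsc⟩ := exists_symbol_decomposition (ν := ν) hα
  obtain ⟨c₀, hc₀, hψ⟩ := exists_symbol_ge ν
  have hlow : ∀ z, c₀ * ‖z‖ - (c₀ + a) ≤ s z := by
    intro z
    have h1 : s z = symbol α ν z + (c z).re := by
      have := congrArg Complex.re (hsc z)
      simp at this
      linarith
    have h2 : -a ≤ (c z).re := by
      have := (Complex.abs_re_le_norm (c z)).trans (hca z)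
      linarith [neg_abs_le (c z).re]
    have h3 : ‖z‖ - 1 ≤ ‖z‖ ^ α := by
      rcases le_total ‖z‖ 1 with hz | hz
      · have : 0 ≤ ‖z‖ ^ α := by positivity
        linarith
      · have := rpow_le_rpow_of_exponent_le hz hα.1.le
        rw [rpow_one] at this
        linarith
    have h4 := hψ z
    have h5 := mul_le_mul_of_nonneg_left h3 hc₀.le
    linarith
  obtain ⟨φ, hφ⟩ := exists_schwartz_exp_neg hs hc₀ hlow
  obtain ⟨A, B, hAB⟩ := exists_ker_schwartz (smulLeftCLM ℂ g φ)
  have := hc.exp.2.2 _ A B hAB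
  have e : ((smulLeftCLM ℂ g φ : 𝓢(Space d, ℂ)) : Space d → ℂ) *
      (fun z => Complex.exp (c z)) = fun z => g z * (exp (-symbol α ν z) : ℂ) := by
    ext z
    rw [Pi.mul_apply, smulLeftCLM_apply_apply hg, hφ, smul_eq_mul, mul_assoc]
    congr 1
    rw [Complex.ofReal_exp, Complex.ofReal_exp, ← Complex.exp_add]
    congr 1
    push_cast
    rw [hsc z]
    ring
  rw [e] at this
  exact ⟨_, _, this⟩

theorem exists_ker_mul_symbol (hq : HasCompactSupport q) (hqs : ContDiff ℝ ∞ q) :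
    ∃ A B, Ker (fun z => q z * (symbol α ν z : ℂ)) A B := by
  have hα := Stable.index (ν := ν)
  obtain ⟨s, c, a, b, hs, hc, hca, hsc⟩ := exists_symbol_decomposition (ν := ν) hα
  obtain ⟨A, B, hAB⟩ := exists_ker_of_hasCompactSupport hq hqs
  have h1 : ContDiff ℝ ∞ (fun z => (s z : ℂ)) := ofRealCLM.contDiff.comp hs.1
  obtain ⟨A', B', hAB'⟩ := exists_ker_of_hasCompactSupport (m := q * fun z => (s z : ℂ))
    hq.mul_right (hqs.mul h1)
  have := hAB'.sub (hc.2.2 _ A B hAB)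
  have e : (q * fun z => (s z : ℂ)) - q * c = fun z => q z * (symbol α ν z : ℂ) := by
    ext z
    simp only [Pi.sub_apply, Pi.mul_apply]
    rw [hsc]
    ring
  rw [e] at this
  exact ⟨_, _, this⟩

theorem expSymbol_zero : expSymbol α ν 0 = 1 := by
  ext z
  simp [expSymbol]

theorem expSymbol_add (s t : ℝ) : expSymbol α ν (s + t) = expSymbol α ν s * expSymbol α ν t := by
  ext z
  simp only [expSymbol, Pi.mul_apply]
  rw [← Complex.ofReal_mul, ← exp_add]
  ring_nf

theorem expSymbol_smul {σ : ℝ} (hσ : 0 ≤ σ) (t : ℝ) (z : Space d) :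
    expSymbol α ν t (σ • z) = expSymbol α ν (t * σ ^ α) z := by
  simp only [expSymbol]
  rw [symbol_smul hσ]
  ring_nf

theorem exists_ker_expSymbol : ∃ A B, ∀ t, 0 < t → Ker (expSymbol α ν t) A (t ^ (1 / α) * B) := by
  have hα0 : 0 < α := Stable.pos ν
  obtain ⟨A, B, h⟩ := exists_ker_mul_exp_symbol (ν := ν)
    (g := fun _ => (1 : ℂ)) (Function.HasTemperateGrowth.const _)
  refine ⟨A, B, fun t ht => ?_⟩
  have h2 := h.dilate (δ := t ^ (1 / α)) (by positivity)
  have e : (fun z => (1 : ℂ) * (exp (-symbol α ν ((t ^ (1 / α)) • z)) : ℂ)) =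
      expSymbol α ν t := by
    ext z
    rw [one_mul, symbol_smul (by positivity), ← rpow_mul ht.le, one_div,
      inv_mul_cancel₀ hα0.ne', rpow_one]
    simp [expSymbol]
  rwa [e] at h2

/-- Decay of the semigroup on functions whose Fourier transform is carried by an annulus. -/
theorem exists_ker_annulus_expSymbol (hq : HasCompactSupport q) (hqs : ContDiff ℝ ∞ q)
    (hq0 : (0 : Space d) ∉ tsupport q) : ∃ C, 0 ≤ C ∧ ∀ δ t γ : ℝ, 0 < δ → 0 ≤ t →
    γ ∈ Icc (0 : ℝ) 5 → Ker (fun z => q (δ • z) * expSymbol α ν t z)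
    (C * (1 + t ^ (1 / α) / δ) ^ (-γ)) (δ * (C * (1 + t ^ (1 / α) / δ) ^ (-γ))) := by
  have hα0 : 0 < α := Stable.pos ν
  obtain ⟨A, B, hAB⟩ := exists_ker_expSymbol (ν := ν)
  obtain ⟨A₁, B₁, h₁⟩ := exists_ker_of_hasCompactSupport hq hqs
  have hg : (fun z : Space d => ((‖z‖ ^ 2 : ℝ) : ℂ) ^ 3).HasTemperateGrowth :=
    (Function.Complex.hasTemperateGrowth_ofReal.comp
      (Function.hasTemperateGrowth_norm_sq (H := Space d))).pow 3
  obtain ⟨A₂, B₂, h₂⟩ := exists_ker_mul_exp_symbol (ν := ν) hg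
  have hq3 : ContDiff ℝ ∞ (fun z => q z * (((‖z‖ ^ 2 : ℝ) : ℂ) ^ 3)⁻¹) := by
    rw [contDiff_iff_contDiffAt]
    intro z
    by_cases hz : z ∈ tsupport q
    · have hz0 : z ≠ 0 := fun h => hq0 (h ▸ hz)
      refine hqs.contDiffAt.mul (ContDiffAt.inv ?_ ?_)
      · exact hg.1.contDiffAt
      · have : (‖z‖ : ℝ) ≠ 0 := norm_ne_zero_iff.2 hz0
        exact pow_ne_zero _ (Complex.ofReal_ne_zero.2 (pow_ne_zero _ this))
    · have : (fun z => q z * (((‖z‖ ^ 2 : ℝ) : ℂ) ^ 3)⁻¹) =ᶠ[𝓝 z] fun _ => 0 := by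
        filter_upwards [(isClosed_tsupport q).isOpen_compl.mem_nhds hz] with w hw
        rw [image_eq_zero_of_notMem_tsupport hw, zero_mul]
      exact contDiffAt_const.congr_of_eventuallyEq this
  obtain ⟨A₃, B₃, h₃⟩ := exists_ker_of_hasCompactSupport (m := q * fun z => (((‖z‖ ^ 2 : ℝ) : ℂ) ^ 3)⁻¹)
    hq.mul_right hq3
  have hA := (hAB 1 one_pos).nonneg_left
  have hB : 0 ≤ B := by simpa using (hAB 1 one_pos).nonneg_right
  have hA1 := h₁.nonneg_left
  have hB1 := h₁.nonneg_right
  have hA2 := h₂.nonneg_left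
  have hB2 := h₂.nonneg_right
  have hA3 := h₃.nonneg_left
  have hB3 := h₃.nonneg_right
  -- the small and the large dilations
  set C₁ := (A₁ + B₁) + (A₁ * A + (A₁ * B + B₁ * A)) with hC1
  set C₂ := A₃ * A₂ + (A₃ * B₂ + B₃ * A₂) with hC2
  have hC₁ : 0 ≤ C₁ := by positivity
  have hC₂ : 0 ≤ C₂ := by positivity
  refine ⟨32 * (C₁ + C₂), by positivity, fun δ t γ hδ ht hγ => ?_⟩
  set σ := t ^ (1 / α) / δ with hσ
  have hσ0 : 0 ≤ σ := by positivity
  have hσα : σ ^ α * δ ^ α = t := by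
    rw [← mul_rpow hσ0 hδ.le, hσ, div_mul_cancel₀ _ hδ.ne', ← rpow_mul ht, one_div,
      inv_mul_cancel₀ hα0.ne', rpow_one]
  suffices h : Ker (fun z => q z * expSymbol α ν (σ ^ α) z)
      (32 * (C₁ + C₂) * (1 + σ) ^ (-γ)) (32 * (C₁ + C₂) * (1 + σ) ^ (-γ)) by
    have := h.dilate hδ
    have e : (fun z => q (δ • z) * expSymbol α ν (σ ^ α) (δ • z)) =
        fun z => q (δ • z) * expSymbol α ν t z := by
      ext z
      rw [expSymbol_smul hδ.le, hσα]
    rwa [e] at this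
  have lowb : ∀ x : ℝ, 1 ≤ x → x ^ (-5 : ℝ) ≤ x ^ (-γ) := fun x hx =>
    rpow_le_rpow_of_exponent_le hx (by linarith [hγ.2])
  have two : (1 : ℝ) ≤ 32 * (2 : ℝ) ^ (-5 : ℝ) := by
    rw [rpow_neg (by norm_num)]
    norm_num
  rcases le_total σ 1 with h1 | h1
  · have hge : C₁ ≤ 32 * (C₁ + C₂) * (1 + σ) ^ (-γ) := by
      have h2 : (2 : ℝ) ^ (-5 : ℝ) ≤ (1 + σ) ^ (-γ) := by
        refine le_trans ?_ (lowb _ (by linarith))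
        exact Real.rpow_le_rpow_of_nonpos (by linarith) (by linarith) (by norm_num)
      have h3 : (1 : ℝ) ≤ 32 * (1 + σ) ^ (-γ) := by linarith
      nlinarith
    rcases hσ0.eq_or_lt with h0 | h0
    · rw [← h0] at hge ⊢
      rw [zero_rpow hα0.ne', expSymbol_zero]
      have : (fun z => q z * (1 : Space d → ℂ) z) = q := by ext z; simp
      rw [this]
      have : 0 ≤ A₁ * A + (A₁ * B + B₁ * A) := by positivity
      exact h₁.mono (by linarith) (by linarith)
    · have := h₁.mul (hAB (σ ^ α) (by positivity))
      refine this.mono (le_trans ?_ hge) (le_trans ?_ hge)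
      · have : 0 ≤ A₁ * B + B₁ * A := by positivity
        linarith
      · have h4 : (σ ^ α) ^ (1 / α) ≤ 1 := by
          rw [← rpow_mul hσ0, mul_one_div_cancel hα0.ne', rpow_one]
          exact h1
        have : A₁ * ((σ ^ α) ^ (1 / α) * B) ≤ A₁ * B := by
          gcongr
          exact mul_le_of_le_one_left hB h4
        have : 0 ≤ A₁ * A := by positivity
        linarith
  · have h0 : 0 < σ := one_pos.trans_le h1
    have hge : C₂ * σ ^ (-5 : ℝ) ≤ 32 * (C₁ + C₂) * (1 + σ) ^ (-γ) := by
      have h2 : (2 : ℝ) ^ (-5 : ℝ) * σ ^ (-5 : ℝ) ≤ (1 + σ) ^ (-γ) := by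
        refine le_trans ?_ (lowb _ (by linarith))
        rw [← mul_rpow (by norm_num) hσ0]
        exact Real.rpow_le_rpow_of_nonpos (by linarith) (by linarith) (by norm_num)
      have h3 : 0 ≤ σ ^ (-5 : ℝ) := by positivity
      have h4 : σ ^ (-5 : ℝ) ≤ 32 * (1 + σ) ^ (-γ) := by nlinarith
      have h5 : 0 ≤ (1 + σ) ^ (-γ) := by positivity
      nlinarith
    have := (h₃.mul (h₂.dilate h0)).smul (((σ ^ 6)⁻¹ : ℝ) : ℂ)
    have e : ((((σ ^ 6)⁻¹ : ℝ) : ℂ) • ((q * fun z => (((‖z‖ ^ 2 : ℝ) : ℂ) ^ 3)⁻¹) *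
        fun z => ((‖σ • z‖ ^ 2 : ℝ) : ℂ) ^ 3 * (exp (-symbol α ν (σ • z)) : ℂ))) =
        fun z => q z * expSymbol α ν (σ ^ α) z := by
      ext z
      simp only [Pi.smul_apply, Pi.mul_apply, smul_eq_mul]
      have e1 : (exp (-symbol α ν (σ • z)) : ℂ) = expSymbol α ν (σ ^ α) z := by
        rw [symbol_smul hσ0]
        simp [expSymbol]
      rw [e1]
      rcases eq_or_ne z 0 with rfl | hz
      · rw [image_eq_zero_of_notMem_tsupport hq0]
        simp
      · have hz' : ((‖z‖ : ℝ) : ℂ) ≠ 0 := by simpa using hz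
        have hs' : (σ : ℂ) ≠ 0 := by simpa using h0.ne'
        rw [norm_smul, norm_of_nonneg hσ0]
        push_cast
        field_simp
    rw [e] at this
    rw [norm_real, norm_of_nonneg (by positivity)] at this
    have e6 : (σ ^ 6)⁻¹ = σ ^ (-5 : ℝ) * σ⁻¹ := by
      rw [rpow_neg hσ0]
      norm_cast
      rw [← mul_inv, ← pow_succ]
    have hi : σ⁻¹ ≤ 1 := inv_le_one_of_one_le₀ h1
    have h3 : 0 ≤ σ ^ (-5 : ℝ) := by positivity
    have hi0 : 0 ≤ σ⁻¹ := by positivity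
    refine this.mono (le_trans ?_ hge) (le_trans ?_ hge)
    · rw [e6, mul_assoc, mul_comm C₂]
      gcongr
      have : σ⁻¹ * (A₃ * A₂) ≤ A₃ * A₂ := mul_le_of_le_one_left (by positivity) hi
      have : 0 ≤ A₃ * B₂ + B₃ * A₂ := by positivity
      linarith
    · rw [e6, mul_assoc, mul_comm C₂]
      gcongr
      have e7 : σ⁻¹ * (A₃ * (σ * B₂) + B₃ * A₂) = A₃ * B₂ + σ⁻¹ * (B₃ * A₂) := by field_simp
      have : σ⁻¹ * (B₃ * A₂) ≤ B₃ * A₂ := mul_le_of_le_one_left (by positivity) hi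
      have : 0 ≤ A₃ * A₂ := by positivity
      linarith

/-- Small times. -/
theorem exists_ker_expSymbol_sub_one (hq : HasCompactSupport q) (hqs : ContDiff ℝ ∞ q) :
    ∃ C, 0 ≤ C ∧ ∀ δ t : ℝ, 0 < δ → 0 ≤ t → ∃ B, Ker (fun z => q (δ • z) * (expSymbol α ν t z - 1))
      (C * min 1 (t * δ ^ (-α))) B := by
  obtain ⟨A, B, hAB⟩ := exists_ker_expSymbol (ν := ν)
  obtain ⟨A₁, B₁, h₁⟩ := exists_ker_of_hasCompactSupport hq hqs
  obtain ⟨R, hR⟩ := hq.isCompact.isBounded.subset_closedBall (0 : Space d)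
  set b : ContDiffBump (0 : Space d) := ⟨|R| + 1, |R| + 2, by positivity, by linarith⟩ with hb
  have hbs : ContDiff ℝ ∞ (fun z => (b z : ℂ)) := ofRealCLM.contDiff.comp b.contDiff
  have hbc : HasCompactSupport (fun z => (b z : ℂ)) :=
    b.hasCompactSupport.comp_left (g := Complex.ofReal) Complex.ofReal_zero
  obtain ⟨a, a', ha⟩ := exists_ker_mul_symbol (ν := ν) hbc hbs
  have hb1 : ∀ z, q z ≠ 0 → (b z : ℂ) = 1 := by
    intro z hz
    have h1 : z ∈ Metric.closedBall (0 : Space d) R := hR (subset_tsupport _ hz)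
    rw [b.one_of_mem_closedBall (Metric.closedBall_subset_closedBall ?_ h1)]
    · simp
    · change R ≤ |R| + 1
      linarith [le_abs_self R]
  have hA := (hAB 1 one_pos).nonneg_left
  have hA1 := h₁.nonneg_left
  have ha0 := ha.nonneg_left
  refine ⟨A₁ + A₁ * A + a * exp a * A₁, by positivity, fun δ t hδ ht => ?_⟩
  set τ := t * δ ^ (-α) with hτ
  have hτ0 : 0 ≤ τ := by positivity
  have hτδ : τ * δ ^ α = t := by
    rw [hτ, mul_assoc, ← rpow_add hδ]
    simp
  suffices h : ∃ B', Ker (fun z => q z * (expSymbol α ν τ z - 1))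
      ((A₁ + A₁ * A + a * exp a * A₁) * min 1 τ) B' by
    obtain ⟨B', h⟩ := h
    have := h.dilate hδ
    have e : (fun z => q (δ • z) * (expSymbol α ν τ (δ • z) - 1)) =
        fun z => q (δ • z) * (expSymbol α ν t z - 1) := by
      ext z
      rw [expSymbol_smul hδ.le, hτδ]
    rw [e] at this
    exact ⟨_, this⟩
  rcases le_total τ 1 with h1 | h1
  · rw [min_eq_right h1]
    have h2 := (ha.toMult.smul (((-τ : ℝ)) : ℂ)).exp_sub_one.2.2 _ _ _ h₁
    have e : (q * fun z => Complex.exp ((((-τ : ℝ) : ℂ) • fun z => (b z : ℂ) * (symbol α ν z : ℂ)) z) - 1)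
        = fun z => q z * (expSymbol α ν τ z - 1) := by
      ext z
      simp only [Pi.mul_apply, Pi.smul_apply, smul_eq_mul]
      by_cases hz : q z = 0
      · simp [hz]
      · rw [hb1 z hz, one_mul, expSymbol, Complex.ofReal_exp]
        push_cast
        rfl
    rw [e] at h2
    refine ⟨_, h2.mono ?_ le_rfl⟩
    rw [norm_real, norm_neg, norm_of_nonneg hτ0]
    have h3 : exp (τ * a) - 1 ≤ τ * (a * exp a) := by
      have h4 := Real.add_one_le_exp (-(τ * a))
      have h5 : exp (τ * a) * exp (-(τ * a)) = 1 := by rw [← exp_add]; simp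
      have h6 : exp (τ * a) ≤ exp a := Real.exp_le_exp.2 (mul_le_of_le_one_left ha0 h1)
      have h7 : 0 ≤ τ * a := by positivity
      nlinarith [exp_pos (τ * a)]
    calc _ ≤ τ * (a * exp a) * A₁ := by gcongr
      _ ≤ _ := by
        have : 0 ≤ τ * (A₁ + A₁ * A) := by positivity
        nlinarith
  · rw [min_eq_left h1, mul_one]
    have h0 : 0 < τ := one_pos.trans_le h1
    have h2 := (h₁.mul (hAB τ h0)).sub h₁
    have e : q * expSymbol α ν τ - q = fun z => q z * (expSymbol α ν τ z - 1) := by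
      ext z
      simp only [Pi.sub_apply, Pi.mul_apply]
      ring
    rw [e] at h2
    refine ⟨_, h2.mono ?_ le_rfl⟩
    have : 0 ≤ a * exp a * A₁ := by positivity
    linarith

end

section

variable {d : ℕ} {α : ℝ} {ν : Measure (Sphere d)} [IsFiniteMeasure ν]
  [Stable α ν]
variable {m n : ℕ}

/-! ### The multipliers of the dyadic partition -/

namespace DyadicPartition

variable (χ : DyadicPartition d)

/-- The complex valued function `p_{n-1}`. -/
def pc (n : ℕ) (x : Space d) : ℂ := (χ.p n x : ℂ)

/-- The sum of `p_{n-1}` and its neighbours. -/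
def pt (n : ℕ) : Space d → ℂ := ∑ i ∈ Finset.Icc (n - 1) (n + 1), χ.pc i

theorem p_zero : χ.p 0 = χ.low := rfl

theorem p_succ (n : ℕ) : χ.p (n + 1) = fun x => χ.ann (((2 : ℝ) ^ n)⁻¹ • x) := rfl

theorem exists_radii : ∃ R a b : ℝ, 0 < a ∧ R < 2 * a ∧ b < 4 * a ∧ (∀ x, χ.p 0 x ≠ 0 → ‖x‖ ≤ R) ∧
    ∀ n x, χ.p (n + 1) x ≠ 0 → a * 2 ^ n ≤ ‖x‖ ∧ ‖x‖ ≤ b * 2 ^ n := by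
  obtain ⟨R, a, b, ha, hR, hb, hl, hann⟩ := χ.supports
  refine ⟨R, a, b, ha, hR, hb, fun x hx => hl (subset_tsupport _ hx), fun n x hx => ?_⟩
  have h := hann (subset_tsupport _ (show (((2 : ℝ) ^ n)⁻¹ • x) ∈ Function.support χ.ann from hx))
  rw [mem_ofPred_eq, norm_smul, norm_inv, norm_pow, Real.norm_two, inv_mul_eq_div] at h
  have h2 : (0 : ℝ) < 2 ^ n := by positivity
  rw [le_div_iff₀ h2, div_le_iff₀ h2] at h
  exact h

theorem p_mul_p_eq_zero (h : n + 2 ≤ m) (x : Space d) : χ.p n x * χ.p m x = 0 := by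
  obtain ⟨R, a, b, ha, hR, hb, h0, h1⟩ := χ.exists_radii
  by_contra hne
  obtain ⟨hn, hm⟩ := mul_ne_zero_iff.1 hne
  obtain ⟨k, rfl⟩ : ∃ k, m = k + 1 := ⟨m - 1, by omega⟩
  have hm' := (h1 k x hm).1
  rcases n with _ | n
  · have h2 := h0 x hn
    have : (2 : ℝ) ^ 1 ≤ 2 ^ k := pow_le_pow_right₀ (by norm_num) (by omega)
    nlinarith
  · have h2 := (h1 n x hn).2
    have : (2 : ℝ) ^ (n + 2) ≤ 2 ^ k := pow_le_pow_right₀ (by norm_num) (by omega)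
    have h3 : (0 : ℝ) < 2 ^ n := by positivity
    have h4 : (2 : ℝ) ^ (n + 2) = 4 * 2 ^ n := by ring
    nlinarith

theorem pc_mul_pc_eq_zero (h : n + 2 ≤ m) : χ.pc n * χ.pc m = 0 := by
  ext x
  simp only [pc, Pi.mul_apply, Pi.zero_apply]
  exact_mod_cast χ.p_mul_p_eq_zero h x

theorem pc_mul_pc_eq_zero' (h : n + 2 ≤ m ∨ m + 2 ≤ n) : χ.pc n * χ.pc m = 0 := by
  rcases h with h | h
  · exact χ.pc_mul_pc_eq_zero h
  · rw [mul_comm]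
    exact χ.pc_mul_pc_eq_zero h

theorem low_add_ann (x : Space d) : χ.low x + χ.ann x = χ.low ((2 : ℝ)⁻¹ • x) := by
  have h1 := (hasSum_nat_add_iff' 1).2 (χ.sum_eq_one x)
  have h2 := χ.sum_eq_one ((2 : ℝ)⁻¹ • x)
  have e : (fun j : ℕ => χ.ann (((2 : ℝ) ^ j)⁻¹ • (2 : ℝ)⁻¹ • x)) =
      fun j : ℕ => χ.ann (((2 : ℝ) ^ (j + 1))⁻¹ • x) := by
    ext j
    rw [smul_smul, ← mul_inv, ← pow_succ]
  rw [e] at h2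
  have := h1.unique h2
  simp at this
  linarith

theorem sum_p (N : ℕ) (x : Space d) :
    ∑ n ∈ Finset.range (N + 1), χ.p n x = χ.low (((2 : ℝ) ^ N)⁻¹ • x) := by
  induction N with
  | zero => simp [p_zero]
  | succ N ih =>
    rw [Finset.sum_range_succ, ih, p_succ, low_add_ann, smul_smul, ← mul_inv, ← pow_succ']

theorem sum_pc (N : ℕ) :
    ∑ n ∈ Finset.range (N + 1), χ.pc n = fun x => (χ.low (((2 : ℝ) ^ N)⁻¹ • x) : ℂ) := by
  ext x
  rw [Finset.sum_apply, ← sum_p]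
  simp [pc]

/-- The function `p_{-1}` is one near the origin. -/
theorem exists_low_eq_one : ∃ a : ℝ, 0 < a ∧ ∀ x, ‖x‖ < a → χ.low x = 1 := by
  obtain ⟨R, a, b, ha, hR, hb, h0, h1⟩ := χ.exists_radii
  refine ⟨a, ha, fun x hx => ?_⟩
  have h2 := χ.sum_eq_one x
  have : (fun j : ℕ => χ.ann (((2 : ℝ) ^ j)⁻¹ • x)) = fun _ => 0 := by
    ext j
    by_contra hne
    have h3 := (h1 j x hne).1
    have : (1 : ℝ) ≤ 2 ^ j := one_le_pow₀ (by norm_num)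
    nlinarith
  rw [this] at h2
  linarith [h2.unique hasSum_zero]

theorem low_zero : χ.low 0 = 1 := by
  obtain ⟨a, ha, h⟩ := χ.exists_low_eq_one
  exact h 0 (by simpa using ha)

theorem p_succ_zero (n : ℕ) : χ.p (n + 1) 0 = 0 := by
  obtain ⟨R, a, b, ha, hR, hb, h0, h1⟩ := χ.exists_radii
  by_contra hne
  have := (h1 n 0 hne).1
  have h2 : (0 : ℝ) < a * 2 ^ n := by positivity
  rw [norm_zero] at this
  linarith

theorem sum_p_eq_one (x : Space d) : ∃ N₀, ∀ N ≥ N₀, ∑ n ∈ Finset.range (N + 1), χ.p n x = 1 := by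
  obtain ⟨a, ha, h⟩ := χ.exists_low_eq_one
  obtain ⟨N₀, hN⟩ := pow_unbounded_of_one_lt (‖x‖ / a) (one_lt_two : (1 : ℝ) < 2)
  refine ⟨N₀, fun N hle => ?_⟩
  rw [sum_p]
  refine h _ ?_
  have h1 : (2 : ℝ) ^ N₀ ≤ 2 ^ N := pow_le_pow_right₀ (by norm_num) hle
  rw [norm_smul, norm_inv, norm_pow, Real.norm_two, inv_mul_lt_iff₀ (by positivity)]
  rw [div_lt_iff₀ ha] at hN
  nlinarith

theorem pt_mul_pc (n : ℕ) : χ.pt n * χ.pc n = χ.pc n := by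
  ext x
  obtain ⟨N₀, hN⟩ := χ.sum_p_eq_one x
  have h1 := hN (N₀ + n + 2) (by omega)
  have h2 : ∑ i ∈ Finset.range (N₀ + n + 2 + 1), χ.p i x * χ.p n x =
      ∑ i ∈ Finset.Icc (n - 1) (n + 1), χ.p i x * χ.p n x := by
    symm
    refine Finset.sum_subset ?_ ?_
    · intro i hi
      simp only [Finset.mem_Icc, Finset.mem_range] at hi ⊢
      omega
    · intro i _ hi
      simp only [Finset.mem_Icc, not_and, not_le] at hi
      by_cases h : n - 1 ≤ i
      · rw [mul_comm]
        exact χ.p_mul_p_eq_zero (by have := hi h; omega) x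
      · exact χ.p_mul_p_eq_zero (by omega) x
  rw [← sum_mul, h1, one_mul] at h2
  rw [Pi.mul_apply, pt, Finset.sum_apply, sum_mul]
  simp only [pc]
  exact_mod_cast h2.symm

theorem low_hasCompactSupport : HasCompactSupport χ.low := by
  obtain ⟨R, a, b, ha, hR, hb, h0, h1⟩ := χ.supports
  exact HasCompactSupport.of_support_subset_isCompact (isCompact_closedBall (0 : Space d) R)
    fun x hx => by simpa using h0 (subset_tsupport _ hx)

theorem ann_hasCompactSupport : HasCompactSupport χ.ann := by
  obtain ⟨R, a, b, ha, hR, hb, h0, h1⟩ := χ.supports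
  exact HasCompactSupport.of_support_subset_isCompact (isCompact_closedBall (0 : Space d) b)
    fun x hx => by simpa using (h1 (subset_tsupport _ hx)).2

/-- The function `p_0` as a complex valued function. -/
def annC (x : Space d) : ℂ := (χ.ann x : ℂ)

theorem annC_hasCompactSupport : HasCompactSupport χ.annC :=
  χ.ann_hasCompactSupport.comp_left (g := Complex.ofReal) Complex.ofReal_zero

theorem annC_smooth : ContDiff ℝ ∞ χ.annC := ofRealCLM.contDiff.comp χ.ann_smooth

theorem zero_notMem_tsupport_annC : (0 : Space d) ∉ tsupport χ.annC := by
  obtain ⟨R, a, b, ha, hR, hb, h0, h1⟩ := χ.supports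
  intro h
  have hsub : tsupport χ.annC ⊆ tsupport χ.ann := closure_mono (by
    intro x hx hz
    exact hx (by simp [annC, hz]))
  have := (h1 (hsub h)).1
  rw [norm_zero] at this
  linarith

theorem pc_zero_hasCompactSupport : HasCompactSupport (χ.pc 0) :=
  χ.low_hasCompactSupport.comp_left (g := Complex.ofReal) Complex.ofReal_zero

theorem pc_zero_smooth : ContDiff ℝ ∞ (χ.pc 0) := ofRealCLM.contDiff.comp χ.low_smooth

theorem pc_succ (n : ℕ) : χ.pc (n + 1) = fun z => χ.annC (((2 : ℝ) ^ n)⁻¹ • z) := rfl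

theorem pc_hasCompactSupport (n : ℕ) : HasCompactSupport (χ.pc n) := by
  rcases n with _ | n
  · exact χ.pc_zero_hasCompactSupport
  · exact χ.annC_hasCompactSupport.comp_homeomorph
      (Homeomorph.smulOfNeZero (((2 : ℝ) ^ n)⁻¹) (by positivity))

theorem pc_smooth (n : ℕ) : ContDiff ℝ ∞ (χ.pc n) := by
  rcases n with _ | n
  · exact χ.pc_zero_smooth
  · exact χ.annC_smooth.comp (contDiff_const_smul _)

theorem pc_hasTemperateGrowth (n : ℕ) : (χ.pc n).HasTemperateGrowth :=
  (χ.pc_hasCompactSupport n).hasTemperateGrowth (χ.pc_smooth n)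

theorem pt_hasCompactSupport (n : ℕ) : HasCompactSupport (χ.pt n) := by
  refine HasCompactSupport.intro' (K := ⋃ i ∈ Finset.Icc (n - 1) (n + 1), tsupport (χ.pc i))
    ((Finset.Icc (n - 1) (n + 1)).isCompact_biUnion fun i _ => χ.pc_hasCompactSupport i)
    ?_ fun x hx => ?_
  · exact (Finset.finite_toSet _).isClosed_biUnion fun i _ => isClosed_tsupport _
  · rw [pt, Finset.sum_apply]
    refine Finset.sum_eq_zero fun i hi => image_eq_zero_of_notMem_tsupport fun h => hx ?_
    exact mem_biUnion hi h

theorem pt_smooth (n : ℕ) : ContDiff ℝ ∞ (χ.pt n) := by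
  have e : χ.pt n = fun x => ∑ i ∈ Finset.Icc (n - 1) (n + 1), χ.pc i x := by
    ext x
    rw [pt, Finset.sum_apply]
  rw [e]
  exact ContDiff.sum fun i _ => χ.pc_smooth i

theorem exists_ker_pc : ∃ C : ℝ, 0 ≤ C ∧ ∀ n, Ker (χ.pc n) C (C * ((2 : ℝ) ^ n)⁻¹) := by
  obtain ⟨A, B, h⟩ := exists_ker_of_hasCompactSupport χ.pc_zero_hasCompactSupport χ.pc_zero_smooth
  obtain ⟨A', B', h'⟩ := exists_ker_of_hasCompactSupport χ.annC_hasCompactSupport χ.annC_smooth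
  have := h.nonneg_left
  have := h.nonneg_right
  have := h'.nonneg_left
  have := h'.nonneg_right
  refine ⟨A + B + A' + 2 * B', by positivity, fun n => ?_⟩
  rcases n with _ | n
  · exact h.mono (by linarith) (by simp; linarith)
  · have hd := h'.dilate (δ := ((2 : ℝ) ^ n)⁻¹) (by positivity)
    refine hd.mono (by linarith) ?_
    rw [pow_succ, mul_inv, mul_comm _ B', ← mul_assoc, mul_comm _ (2 : ℝ)⁻¹, ← mul_assoc]
    gcongr
    linarith

/-- Bernstein's inequality. -/
theorem exists_lipMul_pc : ∃ L : ℝ, 0 ≤ L ∧ ∀ n, LipMul (χ.pc n) (L * 2 ^ n) := by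
  obtain ⟨L, hL, h⟩ := exists_lipMul_dilate
    (χ.pc_zero_hasCompactSupport.toSchwartzMap χ.pc_zero_smooth)
  obtain ⟨L', hL', h'⟩ := exists_lipMul_dilate
    (χ.annC_hasCompactSupport.toSchwartzMap χ.annC_smooth)
  have mono : ∀ {m : Space d → ℂ} {l l' : ℝ}, LipMul m l → l ≤ l' → LipMul m l' := by
    intro m l l' h hl f x y
    refine (h f x y).trans ?_
    gcongr
  refine ⟨L + L', by positivity, fun n => ?_⟩
  rcases n with _ | n
  · have := h 1 one_pos
    simp only [one_smul, inv_one, mul_one] at this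
    refine mono this ?_
    simp
    linarith
  · have := h' (((2 : ℝ) ^ n)⁻¹) (by positivity)
    refine mono this ?_
    rw [inv_inv]
    gcongr
    · linarith
    · norm_num
    · omega

end DyadicPartition

end

section

variable {d : ℕ} {α : ℝ} {ν : Measure (Sphere d)} [IsFiniteMeasure ν]
  [Stable α ν]
variable {γ : ℝ}

/-! ### Dyadic weights -/

/-- The weight `2^{γn}`. -/
def pw (γ : ℝ) (n : ℕ) : ℝ := (2 : ℝ) ^ (γ * n)

theorem pw_pos (γ : ℝ) (n : ℕ) : 0 < pw γ n := Real.rpow_pos_of_pos two_pos _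

theorem pw_nonneg (γ : ℝ) (n : ℕ) : 0 ≤ pw γ n := (pw_pos γ n).le

theorem pw_add (γ γ' : ℝ) (n : ℕ) : pw (γ + γ') n = pw γ n * pw γ' n := by
  rw [pw, add_mul, rpow_add two_pos]
  rfl

theorem pw_zero_left (n : ℕ) : pw 0 n = 1 := by simp [pw]

theorem pw_zero_right (γ : ℝ) : pw γ 0 = 1 := by simp [pw]

theorem pw_one (n : ℕ) : pw 1 n = 2 ^ n := by simp [pw]

theorem pw_neg (γ : ℝ) (n : ℕ) : pw (-γ) n = (pw γ n)⁻¹ := by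
  rw [pw, neg_mul, rpow_neg two_pos.le]
  rfl

theorem pw_mono {γ' : ℝ} (h : γ ≤ γ') (n : ℕ) : pw γ n ≤ pw γ' n :=
  rpow_le_rpow_of_exponent_le one_le_two (by gcongr)

theorem one_le_pw (h : 0 ≤ γ) (n : ℕ) : 1 ≤ pw γ n := by
  rw [← pw_zero_left n]
  exact pw_mono h n

theorem pw_index_add (γ : ℝ) (n m : ℕ) : pw γ (n + m) = pw γ n * pw γ m := by
  rw [pw, Nat.cast_add, mul_add, rpow_add two_pos]
  rfl

theorem pw_eq_rpow (γ : ℝ) (n : ℕ) : pw γ n = ((2 : ℝ) ^ n) ^ γ := by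
  rw [pw, mul_comm, rpow_mul two_pos.le, rpow_natCast]

theorem pw_eq_pow (γ : ℝ) (n : ℕ) : pw γ n = ((2 : ℝ) ^ γ) ^ n := by
  rw [pw, rpow_mul two_pos.le, rpow_natCast]

theorem pw_rpow (γ x : ℝ) (n : ℕ) : (pw γ n) ^ x = pw (γ * x) n := by
  rw [pw, ← rpow_mul two_pos.le, pw]
  ring_nf

/-- Weights with neighbouring indices are comparable. -/
theorem pw_le_of_near {n m k : ℕ} (h1 : n ≤ m + k) (h2 : m ≤ n + k) : pw γ n ≤ pw |γ| k * pw γ m := by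
  simp only [pw]
  rw [← rpow_add two_pos]
  refine rpow_le_rpow_of_exponent_le one_le_two ?_
  have h1' : (n : ℝ) - m ≤ k := by
    have : (n : ℝ) ≤ m + k := by exact_mod_cast h1
    linarith
  have h2' : -(k : ℝ) ≤ (n : ℝ) - m := by
    have : (m : ℝ) ≤ n + k := by exact_mod_cast h2
    linarith
  have h3 : |(n : ℝ) - m| ≤ k := abs_le.2 ⟨h2', h1'⟩
  have h4 : γ * ((n : ℝ) - m) ≤ |γ| * k := by
    calc γ * ((n : ℝ) - m) ≤ |γ * ((n : ℝ) - m)| := le_abs_self _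
      _ = |γ| * |(n : ℝ) - m| := abs_mul _ _
      _ ≤ _ := by gcongr
  linarith

theorem summable_pw (h : γ < 0) : Summable (pw γ) := by
  have : pw γ = fun n => ((2 : ℝ) ^ γ) ^ n := by
    ext n
    exact pw_eq_pow γ n
  rw [this]
  exact summable_geometric_of_lt_one (rpow_nonneg two_pos.le _)
    (Real.rpow_lt_one_of_one_lt_of_neg one_lt_two h)

theorem sum_range_pw_le (h : 0 < γ) : ∃ C, 0 ≤ C ∧ ∀ n : ℕ, ∑ i ∈ Finset.range n, pw γ i ≤
    C * pw γ n := by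
  set x : ℝ := (2 : ℝ) ^ γ with hx
  have hx1 : 1 < x := Real.one_lt_rpow one_lt_two h
  refine ⟨(x - 1)⁻¹, by simp; linarith, fun n => ?_⟩
  have : ∀ i, pw γ i = x ^ i := pw_eq_pow γ
  simp only [this]
  rw [geom_sum_eq hx1.ne', div_eq_inv_mul]
  have h1 : 0 ≤ (x - 1)⁻¹ := by simp; linarith
  gcongr
  linarith

theorem sum_range_pw_neg_le (h : γ < 0) : ∃ C, 0 ≤ C ∧ ∀ n : ℕ, ∑ i ∈ Finset.range n, pw γ i ≤ C :=
  ⟨∑' i, pw γ i, tsum_nonneg fun i => pw_nonneg γ i, fun _ =>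
    (summable_pw h).sum_le_tsum _ fun i _ => pw_nonneg γ i⟩

/-! ### The semigroup on the dyadic blocks -/

theorem Ker.congr {m m' : Space d → ℂ} {A B : ℝ} (h : Ker m A B) (e : m = m') : Ker m' A B := e ▸ h

theorem exists_ker_pc_expSymbol (χ : DyadicPartition d) (T : ℝ) :
    ∃ C, 0 ≤ C ∧ ∀ n t γ, t ∈ Icc 0 T → γ ∈ Icc (0 : ℝ) 5 → 0 < t ∨ γ = 0 →
      Ker (χ.pc n * expSymbol α ν t) (C * (t ^ (-(γ / α)) * pw (-γ) n))
      (pw (-1) n * (C * (t ^ (-(γ / α)) * pw (-γ) n))) := by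
  have hα := Stable.index (ν := ν)
  have hα0 : 0 < α := Stable.pos ν
  obtain ⟨C, hC, h⟩ := exists_ker_annulus_expSymbol (ν := ν) χ.annC_hasCompactSupport
    χ.annC_smooth χ.zero_notMem_tsupport_annC
  obtain ⟨A, B, hAB⟩ := exists_ker_expSymbol (ν := ν)
  obtain ⟨A', B', h'⟩ := exists_ker_of_hasCompactSupport χ.pc_zero_hasCompactSupport
    χ.pc_zero_smooth
  have hA := (hAB 1 one_pos).nonneg_left
  have hB : 0 ≤ B := by simpa using (hAB 1 one_pos).nonneg_right
  have hA' := h'.nonneg_left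
  have hB' := h'.nonneg_right
  set T' : ℝ := max T 1 with hT'
  have hT1 : 1 ≤ T' := le_max_right _ _
  set D := A' + B' + (A' * A + (A' * (T' * B) + B' * A)) with hD
  have hD0 : 0 ≤ D := by positivity
  refine ⟨64 * C + D * T' ^ (5 : ℝ), by positivity, fun n t γ ht hγ htγ => ?_⟩
  have ht0 := ht.1
  have hts : 0 < t → (t ^ (1 / α)) ^ (-γ) = t ^ (-(γ / α)) := by
    intro _
    rw [← rpow_mul ht0]
    ring_nf
  rcases n with _ | n
  · -- the low frequencies
    have hge : D ≤ (64 * C + D * T' ^ (5 : ℝ)) * (t ^ (-(γ / α)) * pw (-γ) 0) := by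
      rw [pw_zero_right, mul_one]
      have h1 : 1 ≤ T' ^ (5 : ℝ) * t ^ (-(γ / α)) := by
        rcases htγ with h0 | rfl
        · have h2 : T' ^ (-(γ / α)) ≤ t ^ (-(γ / α)) :=
            Real.rpow_le_rpow_of_nonpos h0 (ht.2.trans (le_max_left _ _))
              (by have := hγ.1; simp; positivity)
          have h3 : T' ^ (-5 : ℝ) ≤ T' ^ (-(γ / α)) := by
            refine rpow_le_rpow_of_exponent_le hT1 ?_
            have : γ / α ≤ 5 := by
              rw [div_le_iff₀ hα0]
              nlinarith [hγ.2, hα.1]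
            linarith
          have h4 : T' ^ (5 : ℝ) * T' ^ (-5 : ℝ) = 1 := by
            rw [← rpow_add (by linarith)]
            simp
          have h5 : 0 ≤ T' ^ (5 : ℝ) := by positivity
          nlinarith
        · simpa using Real.one_le_rpow hT1 (by norm_num : (0 : ℝ) ≤ 5)
      have h2 : 0 ≤ t ^ (-(γ / α)) := by positivity
      have h3 : 0 ≤ C * t ^ (-(γ / α)) := by positivity
      nlinarith
    have hge' := hge
    rw [pw_zero_right, mul_one] at hge' ⊢
    rw [pw_zero_right, one_mul]
    rcases ht0.eq_or_lt with h0 | h0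
    · rw [← h0, expSymbol_zero, mul_one]
      rw [← h0] at hge'
      have : 0 ≤ A' * A + (A' * (T' * B) + B' * A) := by positivity
      exact h'.mono (le_trans (by linarith) hge') (le_trans (by linarith) hge')
    · refine (h'.mul (hAB t h0)).mono (le_trans ?_ hge') (le_trans ?_ hge')
      · have : 0 ≤ A' * (T' * B) + B' * A := by positivity
        linarith
      · have h1 : t ^ (1 / α) ≤ T' := by
          calc t ^ (1 / α) ≤ T' ^ (1 / α) :=
                Real.rpow_le_rpow ht0 (ht.2.trans (le_max_left _ _)) (by positivity)
            _ ≤ T' ^ (1 : ℝ) := by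
                refine rpow_le_rpow_of_exponent_le hT1 ?_
                rw [div_le_one hα0]
                exact hα.1.le
            _ = T' := rpow_one _
        have h2 : A' * (t ^ (1 / α) * B) ≤ A' * (T' * B) := by gcongr
        have : 0 ≤ A' * A := by positivity
        linarith
  · have h1 := h (((2 : ℝ) ^ n)⁻¹) t γ (by positivity) ht0 hγ
    have hD1 : 0 ≤ D * T' ^ (5 : ℝ) := by positivity
    have hle : (1 + t ^ (1 / α) / ((2 : ℝ) ^ n)⁻¹) ^ (-γ) ≤
        32 * (t ^ (-(γ / α)) * pw (-γ) (n + 1)) := by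
      have h5 : pw (-γ) n ≤ 32 * pw (-γ) (n + 1) := by
        rw [pw_index_add]
        have : (1 : ℝ) / 32 ≤ pw (-γ) 1 := by
          rw [pw, Nat.cast_one, mul_one]
          calc (1 : ℝ) / 32 = 2 ^ (-5 : ℝ) := by rw [rpow_neg (by norm_num)]; norm_num
            _ ≤ _ := rpow_le_rpow_of_exponent_le one_le_two (by linarith [hγ.2])
        have := pw_pos (-γ) n
        nlinarith
      rcases htγ with h0 | rfl
      · rw [div_inv_eq_mul]
        have h3 : 0 < t ^ (1 / α) * 2 ^ n := by positivity
        calc _ ≤ (t ^ (1 / α) * 2 ^ n) ^ (-γ) :=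
              Real.rpow_le_rpow_of_nonpos h3 (by linarith) (by linarith [hγ.1])
          _ = t ^ (-(γ / α)) * pw (-γ) n := by
              rw [mul_rpow (by positivity) (by positivity), hts h0, pw_eq_rpow]
          _ ≤ t ^ (-(γ / α)) * (32 * pw (-γ) (n + 1)) := by gcongr
          _ = _ := by ring
      · simp [pw_zero_left]
    have hX : 0 ≤ t ^ (-(γ / α)) * pw (-γ) (n + 1) := by
      have := pw_pos (-γ) (n + 1)
      positivity
    refine (h1.congr (by ext z; rfl)).mono ?_ ?_
    · calc _ ≤ C * (32 * (t ^ (-(γ / α)) * pw (-γ) (n + 1))) := by gcongr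
        _ ≤ _ := by nlinarith
    · have e : pw (-1) (n + 1) = ((2 : ℝ) ^ n)⁻¹ * 2⁻¹ := by rw [pw_neg, pw_one, pow_succ, mul_inv]
      rw [e, mul_assoc]
      refine mul_le_mul_of_nonneg_left ?_ (by positivity)
      calc _ ≤ C * (32 * (t ^ (-(γ / α)) * pw (-γ) (n + 1))) := by gcongr
        _ ≤ _ := by nlinarith

theorem exists_ker_pc_expSymbol_sub_one (χ : DyadicPartition d) :
    ∃ C, 0 ≤ C ∧ ∀ n t, 0 ≤ t → ∃ B, Ker (χ.pc n * (expSymbol α ν t - 1)) (C * min 1 (t * pw α n)) B := by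
  have hα0 : 0 < α := Stable.pos ν
  obtain ⟨C, hC, h⟩ := exists_ker_expSymbol_sub_one (ν := ν) χ.annC_hasCompactSupport
    χ.annC_smooth
  obtain ⟨C', hC', h'⟩ := exists_ker_expSymbol_sub_one (ν := ν) χ.pc_zero_hasCompactSupport
    χ.pc_zero_smooth
  refine ⟨C + C', by positivity, fun n t ht => ?_⟩
  have h0 : 0 ≤ min 1 (t * pw α n) := le_min zero_le_one (mul_nonneg ht (pw_nonneg _ _))
  rcases n with _ | n
  · obtain ⟨B, hB⟩ := h' 1 t one_pos ht
    refine ⟨B, (hB.congr ?_).mono ?_ le_rfl⟩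
    · ext z
      simp
    · rw [Real.one_rpow, pw_zero_right] at *
      nlinarith
  · obtain ⟨B, hB⟩ := h (((2 : ℝ) ^ n)⁻¹) t (by positivity) ht
    refine ⟨B, (hB.congr ?_).mono ?_ le_rfl⟩
    · ext z
      rfl
    · have h1 : (((2 : ℝ) ^ n)⁻¹) ^ (-α) ≤ pw α (n + 1) := by
        rw [Real.inv_rpow (by positivity), rpow_neg (by positivity), inv_inv, ← pw_eq_rpow,
          pw_index_add]
        have := one_le_pw hα0.le 1
        nlinarith [pw_pos α n]
      have h2 : min 1 (t * (((2 : ℝ) ^ n)⁻¹) ^ (-α)) ≤ min 1 (t * pw α (n + 1)) :=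
        min_le_min le_rfl (by gcongr)
      calc _ ≤ C * min 1 (t * pw α (n + 1)) := by gcongr
        _ ≤ _ := by nlinarith

theorem card_Icc_pred_succ (n : ℕ) : (Finset.Icc (n - 1) (n + 1)).card ≤ 3 := by
  rw [Nat.card_Icc]
  omega

theorem exists_ker_pt_expSymbol (χ : DyadicPartition d) (T : ℝ) :
    ∃ C, 0 ≤ C ∧ ∀ n t γ, t ∈ Icc 0 T → γ ∈ Icc (0 : ℝ) 5 → 0 < t ∨ γ = 0 →
      Ker (χ.pt n * expSymbol α ν t) (C * (t ^ (-(γ / α)) * pw (-γ) n))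
      (pw (-1) n * (C * (t ^ (-(γ / α)) * pw (-γ) n))) := by
  obtain ⟨C, hC, h⟩ := exists_ker_pc_expSymbol (ν := ν) χ T
  refine ⟨192 * C, by positivity, fun n t γ ht hγ htγ => ?_⟩
  have h1 := Ker.finset_sum (Finset.Icc (n - 1) (n + 1)) fun i _ => h i t γ ht hγ htγ
  have near : ∀ i ∈ Finset.Icc (n - 1) (n + 1), ∀ x : ℝ, pw x i ≤ pw |x| 1 * pw x n := by
    intro i hi x
    rw [Finset.mem_Icc] at hi
    exact pw_le_of_near (by omega) (by omega)
  have ht0 : 0 ≤ t ^ (-(γ / α)) := rpow_nonneg ht.1 _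
  have b1 : pw |-γ| 1 ≤ 32 := by
    rw [abs_neg, abs_of_nonneg hγ.1, pw, Nat.cast_one, mul_one]
    calc (2 : ℝ) ^ γ ≤ 2 ^ (5 : ℝ) := rpow_le_rpow_of_exponent_le one_le_two hγ.2
      _ = 32 := by norm_num
  have b2 : pw |(-1 : ℝ)| 1 = 2 := by simp [pw]
  have pn := pw_pos (-γ) n
  have pn1 := pw_pos (-1) n
  have bi : ∀ i ∈ Finset.Icc (n - 1) (n + 1), C * (t ^ (-(γ / α)) * pw (-γ) i) ≤
      32 * (C * (t ^ (-(γ / α)) * pw (-γ) n)) := by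
    intro i hi
    have : pw (-γ) i ≤ 32 * pw (-γ) n := (near i hi _).trans (by gcongr)
    calc _ ≤ C * (t ^ (-(γ / α)) * (32 * pw (-γ) n)) := by gcongr
      _ = _ := by ring
  have hX : 0 ≤ C * (t ^ (-(γ / α)) * pw (-γ) n) := by positivity
  refine (h1.congr ?_).mono ?_ ?_
  · rw [DyadicPartition.pt, sum_mul]
  · refine (sum_le_card_nsmul _ _ _ bi).trans ?_
    rw [nsmul_eq_mul]
    have : ((Finset.Icc (n - 1) (n + 1)).card : ℝ) ≤ 3 := by exact_mod_cast card_Icc_pred_succ n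
    nlinarith
  · have bj : ∀ i ∈ Finset.Icc (n - 1) (n + 1), pw (-1) i * (C * (t ^ (-(γ / α)) * pw (-γ) i)) ≤
        64 * (pw (-1) n * (C * (t ^ (-(γ / α)) * pw (-γ) n))) := by
      intro i hi
      have h2 := near i hi (-1)
      rw [b2] at h2
      have h3 := bi i hi
      have := pw_pos (-1) i
      have := pw_pos (-γ) i
      calc _ ≤ (2 * pw (-1) n) * (32 * (C * (t ^ (-(γ / α)) * pw (-γ) n))) := by gcongr
        _ = _ := by ring
    refine (sum_le_card_nsmul _ _ _ bj).trans ?_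
    rw [nsmul_eq_mul]
    have : ((Finset.Icc (n - 1) (n + 1)).card : ℝ) ≤ 3 := by exact_mod_cast card_Icc_pred_succ n
    have hY : 0 ≤ pw (-1) n * (C * (t ^ (-(γ / α)) * pw (-γ) n)) := by positivity
    nlinarith

theorem exists_ker_pt_expSymbol_sub_one (χ : DyadicPartition d) :
    ∃ C, 0 ≤ C ∧ ∀ n t, 0 ≤ t → ∃ B, Ker (χ.pt n * (expSymbol α ν t - 1)) (C * min 1 (t * pw α n)) B := by
  have hα := Stable.index (ν := ν)
  obtain ⟨C, hC, h⟩ := exists_ker_pc_expSymbol_sub_one (ν := ν) χ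
  refine ⟨12 * C, by positivity, fun n t ht => ?_⟩
  choose B hB using fun i => h i t ht
  have h1 := Ker.finset_sum (Finset.Icc (n - 1) (n + 1)) fun i _ => hB i
  refine ⟨_, (h1.congr (by rw [DyadicPartition.pt, sum_mul])).mono ?_ le_rfl⟩
  have h0 : 0 ≤ min 1 (t * pw α n) := le_min zero_le_one (mul_nonneg ht (pw_nonneg _ _))
  have bi : ∀ i ∈ Finset.Icc (n - 1) (n + 1), C * min 1 (t * pw α i) ≤
      4 * (C * min 1 (t * pw α n)) := by
    intro i hi
    rw [Finset.mem_Icc] at hi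
    have h2 : pw α i ≤ pw |α| 1 * pw α n := pw_le_of_near (by omega) (by omega)
    have h3 : pw |α| 1 ≤ 4 := by
      rw [abs_of_pos (one_pos.trans hα.1), pw, Nat.cast_one, mul_one]
      calc (2 : ℝ) ^ α ≤ 2 ^ (2 : ℝ) := rpow_le_rpow_of_exponent_le one_le_two hα.2
        _ = 4 := by norm_num
    have h4 : pw α i ≤ 4 * pw α n := h2.trans (by have := pw_pos α n; gcongr)
    have h5 : min 1 (t * pw α i) ≤ 4 * min 1 (t * pw α n) := by
      rw [mul_min_of_nonneg _ _ (by norm_num)]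
      refine min_le_min (by norm_num) ?_
      nlinarith
    nlinarith
  refine (sum_le_card_nsmul _ _ _ bi).trans ?_
  rw [nsmul_eq_mul]
  have : ((Finset.Icc (n - 1) (n + 1)).card : ℝ) ≤ 3 := by exact_mod_cast card_Icc_pred_succ n
  have : 0 ≤ C * min 1 (t * pw α n) := by positivity
  nlinarith

/-- The multiplier of the derivative on a block. -/
def dmul (χ : DyadicPartition d) (j : Fin d) (n : ℕ) (z : Space d) : ℂ :=
  (2 * π * Complex.I) * (z j : ℂ) * χ.pt n z

theorem exists_ker_dmul (χ : DyadicPartition d) : ∃ C, 0 ≤ C ∧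
    ∀ j n, Ker (dmul χ j n) (C * pw 1 n) C := by
  have key : ∀ j : Fin d, ∃ C, 0 ≤ C ∧ ∀ n, Ker (fun z => (z j : ℂ) * χ.pc n z) (C * pw 1 n) C := by
    intro j
    have hs : ContDiff ℝ ∞ (fun z : Space d => (z j : ℂ)) :=
      ofRealCLM.contDiff.comp (EuclideanSpace.proj j : Space d →L[ℝ] ℝ).contDiff
    obtain ⟨A, B, h⟩ := exists_ker_of_hasCompactSupport (m := (fun z : Space d => (z j : ℂ)) * χ.pc 0)
      χ.pc_zero_hasCompactSupport.mul_left (hs.mul χ.pc_zero_smooth)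
    obtain ⟨A', B', h'⟩ := exists_ker_of_hasCompactSupport
      (m := (fun z : Space d => (z j : ℂ)) * χ.annC)
      χ.annC_hasCompactSupport.mul_left (hs.mul χ.annC_smooth)
    have := h.nonneg_left
    have := h.nonneg_right
    have := h'.nonneg_left
    have := h'.nonneg_right
    refine ⟨A + B + A' + B', by positivity, fun n => ?_⟩
    rcases n with _ | n
    · refine (h.congr (by ext z; rfl)).mono ?_ (by linarith)
      rw [pw_zero_right]
      linarith
    · have h1 := (h'.dilate (δ := ((2 : ℝ) ^ n)⁻¹) (by positivity)).smul (((2 : ℝ) ^ n : ℝ) : ℂ)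
      rw [norm_real, norm_of_nonneg (by positivity)] at h1
      refine (h1.congr ?_).mono ?_ ?_
      · ext z
        simp only [Pi.smul_apply, Pi.mul_apply, smul_eq_mul, PiLp.smul_apply, χ.pc_succ]
        push_cast
        field_simp
      · rw [pw_one, pow_succ, mul_comm]
        have : (0 : ℝ) < 2 ^ n := by positivity
        nlinarith
      · rw [← mul_assoc, mul_inv_cancel₀ (by positivity), one_mul]
        linarith
  choose C hC h using key
  set K := ∑ j, C j with hK
  have hK0 : 0 ≤ K := sum_nonneg fun j _ => hC j
  have hCK : ∀ j, C j ≤ K := fun j => single_le_sum (fun i _ => hC i) (Finset.mem_univ j)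
  refine ⟨‖(2 * π * Complex.I : ℂ)‖ * (6 * K), by positivity, fun j n => ?_⟩
  have h1 := (Ker.finset_sum (Finset.Icc (n - 1) (n + 1)) fun i _ => h j i).smul
    (2 * π * Complex.I)
  have hcard : ((Finset.Icc (n - 1) (n + 1)).card : ℝ) ≤ 3 := by exact_mod_cast card_Icc_pred_succ n
  have pn := pw_pos 1 n
  refine (h1.congr ?_).mono ?_ ?_
  · ext z
    simp only [Pi.smul_apply, Finset.sum_apply, smul_eq_mul, dmul, DyadicPartition.pt]
    rw [← mul_sum]
    ring
  · refine le_trans (mul_le_mul_of_nonneg_left (b := _) (c := 6 * K * pw 1 n) ?_ (norm_nonneg _))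
      (le_of_eq (by ring))
    have bi : ∀ i ∈ Finset.Icc (n - 1) (n + 1), C j * pw 1 i ≤ 2 * (K * pw 1 n) := by
      intro i hi
      rw [Finset.mem_Icc] at hi
      have h2 : pw 1 i ≤ pw |(1 : ℝ)| 1 * pw 1 n := pw_le_of_near (by omega) (by omega)
      have h3 : pw |(1 : ℝ)| 1 = 2 := by simp [pw]
      rw [h3] at h2
      calc _ ≤ K * (2 * pw 1 n) := mul_le_mul (hCK j) h2 (pw_nonneg _ _) hK0
        _ = _ := by ring
    refine (sum_le_card_nsmul _ _ _ bi).trans ?_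
    rw [nsmul_eq_mul]
    have : 0 ≤ K * pw 1 n := by positivity
    nlinarith
  · gcongr
    refine (sum_le_card_nsmul _ _ _ fun i _ => hCK j).trans ?_
    rw [nsmul_eq_mul]
    nlinarith

end

section

variable {d : ℕ}
variable {g k m : Space d → ℂ} {C : ℝ}

/-! ### Bounded functions as distributions -/

theorem Bdd.memLp_top (f : Bdd d) : MemLp f ⊤ (volume : Measure (Space d)) :=
  memLp_top_of_bound f.continuous.aestronglyMeasurable ‖f‖
    (.of_forall fun x => f.norm_coe_le_norm x)

/-- The distribution given by a bounded continuous function. -/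
def tf (f : Bdd d) : Distr d := Lp.toTemperedDistribution ((Bdd.memLp_top f).toLp f)

theorem tf_apply (f : Bdd d) (φ : 𝓢(Space d, ℂ)) : tf f φ = ∫ x, φ x * f x := by
  rw [tf, Lp.toTemperedDistribution_apply]
  refine integral_congr_ae ?_
  filter_upwards [(Bdd.memLp_top f).coeFn_toLp] with x hx
  rw [hx, smul_eq_mul]

theorem integrable_schwartz_mul (φ : 𝓢(Space d, ℂ)) (hg : AEStronglyMeasurable g volume)
    (hC : ∀ᵐ x, ‖g x‖ ≤ C) : Integrable fun x => φ x * g x :=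
  φ.integrable.mul_bdd (c := C) hg hC

theorem integrable_schwartz_mul_bdd (φ : 𝓢(Space d, ℂ)) (f : Bdd d) :
    Integrable fun x => φ x * f x :=
  integrable_schwartz_mul φ f.continuous.aestronglyMeasurable
    (.of_forall fun x => f.norm_coe_le_norm x)

theorem norm_tf_apply_le (f : Bdd d) (φ : 𝓢(Space d, ℂ)) : ‖tf f φ‖ ≤ (∫ x, ‖φ x‖) * ‖f‖ := by
  rw [tf_apply, ← integral_mul_const]
  refine norm_integral_le_of_norm_le (φ.integrable.norm.mul_const _) ?_
  refine .of_forall fun x => ?_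
  rw [norm_mul]
  gcongr
  exact f.norm_coe_le_norm x

theorem tf_add (f g : Bdd d) : tf (f + g) = tf f + tf g := by
  ext φ
  change tf (f + g) φ = tf f φ + tf g φ
  rw [tf_apply, tf_apply, tf_apply, ← integral_add (integrable_schwartz_mul_bdd φ f)
    (integrable_schwartz_mul_bdd φ g)]
  congr 1
  ext x
  simp [mul_add]

theorem tf_smul (c : ℂ) (f : Bdd d) : tf (c • f) = c • tf f := by
  ext φ
  change tf (c • f) φ = c * tf f φ
  rw [tf_apply, tf_apply, ← integral_const_mul]
  congr 1
  ext x
  simp only [BoundedContinuousFunction.coe_smul, smul_eq_mul]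
  ring

/-- `tf` as a linear map. -/
def tfL : Bdd d →ₗ[ℂ] Distr d where
  toFun := tf
  map_add' := tf_add
  map_smul' := tf_smul

theorem tf_zero : tf (0 : Bdd d) = 0 := map_zero (tfL (d := d))

theorem tf_sub (f g : Bdd d) : tf (f - g) = tf f - tf g := map_sub (tfL (d := d)) f g

theorem tf_neg (f : Bdd d) : tf (-f) = -tf f := map_neg (tfL (d := d)) f

theorem tf_sum {ι : Type*} (s : Finset ι) (f : ι → Bdd d) :
    tf (∑ i ∈ s, f i) = ∑ i ∈ s, tf (f i) :=
  map_sum (tfL (d := d)) f s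

theorem toTemperedDistribution_injective {g h : Lp ℂ ⊤ (volume : Measure (Space d))}
    (e : Lp.toTemperedDistribution g = Lp.toTemperedDistribution h) : g = h := by
  have hb : ∀ g : Lp ℂ ⊤ (volume : Measure (Space d)), LocallyIntegrable g volume :=
    fun g => (Lp.memLp g).locallyIntegrable le_top
  refine Lp.ext (ae_eq_of_integral_schwartz_eq (hb g) (hb h) fun φ _ => ?_)
  have := congrArg (fun u : Distr d => u φ) e
  simpa only [Lp.toTemperedDistribution_apply, smul_eq_mul] using this

theorem tf_injective {f g : Bdd d} (h : tf f = tf g) : f = g := by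
  have h1 := toTemperedDistribution_injective h
  have h2 : (f : Space d → ℂ) =ᵐ[volume] g :=
    ((Bdd.memLp_top f).coeFn_toLp.symm.trans (by rw [h1])).trans (Bdd.memLp_top g).coeFn_toLp
  have := (Continuous.ae_eq_iff_eq volume f.continuous g.continuous).1 h2
  exact DFunLike.coe_injective this

theorem enorm_toLp_bdd (f : Bdd d) : ‖(Bdd.memLp_top f).toLp f‖ₑ = ‖f‖ₑ := by
  rw [Lp.enorm_toLp, eLpNorm_exponent_top]
  refine le_antisymm ?_ ?_
  · refine essSup_le_of_ae_le _ (.of_forall fun x => ?_)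
    exact enorm_le_iff_norm_le.2 (f.norm_coe_le_norm x)
  · set c := eLpNormEssSup f (volume : Measure (Space d)) with hc
    have h1 : ∀ᵐ x, ‖f x‖ₑ ≤ c := enorm_ae_le_eLpNormEssSup f volume
    have h2 : IsClosed {x : Space d | ‖f x‖ₑ ≤ c} := isClosed_le (by fun_prop) continuous_const
    have h3 : ∀ x, ‖f x‖ₑ ≤ c := by
      have := h2.closure_eq.symm.trans (Measure.dense_of_ae h1).closure_eq
      exact fun x => (this ▸ mem_univ x : x ∈ {x : Space d | ‖f x‖ₑ ≤ c})
    have hfin : c ≠ ⊤ := by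
      have : c = eLpNorm f ⊤ volume := eLpNorm_exponent_top.symm
      rw [this]
      exact (Bdd.memLp_top f).2.ne
    have h4 : ‖f‖ ≤ c.toReal := by
      refine (BoundedContinuousFunction.norm_le toReal_nonneg).2 fun x => ?_
      have := ENNReal.toReal_mono hfin (h3 x)
      simpa using this
    rw [← ofReal_norm]
    exact ENNReal.ofReal_le_of_le_toReal h4

theorem linftyNorm_tf (f : Bdd d) : linftyNorm (tf f) = ‖f‖ₑ := by
  unfold linftyNorm
  refine le_antisymm ?_ ?_
  · exact (iInf₂_le (f := fun (g : Lp ℂ ⊤ (volume : Measure (Space d)))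
      (_ : Lp.toTemperedDistribution g = tf f) => ‖g‖ₑ) ((Bdd.memLp_top f).toLp f) rfl).trans
      (enorm_toLp_bdd f).le
  · refine le_iInf₂ fun g hg => ?_
    rw [toTemperedDistribution_injective (hg.trans rfl), enorm_toLp_bdd]

theorem toFun_tf (f : Bdd d) : toFun (tf f) =ᵐ[volume] f := by
  have h : ∃ g : Lp ℂ ⊤ (volume : Measure (Space d)), Lp.toTemperedDistribution g = tf f := ⟨_, rfl⟩
  unfold toFun
  rw [dif_pos h, toTemperedDistribution_injective (h.choose_spec.trans rfl)]
  exact (Bdd.memLp_top f).coeFn_toLp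

/-! ### Fourier multipliers on bounded functions -/

theorem fourier_smulLeft_fourierInv (hm : m.HasTemperateGrowth) (hk : Integrable k)
    (hkm : 𝓕 k = m) (φ : 𝓢(Space d, ℂ)) (z : Space d) :
    (𝓕 (smulLeftCLM ℂ m (𝓕⁻ φ : 𝓢(Space d, ℂ))) : 𝓢(Space d, ℂ)) z = ∫ y, k y * φ (z + y) := by
  set ψ : 𝓢(Space d, ℂ) := 𝓕⁻ φ with hψ
  have hφ : (𝓕 ψ : 𝓢(Space d, ℂ)) = φ := fourier_fourierInv_eq φ
  have h1 := integral_fourier_mul_eq_of_integrable hk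
    (g := fun ξ => 𝐞 (-inner ℝ ξ z) • ψ ξ) ((Real.fourierIntegral_convergent_iff z).2 ψ.integrable)
  rw [fourier_coe, fourier_eq]
  have e1 : ∀ ξ, 𝐞 (-inner ℝ ξ z) • (smulLeftCLM ℂ m ψ) ξ =
      𝓕 k ξ * (𝐞 (-inner ℝ ξ z) • ψ ξ) := by
    intro ξ
    rw [smulLeftCLM_apply_apply hm, hkm, mul_smul_comm]
    rfl
  simp only [e1]
  rw [h1]
  congr 1
  ext y
  congr 1
  rw [← hφ, fourier_coe, fourier_eq, fourier_eq]
  congr 1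
  ext ξ
  simp only [Circle.smul_def, smul_eq_mul]
  rw [← mul_assoc, ← Circle.coe_mul, ← AddChar.map_add_eq_mul, ← neg_add, inner_add_right, add_comm]

theorem integral_schwartz_conv (hk : Integrable k) (hg : StronglyMeasurable g)
    (hC : ∀ x, ‖g x‖ ≤ C) (φ : 𝓢(Space d, ℂ)) :
    ∫ z, (∫ y, k y * φ (z + y)) * g z = ∫ x, φ x * ∫ y, k y * g (x - y) := by
  have i1 : Integrable (fun p : Space d × Space d => k p.2 * φ (p.1 + p.2) * g p.1)
      (volume.prod volume) := by
    have h0 : Integrable (fun p : Space d × Space d => φ p.1 * k p.2) (volume.prod volume) :=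
      φ.integrable.mul_prod hk
    have hmp : MeasurePreserving (fun p : Space d × Space d => (p.1 + p.2, p.2))
        (volume.prod volume) (volume.prod volume) := measurePreserving_add_prod volume volume
    have h1 := (hmp.integrable_comp h0.aestronglyMeasurable).2 h0
    have h2 := h1.mul_bdd (c := C) (g := fun p : Space d × Space d => g p.1)
      (hg.comp_measurable measurable_fst).aestronglyMeasurable
      (.of_forall fun p => hC p.1)
    refine h2.congr (.of_forall fun p => ?_)
    simp only [Function.comp]
    ring
  calc ∫ z, (∫ y, k y * φ (z + y)) * g z = ∫ z, ∫ y, k y * φ (z + y) * g z := by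
        congr 1
        ext z
        rw [integral_mul_const]
    _ = ∫ y, ∫ z, k y * φ (z + y) * g z := integral_integral_swap i1
    _ = ∫ y, ∫ x, k y * φ x * g (x - y) := by
        congr 1
        ext y
        rw [← integral_sub_right_eq_self _ y]
        simp
    _ = ∫ x, ∫ y, k y * φ x * g (x - y) := by
        refine integral_integral_swap ?_
        have h0 : Integrable (fun p : Space d × Space d => k p.1 * φ p.2) (volume.prod volume) :=
          hk.mul_prod φ.integrable
        refine h0.mul_bdd (c := C) ?_ (.of_forall fun p => hC _)
        exact (hg.comp_measurable (measurable_snd.sub measurable_fst)).aestronglyMeasurable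
    _ = _ := by
        congr 1
        ext x
        rw [← integral_const_mul]
        congr 1
        ext y
        ring

/-- A Fourier multiplier. -/
abbrev fm (m : Space d → ℂ) : Distr d →L[ℂ] Distr d := TemperedDistribution.fourierMultiplierCLM ℂ m

theorem fm_tf {A B : ℝ} (hm : m.HasTemperateGrowth) (h : Ker m A B) (f : Bdd d) :
    fm m (tf f) = tf (Op m f) := by
  obtain ⟨k, hk, _, hkm, _, _⟩ := h
  ext φ
  rw [fourierMultiplierCLM_apply_apply, tf_apply, tf_apply, Op_eq hk hkm]
  simp only [fourier_smulLeft_fourierInv hm hk hkm φ, convCLM_apply]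
  exact integral_schwartz_conv hk f.continuous.stronglyMeasurable
    (fun x => f.norm_coe_le_norm x) φ

theorem fm_fm {n : Space d → ℂ} (hm : m.HasTemperateGrowth) (hn : n.HasTemperateGrowth)
    (u : Distr d) : fm n (fm m u) = fm (m * n) u :=
  TemperedDistribution.fourierMultiplierCLM_fourierMultiplierCLM_apply hm hn u

/-- A smooth multiplier with compact support maps `L^∞` to bounded continuous functions. -/
theorem exists_fm_toTemperedDistribution (hc : HasCompactSupport m) (hs : ContDiff ℝ ∞ m)
    (g : Lp ℂ ⊤ (volume : Measure (Space d))) : ∃ f : Bdd d, fm m (Lp.toTemperedDistribution g) =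
    tf f := by
  set mS : 𝓢(Space d, ℂ) := hc.toSchwartzMap hs with hmS
  set k : 𝓢(Space d, ℂ) := 𝓕⁻ mS with hk
  have hkm : 𝓕 (k : Space d → ℂ) = m := by
    have h1 : (𝓕 k : 𝓢(Space d, ℂ)) = mS := fourier_fourierInv_eq mS
    rw [← fourier_coe, h1]
    rfl
  -- a bounded representative
  obtain ⟨g₀, hg₀, C, hC, hgg⟩ : ∃ g₀ : Space d → ℂ, StronglyMeasurable g₀ ∧ ∃ C : ℝ,
      (∀ x, ‖g₀ x‖ ≤ C) ∧ (g : Space d → ℂ) =ᵐ[volume] g₀ := by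
    have hb : ∀ᵐ x, ‖g x‖ ≤ ‖g‖ := by
      have h1 := enorm_ae_le_eLpNormEssSup (g : Space d → ℂ) volume
      filter_upwards [h1] with x hx
      rw [← eLpNorm_exponent_top] at hx
      have := ENNReal.toReal_mono (Lp.eLpNorm_ne_top g) hx
      simpa [Lp.norm_def] using this
    refine ⟨{x | ‖g x‖ ≤ ‖g‖}.indicator g, ?_, ‖g‖, fun x => ?_, ?_⟩
    · refine (Lp.stronglyMeasurable g).indicator ?_
      exact measurableSet_le (Lp.stronglyMeasurable g).norm.measurable measurable_const
    · by_cases hx : x ∈ {x | ‖g x‖ ≤ ‖g‖}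
      · rw [indicator_of_mem hx]
        exact hx
      · rw [indicator_of_notMem hx, norm_zero]
        exact norm_nonneg _
    · filter_upwards [hb] with x hx
      rw [indicator_of_mem (show x ∈ {x | ‖g x‖ ≤ ‖g‖} from hx)]
  have hC0 : 0 ≤ C := (norm_nonneg _).trans (hC 0)
  have hi : ∀ x, Integrable fun y => k y * g₀ (x - y) := fun x =>
    k.integrable.mul_bdd (c := C) (hg₀.comp_measurable (measurable_const.sub measurable_id)).aestronglyMeasurable
      (.of_forall fun y => hC _)
  have hcont : Continuous fun x => ∫ y, k y * g₀ (x - y) := by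
    have e : (fun x => ∫ y, k y * g₀ (x - y)) = fun x => ∫ y, k (x - y) * g₀ y := by
      ext x
      rw [← integral_sub_left_eq_self _ volume x]
      simp
    rw [e]
    have hi' : ∀ x, Integrable fun y => k (x - y) * g₀ y := fun x =>
      (k.integrable.comp_sub_left x).mul_bdd (c := C) hg₀.aestronglyMeasurable
        (.of_forall fun y => hC _)
    have hlip : ∀ x x' : Space d, ‖(∫ y, k (x - y) * g₀ y) - ∫ y, k (x' - y) * g₀ y‖ ≤
        ((∫ y, ‖fderiv ℝ k y‖) * C) * ‖x - x'‖ := by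
      intro x x'
      rw [← integral_sub (hi' x) (hi' x')]
      have i2 : Integrable fun y => ‖k (x - y) - k (x' - y)‖ * C :=
        (((k.integrable.comp_sub_left x).sub (k.integrable.comp_sub_left x')).norm).mul_const C
      calc _ ≤ ∫ y, ‖k (x - y) - k (x' - y)‖ * C := by
            refine norm_integral_le_of_norm_le i2 (.of_forall fun y => ?_)
            rw [← sub_mul, norm_mul]
            gcongr
            exact hC y
        _ = (∫ y, ‖k (y + (x - x')) - k y‖) * C := by
            rw [integral_mul_const, ← integral_sub_left_eq_self _ volume x']
            congr 3
            ext y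
            congr 2 <;> congr 1 <;> abel
        _ ≤ _ := by
            have := SchwartzMap.integral_norm_translate_sub_le k (x - x')
            nlinarith
    refine LipschitzWith.continuous (K := ⟨(∫ y, ‖fderiv ℝ k y‖) * C, by positivity⟩)
      (LipschitzWith.of_dist_le_mul fun x x' => ?_)
    rw [dist_eq_norm, dist_eq_norm]
    exact hlip x x'
  refine ⟨BoundedContinuousFunction.ofNormedAddCommGroup (fun x => ∫ y, k y * g₀ (x - y)) hcont
    ((∫ y, ‖k y‖) * C) fun x => ?_, ?_⟩
  · rw [← integral_mul_const]
    refine norm_integral_le_of_norm_le (k.integrable.norm.mul_const C)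
      (.of_forall fun y => ?_)
    rw [norm_mul]
    gcongr
    exact hC _
  · ext φ
    rw [fourierMultiplierCLM_apply_apply, tf_apply,
      Lp.toTemperedDistribution_apply]
    have := integral_schwartz_conv (k := k) k.integrable hg₀ hC φ
    simp only [coe_ofNormedAddCommGroup]
    rw [← this]
    refine integral_congr_ae ?_
    filter_upwards [hgg] with x hx
    rw [hx, smul_eq_mul,
      fourier_smulLeft_fourierInv (hc.hasTemperateGrowth hs) k.integrable hkm φ x]

end

section

variable {d : ℕ}
variable {q : Space d → ℂ} {u v : Distr d} {f g : BSeq d} {n : ℕ}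

/-! ### The Littlewood–Paley decomposition of a distribution -/

/-- Cutting off a test function. -/
theorem tendsto_smulLeftCLM_cutoff (hq : HasCompactSupport q) (hqs : ContDiff ℝ ∞ q) {a : ℝ}
    (ha : 0 < a) (hqa : ∀ x, ‖x‖ < a → q x = 1) (ψ : 𝓢(Space d, ℂ)) :
    Tendsto (fun N : ℕ => smulLeftCLM ℂ (fun x => q (((2 : ℝ) ^ N)⁻¹ • x)) ψ) atTop (𝓝 ψ) := by
  have hbd : ∀ i : ℕ, ∃ K : ℝ, 0 ≤ K ∧ ∀ x, ‖iteratedFDeriv ℝ i q x‖ ≤ K := by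
    intro i
    have hc : Continuous (iteratedFDeriv ℝ i q) := hqs.continuous_iteratedFDeriv (mod_cast le_top)
    obtain ⟨K, hK⟩ := hc.bounded_above_of_compact_support (hq.iteratedFDeriv i)
    exact ⟨K, (norm_nonneg _).trans (hK 0), hK⟩
  choose K hK0 hK using hbd
  have hsm : ∀ N : ℕ, ContDiff ℝ ∞ (fun x => q (((2 : ℝ) ^ N)⁻¹ • x)) := fun N =>
    hqs.comp (contDiff_const_smul _)
  have htemp : ∀ N : ℕ, (fun x => q (((2 : ℝ) ^ N)⁻¹ • x)).HasTemperateGrowth := fun N =>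
    HasCompactSupport.hasTemperateGrowth (hq.comp_homeomorph
      (Homeomorph.smulOfNeZero (((2 : ℝ) ^ N)⁻¹) (by positivity))) (hsm N)
  have hder : ∀ (N i : ℕ) (x : Space d),
      ‖iteratedFDeriv ℝ i (fun x => q (((2 : ℝ) ^ N)⁻¹ • x)) x‖ ≤ K i := by
    intro N i x
    set L : Space d →L[ℝ] Space d := ((2 : ℝ) ^ N)⁻¹ • ContinuousLinearMap.id ℝ (Space d) with hL
    have e : (fun x => q (((2 : ℝ) ^ N)⁻¹ • x)) = q ∘ L := rfl
    rw [e, L.iteratedFDeriv_comp_right hqs x (mod_cast le_top)]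
    refine (ContinuousMultilinearMap.norm_compContinuousLinearMap_le _ _).trans ?_
    have hL1 : ‖L‖ ≤ 1 := by
      refine ContinuousLinearMap.opNorm_le_bound _ zero_le_one fun y => ?_
      rw [hL, _root_.smul_apply, norm_smul, ContinuousLinearMap.id_apply, norm_inv,
        norm_pow, Real.norm_two]
      gcongr
      exact inv_le_one_of_one_le₀ (one_le_pow₀ one_le_two)
    calc _ ≤ K i * 1 := by
          gcongr
          · exact hK0 i
          · exact hK i _
          · exact Finset.prod_le_one (fun _ _ => norm_nonneg _) fun _ _ => hL1
      _ = K i := mul_one _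
  rw [(schwartz_withSeminorms ℂ (Space d) ℂ).tendsto_nhds]
  rintro ⟨k, n⟩ ε hε
  set M : ℝ := (∑ i ∈ Finset.range (n + 1), (n.choose i : ℝ) * K i *
    SchwartzMap.seminorm ℂ (k + 1) (n - i) ψ) + SchwartzMap.seminorm ℂ (k + 1) n ψ with hM
  have hM0 : 0 ≤ M := by
    refine add_nonneg (sum_nonneg fun i _ => ?_) (apply_nonneg _ _)
    exact mul_nonneg (mul_nonneg (by positivity) (hK0 i)) (apply_nonneg _ _)
  have key : ∀ N : ℕ, SchwartzMap.seminorm ℂ k n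
      (smulLeftCLM ℂ (fun x => q (((2 : ℝ) ^ N)⁻¹ • x)) ψ - ψ) ≤
        M * (a * 2 ^ N)⁻¹ := by
    intro N
    have h2N : (0 : ℝ) < 2 ^ N := by positivity
    refine SchwartzMap.seminorm_le_bound ℂ k n _ (by positivity) fun x => ?_
    have efun : (⇑(smulLeftCLM ℂ (fun x => q (((2 : ℝ) ^ N)⁻¹ • x)) ψ - ψ) :
        Space d → ℂ) = (fun x => q (((2 : ℝ) ^ N)⁻¹ • x) * ψ x) - ψ := by
      ext y
      rw [_root_.sub_apply, smulLeftCLM_apply_apply (htemp N)]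
      rfl
    rw [efun]
    rcases lt_or_ge ‖x‖ (a * 2 ^ N) with hx | hx
    · have : ((fun x => q (((2 : ℝ) ^ N)⁻¹ • x) * ψ x) - ⇑ψ) =ᶠ[𝓝 x] fun _ => 0 := by
        have hopen : IsOpen {y : Space d | ‖y‖ < a * 2 ^ N} :=
          isOpen_lt continuous_norm continuous_const
        filter_upwards [hopen.mem_nhds hx] with y hy
        have : q (((2 : ℝ) ^ N)⁻¹ • y) = 1 := by
          refine hqa _ ?_
          rw [norm_smul, norm_inv, norm_pow, Real.norm_two, inv_mul_lt_iff₀ h2N]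
          rw [mul_comm]
          exact hy
        rw [Pi.sub_apply, this, one_mul, sub_self]
      rw [(Filter.EventuallyEq.iteratedFDeriv ℝ this n).eq_of_nhds]
      have h0 : iteratedFDeriv ℝ n (fun _ : Space d => (0 : ℂ)) x = 0 := by
        change iteratedFDeriv ℝ n (0 : Space d → ℂ) x = 0
        rw [iteratedFDeriv_zero]
        rfl
      rw [h0, norm_zero, mul_zero]
      positivity
    · have hax : 0 < a * 2 ^ N := by positivity
      have hk : ‖x‖ ^ k ≤ ‖x‖ ^ (k + 1) * (a * 2 ^ N)⁻¹ := by
        rw [pow_succ, mul_assoc]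
        refine le_mul_of_one_le_right (by positivity) ?_
        rw [← div_eq_mul_inv, one_le_div hax]
        exact hx
      have hψ : ∀ j, ‖x‖ ^ (k + 1) * ‖iteratedFDeriv ℝ j ψ x‖ ≤
          SchwartzMap.seminorm ℂ (k + 1) j ψ := fun j => SchwartzMap.le_seminorm ℂ (k + 1) j ψ x
      have h1 : ‖iteratedFDeriv ℝ n ((fun x => q (((2 : ℝ) ^ N)⁻¹ • x) * ψ x) - ⇑ψ) x‖ ≤
          (∑ i ∈ Finset.range (n + 1), (n.choose i : ℝ) * K i * ‖iteratedFDeriv ℝ (n - i) ψ x‖) +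
            ‖iteratedFDeriv ℝ n ψ x‖ := by
        have hs1 : ContDiff ℝ n (fun x => q (((2 : ℝ) ^ N)⁻¹ • x) * ψ x) :=
          ((hsm N).mul (ψ.smooth ⊤)).of_le (mod_cast le_top)
        rw [iteratedFDeriv_sub_apply hs1.contDiffAt (ψ.smooth n).contDiffAt]
        refine (norm_sub_le _ _).trans (add_le_add ?_ le_rfl)
        refine (norm_iteratedFDeriv_mul_le (N := ∞) (hsm N) (ψ.smooth ⊤) x
          (mod_cast le_top)).trans ?_
        refine sum_le_sum fun i _ => ?_
        gcongr
        exact hder N i x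
      calc ‖x‖ ^ k * ‖iteratedFDeriv ℝ n ((fun x => q (((2 : ℝ) ^ N)⁻¹ • x) * ψ x) - ⇑ψ) x‖
          ≤ (‖x‖ ^ (k + 1) * (a * 2 ^ N)⁻¹) * ((∑ i ∈ Finset.range (n + 1),
            (n.choose i : ℝ) * K i * ‖iteratedFDeriv ℝ (n - i) ψ x‖) +
            ‖iteratedFDeriv ℝ n ψ x‖) := by gcongr
        _ = ((∑ i ∈ Finset.range (n + 1),
            (n.choose i : ℝ) * K i * (‖x‖ ^ (k + 1) * ‖iteratedFDeriv ℝ (n - i) ψ x‖)) +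
            ‖x‖ ^ (k + 1) * ‖iteratedFDeriv ℝ n ψ x‖) * (a * 2 ^ N)⁻¹ := by
            rw [mul_add, mul_sum, add_mul, sum_mul]
            congr 1
            · refine sum_congr rfl fun i _ => ?_
              ring
            · ring
        _ ≤ M * (a * 2 ^ N)⁻¹ := by
            gcongr
            rw [hM]
            refine add_le_add (sum_le_sum fun i _ => ?_) (hψ n)
            exact mul_le_mul_of_nonneg_left (hψ (n - i)) (mul_nonneg (by positivity) (hK0 i))
  have hlim : Tendsto (fun N : ℕ => M * (a * 2 ^ N)⁻¹) atTop (𝓝 0) := by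
    have h1 : Tendsto (fun N : ℕ => ((2 : ℝ) ^ N)⁻¹) atTop (𝓝 0) :=
      (tendsto_pow_atTop_atTop_of_one_lt one_lt_two).inv_tendsto_atTop
    have := h1.const_mul (M * a⁻¹)
    rw [mul_zero] at this
    refine this.congr fun N => ?_
    rw [mul_inv]
    ring
  filter_upwards [(tendsto_order.1 hlim).2 ε hε] with N hN
  exact (key N).trans_lt hN

variable (χ : DyadicPartition d)

theorem block_eq_fm (n : ℕ) (u : Distr d) : block χ n u = fm (χ.pc n) u := rfl

theorem tendsto_sum_block (u : Distr d) (φ : 𝓢(Space d, ℂ)) :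
    Tendsto (fun N => ∑ n ∈ Finset.range (N + 1), block χ n u φ) atTop (𝓝 (u φ)) := by
  obtain ⟨a, ha, h1⟩ := χ.exists_low_eq_one
  have h2 := tendsto_smulLeftCLM_cutoff χ.pc_zero_hasCompactSupport χ.pc_zero_smooth ha
    (fun x hx => by simp [DyadicPartition.pc, DyadicPartition.p_zero, h1 x hx])
    (𝓕⁻ φ : 𝓢(Space d, ℂ))
  have h3 : Tendsto (fun N : ℕ => u (𝓕 (smulLeftCLM ℂ
      (fun x => χ.pc 0 (((2 : ℝ) ^ N)⁻¹ • x)) (𝓕⁻ φ : 𝓢(Space d, ℂ))) : 𝓢(Space d, ℂ))) atTop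
      (𝓝 (u (𝓕 (𝓕⁻ φ : 𝓢(Space d, ℂ)) : 𝓢(Space d, ℂ)))) := by
    have hc : Continuous fun ψ : 𝓢(Space d, ℂ) => u (𝓕 ψ : 𝓢(Space d, ℂ)) :=
      u.continuous.comp (FourierTransform.fourierCLM ℂ 𝓢(Space d, ℂ)).continuous
    exact (hc.tendsto _).comp h2
  rw [fourier_fourierInv_eq] at h3
  refine h3.congr fun N => ?_
  have e := TemperedDistribution.fourierMultiplierCLM_sum ℂ
    (s := Finset.range (N + 1)) (g := χ.pc) fun i _ => χ.pc_hasTemperateGrowth i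
  have e2 := χ.sum_pc N
  have e3 : (fun x => ∑ i ∈ Finset.range (N + 1), χ.pc i x) =
      fun x => χ.pc 0 (((2 : ℝ) ^ N)⁻¹ • x) := by
    ext x
    have := congrFun e2 x
    rw [Finset.sum_apply] at this
    exact this
  rw [e3] at e
  rw [← fourierMultiplierCLM_apply_apply, e]
  simp only [block_eq_fm, _root_.sum_apply]

theorem eq_of_block_eq (h : ∀ n, block χ n u = block χ n v) : u = v := by
  ext φ
  refine tendsto_nhds_unique (tendsto_sum_block χ u φ) ?_
  simp only [h]
  exact tendsto_sum_block χ v φ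

/-- The blocks of `u` are the bounded functions `f n`. -/
def Rep (u : Distr d) (f : BSeq d) : Prop := ∀ n, block χ n u = tf (f n)

variable {χ}

theorem Rep.ext (hu : Rep χ u f) (hv : Rep χ v f) : u = v :=
  eq_of_block_eq χ fun n => (hu n).trans (hv n).symm

theorem Rep.unique (hf : Rep χ u f) (hg : Rep χ u g) : f = g := by
  ext1 n
  exact tf_injective ((hf n).symm.trans (hg n))

theorem Rep.congr (hf : Rep χ u f) (h : f = g) : Rep χ u g := h ▸ hf

theorem Rep.zero : Rep χ 0 0 := fun n => by
  rw [block_eq_fm, map_zero]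
  exact tf_zero.symm

theorem Rep.add (hu : Rep χ u f) (hv : Rep χ v g) : Rep χ (u + v) (f + g) := fun n => by
  rw [block_eq_fm, map_add, ← block_eq_fm, ← block_eq_fm, hu n, hv n, Pi.add_apply, tf_add]

theorem Rep.neg (hu : Rep χ u f) : Rep χ (-u) (-f) := fun n => by
  rw [block_eq_fm, map_neg, ← block_eq_fm, hu n, Pi.neg_apply, tf_neg]

theorem Rep.sub (hu : Rep χ u f) (hv : Rep χ v g) : Rep χ (u - v) (f - g) := fun n => by
  rw [block_eq_fm, map_sub, ← block_eq_fm, ← block_eq_fm, hu n, hv n, Pi.sub_apply, tf_sub]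

theorem Rep.sum {ι : Type*} (s : Finset ι) {u : ι → Distr d} {f : ι → BSeq d}
    (h : ∀ i ∈ s, Rep χ (u i) (f i)) : Rep χ (∑ i ∈ s, u i) (∑ i ∈ s, f i) := fun n => by
  rw [block_eq_fm, map_sum, Finset.sum_apply, tf_sum]
  exact sum_congr rfl fun i hi => h i hi n

theorem fm_tf_of_smooth {m : Space d → ℂ} (h : HasCompactSupport m) (hs : ContDiff ℝ ∞ m)
    (f : Bdd d) : fm m (tf f) = tf (Op m f) := by
  obtain ⟨A, B, hAB⟩ := exists_ker_of_hasCompactSupport h hs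
  exact fm_tf (h.hasTemperateGrowth hs) hAB f

theorem block_tf (n : ℕ) (f : Bdd d) : block χ n (tf f) = tf (Op (χ.pc n) f) :=
  fm_tf_of_smooth (χ.pc_hasCompactSupport n) (χ.pc_smooth n) f

theorem Rep.of_bdd (f : Bdd d) : Rep χ (tf f) fun n => Op (χ.pc n) f := fun n => block_tf n f

theorem Rep.Op_eq_self (h : Rep χ u f) (hq : HasCompactSupport q) (hqs : ContDiff ℝ ∞ q)
    (hqn : χ.pc n * q = χ.pc n) : Op q (f n) = f n := by
  refine tf_injective ?_
  rw [← fm_tf_of_smooth hq hqs, ← h n, block_eq_fm,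
    fm_fm (χ.pc_hasTemperateGrowth n) (hq.hasTemperateGrowth hqs), hqn]

theorem Rep.Op_pt (h : Rep χ u f) (n : ℕ) : Op (χ.pt n) (f n) = f n :=
  h.Op_eq_self (χ.pt_hasCompactSupport n) (χ.pt_smooth n) (by rw [mul_comm, χ.pt_mul_pc])

theorem Rep.Op_pc_comm (h : Rep χ u f) (m n : ℕ) : Op (χ.pc m) (f n) = Op (χ.pc n) (f m) := by
  refine tf_injective ?_
  rw [← block_tf, ← block_tf, ← h n, ← h m, block_eq_fm, block_eq_fm, block_eq_fm, block_eq_fm,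
    fm_fm (χ.pc_hasTemperateGrowth n) (χ.pc_hasTemperateGrowth m),
    fm_fm (χ.pc_hasTemperateGrowth m) (χ.pc_hasTemperateGrowth n), mul_comm]

theorem ker_pc (χ : DyadicPartition d) (n : ℕ) : ∃ A B, Ker (χ.pc n) A B :=
  exists_ker_of_hasCompactSupport (χ.pc_hasCompactSupport n) (χ.pc_smooth n)

theorem Op_pc_mul (m n : ℕ) (f : Bdd d) : Op (χ.pc m) (Op (χ.pc n) f) = Op (χ.pc m * χ.pc n) f := by
  obtain ⟨A, B, h⟩ := ker_pc χ m
  obtain ⟨A', B', h'⟩ := ker_pc χ n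
  rw [Op_mul h h']

theorem Op_pt_pc (n : ℕ) (f : Bdd d) : Op (χ.pt n) (Op (χ.pc n) f) = Op (χ.pc n) f := by
  obtain ⟨A, B, h⟩ := exists_ker_of_hasCompactSupport (χ.pt_hasCompactSupport n) (χ.pt_smooth n)
  obtain ⟨A', B', h'⟩ := ker_pc χ n
  rw [← Op_mul h h', χ.pt_mul_pc]

theorem Op_pt_eq_sum (n : ℕ) (f : Bdd d) :
    Op (χ.pt n) f = ∑ i ∈ Finset.Icc (n - 1) (n + 1), Op (χ.pc i) f := by
  choose A B h using ker_pc χ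
  exact Op_finset_sum _ (fun i _ => h i) f

theorem Rep.Op_pc_eq_zero (h : Rep χ u f) {m : ℕ} (hmn : n + 1 < m ∨ m + 1 < n) :
    Op (χ.pc m) (f n) = 0 := by
  refine tf_injective ?_
  rw [← block_tf, ← h n, block_eq_fm, block_eq_fm,
    fm_fm (χ.pc_hasTemperateGrowth n) (χ.pc_hasTemperateGrowth m),
    χ.pc_mul_pc_eq_zero' (by omega), tf_zero]
  ext φ
  rw [fourierMultiplierCLM_apply_apply]
  have e : smulLeftCLM ℂ (0 : Space d → ℂ) (𝓕⁻ φ : 𝓢(Space d, ℂ)) = 0 := by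
    ext x
    have := smulLeftCLM_apply_apply
      (Function.HasTemperateGrowth.const (E := Space d) (0 : ℂ)) (𝓕⁻ φ : 𝓢(Space d, ℂ)) x
    exact this.trans (zero_smul ℂ _)
  rw [e, FourierTransform.fourier_zero, map_zero]
  rfl

/-- A distribution of a Besov space has bounded blocks. -/
theorem exists_rep {θ : ℝ} (h : besovNorm χ θ u < ⊤) : ∃ f, Rep χ u f := by
  have hn : ∀ n, ∃ f : Bdd d, block χ n u = tf f := by
    intro n
    have h1 : weight θ n * linftyNorm (block χ n u) < ⊤ :=
      (le_iSup (fun n => weight θ n * linftyNorm (block χ n u)) n).trans_lt h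
    have h2 : linftyNorm (block χ n u) ≠ ⊤ := by
      intro h2
      rw [h2, ENNReal.mul_top] at h1
      · exact lt_irrefl _ h1
      · rw [weight, ne_eq, ENNReal.ofReal_eq_zero, not_le]
        positivity
    obtain ⟨g, hg⟩ : ∃ g : Lp ℂ ⊤ (volume : Measure (Space d)),
        Lp.toTemperedDistribution g = block χ n u := by
      by_contra hne
      push Not at hne
      refine h2 ?_
      unfold linftyNorm
      simp [hne]
    obtain ⟨f, hf⟩ := exists_fm_toTemperedDistribution (χ.pt_hasCompactSupport n) (χ.pt_smooth n) g
    refine ⟨f, ?_⟩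
    rw [← hf, hg, block_eq_fm, fm_fm (χ.pc_hasTemperateGrowth n)
      ((χ.pt_hasCompactSupport n).hasTemperateGrowth (χ.pt_smooth n)), mul_comm, χ.pt_mul_pc]
  choose f hf using hn
  exact ⟨f, hf⟩

theorem Rep.besovNorm_eq (h : Rep χ u f) (θ : ℝ) : besovNorm χ θ u = ⨆ n, weight θ n * ‖f n‖ₑ := by
  unfold besovNorm
  congr 1
  ext n
  rw [h n, linftyNorm_tf]

end

section

variable {d : ℕ}
variable {N n : ℕ} {X : Bdd d} {f : BSeq d} {C γ : ℝ}

theorem ofPairing_eq {F : 𝓢(Space d, ℂ) → ℂ} {w : Distr d} (h : ∀ φ, w φ = F φ) :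
    ofPairing F = w := by
  ext φ
  rw [ofPairing_apply ⟨w, h⟩, h]

/-! ### Sums of functions with localized Fourier transform -/

variable (χ : DyadicPartition d)

/-- The Fourier transform of `X` is carried by the annuli whose index differs from `n` by at most
`N`. -/
def Win (N n : ℕ) (X : Bdd d) : Prop := ∀ m, n + N < m ∨ m + N < n → Op (χ.pc m) X = 0

variable {χ}

theorem Win.add {Y : Bdd d} (hX : Win χ N n X) (hY : Win χ N n Y) : Win χ N n (X + Y) := fun m hm => by rw [map_add, hX m hm, hY m hm, add_zero]

theorem Rep.win {u : Distr d} (h : Rep χ u f) (n : ℕ) : Win χ 1 n (f n) :=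
  fun _ hm => h.Op_pc_eq_zero hm

theorem Win.sum_Op (h : Win χ N n X) : ∑ i ∈ Finset.Icc (n - N) (n + N), Op (χ.pc i) X = X := by
  refine tf_injective (eq_of_block_eq χ fun k => ?_)
  rw [block_tf, block_tf]
  congr 1
  rw [map_sum]
  have hcomm : ∀ i, Op (χ.pc k) (Op (χ.pc i) X) = Op (χ.pc i) (Op (χ.pc k) X) := by
    intro i
    rw [Op_pc_mul, Op_pc_mul, mul_comm]
  have e1 : Op (χ.pc k) X = ∑ i ∈ Finset.Icc (k - 1) (k + 1), Op (χ.pc k) (Op (χ.pc i) X) := by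
    rw [← Op_pt_pc k X, Op_pt_eq_sum]
    exact sum_congr rfl fun i _ => (hcomm i).symm
  rw [e1]
  have z1 : ∀ i, i ∉ Finset.Icc (n - N) (n + N) → Op (χ.pc k) (Op (χ.pc i) X) = 0 := by
    intro i hi
    rw [Finset.mem_Icc] at hi
    rw [h i (by omega), map_zero]
  have z2 : ∀ i, i ∉ Finset.Icc (k - 1) (k + 1) → Op (χ.pc k) (Op (χ.pc i) X) = 0 := by
    intro i hi
    rw [Finset.mem_Icc] at hi
    rw [Op_pc_mul, χ.pc_mul_pc_eq_zero' (by omega), Op_zero]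
  rw [Finset.sum_subset Finset.subset_union_left fun i _ hi => z1 i hi,
    ← Finset.sum_subset Finset.subset_union_right fun i _ hi => z2 i hi]

/-- The multiplier `‖z‖^{2 * K}`. -/
def normPow (K : ℕ) (z : Space d) : ℂ := ((‖z‖ ^ 2 : ℝ) : ℂ) ^ K

theorem normPow_hasTemperateGrowth (K : ℕ) : (normPow (d := d) K).HasTemperateGrowth :=
  (Function.Complex.hasTemperateGrowth_ofReal.comp
    (Function.hasTemperateGrowth_norm_sq (H := Space d))).pow K

theorem contDiff_mul_normPow_inv {q : Space d → ℂ} (hqs : ContDiff ℝ ∞ q)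
    (hq0 : (0 : Space d) ∉ tsupport q) (K : ℕ) : ContDiff ℝ ∞ (fun z => q z * (normPow K z)⁻¹) := by
  rw [contDiff_iff_contDiffAt]
  intro z
  by_cases hz : z ∈ tsupport q
  · have hz0 : z ≠ 0 := fun h => hq0 (h ▸ hz)
    refine hqs.contDiffAt.mul (ContDiffAt.inv (normPow_hasTemperateGrowth K).1.contDiffAt ?_)
    have : (‖z‖ : ℝ) ≠ 0 := norm_ne_zero_iff.2 hz0
    exact pow_ne_zero _ (Complex.ofReal_ne_zero.2 (pow_ne_zero _ this))
  · have : (fun z => q z * (normPow K z)⁻¹) =ᶠ[𝓝 z] fun _ => 0 := by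
      filter_upwards [(isClosed_tsupport q).isOpen_compl.mem_nhds hz] with w hw
      rw [image_eq_zero_of_notMem_tsupport hw, zero_mul]
    exact contDiffAt_const.congr_of_eventuallyEq this

/-- Negative powers of the Laplacian on a block. -/
theorem exists_ker_pc_normPow_inv (χ : DyadicPartition d) (K : ℕ) :
    ∃ C, 0 ≤ C ∧ ∀ n, 1 ≤ n → ∃ r : Space d → ℂ, r.HasTemperateGrowth ∧ r * normPow K = χ.pc n ∧
      ∃ B, Ker r (C * pw (-(2 * K : ℝ)) n) B := by
  obtain ⟨A, B, h⟩ := exists_ker_of_hasCompactSupport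
    (m := χ.annC * fun z => (normPow K z)⁻¹) χ.annC_hasCompactSupport.mul_right
    (contDiff_mul_normPow_inv χ.annC_smooth χ.zero_notMem_tsupport_annC K)
  have hA := h.nonneg_left
  refine ⟨A * 2 ^ (2 * K), by positivity, fun n hn => ?_⟩
  obtain ⟨n, rfl⟩ : ∃ k, n = k + 1 := ⟨n - 1, by omega⟩
  have hc0 : ((((2 : ℝ) ^ n)⁻¹ ^ (2 * K) : ℝ) : ℂ) ≠ 0 := by
    rw [Complex.ofReal_ne_zero]
    positivity
  set δ : ℝ := ((2 : ℝ) ^ n)⁻¹ with hδ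
  have hδ0 : 0 < δ := by positivity
  have hk := (h.dilate hδ0).smul (((δ ^ (2 * K) : ℝ) : ℂ))
  rw [norm_real, norm_of_nonneg (by positivity)] at hk
  have hn0 : ∀ z : Space d, z ≠ 0 → normPow K z ≠ 0 := by
    intro z hz
    have : (‖z‖ : ℝ) ≠ 0 := norm_ne_zero_iff.2 hz
    exact pow_ne_zero _ (Complex.ofReal_ne_zero.2 (pow_ne_zero _ this))
  refine ⟨_, ?_, ?_, _, hk.mono ?_ le_rfl⟩
  · have hs : ContDiff ℝ ∞ (fun z => (χ.annC * fun z => (normPow K z)⁻¹ : Space d → ℂ) (δ • z)) :=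
      (contDiff_mul_normPow_inv χ.annC_smooth χ.zero_notMem_tsupport_annC K).comp
        (contDiff_const_smul δ)
    have hcs : HasCompactSupport (fun z => (χ.annC * fun z => (normPow K z)⁻¹ : Space d → ℂ) (δ • z)) :=
      HasCompactSupport.comp_homeomorph (χ.annC_hasCompactSupport.mul_right)
        (Homeomorph.smulOfNeZero δ hδ0.ne')
    exact (Function.HasTemperateGrowth.const _).mul (hcs.hasTemperateGrowth hs)
  · ext z
    simp only [Pi.mul_apply, Pi.smul_apply, smul_eq_mul]
    rw [χ.pc_succ]
    rcases eq_or_ne z 0 with rfl | hz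
    · simp only [smul_zero]
      rw [image_eq_zero_of_notMem_tsupport χ.zero_notMem_tsupport_annC]
      simp
    · have e : normPow K (δ • z) = ((δ ^ (2 * K) : ℝ) : ℂ) * normPow K z := by
        simp only [normPow]
        rw [norm_smul, norm_of_nonneg hδ0.le, mul_pow, Complex.ofReal_mul, mul_pow, pow_mul]
        push_cast
        rfl
      rw [e]
      have := hn0 z hz
      have hd : ((δ ^ (2 * K) : ℝ) : ℂ) ≠ 0 := hc0
      rw [← hδ]
      field_simp
  · apply le_of_eq
    have e : pw (-(2 * K : ℝ)) (n + 1) = δ ^ (2 * K) * ((2 : ℝ) ^ (2 * K))⁻¹ := by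
      rw [pw_neg, pw_eq_rpow, hδ]
      have : (2 * K : ℝ) = ((2 * K : ℕ) : ℝ) := by push_cast; ring
      rw [this, rpow_natCast, pow_succ, mul_pow, mul_inv, inv_pow]
    rw [e]
    field_simp

theorem exists_antiderivative (χ : DyadicPartition d) (N K : ℕ) :
    ∃ C, 0 ≤ C ∧ ∀ n X, N < n → Win χ N n X → ∃ h : Bdd d, ‖h‖ ≤ C * pw (-(2 * K : ℝ)) n * ‖X‖ ∧
      fm (normPow K) (tf h) = tf X := by
  obtain ⟨C, hC, hr⟩ := exists_ker_pc_normPow_inv χ K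
  refine ⟨(2 * N + 1) * (C * pw |(-(2 * K : ℝ))| N), by have := pw_nonneg |(-(2 * K : ℝ))| N; positivity,
    fun n X hn hX => ?_⟩
  choose! r r1 r2 B r3 using hr
  have hi : ∀ i ∈ Finset.Icc (n - N) (n + N), 1 ≤ i ∧ i ≤ n + N ∧ n ≤ i + N := by
    intro i hi
    rw [Finset.mem_Icc] at hi
    omega
  refine ⟨∑ i ∈ Finset.Icc (n - N) (n + N), Op (r i) X, ?_, ?_⟩
  · refine (norm_sum_le _ _).trans ?_
    have hb : ∀ i ∈ Finset.Icc (n - N) (n + N), ‖Op (r i) X‖ ≤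
        C * pw |(-(2 * K : ℝ))| N * pw (-(2 * K : ℝ)) n * ‖X‖ := by
      intro i hi'
      obtain ⟨h1, h2, h3⟩ := hi i hi'
      refine ((r3 i h1).norm_Op_le X).trans ?_
      have h4 := pw_le_of_near (γ := -(2 * K : ℝ)) h2 h3
      calc C * pw (-(2 * K : ℝ)) i * ‖X‖
          ≤ C * (pw |(-(2 * K : ℝ))| N * pw (-(2 * K : ℝ)) n) * ‖X‖ := by gcongr
        _ = _ := by ring
    refine (sum_le_card_nsmul _ _ _ hb).trans ?_
    rw [nsmul_eq_mul, Nat.card_Icc]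
    have hcard : ((n + N + 1 - (n - N) : ℕ) : ℝ) ≤ 2 * N + 1 := by
      have : n + N + 1 - (n - N) ≤ 2 * N + 1 := by omega
      exact_mod_cast this
    have hX0 : 0 ≤ C * pw |(-(2 * K : ℝ))| N * pw (-(2 * K : ℝ)) n * ‖X‖ := by
      have := pw_nonneg |(-(2 * K : ℝ))| N
      have := pw_nonneg (-(2 * K : ℝ)) n
      positivity
    calc _ ≤ (2 * N + 1) * (C * pw |(-(2 * K : ℝ))| N * pw (-(2 * K : ℝ)) n * ‖X‖) := by gcongr
      _ = _ := by ring
  · rw [tf_sum, map_sum]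
    conv_rhs => rw [← hX.sum_Op, tf_sum]
    refine sum_congr rfl fun i hi' => ?_
    obtain ⟨h1, h2, h3⟩ := hi i hi'
    rw [← fm_tf (r1 i h1) (r3 i h1), fm_fm (r1 i h1) (normPow_hasTemperateGrowth K), r2 i h1,
      ← block_eq_fm, block_tf]

/-- A localized function, tested against a Schwartz function, is rapidly decreasing. -/
theorem exists_pairing_bound (χ : DyadicPartition d) (N K : ℕ) (φ : 𝓢(Space d, ℂ)) :
    ∃ C, 0 ≤ C ∧ ∀ n X, Win χ N n X → ‖tf X φ‖ ≤ C * pw (-(K : ℝ)) n * ‖X‖ := by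
  obtain ⟨C, hC, h⟩ := exists_antiderivative χ N K
  set φ' : 𝓢(Space d, ℂ) := 𝓕 (smulLeftCLM ℂ (normPow K) (𝓕⁻ φ : 𝓢(Space d, ℂ))) with hφ'
  set I := ∫ x, ‖φ x‖ with hI
  set I' := ∫ x, ‖φ' x‖ with hI'
  have hI0 : 0 ≤ I := by positivity
  have hI0' : 0 ≤ I' := by positivity
  have hN := pw_nonneg (K : ℝ) N
  refine ⟨I * pw (K : ℝ) N + I' * C, by positivity, fun n X hX => ?_⟩
  have hn := pw_nonneg (-(K : ℝ)) n
  rcases le_or_gt n N with hle | hgt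
  · refine (norm_tf_apply_le X φ).trans ?_
    have h1 : 1 ≤ pw (K : ℝ) N * pw (-(K : ℝ)) n := by
      rw [pw, pw, ← rpow_add two_pos]
      refine Real.one_le_rpow one_le_two ?_
      have : (n : ℝ) ≤ N := by exact_mod_cast hle
      have hK : (0 : ℝ) ≤ K := by positivity
      nlinarith
    have h2 : 0 ≤ I' * C * pw (-(K : ℝ)) n * ‖X‖ := by positivity
    have h3 : I * ‖X‖ ≤ I * ‖X‖ * (pw (K : ℝ) N * pw (-(K : ℝ)) n) :=
      le_mul_of_one_le_right (by positivity) h1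
    calc I * ‖X‖ ≤ I * ‖X‖ * (pw (K : ℝ) N * pw (-(K : ℝ)) n) + I' * C * pw (-(K : ℝ)) n * ‖X‖ := by
          linarith
      _ = _ := by ring
  · obtain ⟨b, hb1, hb2⟩ := h n X hgt hX
    rw [← hb2, fourierMultiplierCLM_apply_apply]
    refine (norm_tf_apply_le b φ').trans ?_
    have h1 : pw (-(2 * K : ℝ)) n ≤ pw (-(K : ℝ)) n :=
      pw_mono (by have : (0 : ℝ) ≤ K := by positivity
                  linarith) n
    have h2 : 0 ≤ I * pw (K : ℝ) N * pw (-(K : ℝ)) n * ‖X‖ := by positivity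
    calc I' * ‖b‖ ≤ I' * (C * pw (-(2 * K : ℝ)) n * ‖X‖) := by gcongr
      _ ≤ I' * (C * pw (-(K : ℝ)) n * ‖X‖) := by gcongr
      _ ≤ I * pw (K : ℝ) N * pw (-(K : ℝ)) n * ‖X‖ + I' * (C * pw (-(K : ℝ)) n * ‖X‖) := by linarith
      _ = _ := by ring

/-- Pairing with a fixed test function. -/
def tfEval (φ : 𝓢(Space d, ℂ)) : Bdd d →L[ℂ] ℂ :=
  LinearMap.mkContinuous
    { toFun := fun f => tf f φ
      map_add' := fun f g => by rw [tf_add]; rfl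
      map_smul' := fun c f => by rw [tf_smul]; rfl } (∫ x, ‖φ x‖) fun f => norm_tf_apply_le f φ

theorem tfEval_apply (φ : 𝓢(Space d, ℂ)) (f : Bdd d) : tfEval φ f = tf f φ := rfl

/-- The bound `‖f_n‖ ≤ C 2^{-γn}`. -/
def PB (γ C : ℝ) (f : BSeq d) : Prop := ∀ n, ‖f n‖ ≤ C * pw (-γ) n

theorem PB.nonneg (h : PB γ C f) : 0 ≤ C := by
  have := (norm_nonneg _).trans (h 0)
  rwa [pw_zero_right, mul_one] at this

/-- Synthesis of a distribution from localized functions. -/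
theorem exists_synthesis (χ : DyadicPartition d) {X : BSeq d} (hX : PB γ C X)
    (hW : ∀ n, Win χ N n (X n)) : ∃ w : Distr d, (∀ φ, HasSum (fun n => tf (X n) φ) (w φ)) ∧
    Rep χ w fun m => ∑ n ∈ Finset.Icc (m - N) (m + N), Op (χ.pc m) (X n) := by
  obtain ⟨K, hK⟩ := exists_nat_gt (-γ)
  have hC := hX.nonneg
  obtain ⟨D, hD, h⟩ := exists_antiderivative χ N K
  choose! b b1 b2 using h
  have hsum : Summable fun n => b (n + (N + 1)) (X (n + (N + 1))) := by
    have hs : Summable fun n => D * C * pw (-(2 * K : ℝ) - γ) n :=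
      (summable_pw (by have : (0 : ℝ) ≤ K := by positivity
                       linarith)).mul_left _
    refine Summable.of_norm_bounded ((summable_nat_add_iff (N + 1)).2 hs) fun n => ?_
    refine (b1 _ _ (by omega) (hW _)).trans ?_
    rw [sub_eq_add_neg, pw_add]
    have := hX (n + (N + 1))
    have h3 := pw_nonneg (-(2 * K : ℝ)) (n + (N + 1))
    calc _ ≤ D * pw (-(2 * K : ℝ)) (n + (N + 1)) * (C * pw (-γ) (n + (N + 1))) := by gcongr
      _ = _ := by ring
  set H := ∑' n, b (n + (N + 1)) (X (n + (N + 1))) with hH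
  set w : Distr d := (∑ n ∈ Finset.range (N + 1), tf (X n)) + fm (normPow K) (tf H) with hw
  have hsumφ : ∀ φ, HasSum (fun n => tf (X n) φ) (w φ) := by
    intro φ
    rw [← hasSum_nat_add_iff' (N + 1)]
    set φ' : 𝓢(Space d, ℂ) := 𝓕 (smulLeftCLM ℂ (normPow K) (𝓕⁻ φ : 𝓢(Space d, ℂ))) with hφ'
    have h1 := (tfEval φ').hasSum hsum.hasSum
    have e1 : w φ - ∑ n ∈ Finset.range (N + 1), tf (X n) φ = tf H φ' := by
      have : w φ = (∑ n ∈ Finset.range (N + 1), tf (X n) φ) + fm (normPow K) (tf H) φ := by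
        rw [hw]
        change (∑ n ∈ Finset.range (N + 1), tf (X n)) φ + _ = _
        rw [_root_.sum_apply]
        rfl
      rw [this, fourierMultiplierCLM_apply_apply]
      ring
    rw [e1]
    refine h1.congr_fun fun n => ?_
    simp only [tfEval_apply]
    rw [← b2 (n + (N + 1)) (X (n + (N + 1))) (by omega) (hW _),
      fourierMultiplierCLM_apply_apply]
  refine ⟨w, hsumφ, fun m => ?_⟩
  ext φ
  rw [block_eq_fm, fourierMultiplierCLM_apply_apply]
  refine (hsumφ _).unique ?_
  have e : ∀ n, tf (X n) (𝓕 (smulLeftCLM ℂ (χ.pc m) (𝓕⁻ φ : 𝓢(Space d, ℂ))) :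
      𝓢(Space d, ℂ)) = tf (Op (χ.pc m) (X n)) φ := by
    intro n
    rw [← fourierMultiplierCLM_apply_apply, ← block_tf]
    rfl
  simp only [e]
  rw [tf_sum, _root_.sum_apply]
  refine hasSum_sum_of_ne_finset_zero fun n hn => ?_
  rw [Finset.mem_Icc] at hn
  rw [hW n m (by omega), tf_zero]
  rfl

end

section

variable {d : ℕ}
variable {u v : Distr d} {f g : BSeq d} {C₁ C₂ γ₁ γ₂ : ℝ}

/-! ### The paraproduct -/

/-- The terms of the paraproduct. -/
def paraTerm (f g : BSeq d) (n : ℕ) : Bdd d := (∑ m ∈ Finset.range (n - 1), f m) * g n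

theorem hasCompactSupport_comp_smul {q : Space d → ℂ} (h : HasCompactSupport q) {δ : ℝ}
    (hδ : δ ≠ 0) : HasCompactSupport fun z => q (δ • z) :=
  h.comp_homeomorph (Homeomorph.smulOfNeZero δ hδ)

theorem exists_paraTerm_win (χ : DyadicPartition d) : ∃ N : ℕ, 1 ≤ N ∧
    ∀ (u v : Distr d) (f g : BSeq d), Rep χ u f → Rep χ v g → ∀ n, Win χ N n (paraTerm f g n) := by
  obtain ⟨R, a, b, ha, hR, hb, h0, h1⟩ := χ.exists_radii
  have hR0 : 0 ≤ R := by
    have := h0 0 (by rw [χ.p_zero, χ.low_zero]; exact one_ne_zero)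
    simpa using this
  set ρ := max R (b / 2) with hρ
  have hρ0 : 0 ≤ ρ := hR0.trans (le_max_left _ _)
  have hρa : ρ < 2 * a := max_lt hR (by linarith)
  set ε := (2 * a - ρ) / 8 with hε
  have hε0 : 0 < ε := by rw [hε]; linarith
  have e8 : 2 * a = ρ + 8 * ε := by rw [hε]; ring
  set B := 2 * |b| + 2 * a + 2 with hB
  set b₁ : ContDiffBump (0 : Space d) := ⟨ρ + ε, ρ + 2 * ε, by linarith, by linarith⟩ with hb₁
  set b₂ : ContDiffBump (0 : Space d) := ⟨2 * a - 2 * ε, 2 * a - ε, by linarith, by linarith⟩ with hb₂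
  set b₃ : ContDiffBump (0 : Space d) := ⟨B - 1, B, by rw [hB]; have := abs_nonneg b; linarith, by linarith⟩ with hb₃
  set q₁ : Space d → ℂ := fun z => (b₁ z : ℂ) with hq₁
  set q₂ : Space d → ℂ := fun z => (b₃ z : ℂ) - (b₂ z : ℂ) with hq₂
  have bs : ∀ b : ContDiffBump (0 : Space d), ContDiff ℝ ∞ (fun z => (b z : ℂ)) := fun b =>
    ofRealCLM.contDiff.comp b.contDiff
  have bc : ∀ b : ContDiffBump (0 : Space d), HasCompactSupport (fun z => (b z : ℂ)) := fun b =>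
    b.hasCompactSupport.comp_left (g := Complex.ofReal) Complex.ofReal_zero
  have s₁ : ContDiff ℝ ∞ q₁ := bs b₁
  have s₂ : ContDiff ℝ ∞ q₂ := (bs b₃).sub (bs b₂)
  have c₁ : HasCompactSupport q₁ := bc b₁
  have c₂ : HasCompactSupport q₂ := by simpa [hq₂, sub_eq_add_neg] using! (bc b₃).add ((bc b₂).neg)
  have q₁_one : ∀ z, ‖z‖ ≤ ρ → q₁ z = 1 := by
    intro z hz
    have : b₁ z = 1 := b₁.one_of_mem_closedBall (by
      rw [mem_closedBall_zero_iff]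
      change ‖z‖ ≤ ρ + ε
      linarith)
    simp [hq₁, this]
  have q₁_supp : ∀ z, q₁ z ≠ 0 → ‖z‖ ≤ ρ + 2 * ε := by
    intro z hz
    by_contra hlt
    have : b₁ z = 0 := b₁.zero_of_le_dist (by
      rw [dist_zero_right]
      exact (not_le.1 hlt).le)
    exact hz (by simp [hq₁, this])
  have hBa : 2 * a - ε ≤ B - 1 := by
    have := abs_nonneg b
    rw [hB]
    linarith
  have q₂_one : ∀ z, 2 * a ≤ ‖z‖ → ‖z‖ ≤ 2 * b → q₂ z = 1 := by
    intro z hz hz2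
    have h3 : b₃ z = 1 := b₃.one_of_mem_closedBall (by
      rw [mem_closedBall_zero_iff]
      change ‖z‖ ≤ B - 1
      have := le_abs_self b
      rw [hB]
      linarith)
    have h2 : b₂ z = 0 := b₂.zero_of_le_dist (by
      rw [dist_zero_right]
      change 2 * a - ε ≤ ‖z‖
      linarith)
    simp [hq₂, h3, h2]
  have q₂_supp : ∀ z, q₂ z ≠ 0 → 2 * a - 2 * ε ≤ ‖z‖ ∧ ‖z‖ ≤ B := by
    intro z hz
    constructor
    · by_contra hlt
      rw [not_le] at hlt
      have h2 : b₂ z = 1 := b₂.one_of_mem_closedBall (by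
        rw [mem_closedBall_zero_iff]
        exact hlt.le)
      have h3 : b₃ z = 1 := b₃.one_of_mem_closedBall (by
        rw [mem_closedBall_zero_iff]
        change ‖z‖ ≤ B - 1
        linarith)
      exact hz (by simp [hq₂, h3, h2])
    · by_contra hlt
      rw [not_le] at hlt
      have h3 : b₃ z = 0 := b₃.zero_of_le_dist (by
        rw [dist_zero_right]
        exact hlt.le)
      have h2 : b₂ z = 0 := b₂.zero_of_le_dist (by
        rw [dist_zero_right]
        change 2 * a - ε ≤ ‖z‖
        linarith)
      exact hz (by simp [hq₂, h3, h2])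
  set C := ρ + 2 * ε + B with hC
  obtain ⟨M, hM⟩ := pow_unbounded_of_one_lt (max (max (R / (4 * ε)) (C / a)) (b / (4 * ε)))
    (one_lt_two : (1 : ℝ) < 2)
  have hM1 : R < 4 * ε * 2 ^ M := by
    have := ((le_max_left _ _).trans (le_max_left _ _)).trans_lt hM
    rw [div_lt_iff₀ (by positivity)] at this
    linarith
  have hM2 : C < a * 2 ^ M := by
    have := ((le_max_right _ _).trans (le_max_left _ _)).trans_lt hM
    rw [div_lt_iff₀ ha] at this
    linarith
  have hM3 : b < 4 * ε * 2 ^ M := by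
    have := (le_max_right _ _).trans_lt hM
    rw [div_lt_iff₀ (by positivity)] at this
    linarith
  refine ⟨M + 2, by omega, fun u v f g hu hv n => ?_⟩
  rcases lt_or_ge n 2 with hn | hn
  · have : n - 1 = 0 := by omega
    intro m _
    rw [paraTerm, this, Finset.sum_range_zero, zero_mul, map_zero]
  obtain ⟨k, rfl⟩ : ∃ k, n = k + 2 := ⟨n - 2, by omega⟩
  set δ : ℝ := ((2 : ℝ) ^ k)⁻¹ with hδ
  have h2k : (0 : ℝ) < 2 ^ k := by positivity
  have hδ0 : 0 < δ := by positivity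
  have nrm : ∀ z : Space d, ‖δ • z‖ = ‖z‖ / 2 ^ k := by
    intro z
    rw [norm_smul, norm_of_nonneg hδ0.le, hδ, inv_mul_eq_div]
  have cs₁ := hasCompactSupport_comp_smul c₁ hδ0.ne'
  have cs₂ := hasCompactSupport_comp_smul c₂ hδ0.ne'
  have ss₁ : ContDiff ℝ ∞ fun z => q₁ (δ • z) := s₁.comp (contDiff_const_smul δ)
  have ss₂ : ContDiff ℝ ∞ fun z => q₂ (δ • z) := s₂.comp (contDiff_const_smul δ)
  have hF : Op (fun z => q₁ (δ • z)) (∑ m ∈ Finset.range (k + 2 - 1), f m) =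
      ∑ m ∈ Finset.range (k + 2 - 1), f m := by
    rw [map_sum]
    refine sum_congr rfl fun i hi => hu.Op_eq_self cs₁ ss₁ ?_
    rw [Finset.mem_range] at hi
    ext z
    rw [Pi.mul_apply]
    by_cases hz : χ.pc i z = 0
    · rw [hz, zero_mul]
    · have hz' : χ.p i z ≠ 0 := fun h => hz (by simp [DyadicPartition.pc, h])
      rw [q₁_one, mul_one]
      rw [nrm, div_le_iff₀ h2k]
      rcases i with _ | i
      · calc ‖z‖ ≤ R := h0 z hz'
          _ ≤ ρ * 1 := by rw [mul_one]; exact le_max_left _ _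
          _ ≤ ρ * 2 ^ k := by
            gcongr
            exact one_le_pow₀ one_le_two
      · calc ‖z‖ ≤ b * 2 ^ i := (h1 i z hz').2
          _ = b / 2 * 2 ^ (i + 1) := by ring
          _ ≤ ρ * 2 ^ (i + 1) := by gcongr; exact le_max_right _ _
          _ ≤ ρ * 2 ^ k := by
            gcongr
            · exact one_le_two
            · omega
  have hG : Op (fun z => q₂ (δ • z)) (g (k + 2)) = g (k + 2) := by
    refine hv.Op_eq_self cs₂ ss₂ ?_
    ext z
    rw [Pi.mul_apply]
    by_cases hz : χ.pc (k + 2) z = 0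
    · rw [hz, zero_mul]
    · have hz' : χ.p (k + 2) z ≠ 0 := fun h => hz (by simp [DyadicPartition.pc, h])
      have h3 := h1 (k + 1) z hz'
      rw [pow_succ] at h3
      rw [q₂_one, mul_one]
      · rw [nrm, le_div_iff₀ h2k]
        linarith
      · rw [nrm, div_le_iff₀ h2k]
        linarith
  intro m hm
  obtain ⟨A₁, B₁, K₁⟩ := exists_ker_of_hasCompactSupport cs₁ ss₁
  obtain ⟨A₂, B₂, K₂⟩ := exists_ker_of_hasCompactSupport cs₂ ss₂
  obtain ⟨A₃, B₃, K₃⟩ := ker_pc χ m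
  refine Op_mul_eq_zero K₃ K₁ K₂ hF hG fun ξ η => ?_
  by_contra hne
  have hne1 := (mul_ne_zero_iff.1 (mul_ne_zero_iff.1 hne).1)
  have hne2 := (mul_ne_zero_iff.1 hne).2
  have k1 := q₁_supp _ hne1.2
  have k2 := q₂_supp _ hne2
  rw [nrm] at k1 k2
  rw [div_le_iff₀ h2k] at k1
  rw [le_div_iff₀ h2k, div_le_iff₀ h2k] at k2
  have up : ‖ξ + η‖ ≤ C * 2 ^ k := by
    refine (norm_add_le _ _).trans ?_
    rw [hC]
    linarith [k2.2]
  have lo : 4 * ε * 2 ^ k ≤ ‖ξ + η‖ := by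
    have : ‖η‖ ≤ ‖ξ + η‖ + ‖ξ‖ := by
      calc ‖η‖ = ‖(ξ + η) - ξ‖ := by congr 1; abel
        _ ≤ _ := norm_sub_le _ _
    have h5 := k2.1
    rw [e8] at h5
    linarith
  have hp : χ.p m (ξ + η) ≠ 0 := fun h => hne1.1 (by simp [DyadicPartition.pc, h])
  have pinj : ∀ {x y : ℕ}, (2 : ℝ) ^ x < 2 ^ y → x < y := fun h =>
    (pow_lt_pow_iff_right₀ one_lt_two).1 h
  rcases m with _ | m
  · have h3 := h0 _ hp
    have h4 : 4 * ε * 2 ^ k < 4 * ε * 2 ^ M := by linarith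
    have := pinj (lt_of_mul_lt_mul_left h4 (by positivity))
    omega
  · have h3 := h1 m _ hp
    have h4 : a * 2 ^ m < a * 2 ^ (M + k) := by
      rw [pow_add, ← mul_assoc]
      nlinarith [h3.1]
    have h5 : 4 * ε * 2 ^ k < 4 * ε * 2 ^ (M + m) := by
      rw [pow_add, ← mul_assoc]
      have : (0 : ℝ) < 2 ^ m := by positivity
      nlinarith [h3.2]
    have i1 := pinj (lt_of_mul_lt_mul_left h4 ha.le)
    have i2 := pinj (lt_of_mul_lt_mul_left h5 (by positivity))
    omega

/-- The width of the annuli that carry the terms of the paraproduct. -/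
def paraN (χ : DyadicPartition d) : ℕ := (exists_paraTerm_win χ).choose

theorem one_le_paraN (χ : DyadicPartition d) : 1 ≤ paraN χ := (exists_paraTerm_win χ).choose_spec.1

variable {χ : DyadicPartition d}

theorem Rep.paraTerm_win (hu : Rep χ u f) (hv : Rep χ v g) (n : ℕ) :
    Win χ (paraN χ) n (paraTerm f g n) :=
  (exists_paraTerm_win χ).choose_spec.2 u v f g hu hv n

variable (χ) in
/-- The blocks of the paraproduct. -/
def paraSeq (f g : BSeq d) (m : ℕ) : Bdd d :=
  ∑ n ∈ Finset.Icc (m - paraN χ) (m + paraN χ), Op (χ.pc m) (paraTerm f g n)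

theorem Rep.blockFun_ae (h : Rep χ u f) (n : ℕ) : blockFun χ n u =ᵐ[volume] f n := by
  rw [blockFun, h n]
  exact toFun_tf _

theorem Rep.sum_blockFun_ae (h : Rep χ u f) (s : Finset ℕ) :
    (fun x => ∑ m ∈ s, blockFun χ m u x) =ᵐ[volume] ⇑(∑ m ∈ s, f m) := by
  have : ∀ᵐ x, ∀ m ∈ s, blockFun χ m u x = f m x := by
    exact (Finset.eventually_all s).2 fun m _ => h.blockFun_ae m
  filter_upwards [this] with x hx
  rw [coe_sum, Finset.sum_apply]
  exact sum_congr rfl hx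

theorem paraTerm_bound (hf : PB γ₁ C₁ f) (hg : PB γ₂ C₂ g) : ∃ γ C, PB γ C (paraTerm f g) := by
  have hC1 := hf.nonneg
  have hC2 := hg.nonneg
  obtain ⟨S, hS, hsum⟩ := sum_range_pw_le (γ := |γ₁| + 1) (by positivity)
  refine ⟨γ₂ - (|γ₁| + 1), C₁ * S * C₂, fun n => ?_⟩
  have hF : ‖∑ m ∈ Finset.range (n - 1), f m‖ ≤ C₁ * (S * pw (|γ₁| + 1) n) := by
    refine (norm_sum_le _ _).trans ?_
    calc ∑ m ∈ Finset.range (n - 1), ‖f m‖ ≤ ∑ m ∈ Finset.range n, ‖f m‖ :=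
          Finset.sum_le_sum_of_subset_of_nonneg (Finset.range_mono (by omega))
            fun _ _ _ => norm_nonneg _
      _ ≤ ∑ m ∈ Finset.range n, C₁ * pw (|γ₁| + 1) m := by
          refine sum_le_sum fun m _ => (hf m).trans ?_
          gcongr
          exact pw_mono (by linarith [neg_abs_le γ₁]) m
      _ ≤ _ := by
          rw [← mul_sum]
          gcongr
          exact hsum n
  refine (norm_mul_le _ _).trans ?_
  rw [show -(γ₂ - (|γ₁| + 1)) = (|γ₁| + 1) + -γ₂ by ring, pw_add]
  have := pw_nonneg (|γ₁| + 1) n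
  calc _ ≤ C₁ * (S * pw (|γ₁| + 1) n) * (C₂ * pw (-γ₂) n) :=
        mul_le_mul hF (hg n) (norm_nonneg _) (by positivity)
    _ = _ := by ring

/-- The paraproduct of two distributions of Besov type. -/
theorem Rep.para (hu : Rep χ u f) (hv : Rep χ v g) (hf : PB γ₁ C₁ f) (hg : PB γ₂ C₂ g) :
    Rep χ (para χ u v) (paraSeq χ f g) := by
  obtain ⟨γ, C, hb⟩ := paraTerm_bound hf hg
  obtain ⟨w, hw, hrep⟩ := exists_synthesis χ hb (hu.paraTerm_win hv)
  have : RoughKolmogorov.para χ u v = w := by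
    refine ofPairing_eq fun φ => ?_
    rw [← (hw φ).tsum_eq]
    congr 1
    ext n
    rw [tf_apply]
    refine integral_congr_ae ?_
    filter_upwards [hu.sum_blockFun_ae (Finset.range (n - 1)), hv.blockFun_ae n] with x h1 h2
    rw [h1, h2]
    rfl
  rw [this]
  exact hrep

/-! ### The resonant product and the commutator -/

/-- The terms of the resonant product. -/
def resoTerm (f g : BSeq d) (n : ℕ) : Bdd d := (∑ m ∈ Finset.Icc (n - 1) (n + 1), f m) * g n

/-- The resonant product of two sequences of blocks. -/
def resoB (f g : BSeq d) : Bdd d := ∑' n, resoTerm f g n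

theorem reso_eq (hu : Rep χ u f) (hv : Rep χ v g) (hs : Summable (resoTerm f g)) :
    reso χ u v = tf (resoB f g) := by
  refine ofPairing_eq fun φ => ?_
  have h1 := (tfEval φ).hasSum hs.hasSum
  rw [← tfEval_apply, resoB, ← h1.tsum_eq]
  congr 1
  ext n
  rw [tfEval_apply, tf_apply]
  refine integral_congr_ae ?_
  filter_upwards [hu.sum_blockFun_ae (Finset.Icc (n - 1) (n + 1)), hv.blockFun_ae n] with x h1 h2
  rw [h1, h2]
  rfl

variable (χ) in
/-- The terms of the commutator. -/
def commTerm (F : Bdd d) (f g h : BSeq d) (n : ℕ) : Bdd d :=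
  (∑ m ∈ Finset.Icc (n - 1) (n + 1), (paraSeq χ f g m - F * g m)) * h n

variable (χ) in
/-- The commutator on sequences of blocks. -/
def commB (F : Bdd d) (f g h : BSeq d) : Bdd d := ∑' n, commTerm χ F f g h n

theorem comm_eq {w : Distr d} {F : Bdd d} {h : BSeq d} (hu : Rep χ u f) (huF : u = tf F)
    (hv : Rep χ v g) (hw : Rep χ w h) (hf : PB γ₁ C₁ f) (hg : PB γ₂ C₂ g)
    (hs : Summable (commTerm χ F f g h)) : comm χ u v w = tf (commB χ F f g h) := by
  refine ofPairing_eq fun φ => ?_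
  have h1 := (tfEval φ).hasSum hs.hasSum
  rw [← tfEval_apply, commB, ← h1.tsum_eq]
  congr 1
  ext n
  rw [tfEval_apply, tf_apply]
  refine integral_congr_ae ?_
  have hp := hu.para hv hf hg
  have hF : toFun u =ᵐ[volume] F := by
    rw [huF]
    exact toFun_tf F
  have ha1 : ∀ᵐ x, ∀ m ∈ Finset.Icc (n - 1) (n + 1), blockFun χ m (para χ u v) x = paraSeq χ f g m x := by
    exact (Finset.eventually_all _).2 fun m _ => hp.blockFun_ae m
  have ha2 : ∀ᵐ x, ∀ m ∈ Finset.Icc (n - 1) (n + 1), blockFun χ m v x = g m x := by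
    exact (Finset.eventually_all _).2 fun m _ => hv.blockFun_ae m
  filter_upwards [ha1, ha2, hF, hw.blockFun_ae n] with x h1 h2 h3 h4
  rw [h4, commTerm, BoundedContinuousFunction.mul_apply, coe_sum,
    Finset.sum_apply]
  congr 2
  refine sum_congr rfl fun m hm => ?_
  rw [h1 m hm, h2 m hm, h3]
  rfl

/-! ### Derivatives and constants -/

variable (χ) in
/-- The blocks of a derivative. -/
def derSeq (j : Fin d) (f : BSeq d) (n : ℕ) : Bdd d := Op (dmul χ j n) (f n)

theorem Rep.partialD (hu : Rep χ u f) (j : Fin d) : Rep χ (partialD j u) (derSeq χ j f) := by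
  intro n
  have hz : (fun z : Space d => ((inner ℝ z (EuclideanSpace.single j (1 : ℝ)) : ℝ) : ℂ)).HasTemperateGrowth := by
    fun_prop
  have hpt := (χ.pt_hasCompactSupport n).hasTemperateGrowth (χ.pt_smooth n)
  have hm : (fun z : Space d => (2 * π * Complex.I) *
      ((inner ℝ z (EuclideanSpace.single j (1 : ℝ)) : ℝ) : ℂ)).HasTemperateGrowth := by
    fun_prop
  have e0 : RoughKolmogorov.partialD j u = fm (fun z : Space d => (2 * π * Complex.I) *
      ((inner ℝ z (EuclideanSpace.single j (1 : ℝ)) : ℝ) : ℂ)) u := by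
    rw [RoughKolmogorov.partialD, TemperedDistribution.lineDeriv_eq_fourierMultiplierCLM]
    have := TemperedDistribution.fourierMultiplierCLM_smul (F := ℂ) hz (2 * π * Complex.I)
    exact (congrArg (fun L => L u) this).symm
  obtain ⟨C, _, hK⟩ := exists_ker_dmul χ
  have ed : dmul χ j n = (χ.pt n) * fun z : Space d => (2 * π * Complex.I) *
      ((inner ℝ z (EuclideanSpace.single j (1 : ℝ)) : ℝ) : ℂ) := by
    ext z
    simp [dmul, EuclideanSpace.inner_single_right]
    ring
  have hd : (dmul χ j n).HasTemperateGrowth := by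
    rw [ed]
    exact hpt.mul hm
  rw [derSeq, ← fm_tf hd (hK j n), ← hu n, e0, block_eq_fm, block_eq_fm,
    fm_fm hm (χ.pc_hasTemperateGrowth n), fm_fm (χ.pc_hasTemperateGrowth n) hd]
  congr 1
  rw [ed, ← mul_assoc, mul_comm (χ.pc n), χ.pt_mul_pc, mul_comm]

theorem ofFun_const (c : ℂ) :
    ofFun (fun _ : Space d => c) = tf (BoundedContinuousFunction.const _ c) :=
  ofPairing_eq fun φ => by
    rw [tf_apply]
    rfl

end

section

variable {d : ℕ} {χ : DyadicPartition d}
variable {u : Distr d} {f : BSeq d} {A B C T a b s t γ : ℝ} {F v : BPath d} {w : ℝ → Distr d}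

/-! ### Sequences of blocks -/

variable (χ) in
/-- The compatibility conditions that characterize the sequences of blocks of distributions. -/
structure Blk (f : BSeq d) : Prop where
  comm : ∀ m n, Op (χ.pc m) (f n) = Op (χ.pc n) (f m)
  pt : ∀ n, Op (χ.pt n) (f n) = f n
  win : ∀ n, Win χ 1 n (f n)

theorem Rep.blk (h : Rep χ u f) : Blk χ f := ⟨h.Op_pc_comm, h.Op_pt, h.win⟩

theorem Blk.exists_hasSum (h : Blk χ f) (hf : PB γ C f) : ∃ w : Distr d,
    (∀ φ, HasSum (fun n => tf (f n) φ) (w φ)) ∧ Rep χ w f := by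
  obtain ⟨w, h1, h2⟩ := exists_synthesis χ hf h.win
  refine ⟨w, h1, h2.congr ?_⟩
  ext1 m
  rw [← h.pt m, Op_pt_eq_sum]
  refine sum_congr rfl fun n _ => ?_
  rw [h.comm m n]

theorem Blk.exists_rep (h : Blk χ f) (hf : PB γ C f) : ∃ w : Distr d, Rep χ w f :=
  let ⟨w, _, h2⟩ := h.exists_hasSum hf
  ⟨w, h2⟩

theorem Rep.hasSum (h : Rep χ u f) (hf : PB γ C f) (φ : 𝓢(Space d, ℂ)) :
    HasSum (fun n => tf (f n) φ) (u φ) := by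
  obtain ⟨w, h1, h2⟩ := h.blk.exists_hasSum hf
  rw [h.ext h2]
  exact h1 φ

theorem Blk.zero : Blk χ (0 : BSeq d) := (Rep.zero (χ := χ)).blk

theorem Blk.add {g : BSeq d} (hf : Blk χ f) (hg : Blk χ g) : Blk χ (f + g) where
  comm m n := by simp only [Pi.add_apply, map_add, hf.comm m n, hg.comm m n]
  pt n := by simp only [Pi.add_apply, map_add, hf.pt n, hg.pt n]
  win n := (hf.win n).add (hg.win n)

theorem Blk.smul (hf : Blk χ f) (c : ℂ) : Blk χ (c • f) where
  comm m n := by simp only [Pi.smul_apply, map_smul, hf.comm m n]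
  pt n := by simp only [Pi.smul_apply, map_smul, hf.pt n]
  win n m hm := by rw [Pi.smul_apply, map_smul, hf.win n m hm, smul_zero]

theorem Blk.of_tendsto {ι : Type*} {l : Filter ι} [l.NeBot] {F : ι → BSeq d}
    (hF : ∀ᶠ i in l, Blk χ (F i)) (h : ∀ n, Tendsto (fun i => F i n) l (𝓝 (f n))) : Blk χ f where
  comm m n := by
    refine tendsto_nhds_unique (((Op (χ.pc m)).continuous.tendsto _).comp (h n))
      ((((Op (χ.pc n)).continuous.tendsto _).comp (h m)).congr' ?_)
    filter_upwards [hF] with i hi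
    exact hi.comm n m
  pt n := by
    refine tendsto_nhds_unique (((Op (χ.pt n)).continuous.tendsto _).comp (h n))
      ((h n).congr' ?_)
    filter_upwards [hF] with i hi
    exact (hi.pt n).symm
  win n m hm := by
    refine tendsto_nhds_unique (((Op (χ.pc m)).continuous.tendsto _).comp (h n))
      (tendsto_const_nhds.congr' ?_)
    filter_upwards [hF] with i hi
    exact (hi.win n m hm).symm

theorem Ker.Op_comm {m n : Space d → ℂ} {A' B' : ℝ} (h : Ker m A B) (h' : Ker n A' B') (f : Bdd d) :
    Op m (Op n f) = Op n (Op m f) := by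
  rw [← Op_mul h h', ← Op_mul h' h, mul_comm]

theorem ker_pt (χ : DyadicPartition d) (n : ℕ) : ∃ A B, Ker (χ.pt n) A B :=
  exists_ker_of_hasCompactSupport (χ.pt_hasCompactSupport n) (χ.pt_smooth n)

theorem Blk.apply_Op {q : Space d → ℂ} (hq : Ker q A B) (hf : Blk χ f) :
    Blk χ fun n => Op q (f n) where
  comm m n := by
    obtain ⟨_, _, hm⟩ := ker_pc χ m
    obtain ⟨_, _, hn⟩ := ker_pc χ n
    rw [hm.Op_comm hq, hn.Op_comm hq, hf.comm]
  pt n := by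
    obtain ⟨_, _, hn⟩ := ker_pt χ n
    rw [hn.Op_comm hq, hf.pt]
  win n m hmn := by
    obtain ⟨_, _, hm⟩ := ker_pc χ m
    rw [hm.Op_comm hq, hf.win n m hmn, map_zero]

theorem Blk.integral (hab : a ≤ b) (hF : ∀ r ∈ Icc a b, Blk χ (F r))
    (hi : ∀ n, IntervalIntegrable (fun r => F r n) volume a b) :
    Blk χ fun n => ∫ r in a..b, F r n where
  comm m n := by
    simp only [← intervalIntegral_comp_comm _ (hi _)]
    refine intervalIntegral.integral_congr fun r hr => ?_
    rw [uIcc_of_le hab] at hr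
    exact (hF r hr).comm m n
  pt n := by
    rw [← intervalIntegral_comp_comm _ (hi _)]
    refine intervalIntegral.integral_congr fun r hr => ?_
    rw [uIcc_of_le hab] at hr
    exact (hF r hr).pt n
  win n m hm := by
    rw [← intervalIntegral_comp_comm _ (hi _)]
    refine (intervalIntegral.integral_congr fun r hr => ?_).trans intervalIntegral.integral_zero
    rw [uIcc_of_le hab] at hr
    exact (hF r hr).win n m hm

/-- Integrals of distributions depending on a parameter. -/
theorem Rep.integral (hab : a ≤ b) (hF : ∀ r ∈ Icc a b, Rep χ (w r) (F r))
    (hC : ∀ r ∈ Icc a b, PB γ C (F r)) (hi : ∀ n, IntervalIntegrable (fun r => F r n) volume a b) :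
    Rep χ (ofPairing fun φ => ∫ r in a..b, w r φ) fun n => ∫ r in a..b, F r n := by
  have hb : Blk χ fun n => ∫ r in a..b, F r n := Blk.integral hab (fun r hr => (hF r hr).blk) hi
  have hC0 : 0 ≤ C := (hC a ⟨le_rfl, hab⟩).nonneg
  have hPB : PB γ (C * (b - a)) fun n => ∫ r in a..b, F r n := by
    intro n
    have := intervalIntegral.norm_integral_le_of_norm_le_const (a := a) (b := b)
      (f := fun r => F r n) (C := C * pw (-γ) n) fun r hr => by
        rw [uIoc_of_le hab] at hr
        exact hC r ⟨hr.1.le, hr.2⟩ n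
    rw [abs_of_nonneg (sub_nonneg.2 hab)] at this
    linarith
  obtain ⟨W, h1, h2⟩ := hb.exists_hasSum hPB
  have : ofPairing (fun φ => ∫ r in a..b, w r φ) = W := by
    refine ofPairing_eq fun φ => ?_
    refine (h1 φ).unique ?_
    obtain ⟨K, hK⟩ := exists_nat_gt (-γ)
    obtain ⟨D, hD, hp⟩ := exists_pairing_bound χ 1 K φ
    have e : ∀ n, tf (∫ r in a..b, F r n) φ = ∫ r in a..b, tf (F r n) φ := by
      intro n
      rw [← tfEval_apply, ← intervalIntegral_comp_comm _ (hi n)]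
      rfl
    simp only [e]
    refine intervalIntegral.hasSum_integral_of_dominated_convergence
      (bound := fun n _ => D * C * pw (-K - γ) n) ?_ ?_ ?_ ?_ ?_
    · intro n
      have := (hi n).aestronglyMeasurable
      rw [uIoc_of_le hab]
      exact ((tfEval φ).continuous.comp_aestronglyMeasurable this)
    · intro n
      refine .of_forall fun r hr => ?_
      rw [uIoc_of_le hab] at hr
      have hr' : r ∈ Icc a b := ⟨hr.1.le, hr.2⟩
      refine (hp n _ ((hF r hr').win n)).trans ?_
      rw [sub_eq_add_neg, pw_add]
      have := hC r hr' n
      have h3 := pw_nonneg (-(K : ℝ)) n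
      calc _ ≤ D * pw (-(K : ℝ)) n * (C * pw (-γ) n) := by gcongr
        _ = _ := by ring
    · exact .of_forall fun r _ => (summable_pw (by linarith)).mul_left _
    · exact intervalIntegrable_const
    · refine .of_forall fun r hr => ?_
      rw [uIoc_of_le hab] at hr
      have hr' : r ∈ Icc a b := ⟨hr.1.le, hr.2⟩
      exact (hF r hr').hasSum (hC r hr') φ
  rw [this]
  exact h2

/-! ### The semigroup -/

variable {α : ℝ} {ν : Measure (Sphere d)} [IsFiniteMeasure ν]
  [Stable α ν]

theorem integrable_expSymbol (ht : 0 < t) : Integrable (expSymbol α ν t) := by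
  have hα0 : 0 < α := Stable.pos ν
  have h1 : Integrable (expSymbol α ν 1) := by
    have hg : (fun z : Space d => (((1 + ‖z‖ ^ 2 : ℝ) : ℂ)) ^ (d + 1)).HasTemperateGrowth := by
      refine (Function.Complex.hasTemperateGrowth_ofReal.comp ?_).pow _
      exact (Function.HasTemperateGrowth.const 1).add (Function.hasTemperateGrowth_norm_sq _)
    obtain ⟨A, B, h⟩ := exists_ker_mul_exp_symbol (ν := ν) hg
    have hi := integrable_rpow_neg_one_add_norm_sq (E := Space d) (μ := volume)
      (r := 2 * (d + 1 : ℕ)) (by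
        rw [finrank_euclideanSpace_fin]
        push_cast
        have : (0 : ℝ) ≤ d := by positivity
        linarith)
    refine (hi.const_mul A).mono' ?_ (.of_forall fun z => ?_)
    · have : Continuous (expSymbol α ν 1) := by
        unfold expSymbol
        have := continuous_symbol (ν := ν)
        fun_prop
      exact this.aestronglyMeasurable
    · have h2 := h.norm_le z
      have hp : (0 : ℝ) < 1 + ‖z‖ ^ 2 := by positivity
      rw [norm_mul, norm_pow, norm_real, norm_of_nonneg hp.le] at h2
      rw [show -(2 * ((d + 1 : ℕ) : ℝ)) / 2 = -((d + 1 : ℕ) : ℝ) by ring, rpow_neg hp.le,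
        rpow_natCast, ← div_eq_mul_inv, le_div_iff₀ (by positivity)]
      simpa [expSymbol, mul_comm] using h2
  have e : expSymbol α ν t = fun z => expSymbol α ν 1 (t ^ (1 / α) • z) := by
    ext z
    rw [expSymbol_smul (by positivity), one_mul, ← rpow_mul ht.le,
      one_div_mul_cancel hα0.ne', rpow_one]
  rw [e]
  exact h1.comp_smul (by positivity)

theorem density_ae (ht : 0 < t) {k : Space d → ℂ} (hk : Integrable k)
    (hkm : 𝓕 k = expSymbol α ν t) : density α ν t =ᵐ[volume] k := by
  have hE := integrable_expSymbol (ν := ν) ht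
  have hd : density α ν t = fun x => 𝓕 (expSymbol α ν t) (-x) := by
    ext x
    rw [density, Real.fourierInv_eq_fourier_neg]
    rfl
  have hc : Continuous (𝓕 (expSymbol α ν t)) :=
    VectorFourier.fourierIntegral_continuous Real.continuous_fourierChar
      (by exact continuous_inner) hE
  have hcd : Continuous (density α ν t) := by
    rw [hd]
    exact hc.comp continuous_neg
  refine ae_eq_of_integral_schwartz_eq hcd.locallyIntegrable hk.locallyIntegrable fun φ _ => ?_
  have h1 : ∫ x, φ x * density α ν t x = ∫ x, φ (-x) * 𝓕 (expSymbol α ν t) x := by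
    rw [← integral_neg_eq_self]
    simp only [hd, neg_neg]
  have hφ : Integrable fun x => φ (-x) := φ.integrable.comp_neg
  have h2 := integral_fourier_mul_eq_of_integrable hφ hE
  have h3 : ∀ ξ, 𝓕 (fun x => φ (-x)) ξ = (𝓕⁻ φ : 𝓢(Space d, ℂ)) ξ := by
    intro ξ
    rw [SchwartzMap.fourierInv_coe, Real.fourierInv_eq_fourier_comp_neg]
  have h4 := integral_fourier_mul_eq_of_integrable hk (𝓕⁻ φ : 𝓢(Space d, ℂ)).integrable
  have h5 : 𝓕 ((𝓕⁻ φ : 𝓢(Space d, ℂ)) : Space d → ℂ) = φ := by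
    rw [← fourier_coe, fourier_fourierInv_eq]
  rw [h1, ← h2]
  simp only [h3]
  rw [h5, hkm] at h4
  simp only [mul_comm (φ _), ← h4, mul_comm (expSymbol α ν t _)]

variable (χ α ν) in
/-- The semigroup on sequences of blocks. -/
def Pseq (s : ℝ) (f : BSeq d) (n : ℕ) : Bdd d := Op (χ.pt n * expSymbol α ν s) (f n)

theorem Pseq_zero (hf : Blk χ f) : Pseq χ α ν 0 f = f := by
  ext1 n
  rw [Pseq, expSymbol_zero, mul_one, hf.pt]

theorem Pseq_eq (hs : 0 < s) (hf : Blk χ f) :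
    Pseq χ α ν s f = fun n => Op (expSymbol α ν s) (f n) := by
  obtain ⟨A, B, h⟩ := exists_ker_expSymbol (ν := ν)
  ext1 n
  obtain ⟨_, _, hn⟩ := ker_pt χ n
  rw [Pseq, Op_mul hn (h s hs), hn.Op_comm (h s hs), hf.pt]

theorem Blk.Pseq (hs : 0 ≤ s) (hf : Blk χ f) : Blk χ (Pseq χ α ν s f) := by
  rcases hs.eq_or_lt with rfl | hs
  · rwa [Pseq_zero hf]
  · obtain ⟨A, B, h⟩ := exists_ker_expSymbol (ν := ν)
    rw [Pseq_eq hs hf]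
    exact hf.apply_Op (h s hs)

theorem exists_norm_Pseq_le (χ : DyadicPartition d) (T : ℝ) : ∃ C, 0 ≤ C ∧ ∀ s ∈ Icc 0 T, ∀ f n,
    ‖Pseq χ α ν s f n‖ ≤ C * ‖f n‖ := by
  obtain ⟨C, hC, h⟩ := exists_ker_pt_expSymbol (ν := ν) χ T
  refine ⟨C, hC, fun s hs f n => ?_⟩
  have := (h n s 0 hs ⟨le_rfl, by norm_num⟩ (Or.inr rfl)).norm_Op_le (f n)
  rw [Pseq]
  simpa [pw_zero_left] using this

theorem Rep.semigroup (hs : 0 ≤ s) (hu : Rep χ u f) (hf : PB γ C f) :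
    Rep χ (semigroup χ α ν s u) (Pseq χ α ν s f) := by
  rcases hs.eq_or_lt with rfl | hs
  · rw [Pseq_zero hu.blk, RoughKolmogorov.semigroup, if_pos rfl]
    exact hu
  obtain ⟨A, B, h⟩ := exists_ker_expSymbol (ν := ν)
  have hb := (hu.blk.Pseq (ν := ν) hs.le)
  have hPB : PB γ (A * C) (Pseq χ α ν s f) := fun n => by
    rw [Pseq_eq hs hu.blk]
    refine ((h s hs).norm_Op_le (f n)).trans ?_
    rw [mul_assoc]
    exact mul_le_mul_of_nonneg_left (hf n) (h s hs).nonneg_left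
  obtain ⟨w, h1, h2⟩ := hb.exists_hasSum hPB
  have : RoughKolmogorov.semigroup χ α ν s u = w := by
    rw [RoughKolmogorov.semigroup, if_neg hs.ne']
    refine ofPairing_eq fun φ => ?_
    rw [← (h1 φ).tsum_eq]
    congr 1
    ext n
    rw [tf_apply, Pseq_eq hs hu.blk]
    congr 1
    ext x
    congr 1
    obtain ⟨k, hk, _, hkm, _, _⟩ := h s hs
    rw [Op_eq hk hkm, convCLM_apply]
    refine integral_congr_ae ?_
    have h3 : (fun y => blockFun χ n u (x - y)) =ᵐ[volume] fun y => f n (x - y) :=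
      (quasiMeasurePreserving_sub_left volume x).ae_eq_comp (hu.blockFun_ae n)
    filter_upwards [h3, density_ae hs hk hkm] with y h4 h5
    rw [h4, h5]
  rw [this]
  exact h2

theorem exists_norm_Pseq_sub_le (χ : DyadicPartition d) : ∃ C, 0 ≤ C ∧ ∀ s ≥ 0, ∀ f : BSeq d, ∀ n,
    Op (χ.pt n) (f n) = f n → ‖Pseq χ α ν s f n - f n‖ ≤ C * min 1 (s * pw α n) * ‖f n‖ := by
  obtain ⟨C, hC, h⟩ := exists_ker_pt_expSymbol_sub_one (ν := ν) χ
  refine ⟨C, hC, fun s hs f n hfn => ?_⟩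
  obtain ⟨B, hB⟩ := h n s hs
  obtain ⟨A', B', hn⟩ := ker_pt χ n
  have e : Pseq χ α ν s f n - f n = Op (χ.pt n * (expSymbol α ν s - 1)) (f n) := by
    have e2 : χ.pt n * expSymbol α ν s = χ.pt n * (expSymbol α ν s - 1) + χ.pt n := by ring
    rw [Pseq, e2, hB.Op_add hn, hfn, add_sub_cancel_right]
  rw [e]
  exact hB.norm_Op_le _

theorem Pseq_add (hs : 0 ≤ s) (ht : 0 ≤ t) (hf : Blk χ f) :
    Pseq χ α ν (s + t) f = Pseq χ α ν s (Pseq χ α ν t f) := by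
  have hb := hf.Pseq (ν := ν) ht
  rcases hs.eq_or_lt with rfl | hs
  · rw [zero_add, Pseq_zero hb]
  rcases ht.eq_or_lt with rfl | ht
  · rw [add_zero, Pseq_zero hf]
  obtain ⟨A, B, h⟩ := exists_ker_expSymbol (ν := ν)
  rw [Pseq_eq (by positivity) hf, Pseq_eq hs hb, Pseq_eq ht hf]
  ext1 n
  rw [expSymbol_add, Op_mul (h s hs) (h t ht)]

theorem exists_norm_Pseq_sub_Pseq_le (χ : DyadicPartition d) (T : ℝ) :
    ∃ C, 0 ≤ C ∧ ∀ s ∈ Icc 0 T, ∀ r ∈ Icc 0 T, ∀ f : BSeq d, Blk χ f → ∀ n, ‖Pseq χ α ν s f n -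
      Pseq χ α ν r f n‖ ≤ C * min 1 (|s - r| * pw α n) * ‖f n‖ := by
  obtain ⟨C, hC, h⟩ := exists_norm_Pseq_sub_le (ν := ν) χ
  obtain ⟨C', hC', h'⟩ := exists_norm_Pseq_le (ν := ν) χ T
  have key : ∀ s ∈ Icc 0 T, ∀ r ∈ Icc 0 T, s ≤ r → ∀ f : BSeq d, Blk χ f → ∀ n,
      ‖Pseq χ α ν s f n - Pseq χ α ν r f n‖ ≤ C * C' * min 1 (|s - r| * pw α n) * ‖f n‖ := by
    intro s hs r hr hsr f hf n
    have hb := hf.Pseq (ν := ν) hs.1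
    have e : Pseq χ α ν r f = Pseq χ α ν (r - s) (Pseq χ α ν s f) := by
      rw [← Pseq_add (sub_nonneg.2 hsr) hs.1 hf, sub_add_cancel]
    rw [e, norm_sub_rev, abs_sub_comm, abs_of_nonneg (sub_nonneg.2 hsr)]
    refine (h _ (sub_nonneg.2 hsr) _ n (hb.pt n)).trans ?_
    have : 0 ≤ min 1 ((r - s) * pw α n) :=
      le_min zero_le_one (mul_nonneg (sub_nonneg.2 hsr) (pw_nonneg _ _))
    calc _ ≤ C * min 1 ((r - s) * pw α n) * (C' * ‖f n‖) := by
          gcongr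
          exact h' s hs f n
      _ = _ := by ring
  refine ⟨C * C', by positivity, fun s hs r hr f hf n => ?_⟩
  rcases le_total s r with hsr | hsr
  · exact key s hs r hr hsr f hf n
  · rw [norm_sub_rev, abs_sub_comm]
    exact key r hr s hs hsr f hf n

/-! ### Paths -/

variable (χ) in
/-- A path of sequences of blocks, continuous on each block and bounded with regularity `γ`. -/
structure CP (T γ : ℝ) (f : BPath d) : Prop where
  blk : ∀ t ∈ Icc 0 T, Blk χ (f t)
  cont : ∀ n, ContinuousOn (fun t => f t n) (Icc 0 T)
  bdd : ∃ C, ∀ t ∈ Icc 0 T, PB γ C (f t)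

variable (χ α ν) in
/-- The operator `J^T` on paths of sequences of blocks. -/
def Jseq (T : ℝ) (v : BPath d) (t : ℝ) (n : ℕ) : Bdd d := ∫ r in t..T, Pseq χ α ν (r - t) (v r) n

theorem CP.continuousOn_Pseq (hv : CP χ T γ v) (ht : t ∈ Icc 0 T) (n : ℕ) :
    ContinuousOn (fun r => Pseq χ α ν (r - t) (v r) n) (Icc t T) := by
  obtain ⟨C, hC, h⟩ := exists_norm_Pseq_sub_Pseq_le (ν := ν) χ T
  obtain ⟨C', hC', h'⟩ := exists_norm_Pseq_le (ν := ν) χ T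
  have sub : Icc t T ⊆ Icc 0 T := Icc_subset_Icc_left ht.1
  intro r hr
  have hc := (hv.cont n r (sub hr)).mono sub
  rw [ContinuousWithinAt, tendsto_iff_norm_sub_tendsto_zero]
  have h1 : Tendsto (fun x => C' * ‖v x n - v r n‖ + C * (|x - r| * pw α n) * ‖v r n‖) (𝓝[Icc t T] r)
      (𝓝 0) := by
    have a1 := (tendsto_iff_norm_sub_tendsto_zero.1 hc).const_mul C'
    have a2 : Tendsto (fun x => C * (|x - r| * pw α n) * ‖v r n‖) (𝓝[Icc t T] r) (𝓝 0) := by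
      have : Continuous fun x => C * (|x - r| * pw α n) * ‖v r n‖ := by fun_prop
      have := this.continuousWithinAt (s := Icc t T) (x := r)
      rw [ContinuousWithinAt] at this
      simpa using this
    simpa using a1.add a2
  refine squeeze_zero' (.of_forall fun _ => norm_nonneg _) ?_ h1
  filter_upwards [self_mem_nhdsWithin] with x hx
  have hx' : x - t ∈ Icc 0 T := ⟨by linarith [hx.1], by linarith [hx.2, ht.1]⟩
  have hr' : r - t ∈ Icc 0 T := ⟨by linarith [hr.1], by linarith [hr.2, ht.1]⟩
  have b1 : ‖Pseq χ α ν (x - t) (v x) n - Pseq χ α ν (x - t) (v r) n‖ ≤ C' * ‖v x n - v r n‖ := by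
    have := h' (x - t) hx' (v x - v r) n
    simpa only [Pseq, Pi.sub_apply, map_sub] using this
  have b2 := h (x - t) hx' (r - t) hr' (v r) (hv.blk r (sub hr)) n
  have b3 : min 1 (|x - t - (r - t)| * pw α n) ≤ |x - r| * pw α n := by
    rw [show x - t - (r - t) = x - r by ring]
    exact min_le_right _ _
  calc _ ≤ ‖Pseq χ α ν (x - t) (v x) n - Pseq χ α ν (x - t) (v r) n‖ +
        ‖Pseq χ α ν (x - t) (v r) n - Pseq χ α ν (r - t) (v r) n‖ := norm_sub_le_norm_sub_add_norm_sub _ _ _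
    _ ≤ _ := add_le_add b1 (b2.trans (by gcongr))

theorem CP.intervalIntegrable_Pseq (hv : CP χ T γ v) (ht : t ∈ Icc 0 T) (n : ℕ) :
    IntervalIntegrable (fun r => Pseq χ α ν (r - t) (v r) n) volume t T :=
  ContinuousOn.intervalIntegrable (by
    rw [uIcc_of_le ht.2]
    exact hv.continuousOn_Pseq ht n)

theorem CP.blk_Jseq (hv : CP χ T γ v) (ht : t ∈ Icc 0 T) : Blk χ (Jseq χ α ν T v t) :=
  Blk.integral ht.2 (fun r hr => (hv.blk r ⟨ht.1.trans hr.1, hr.2⟩).Pseq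
    (sub_nonneg.2 hr.1)) fun n => hv.intervalIntegrable_Pseq ht n

theorem Rep.J (hv : CP χ T γ v) (hw : ∀ t ∈ Icc 0 T, Rep χ (w t) (v t)) (ht : t ∈ Icc 0 T) :
    Rep χ (J χ α ν T w t) (Jseq χ α ν T v t) := by
  obtain ⟨C, hC⟩ := hv.bdd
  obtain ⟨C', hC', h'⟩ := exists_norm_Pseq_le (ν := ν) χ T
  have hm : ∀ r ∈ Icc t T, r ∈ Icc 0 T ∧ r - t ∈ Icc 0 T := fun r hr =>
    ⟨⟨ht.1.trans hr.1, hr.2⟩, by linarith [hr.1], by linarith [hr.2, ht.1]⟩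
  refine Rep.integral (C := C' * C) (γ := γ) ht.2 (fun r hr => ?_) (fun r hr n => ?_)
    fun n => hv.intervalIntegrable_Pseq ht n
  · exact (hw r (hm r hr).1).semigroup (hm r hr).2.1 (hC r (hm r hr).1)
  · refine (h' _ (hm r hr).2 _ n).trans ?_
    rw [mul_assoc]
    exact mul_le_mul_of_nonneg_left (hC r (hm r hr).1 n) hC'

end

section

variable {d : ℕ} {χ : DyadicPartition d}
variable {C C' C₁ C₁' C₂ C₂' C₃ γ γ₁ γ₂ γ₃ : ℝ} {f f' g g' k : BSeq d} {N : ℕ}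

/-! ### Bounds for sequences -/

theorem PB.mono {γ' : ℝ} (h : PB γ C f) (hγ : γ' ≤ γ) (hC : C ≤ C') : PB γ' C' f := fun n =>
  (h n).trans (mul_le_mul hC (pw_mono (neg_le_neg hγ) n) (pw_nonneg _ _) (h.nonneg.trans hC))

theorem PB.zero : PB γ 0 (0 : BSeq d) := fun n => by simp

theorem PB.add (hf : PB γ C f) (hg : PB γ C' g) : PB γ (C + C') (f + g) := fun n => by
  rw [add_mul]
  exact (norm_add_le _ _).trans (add_le_add (hf n) (hg n))

theorem PB.sub (hf : PB γ C f) (hg : PB γ C' g) : PB γ (C + C') (f - g) := fun n => by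
  rw [add_mul]
  exact (norm_sub_le _ _).trans (add_le_add (hf n) (hg n))

theorem PB.sum {ι : Type*} (s : Finset ι) {C : ι → ℝ} {f : ι → BSeq d}
    (h : ∀ i ∈ s, PB γ (C i) (f i)) : PB γ (∑ i ∈ s, C i) (∑ i ∈ s, f i) := fun n => by
  rw [Finset.sum_apply, sum_mul]
  exact (norm_sum_le _ _).trans (sum_le_sum fun i hi => h i hi n)

theorem exists_norm_Op_pc_le (χ : DyadicPartition d) : ∃ C, 0 ≤ C ∧ ∀ n f, ‖Op (χ.pc n) f‖ ≤ C * ‖f‖ := by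
  obtain ⟨C, hC, h⟩ := χ.exists_ker_pc
  exact ⟨C, hC, fun n f => (h n).norm_Op_le f⟩

theorem card_Icc_window (m N : ℕ) : (Finset.Icc (m - N) (m + N)).card ≤ 2 * N + 1 := by
  rw [Nat.card_Icc]
  omega

/-- The sum of a function over a window of indices. -/
theorem sum_window_le {m : ℕ} {M : ℝ} (hM : 0 ≤ M) {a : ℕ → ℝ} (ha : ∀ n, a n ≤ M * pw γ n) :
    ∑ n ∈ Finset.Icc (m - N) (m + N), a n ≤ (2 * N + 1) * pw |γ| N * M * pw γ m := by
  have h1 : ∀ n ∈ Finset.Icc (m - N) (m + N), a n ≤ M * (pw |γ| N * pw γ m) := by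
    intro n hn
    rw [Finset.mem_Icc] at hn
    exact (ha n).trans (mul_le_mul_of_nonneg_left (pw_le_of_near (by omega) (by omega)) hM)
  refine (sum_le_sum h1).trans ?_
  rw [sum_const, nsmul_eq_mul]
  have h2 : ((Finset.Icc (m - N) (m + N)).card : ℝ) ≤ 2 * N + 1 := by
    exact_mod_cast card_Icc_window m N
  have := pw_nonneg |γ| N
  have := pw_nonneg γ m
  calc _ ≤ (2 * N + 1 : ℝ) * (M * (pw |γ| N * pw γ m)) := by gcongr
    _ = _ := by ring

theorem exists_window_le (χ : DyadicPartition d) (N : ℕ) (γ : ℝ) :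
    ∃ K, 0 ≤ K ∧ ∀ (X : BSeq d) (M : ℝ), PB γ M X → PB γ (K * M) fun m => ∑ n ∈ Finset.Icc (m - N)
      (m + N), Op (χ.pc m) (X n) := by
  obtain ⟨C, hC, h⟩ := exists_norm_Op_pc_le χ
  refine ⟨(2 * N + 1) * pw |-γ| N * C, by have := pw_nonneg |-γ| N; positivity, fun X M hX m => ?_⟩
  refine (norm_sum_le _ _).trans ?_
  have hM := hX.nonneg
  refine (sum_window_le (M := C * M) (γ := -γ) (by positivity) fun n => ?_).trans (le_of_eq (by ring))
  refine (h m (X n)).trans ?_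
  rw [mul_assoc]
  exact mul_le_mul_of_nonneg_left (hX n) hC

/-! ### Paraproducts -/

theorem exists_paraSeq_le_of_neg (χ : DyadicPartition d) (h₁ : γ₁ < 0) (γ₂ : ℝ) :
    ∃ K, 0 ≤ K ∧ ∀ (f g : BSeq d) (C₁ C₂ : ℝ), PB γ₁ C₁ f → PB γ₂ C₂ g →
      PB (γ₁ + γ₂) (K * (C₁ * C₂)) (paraSeq χ f g) := by
  obtain ⟨K, hK, h⟩ := exists_window_le χ (paraN χ) (γ₁ + γ₂)
  obtain ⟨S, hS, hs⟩ := sum_range_pw_le (γ := -γ₁) (by linarith)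
  refine ⟨K * S, by positivity, fun f g C₁ C₂ hf hg => ?_⟩
  have hC₁ := hf.nonneg
  have hC₂ := hg.nonneg
  rw [mul_assoc]
  refine h (paraTerm f g) _ fun n => ?_
  refine (norm_mul_le _ _).trans ?_
  have h2 : ‖∑ m ∈ Finset.range (n - 1), f m‖ ≤ C₁ * (S * pw (-γ₁) n) := by
    refine (norm_sum_le _ _).trans ?_
    calc ∑ m ∈ Finset.range (n - 1), ‖f m‖ ≤ ∑ m ∈ Finset.range n, ‖f m‖ :=
          Finset.sum_le_sum_of_subset_of_nonneg (Finset.range_mono (by omega))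
            fun _ _ _ => norm_nonneg _
      _ ≤ ∑ m ∈ Finset.range n, C₁ * pw (-γ₁) m := sum_le_sum fun m _ => hf m
      _ ≤ _ := by
          rw [← mul_sum]
          gcongr
          exact hs n
  rw [neg_add, pw_add]
  have := pw_nonneg (-γ₁) n
  calc _ ≤ C₁ * (S * pw (-γ₁) n) * (C₂ * pw (-γ₂) n) :=
        mul_le_mul h2 (hg n) (norm_nonneg _) (by positivity)
    _ = _ := by ring

theorem exists_paraSeq_le_of_sum (χ : DyadicPartition d) (γ : ℝ) :
    ∃ K, 0 ≤ K ∧ ∀ (f g : BSeq d) (C₁ C₂ : ℝ), 0 ≤ C₁ → (∀ n, ‖∑ m ∈ Finset.range n, f m‖ ≤ C₁) →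
      PB γ C₂ g → PB γ (K * (C₁ * C₂)) (paraSeq χ f g) := by
  obtain ⟨K, hK, h⟩ := exists_window_le χ (paraN χ) γ
  refine ⟨K, hK, fun f g C₁ C₂ hC₁ hf hg => h (paraTerm f g) _ fun n => ?_⟩
  refine (norm_mul_le _ _).trans ?_
  rw [mul_assoc]
  exact mul_le_mul (hf _) (hg n) (norm_nonneg _) hC₁

theorem exists_sum_range_le (hγ : 0 < γ) : ∃ S, 0 ≤ S ∧ ∀ (f : BSeq d) (C : ℝ), PB γ C f →
    ∀ n, ∑ m ∈ Finset.range n, ‖f m‖ ≤ S * C := by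
  obtain ⟨S, hS, hs⟩ := sum_range_pw_neg_le (γ := -γ) (by linarith)
  refine ⟨S, hS, fun f C hf n => ?_⟩
  have hC := hf.nonneg
  calc _ ≤ ∑ m ∈ Finset.range n, C * pw (-γ) m := sum_le_sum fun m _ => hf m
    _ ≤ C * S := by
        rw [← mul_sum]
        gcongr
        exact hs n
    _ = _ := mul_comm _ _

theorem exists_paraSeq_le_of_pos (χ : DyadicPartition d) (h₁ : 0 < γ₁) (γ₂ : ℝ) :
    ∃ K, 0 ≤ K ∧ ∀ (f g : BSeq d) (C₁ C₂ : ℝ), PB γ₁ C₁ f → PB γ₂ C₂ g →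
      PB γ₂ (K * (C₁ * C₂)) (paraSeq χ f g) := by
  obtain ⟨K, hK, h⟩ := exists_paraSeq_le_of_sum χ γ₂
  obtain ⟨S, hS, hs⟩ := exists_sum_range_le (d := d) h₁
  refine ⟨K * S, by positivity, fun f g C₁ C₂ hf hg => ?_⟩
  have hC₁ := hf.nonneg
  have := h f g (S * C₁) C₂ (by positivity) (fun n => (norm_sum_le _ _).trans (hs f C₁ hf n)) hg
  rwa [mul_assoc, ← mul_assoc S]

theorem paraSeq_sub_left (f f' g : BSeq d) :
    paraSeq χ (f - f') g = paraSeq χ f g - paraSeq χ f' g := by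
  ext1 m
  simp only [paraSeq, paraTerm, Pi.sub_apply, sum_sub_distrib, sub_mul, map_sub]

theorem paraSeq_sub_right (f g g' : BSeq d) :
    paraSeq χ f (g - g') = paraSeq χ f g - paraSeq χ f g' := by
  ext1 m
  simp only [paraSeq, paraTerm, Pi.sub_apply, sum_sub_distrib, mul_sub, map_sub]

theorem paraSeq_sub_sub (f f' g g' : BSeq d) :
    paraSeq χ f g - paraSeq χ f' g' = paraSeq χ (f - f') g + paraSeq χ f' (g - g') := by
  rw [paraSeq_sub_left, paraSeq_sub_right, sub_add_sub_cancel]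

/-! ### Derivatives -/

theorem exists_derSeq_le (χ : DyadicPartition d) : ∃ K, 0 ≤ K ∧ ∀ (j : Fin d) (f : BSeq d) (n : ℕ),
    ‖derSeq χ j f n‖ ≤ K * pw 1 n * ‖f n‖ := by
  obtain ⟨C, hC, h⟩ := exists_ker_dmul χ
  exact ⟨C, hC, fun j f n => (h j n).norm_Op_le _⟩

theorem exists_PB_derSeq (χ : DyadicPartition d) : ∃ K, 0 ≤ K ∧ ∀ (j : Fin d) (f : BSeq d)
    (γ C : ℝ), PB γ C f → PB (γ - 1) (K * C) (derSeq χ j f) := by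
  obtain ⟨K, hK, h⟩ := exists_derSeq_le χ
  refine ⟨K, hK, fun j f γ C hf n => (h j f n).trans ?_⟩
  rw [show -(γ - 1) = 1 + -γ by ring, pw_add]
  have := pw_nonneg 1 n
  calc _ ≤ K * pw 1 n * (C * pw (-γ) n) := by gcongr; exact hf n
    _ = _ := by ring

theorem derSeq_sub (j : Fin d) (f g : BSeq d) : derSeq χ j (f - g) = derSeq χ j f - derSeq χ j g := by
  ext1 n
  simp only [derSeq, Pi.sub_apply, map_sub]

/-! ### The resonant product -/

theorem exists_resoTerm_le (γ₁ γ₂ : ℝ) : ∃ K, 0 ≤ K ∧ ∀ (f g : BSeq d) (C₁ C₂ : ℝ), PB γ₁ C₁ f →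
    PB γ₂ C₂ g → PB (γ₁ + γ₂) (K * (C₁ * C₂)) (resoTerm f g) := by
  refine ⟨(2 * (1 : ℕ) + 1) * pw |-γ₁| 1, by have := pw_nonneg |-γ₁| 1; positivity,
    fun f g C₁ C₂ hf hg n => ?_⟩
  have hC₁ := hf.nonneg
  refine (norm_mul_le _ _).trans ?_
  have h1 := (norm_sum_le _ _).trans (sum_window_le (N := 1) (m := n) hC₁ hf)
  rw [neg_add, pw_add]
  have h2 := pw_nonneg (-γ₁) n
  have h3 := pw_nonneg |-γ₁| 1
  calc _ ≤ ((2 * (1 : ℕ) + 1) * pw |-γ₁| 1 * C₁ * pw (-γ₁) n) * (C₂ * pw (-γ₂) n) :=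
        mul_le_mul h1 (hg n) (norm_nonneg _) (by positivity)
    _ = _ := by ring

theorem PB.summable (h : PB γ C f) (hγ : 0 < γ) : Summable f :=
  Summable.of_norm_bounded ((summable_pw (γ := -γ) (by linarith)).mul_left C) h

theorem PB.norm_tsum_le (h : PB γ C f) (hγ : 0 < γ) : ‖∑' n, f n‖ ≤ C * ∑' n, pw (-γ) n := by
  rw [← tsum_mul_left]
  exact tsum_of_norm_bounded ((summable_pw (γ := -γ) (by linarith)).mul_left C).hasSum h

theorem summable_resoTerm (h : 0 < γ₁ + γ₂) (hf : PB γ₁ C₁ f) (hg : PB γ₂ C₂ g) :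
    Summable (resoTerm f g) := by
  obtain ⟨K, _, hK⟩ := exists_resoTerm_le (d := d) γ₁ γ₂
  exact (hK f g C₁ C₂ hf hg).summable h

theorem exists_resoB_le (h : 0 < γ₁ + γ₂) : ∃ K, 0 ≤ K ∧ ∀ (f g : BSeq d) (C₁ C₂ : ℝ), PB γ₁ C₁ f →
    PB γ₂ C₂ g → ‖resoB f g‖ ≤ K * (C₁ * C₂) := by
  obtain ⟨K, hK0, hK⟩ := exists_resoTerm_le (d := d) γ₁ γ₂
  have hS : 0 ≤ ∑' n, pw (-(γ₁ + γ₂)) n := tsum_nonneg fun n => pw_nonneg _ n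
  refine ⟨K * ∑' n, pw (-(γ₁ + γ₂)) n, by positivity, fun f g C₁ C₂ hf hg => ?_⟩
  refine ((hK f g C₁ C₂ hf hg).norm_tsum_le h).trans (le_of_eq (by ring))

theorem resoTerm_sub_left (f f' g : BSeq d) : resoTerm (f - f') g = resoTerm f g - resoTerm f' g := by
  ext1 n
  simp only [resoTerm, Pi.sub_apply, sum_sub_distrib, sub_mul]

theorem resoTerm_sub_right (f g g' : BSeq d) :
    resoTerm f (g - g') = resoTerm f g - resoTerm f g' := by
  ext1 n
  simp only [resoTerm, Pi.sub_apply, mul_sub]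

theorem resoB_sub_sub (h : 0 < γ₁ + γ₂) (hf : PB γ₁ C₁ f) (hf' : PB γ₁ C₁' f') (hg : PB γ₂ C₂ g)
    (hg' : PB γ₂ C₂' g') : resoB f g - resoB f' g' = resoB (f - f') g + resoB f' (g - g') := by
  have e1 : resoB (f - f') g = resoB f g - resoB f' g := by
    rw [resoB, resoTerm_sub_left]
    exact (summable_resoTerm h hf hg).tsum_sub (summable_resoTerm h hf' hg)
  have e2 : resoB f' (g - g') = resoB f' g - resoB f' g' := by
    rw [resoB, resoTerm_sub_right]
    exact (summable_resoTerm h hf' hg).tsum_sub (summable_resoTerm h hf' hg')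
  rw [e1, e2, sub_add_sub_cancel]

/-! ### The commutator of the paraproduct and the resonant product -/

theorem Win.mono {N' n : ℕ} {X : Bdd d} (h : Win χ N n X) (hN : N ≤ N') : Win χ N' n X :=
  fun m hm => h m (by omega)

theorem Blk.sum_Op (h : Blk χ f) (hN : 1 ≤ N) (m : ℕ) :
    ∑ n ∈ Finset.Icc (m - N) (m + N), Op (χ.pc m) (f n) = f m := by
  simp only [h.comm m]
  exact ((h.win m).mono hN).sum_Op

theorem exists_lip_blk (χ : DyadicPartition d) : ∃ L, 0 ≤ L ∧ ∀ f : BSeq d, Blk χ f →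
    ∀ n x y, ‖f n x - f n y‖ ≤ L * pw 1 n * ‖f n‖ * ‖x - y‖ := by
  obtain ⟨L, hL, h⟩ := χ.exists_lipMul_pc
  refine ⟨(2 * (1 : ℕ) + 1) * pw |1| 1 * L, by have := pw_nonneg |1| 1; positivity,
    fun f hf n x y => ?_⟩
  have e : ∀ z, f n z = ∑ i ∈ Finset.Icc (n - 1) (n + 1), Op (χ.pc i) (f n) z := by
    intro z
    conv_lhs => rw [← hf.pt n, Op_pt_eq_sum, coe_sum, Finset.sum_apply]
  rw [e x, e y, ← sum_sub_distrib]
  refine (norm_sum_le _ _).trans ?_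
  refine (sum_window_le (N := 1) (m := n) (γ := 1) (M := L * ‖f n‖ * ‖x - y‖) (by positivity)
    fun i => ?_).trans (le_of_eq (by ring))
  refine (h i (f n) x y).trans (le_of_eq ?_)
  rw [pw_one]
  ring

/-- The partial sums of a sequence of positive regularity less than one are Lipschitz. -/
theorem exists_lip_sum_range (χ : DyadicPartition d) (hγ : γ < 1) :
    ∃ L, 0 ≤ L ∧ ∀ (f : BSeq d) (C : ℝ), Blk χ f → PB γ C f →
      ∀ n x y, ‖(∑ m ∈ Finset.range (n - 1), f m) x - (∑ m ∈ Finset.range (n - 1), f m) y‖ ≤ L * C *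
      pw (1 - γ) n * ‖x - y‖ := by
  obtain ⟨L, hL, h⟩ := exists_lip_blk χ
  obtain ⟨S, hS, hs⟩ := sum_range_pw_le (γ := 1 - γ) (by linarith)
  refine ⟨L * S, by positivity, fun f C hf hC n x y => ?_⟩
  have hC0 := hC.nonneg
  rw [coe_sum, Finset.sum_apply, Finset.sum_apply, ← sum_sub_distrib]
  refine (norm_sum_le _ _).trans ?_
  calc ∑ m ∈ Finset.range (n - 1), ‖f m x - f m y‖ ≤ ∑ m ∈ Finset.range n, ‖f m x - f m y‖ :=
        Finset.sum_le_sum_of_subset_of_nonneg (Finset.range_mono (by omega))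
          fun _ _ _ => norm_nonneg _
    _ ≤ ∑ m ∈ Finset.range n, L * C * ‖x - y‖ * pw (1 - γ) m := by
        refine sum_le_sum fun m _ => (h f hf m x y).trans ?_
        rw [sub_eq_add_neg 1 γ, pw_add]
        have := pw_nonneg 1 m
        calc _ ≤ L * pw 1 m * (C * pw (-γ) m) * ‖x - y‖ := by gcongr; exact hC m
          _ = _ := by ring
    _ ≤ L * C * ‖x - y‖ * (S * pw (1 - γ) n) := by
        rw [← mul_sum]
        gcongr
        exact hs n
    _ = _ := by ring

theorem exists_tail_le (hγ : 0 < γ) : ∃ S, 0 ≤ S ∧ ∀ (f : BSeq d) (C : ℝ), PB γ C f → ∀ n, ‖∑' m,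
    f m - ∑ m ∈ Finset.range (n - 1), f m‖ ≤ S * C * pw (-γ) n := by
  have hS : 0 ≤ ∑' n, pw (-γ) n := tsum_nonneg fun n => pw_nonneg _ n
  refine ⟨pw |-γ| 1 * ∑' n, pw (-γ) n, by have := pw_nonneg |-γ| 1; positivity, fun f C hf n => ?_⟩
  have hC := hf.nonneg
  rw [← (hf.summable hγ).sum_add_tsum_nat_add (n - 1), add_sub_cancel_left]
  have h1 : PB γ (C * pw (-γ) (n - 1)) fun m => f (m + (n - 1)) := fun m => by
    refine (hf _).trans (le_of_eq ?_)
    rw [pw_index_add]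
    ring
  refine (h1.norm_tsum_le hγ).trans ?_
  have h2 : pw (-γ) (n - 1) ≤ pw |-γ| 1 * pw (-γ) n := pw_le_of_near (by omega) (by omega)
  calc _ ≤ C * (pw |-γ| 1 * pw (-γ) n) * ∑' n, pw (-γ) n := by gcongr
    _ = _ := by ring

theorem exists_paraSeq_sub_mul_le (χ : DyadicPartition d) (h₁ : γ₁ ∈ Ioo (0 : ℝ) 1) (γ₂ : ℝ) :
    ∃ K, 0 ≤ K ∧ ∀ (f g : BSeq d) (C₁ C₂ : ℝ), Blk χ f → Blk χ g → PB γ₁ C₁ f → PB γ₂ C₂ g →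
      PB (γ₁ + γ₂) (K * (C₁ * C₂)) fun m => paraSeq χ f g m - (∑' n, f n) * g m := by
  obtain ⟨C, hC, hk⟩ := χ.exists_ker_pc
  obtain ⟨L, hL, hl⟩ := exists_lip_sum_range χ h₁.2
  obtain ⟨S, hS, hs⟩ := exists_tail_le (d := d) h₁.1
  set N := paraN χ
  set P := pw |1 - γ₁ - γ₂| N with hP
  set P' := pw |-γ₁ - γ₂| N with hP'
  have hP0 : 0 ≤ P := pw_nonneg _ _
  have hP0' : 0 ≤ P' := pw_nonneg _ _
  refine ⟨(2 * N + 1) * (P * C * L + P' * C * S), by positivity, fun f g C₁ C₂ hf hg hC₁ hC₂ m => ?_⟩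
  have p1 := hC₁.nonneg
  have p2 := hC₂.nonneg
  have e : paraSeq χ f g m - (∑' n, f n) * g m =
      ∑ n ∈ Finset.Icc (m - N) (m + N), ((Op (χ.pc m) (paraTerm f g n) -
        (∑ m ∈ Finset.range (n - 1), f m) * Op (χ.pc m) (g n)) -
        (∑' n, f n - ∑ m ∈ Finset.range (n - 1), f m) * Op (χ.pc m) (g n)) := by
    conv_lhs => rw [← hg.sum_Op (one_le_paraN χ) m, mul_sum, paraSeq, ← sum_sub_distrib]
    refine sum_congr rfl fun n _ => ?_
    ring
  have key1 : ∀ n, ‖Op (χ.pc m) (paraTerm f g n) -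
      (∑ m ∈ Finset.range (n - 1), f m) * Op (χ.pc m) (g n)‖ ≤
      (C * pw (-1) m * L * C₁ * C₂) * pw (1 - γ₁ - γ₂) n := by
    intro n
    have q := pw_nonneg (1 - γ₁) n
    have := (hk m).norm_Op_mul_sub_le (F := ∑ m ∈ Finset.range (n - 1), f m) (G := g n)
      (L := L * C₁ * pw (1 - γ₁) n) (by positivity) (hl f C₁ hf hC₁ n)
    refine this.trans ?_
    have e2 : ((2 : ℝ) ^ m)⁻¹ = pw (-1) m := by rw [pw_neg, pw_one]
    rw [e2, sub_eq_add_neg (1 - γ₁), pw_add]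
    have q2 := pw_nonneg (-1) m
    calc _ ≤ C * pw (-1) m * (L * C₁ * pw (1 - γ₁) n) * (C₂ * pw (-γ₂) n) := by
          gcongr
          exact hC₂ n
      _ = _ := by ring
  have key2 : ∀ n, ‖(∑' n, f n - ∑ m ∈ Finset.range (n - 1), f m) * Op (χ.pc m) (g n)‖ ≤
      (C * S * C₁ * C₂) * pw (-γ₁ - γ₂) n := by
    intro n
    refine (norm_mul_le _ _).trans ?_
    have q := pw_nonneg (-γ₁) n
    have : ‖Op (χ.pc m) (g n)‖ ≤ C * (C₂ * pw (-γ₂) n) :=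
      ((hk m).norm_Op_le _).trans (mul_le_mul_of_nonneg_left (hC₂ n) hC)
    rw [sub_eq_add_neg (-γ₁), pw_add]
    calc _ ≤ (S * C₁ * pw (-γ₁) n) * (C * (C₂ * pw (-γ₂) n)) :=
          mul_le_mul (hs f C₁ hC₁ n) this (norm_nonneg _) (by positivity)
      _ = _ := by ring
  have q2 := pw_nonneg (-1) m
  have s1 := sum_window_le (N := N) (m := m) (by positivity) key1
  have s2 := sum_window_le (N := N) (m := m) (by positivity) key2
  have e3 : pw (-1) m * pw (1 - γ₁ - γ₂) m = pw (-(γ₁ + γ₂)) m := by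
    rw [← pw_add]
    ring_nf
  have e4 : pw (-γ₁ - γ₂) m = pw (-(γ₁ + γ₂)) m := by ring_nf
  dsimp only
  rw [e]
  refine (norm_sum_le _ _).trans ?_
  refine (sum_le_sum fun n _ => norm_sub_le _ _).trans ?_
  rw [Finset.sum_add_distrib]
  refine (add_le_add s1 s2).trans (le_of_eq ?_)
  rw [e4, ← hP, ← hP', ← e3]
  ring

theorem exists_commTerm_le (χ : DyadicPartition d) (h₁ : γ₁ ∈ Ioo (0 : ℝ) 1) (γ₂ γ₃ : ℝ) :
    ∃ K, 0 ≤ K ∧ ∀ (f g h : BSeq d) (C₁ C₂ C₃ : ℝ), Blk χ f → Blk χ g → PB γ₁ C₁ f → PB γ₂ C₂ g →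
      PB γ₃ C₃ h → PB (γ₁ + γ₂ + γ₃) (K * (C₁ * C₂ * C₃)) (commTerm χ (∑' n, f n) f g h) := by
  obtain ⟨K, hK, hk⟩ := exists_paraSeq_sub_mul_le χ h₁ γ₂
  obtain ⟨K', hK', hk'⟩ := exists_resoTerm_le (d := d) (γ₁ + γ₂) γ₃
  refine ⟨K' * K, by positivity, fun f g h C₁ C₂ C₃ hf hg c₁ c₂ c₃ => ?_⟩
  have := hk' _ h _ _ (hk f g C₁ C₂ hf hg c₁ c₂) c₃
  rwa [show K' * (K * (C₁ * C₂) * C₃) = K' * K * (C₁ * C₂ * C₃) by ring] at this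

theorem exists_commB_le (χ : DyadicPartition d) (h₁ : γ₁ ∈ Ioo (0 : ℝ) 1) (h : 0 < γ₁ + γ₂ + γ₃) :
    ∃ K, 0 ≤ K ∧ ∀ (f g h : BSeq d) (C₁ C₂ C₃ : ℝ), Blk χ f → Blk χ g → PB γ₁ C₁ f → PB γ₂ C₂ g →
      PB γ₃ C₃ h → ‖commB χ (∑' n, f n) f g h‖ ≤ K * (C₁ * C₂ * C₃) := by
  obtain ⟨K, hK, hk⟩ := exists_commTerm_le χ h₁ γ₂ γ₃
  have hS : 0 ≤ ∑' n, pw (-(γ₁ + γ₂ + γ₃)) n := tsum_nonneg fun n => pw_nonneg _ n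
  refine ⟨K * ∑' n, pw (-(γ₁ + γ₂ + γ₃)) n, by positivity, fun f g h' C₁ C₂ C₃ hf hg c₁ c₂ c₃ => ?_⟩
  exact ((hk f g h' C₁ C₂ C₃ hf hg c₁ c₂ c₃).norm_tsum_le h).trans (le_of_eq (by ring))

theorem summable_commTerm (χ : DyadicPartition d) (h₁ : γ₁ ∈ Ioo (0 : ℝ) 1) (h : 0 < γ₁ + γ₂ + γ₃)
    (hf : Blk χ f) (hg : Blk χ g) (c₁ : PB γ₁ C₁ f) (c₂ : PB γ₂ C₂ g) (c₃ : PB γ₃ C₃ k) :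
    Summable (commTerm χ (∑' n, f n) f g k) := by
  obtain ⟨K, _, hk⟩ := exists_commTerm_le χ h₁ γ₂ γ₃
  exact (hk f g k C₁ C₂ C₃ hf hg c₁ c₂ c₃).summable h

theorem commTerm_sub (F F' : Bdd d) (f f' g g' k k' : BSeq d) :
    commTerm χ F f g k - commTerm χ F' f' g' k' = commTerm χ (F - F') (f - f') g k +
      commTerm χ F' f' (g - g') k + commTerm χ F' f' g' (k - k') := by
  ext1 n
  simp only [commTerm, Pi.sub_apply, Pi.add_apply, paraSeq_sub_left, paraSeq_sub_right,
    sum_sub_distrib, mul_sub, sub_mul]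
  ring

theorem Blk.neg (hf : Blk χ f) : Blk χ (-f) := by simpa using hf.smul (-1)

theorem Blk.sub (hf : Blk χ f) (hg : Blk χ g) : Blk χ (f - g) := by
  rw [sub_eq_add_neg]
  exact hf.add hg.neg

theorem commB_sub_sub {C₃' : ℝ} (h₁ : γ₁ ∈ Ioo (0 : ℝ) 1) (h : 0 < γ₁ + γ₂ + γ₃) {k' : BSeq d}
    (hf : Blk χ f) (hg : Blk χ g) (hf' : Blk χ f') (hg' : Blk χ g') (c₁ : PB γ₁ C₁ f)
    (c₂ : PB γ₂ C₂ g) (c₃ : PB γ₃ C₃ k) (c₁' : PB γ₁ C₁' f') (c₂' : PB γ₂ C₂' g')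
    (c₃' : PB γ₃ C₃' k') :
    commB χ (∑' n, f n) f g k - commB χ (∑' n, f' n) f' g' k' = commB χ (∑' n, (f - f') n)
      (f - f') g k + commB χ (∑' n, f' n) f' (g - g') k + commB χ (∑' n, f' n) f' g' (k - k') := by
  have s1 := summable_commTerm χ h₁ h (hf.sub hf') hg (c₁.sub c₁') c₂ c₃
  have s2 := summable_commTerm χ h₁ h hf' (hg.sub hg') c₁' (c₂.sub c₂') c₃
  have s3 := summable_commTerm χ h₁ h hf' hg' c₁' c₂' (c₃.sub c₃')
  have e : ∑' n, (f - f') n = ∑' n, f n - ∑' n, f' n :=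
    (c₁.summable h₁.1).tsum_sub (c₁'.summable h₁.1)
  have e2 := commTerm_sub (χ := χ) (∑' n, f n) (∑' n, f' n) f f' g g' k k'
  simp only [commB]
  rw [← (summable_commTerm χ h₁ h hf hg c₁ c₂ c₃).tsum_sub
    (summable_commTerm χ h₁ h hf' hg' c₁' c₂' c₃'), ← s1.tsum_add s2, ← (s1.add s2).tsum_add s3]
  congr 1
  ext1 n
  have := congrFun e2 n
  rw [← e] at this
  exact this

end

section

variable {d : ℕ} {χ : DyadicPartition d}
variable {M M' l r t x y γ' μ ρ : ℝ} {v : BPath d}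

/-! ### Operations on paths -/

section Paths

variable {T γ γ₁ γ₂ γ₃ : ℝ} {f g h : BPath d}

theorem CP.mono (hf : CP χ T γ f) (hγ : γ' ≤ γ) : CP χ T γ' f where
  blk := hf.blk
  cont := hf.cont
  bdd := let ⟨C, hC⟩ := hf.bdd; ⟨C, fun t ht => (hC t ht).mono hγ le_rfl⟩

theorem CP.zero : CP χ T γ (0 : BPath d) where
  blk _ _ := Blk.zero
  cont _ := continuousOn_const
  bdd := ⟨0, fun _ _ => PB.zero⟩

theorem CP.add (hf : CP χ T γ f) (hg : CP χ T γ g) : CP χ T γ (f + g) where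
  blk t ht := (hf.blk t ht).add (hg.blk t ht)
  cont n := (hf.cont n).add (hg.cont n)
  bdd := let ⟨C, hC⟩ := hf.bdd; let ⟨C', hC'⟩ := hg.bdd
    ⟨C + C', fun t ht => (hC t ht).add (hC' t ht)⟩

theorem CP.sub (hf : CP χ T γ f) (hg : CP χ T γ g) : CP χ T γ (f - g) where
  blk t ht := (hf.blk t ht).sub (hg.blk t ht)
  cont n := (hf.cont n).sub (hg.cont n)
  bdd := let ⟨C, hC⟩ := hf.bdd; let ⟨C', hC'⟩ := hg.bdd
    ⟨C + C', fun t ht => (hC t ht).sub (hC' t ht)⟩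

theorem CP.sum {ι : Type*} (s : Finset ι) {F : ι → BPath d} (h : ∀ i ∈ s, CP χ T γ (F i)) :
    CP χ T γ (∑ i ∈ s, F i) := by
  classical
  induction s using Finset.induction_on with
  | empty => simpa using CP.zero
  | insert i s hi ih =>
    rw [sum_insert hi]
    exact (h i (by simp)).add (ih fun j hj => h j (by simp [hj]))

theorem CP.congr (hf : CP χ T γ f) (hfg : ∀ t ∈ Icc 0 T, g t = f t) : CP χ T γ g where
  blk t ht := by rw [hfg t ht]; exact hf.blk t ht
  cont n := (hf.cont n).congr fun t ht => by rw [hfg t ht]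
  bdd := let ⟨C, hC⟩ := hf.bdd; ⟨C, fun t ht => by rw [hfg t ht]; exact hC t ht⟩

theorem Blk.para {f g : BSeq d} (hf : Blk χ f) (hg : Blk χ g) {C₁ C₂ : ℝ} (h₁ : PB γ₁ C₁ f)
    (h₂ : PB γ₂ C₂ g) : Blk χ (paraSeq χ f g) := by
  obtain ⟨u, hu⟩ := hf.exists_rep h₁
  obtain ⟨v, hv⟩ := hg.exists_rep h₂
  exact (hu.para hv h₁ h₂).blk

theorem continuousOn_paraSeq {s : Set ℝ} (hf : ∀ n, ContinuousOn (fun t => f t n) s)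
    (hg : ∀ n, ContinuousOn (fun t => g t n) s) (m : ℕ) :
    ContinuousOn (fun t => paraSeq χ (f t) (g t) m) s := by
  unfold paraSeq paraTerm
  refine continuousOn_finsetSum _ fun n _ => ?_
  exact (Op (χ.pc m)).continuous.comp_continuousOn
    ((continuousOn_finsetSum _ fun i _ => hf i).mul (hg n))

theorem CP.para_of_pos (hf : CP χ T γ₁ f) (hg : CP χ T γ₂ g) (h₁ : 0 < γ₁) :
    CP χ T γ₂ fun t => paraSeq χ (f t) (g t) := by
  obtain ⟨C₁, hC₁⟩ := hf.bdd
  obtain ⟨C₂, hC₂⟩ := hg.bdd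
  obtain ⟨K, _, hK⟩ := exists_paraSeq_le_of_pos χ h₁ γ₂
  exact ⟨fun t ht => (hf.blk t ht).para (hg.blk t ht) (hC₁ t ht) (hC₂ t ht),
    continuousOn_paraSeq hf.cont hg.cont, _, fun t ht => hK _ _ _ _ (hC₁ t ht) (hC₂ t ht)⟩

theorem CP.para_of_neg (hf : CP χ T γ₁ f) (hg : CP χ T γ₂ g) (h₁ : γ₁ < 0) :
    CP χ T (γ₁ + γ₂) fun t => paraSeq χ (f t) (g t) := by
  obtain ⟨C₁, hC₁⟩ := hf.bdd
  obtain ⟨C₂, hC₂⟩ := hg.bdd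
  obtain ⟨K, _, hK⟩ := exists_paraSeq_le_of_neg χ h₁ γ₂
  exact ⟨fun t ht => (hf.blk t ht).para (hg.blk t ht) (hC₁ t ht) (hC₂ t ht),
    continuousOn_paraSeq hf.cont hg.cont, _, fun t ht => hK _ _ _ _ (hC₁ t ht) (hC₂ t ht)⟩

theorem Blk.der {f : BSeq d} (hf : Blk χ f) {C : ℝ} (h : PB γ C f) (j : Fin d) :
    Blk χ (derSeq χ j f) := by
  obtain ⟨u, hu⟩ := hf.exists_rep h
  exact (hu.partialD j).blk

theorem CP.der (hf : CP χ T γ f) (j : Fin d) : CP χ T (γ - 1) fun t => derSeq χ j (f t) := by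
  obtain ⟨C, hC⟩ := hf.bdd
  obtain ⟨K, _, hK⟩ := exists_PB_derSeq χ
  exact ⟨fun t ht => (hf.blk t ht).der (hC t ht) j,
    fun n => (Op (dmul χ j n)).continuous.comp_continuousOn (hf.cont n), _,
    fun t ht => hK j _ _ _ (hC t ht)⟩

variable (χ) in
/-- The blocks of a bounded function. -/
def blocks (F : Bdd d) (n : ℕ) : Bdd d := Op (χ.pc n) F

theorem blocks_sub (F G : Bdd d) : blocks χ (F - G) = blocks χ F - blocks χ G := by
  ext1 n
  simp only [blocks, Pi.sub_apply, map_sub]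

theorem exists_PB_blocks (χ : DyadicPartition d) : ∃ K, 0 ≤ K ∧ ∀ F : Bdd d, PB 0 (K * ‖F‖)
    (blocks χ F) := by
  obtain ⟨C, hC, h⟩ := exists_norm_Op_pc_le χ
  exact ⟨C, hC, fun F n => by rw [blocks]; simpa [pw_zero_left] using h n F⟩

theorem rep_blocks (F : Bdd d) : Rep χ (tf F) (blocks χ F) := Rep.of_bdd F

theorem CP.blocks {F : ℝ → Bdd d} (hF : ContinuousOn F (Icc 0 T)) :
    CP χ T 0 fun t => blocks χ (F t) := by
  obtain ⟨K, hK0, hK⟩ := exists_PB_blocks χ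
  obtain ⟨C, hC⟩ := isCompact_Icc.exists_bound_of_continuousOn hF
  refine ⟨fun t _ => (rep_blocks (F t)).blk, fun n => (Op (χ.pc n)).continuous.comp_continuousOn hF,
    K * C, fun t ht => (hK (F t)).mono le_rfl (by gcongr; exact hC t ht)⟩

theorem continuousOn_resoB (hf : CP χ T γ₁ f) (hg : CP χ T γ₂ g) (h : 0 < γ₁ + γ₂) :
    ContinuousOn (fun t => resoB (f t) (g t)) (Icc 0 T) := by
  obtain ⟨C₁, hC₁⟩ := hf.bdd
  obtain ⟨C₂, hC₂⟩ := hg.bdd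
  obtain ⟨K, _, hK⟩ := exists_resoTerm_le (d := d) γ₁ γ₂
  refine continuousOn_tsum (u := fun n => K * (C₁ * C₂) * pw (-(γ₁ + γ₂)) n) (fun n => ?_)
    ((summable_pw (by linarith)).mul_left _)
    fun n t ht => hK _ _ _ _ (hC₁ t ht) (hC₂ t ht) n
  exact (continuousOn_finsetSum _ fun i _ => hf.cont i).mul (hg.cont n)

theorem CP.continuousOn_tsum (hf : CP χ T γ f) (h : 0 < γ) :
    ContinuousOn (fun t => ∑' n, f t n) (Icc 0 T) := by
  obtain ⟨C, hC⟩ := hf.bdd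
  exact _root_.continuousOn_tsum (u := fun n => C * pw (-γ) n) hf.cont
    ((summable_pw (by linarith)).mul_left _) fun n t ht => hC t ht n

theorem continuousOn_commB (hf : CP χ T γ₁ f) (hg : CP χ T γ₂ g) (hh : CP χ T γ₃ h)
    (h₁ : γ₁ ∈ Ioo (0 : ℝ) 1) (hγ : 0 < γ₁ + γ₂ + γ₃) :
    ContinuousOn (fun t => commB χ (∑' n, f t n) (f t) (g t) (h t)) (Icc 0 T) := by
  obtain ⟨C₁, hC₁⟩ := hf.bdd
  obtain ⟨C₂, hC₂⟩ := hg.bdd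
  obtain ⟨C₃, hC₃⟩ := hh.bdd
  obtain ⟨K, _, hK⟩ := exists_commTerm_le χ h₁ γ₂ γ₃
  refine _root_.continuousOn_tsum (u := fun n => K * (C₁ * C₂ * C₃) * pw (-(γ₁ + γ₂ + γ₃)) n)
    (fun n => ?_) ((summable_pw (by linarith)).mul_left _)
    fun n t ht => hK _ _ _ _ _ _ (hf.blk t ht) (hg.blk t ht) (hC₁ t ht) (hC₂ t ht) (hC₃ t ht) n
  refine (continuousOn_finsetSum _ fun i _ => ?_).mul (hh.cont n)
  exact (continuousOn_paraSeq hf.cont hg.cont i).sub ((hf.continuousOn_tsum h₁.1).mul (hg.cont i))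

end Paths

/-! ### Weighted bounds -/

/-- The exponential weight. -/
def wt (l T t : ℝ) : ℝ := exp (l * (T - t))

theorem wt_pos (l T t : ℝ) : 0 < wt l T t := exp_pos _

theorem wt_anti (hl : 0 ≤ l) (h : t ≤ r) : wt l T r ≤ wt l T t := Real.exp_le_exp.2 (by gcongr)

theorem one_le_wt (hl : 0 ≤ l) (h : t ≤ T) : 1 ≤ wt l T t :=
  Real.one_le_exp (mul_nonneg hl (by linarith))

theorem wt_le (hl : 0 ≤ l) (h : 0 ≤ t) : wt l T t ≤ exp (l * T) :=
  Real.exp_le_exp.2 (by gcongr; linarith)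

theorem exp_neg_le_rpow {z : ℝ} (hz : 0 < z) (hy : y ∈ Icc (0 : ℝ) 1) : exp (-z) ≤ z ^ (-y) := by
  rw [Real.exp_neg, rpow_neg hz.le]
  refine inv_anti₀ (by positivity) ?_
  rcases le_total z 1 with h | h
  · exact (Real.rpow_le_one hz.le h hy.1).trans (Real.one_le_exp hz.le)
  · calc z ^ y ≤ z ^ (1 : ℝ) := rpow_le_rpow_of_exponent_le h hy.2
      _ = z := rpow_one z
      _ ≤ exp z := by linarith [Real.add_one_le_exp z]

theorem wt_le_rpow_mul (hl : 0 < l) (h : t < r) (hy : y ∈ Icc (0 : ℝ) 1) :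
    wt l T r ≤ l ^ (-y) * (r - t) ^ (-y) * wt l T t := by
  have h1 : wt l T r = exp (-(l * (r - t))) * wt l T t := by
    rw [wt, wt, ← exp_add]
    ring_nf
  rw [h1, ← mul_rpow hl.le (sub_nonneg.2 h.le)]
  exact mul_le_mul_of_nonneg_right (exp_neg_le_rpow (mul_pos hl (sub_pos.2 h)) hy) (wt_pos _ _ _).le

/-- Integrals with an integrable singularity at the left end point. -/
theorem norm_integral_le_rpow {F : ℝ → Bdd d} {K b : ℝ} (htr : t ≤ r) (hb : b < 1)
    (hF : ∀ s ∈ Ioc t r, ‖F s‖ ≤ K * (s - t) ^ (-b)) :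
    ‖∫ s in t..r, F s‖ ≤ K * ((r - t) ^ (1 - b) / (1 - b)) := by
  have hi : IntervalIntegrable (fun s => (s - t) ^ (-b)) volume t r := by
    have := (intervalIntegral.intervalIntegrable_rpow' (a := 0) (b := r - t) (r := -b)
      (by linarith)).comp_sub_right t
    simpa using this
  refine (intervalIntegral.norm_integral_le_of_norm_le htr (.of_forall hF)
    (hi.const_mul K)).trans (le_of_eq ?_)
  rw [intervalIntegral.integral_const_mul,
    intervalIntegral.integral_comp_sub_right (fun s => s ^ (-b)) t, sub_self,
    integral_rpow (Or.inl (by linarith)), show -b + 1 = 1 - b by ring,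
    zero_rpow (by linarith), sub_zero]

/-- A weighted bound for a path. -/
def PBW (T l γ M : ℝ) (f : BPath d) : Prop := ∀ t ∈ Icc 0 T, PB γ (M * wt l T t) (f t)

theorem PBW.nonneg (hT : 0 ≤ T) (h : PBW T l γ M f) : 0 ≤ M :=
  nonneg_of_mul_nonneg_left (h 0 ⟨le_rfl, hT⟩).nonneg (wt_pos l T 0)

theorem PBW.add (hf : PBW T l γ M f) (hg : PBW T l γ M' g) : PBW T l γ (M + M') (f + g) := fun t ht => by
  rw [add_mul]
  exact (hf t ht).add (hg t ht)

theorem PBW.sub (hf : PBW T l γ M f) (hg : PBW T l γ M' g) : PBW T l γ (M + M') (f - g) := fun t ht => by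
  rw [add_mul]
  exact (hf t ht).sub (hg t ht)

theorem PBW.sum {ι : Type*} (s : Finset ι) {M : ι → ℝ} {f : ι → BPath d}
    (h : ∀ i ∈ s, PBW T l γ (M i) (f i)) : PBW T l γ (∑ i ∈ s, M i) (∑ i ∈ s, f i) := fun t ht => by
  rw [sum_mul, Finset.sum_apply]
  exact PB.sum s fun i hi => h i hi t ht

theorem PBW.mono (h : PBW T l γ M f) (hγ : γ' ≤ γ) (hM : M ≤ M') : PBW T l γ' M' f := fun t ht =>
  (h t ht).mono hγ (mul_le_mul_of_nonneg_right hM (wt_pos _ _ _).le)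

theorem PBW.of_PB (hl : 0 ≤ l) (h : ∀ t ∈ Icc 0 T, PB γ M (f t)) : PBW T l γ M f := fun t ht =>
  (h t ht).mono le_rfl (le_mul_of_one_le_right (h t ht).nonneg (one_le_wt hl ht.2))

/-- A weighted Hölder bound for a path. -/
def HOL (T l μ ρ M : ℝ) (f : BPath d) : Prop :=
  ∀ t r, 0 ≤ t → t ≤ r → r ≤ T → ∀ N : ℕ,
    ∑ n ∈ Finset.range N, pw μ n * ‖f t n - f r n‖ ≤ M * wt l T t * (r - t) ^ ρ

theorem HOL.add (hf : HOL T l μ ρ M f) (hg : HOL T l μ ρ M' g) : HOL T l μ ρ (M + M') (f + g) := fun t r ht htr hr N => by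
  rw [add_mul, add_mul]
  refine le_trans ?_ (add_le_add (hf t r ht htr hr N) (hg t r ht htr hr N))
  rw [← Finset.sum_add_distrib]
  refine sum_le_sum fun n _ => ?_
  rw [← mul_add]
  refine mul_le_mul_of_nonneg_left ?_ (pw_nonneg _ _)
  simp only [Pi.add_apply]
  rw [add_sub_add_comm]
  exact norm_add_le _ _

theorem HOL.neg (hf : HOL T l μ ρ M f) : HOL T l μ ρ M (-f) := fun t r ht htr hr N => by
  refine le_trans (le_of_eq ?_) (hf t r ht htr hr N)
  refine sum_congr rfl fun n _ => ?_
  simp only [Pi.neg_apply]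
  rw [neg_sub_neg, norm_sub_rev]

theorem HOL.sub (hf : HOL T l μ ρ M f) (hg : HOL T l μ ρ M' g) : HOL T l μ ρ (M + M') (f - g) := by
  rw [sub_eq_add_neg]
  exact hf.add hg.neg

theorem HOL.mono (hf : HOL T l μ ρ M f) (hM : M ≤ M') : HOL T l μ ρ M' f := fun t r ht htr hr N =>
  (hf t r ht htr hr N).trans (by
    have := wt_pos l T t
    have := rpow_nonneg (sub_nonneg.2 htr) ρ
    gcongr)

theorem HOL.continuousOn (hl : 0 ≤ l) (hf : HOL T l μ ρ M f) (hρ : 0 < ρ) (n : ℕ) :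
    ContinuousOn (fun t => f t n) (Icc 0 T) := by
  have hp := pw_pos μ n
  have key : ∀ t r, 0 ≤ t → t ≤ r → r ≤ T → ‖f t n - f r n‖ ≤
      (pw μ n)⁻¹ * (|M| * exp (l * T) * (r - t) ^ ρ) := by
    intro t r ht htr hr
    have h1 := (single_le_sum (f := fun n => pw μ n * ‖f t n - f r n‖)
      (fun i _ => mul_nonneg (pw_nonneg _ _) (norm_nonneg _))
      (Finset.mem_range.2 (Nat.lt_succ_self n))).trans (hf t r ht htr hr (n + 1))
    rw [inv_mul_eq_div, le_div_iff₀ hp, mul_comm]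
    refine h1.trans ?_
    have := wt_le (T := T) hl ht
    have := wt_pos l T t
    have := rpow_nonneg (sub_nonneg.2 htr) ρ
    gcongr
    exact le_abs_self M
  intro r hr
  rw [ContinuousWithinAt, tendsto_iff_norm_sub_tendsto_zero]
  have hlim : Tendsto (fun x => (pw μ n)⁻¹ * (|M| * exp (l * T) * |x - r| ^ ρ))
      (𝓝[Icc 0 T] r) (𝓝 0) := by
    have : Continuous fun x : ℝ => (pw μ n)⁻¹ * (|M| * exp (l * T) * |x - r| ^ ρ) := by
      have : Continuous fun x : ℝ => |x - r| ^ ρ :=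
        (continuous_abs.comp (continuous_id.sub continuous_const)).rpow_const fun _ => Or.inr hρ.le
      fun_prop
    have h2 := this.continuousWithinAt (s := Icc 0 T) (x := r)
    rw [ContinuousWithinAt] at h2
    simpa [zero_rpow hρ.ne'] using h2
  refine squeeze_zero' (.of_forall fun _ => norm_nonneg _) ?_ hlim
  filter_upwards [self_mem_nhdsWithin] with x hx
  rcases le_total x r with hxr | hxr
  · rw [abs_sub_comm, abs_of_nonneg (sub_nonneg.2 hxr)]
    exact key x r hx.1 hxr hr.2
  · rw [abs_of_nonneg (sub_nonneg.2 hxr), norm_sub_rev]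
    exact key r x hr.1 hxr hx.2

/-! ### Estimates for `J` -/

variable {α : ℝ} {ν : Measure (Sphere d)} [IsFiniteMeasure ν]
  [Stable α ν]

theorem exists_norm_Pseq_smoothing (χ : DyadicPartition d) (T : ℝ) :
    ∃ C, 0 ≤ C ∧ ∀ s ∈ Ioc 0 T, ∀ g ∈ Icc (0 : ℝ) 5, ∀ γ M f, PB γ M f →
      PB (γ + g) (C * M * s ^ (-(g / α))) (Pseq χ α ν s f) := by
  obtain ⟨C, hC, h⟩ := exists_ker_pt_expSymbol (ν := ν) χ T
  refine ⟨C, hC, fun s hs g hg γ M f hf n => ?_⟩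
  refine ((h n s g ⟨hs.1.le, hs.2⟩ hg (Or.inl hs.1)).norm_Op_le (f n)).trans ?_
  rw [neg_add, pw_add]
  have h1 := rpow_nonneg hs.1.le (-(g / α))
  have h2 := pw_nonneg (-g) n
  calc _ ≤ C * (s ^ (-(g / α)) * pw (-g) n) * (M * pw (-γ) n) := by gcongr; exact hf n
    _ = _ := by ring

theorem exists_integral_Pseq_le (χ : DyadicPartition d) (T : ℝ) {g : ℝ} (hg : g ∈ Icc (0 : ℝ) 5)
    (hy : y ∈ Icc (0 : ℝ) 1) (hgy : g / α + y < 1) : ∃ C, 0 ≤ C ∧ ∀ l > 0, ∀ γ M v, 0 ≤ M →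
    PBW T l γ M v → ∀ t r, 0 ≤ t → t ≤ r → r ≤ T → ∀ n, ‖∫ s in t..r, Pseq χ α ν (s - t) (v s) n‖ ≤
    C * l ^ (-y) * M * wt l T t * pw (-(γ + g)) n * (r - t) ^ (1 - (g / α + y)) := by
  obtain ⟨C, hC, h⟩ := exists_norm_Pseq_smoothing (ν := ν) χ T
  have hb : 0 < 1 - (g / α + y) := by linarith
  refine ⟨C / (1 - (g / α + y)), by positivity, fun l hl γ M v hM hv t r ht htr hr n => ?_⟩
  have hwt := wt_pos l T t
  have := norm_integral_le_rpow (F := fun s => Pseq χ α ν (s - t) (v s) n) (t := t) (r := r)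
    (K := C * l ^ (-y) * M * wt l T t * pw (-(γ + g)) n) (b := g / α + y) htr hgy (by
      intro s hs
      have hst : 0 < s - t := sub_pos.2 hs.1
      have hs' : s ∈ Icc 0 T := ⟨ht.trans hs.1.le, hs.2.trans hr⟩
      have h1 := h (s - t) ⟨hst, by linarith [hs.2]⟩ g hg γ _ _ (hv s hs') n
      have h2 := wt_le_rpow_mul (T := T) hl hs.1 hy
      have h3 := rpow_nonneg hst.le (-(g / α))
      have h4 := pw_nonneg (-(γ + g)) n
      refine h1.trans ?_
      calc _ ≤ C * (M * (l ^ (-y) * (s - t) ^ (-y) * wt l T t)) * (s - t) ^ (-(g / α)) *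
            pw (-(γ + g)) n := by gcongr
        _ = C * l ^ (-y) * M * wt l T t * pw (-(γ + g)) n *
            ((s - t) ^ (-(g / α)) * (s - t) ^ (-y)) := by ring
        _ = _ := by rw [← rpow_add hst, ← neg_add])
  refine this.trans (le_of_eq ?_)
  ring

theorem exists_PBW_Jseq (χ : DyadicPartition d) (hT : 0 < T) {g : ℝ} (hg : g ∈ Icc (0 : ℝ) 5)
    (hy : y ∈ Icc (0 : ℝ) 1) (hgy : g / α + y < 1) : ∃ C, 0 ≤ C ∧ ∀ l > 0, ∀ γ M v, PBW T l γ M v →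
    PBW T l (γ + g) (C * l ^ (-y) * M) (Jseq χ α ν T v) := by
  obtain ⟨C, hC, h⟩ := exists_integral_Pseq_le (ν := ν) χ T hg hy hgy
  refine ⟨C * T ^ (1 - (g / α + y)), by positivity, fun l hl γ M v hv t ht n => ?_⟩
  have hM := hv.nonneg hT.le
  refine (h l hl γ M v hM hv t T ht.1 ht.2 le_rfl n).trans ?_
  have h1 : (T - t) ^ (1 - (g / α + y)) ≤ T ^ (1 - (g / α + y)) :=
    Real.rpow_le_rpow (by linarith [ht.2]) (by linarith [ht.1]) (by linarith)
  have h2 := wt_pos l T t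
  have h3 := pw_nonneg (-(γ + g)) n
  calc _ ≤ C * l ^ (-y) * M * wt l T t * pw (-(γ + g)) n * T ^ (1 - (g / α + y)) := by gcongr
    _ = _ := by ring

theorem Jseq_eq_add (hv : CP χ T γ v) (ht : 0 ≤ t) (htr : t ≤ r) (hr : r ≤ T) (n : ℕ) :
    Jseq χ α ν T v t n = (∫ s in t..r, Pseq χ α ν (s - t) (v s) n) + Pseq χ α ν (r - t)
      (Jseq χ α ν T v r) n := by
  have hc := hv.continuousOn_Pseq (ν := ν) (t := t) ⟨ht, htr.trans hr⟩ n
  have i1 : IntervalIntegrable (fun s => Pseq χ α ν (s - t) (v s) n) volume t r :=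
    ContinuousOn.intervalIntegrable (by
      rw [uIcc_of_le htr]
      exact hc.mono (Icc_subset_Icc_right hr))
  have i2 : IntervalIntegrable (fun s => Pseq χ α ν (s - t) (v s) n) volume r T :=
    ContinuousOn.intervalIntegrable (by
      rw [uIcc_of_le hr]
      exact hc.mono (Icc_subset_Icc_left htr))
  rw [Jseq, ← intervalIntegral.integral_add_adjacent_intervals i1 i2]
  congr 1
  have i3 := hv.intervalIntegrable_Pseq (ν := ν) (t := r) ⟨ht.trans htr, hr⟩ n
  have : Pseq χ α ν (r - t) (Jseq χ α ν T v r) n =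
      ∫ s in r..T, Op (χ.pt n * expSymbol α ν (r - t)) (Pseq χ α ν (s - r) (v s) n) :=
    (intervalIntegral_comp_comm _ i3).symm
  rw [this]
  refine intervalIntegral.integral_congr fun s hs => ?_
  rw [uIcc_of_le hr] at hs
  have := Pseq_add (ν := ν) (s := r - t) (t := s - r) (sub_nonneg.2 htr) (sub_nonneg.2 hs.1)
    (hv.blk s ⟨ht.trans (htr.trans hs.1), hs.2⟩)
  rw [show s - t = (r - t) + (s - r) by ring, this]
  rfl

theorem min_one_le_rpow (hx : 0 ≤ x) (hρ : ρ ∈ Icc (0 : ℝ) 1) : min 1 x ≤ x ^ ρ := by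
  rcases le_total x 1 with h | h
  · rw [min_eq_right h]
    rcases hx.eq_or_lt with rfl | hx
    · exact rpow_nonneg le_rfl _
    calc x = x ^ (1 : ℝ) := (rpow_one x).symm
      _ ≤ x ^ ρ := Real.rpow_le_rpow_of_exponent_ge hx h hρ.2
  · rw [min_eq_left h]
    exact Real.one_le_rpow h hρ.1

/-- The semigroup is Hölder continuous in time on functions of positive regularity. -/
theorem exists_Pseq_sub_sum_le (χ : DyadicPartition d) (T : ℝ) (hρ : ρ ∈ Icc (0 : ℝ) 1)
    (hγ : μ + α * ρ < γ) : ∃ C, 0 ≤ C ∧ ∀ s ∈ Icc 0 T, ∀ r ∈ Icc 0 T, ∀ f M, Blk χ f → PB γ M f →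
    ∀ N : ℕ, ∑ n ∈ Finset.range N, pw μ n * ‖Pseq χ α ν s f n - Pseq χ α ν r f n‖ ≤ C * M * |s -
    r| ^ ρ := by
  obtain ⟨C, hC, h⟩ := exists_norm_Pseq_sub_Pseq_le (ν := ν) χ T
  obtain ⟨S, hS, hs⟩ := sum_range_pw_neg_le (γ := μ + α * ρ + -γ) (by linarith)
  refine ⟨C * S, by positivity, fun s hs1 r hr f M hf hM N => ?_⟩
  have hM0 := hM.nonneg
  have hpos := rpow_nonneg (abs_nonneg (s - r)) ρ
  have key : ∀ n, pw μ n * ‖Pseq χ α ν s f n - Pseq χ α ν r f n‖ ≤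
      C * M * |s - r| ^ ρ * pw (μ + α * ρ + -γ) n := by
    intro n
    have h1 := h s hs1 r hr f hf n
    have h2 := min_one_le_rpow (mul_nonneg (abs_nonneg (s - r)) (pw_nonneg α n)) hρ
    rw [mul_rpow (abs_nonneg _) (pw_nonneg _ _), pw_rpow] at h2
    have h3 := pw_nonneg μ n
    have h4 := pw_nonneg (α * ρ) n
    calc _ ≤ pw μ n * (C * (|s - r| ^ ρ * pw (α * ρ) n) * (M * pw (-γ) n)) := by
          refine mul_le_mul_of_nonneg_left (h1.trans ?_) h3
          gcongr
          exact hM n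
      _ = _ := by
          rw [pw_add, pw_add]
          ring
  refine (sum_le_sum fun n _ => key n).trans ?_
  rw [← mul_sum]
  calc _ ≤ C * M * |s - r| ^ ρ * S := by gcongr; exact hs N
    _ = _ := by ring

theorem exists_HOL_Jseq (χ : DyadicPartition d) (hT : 0 < T) {g : ℝ} (hρ : ρ ∈ Icc (0 : ℝ) 1)
    (hρ0 : 0 < ρ) (hx : x ∈ Icc (0 : ℝ) 5) (hg : g ∈ Icc (0 : ℝ) 5) (hy : y ∈ Icc (0 : ℝ) 1)
    (hxy : x / α + y = 1 - ρ) (hμ : μ < γ + x) (hgy : g / α + y < 1) (hγ : μ + α * ρ < γ + g) :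
    ∃ C, 0 ≤ C ∧ ∀ l > 0, ∀ M γ' v, CP χ T γ' v → PBW T l γ M v → HOL T l μ ρ (C * l ^ (-y) * M)
      (Jseq χ α ν T v) := by
  obtain ⟨C₁, hC₁, h₁⟩ := exists_integral_Pseq_le (ν := ν) χ T hx hy (by linarith)
  obtain ⟨C₂, hC₂, h₂⟩ := exists_PBW_Jseq (ν := ν) χ hT hg hy hgy
  obtain ⟨C₃, hC₃, h₃⟩ := exists_Pseq_sub_sum_le (ν := ν) χ T hρ hγ
  obtain ⟨S, hS, hs⟩ := sum_range_pw_neg_le (γ := μ + -(γ + x)) (by linarith)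
  refine ⟨C₁ * S + C₃ * C₂, by positivity, fun l hl M γ' v hv hM t r ht htr hr N => ?_⟩
  have hM0 := hM.nonneg hT.le
  have hw := wt_pos l T t
  have hrt := rpow_nonneg (sub_nonneg.2 htr) ρ
  have hr' : r ∈ Icc 0 T := ⟨ht.trans htr, hr⟩
  have hb := hv.blk_Jseq (ν := ν) hr'
  have key : ∀ n, pw μ n * ‖Jseq χ α ν T v t n - Jseq χ α ν T v r n‖ ≤
      C₁ * l ^ (-y) * M * wt l T t * (r - t) ^ ρ * pw (μ + -(γ + x)) n +
      pw μ n * ‖Pseq χ α ν (r - t) (Jseq χ α ν T v r) n - Pseq χ α ν 0 (Jseq χ α ν T v r) n‖ := by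
    intro n
    have h1 := h₁ l hl γ M v hM0 hM t r ht htr hr n
    rw [hxy, sub_sub_cancel] at h1
    rw [Jseq_eq_add hv ht htr hr n, Pseq_zero hb, add_sub_assoc]
    have h3 := pw_nonneg μ n
    calc _ ≤ pw μ n * (C₁ * l ^ (-y) * M * wt l T t * pw (-(γ + x)) n * (r - t) ^ ρ +
          ‖Pseq χ α ν (r - t) (Jseq χ α ν T v r) n - Jseq χ α ν T v r n‖) := by
          gcongr
          exact (norm_add_le _ _).trans (by gcongr)
      _ = _ := by
          rw [pw_add]
          ring
  refine (sum_le_sum fun n _ => key n).trans ?_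
  rw [Finset.sum_add_distrib, ← mul_sum]
  have h5 := h₃ (r - t) ⟨sub_nonneg.2 htr, by linarith⟩ 0 ⟨le_rfl, hT.le⟩ _ _ hb
    (h₂ l hl γ M v hM r hr') N
  rw [sub_zero, abs_of_nonneg (sub_nonneg.2 htr)] at h5
  have h6 := wt_anti (T := T) hl.le htr
  calc _ ≤ C₁ * l ^ (-y) * M * wt l T t * (r - t) ^ ρ * S +
        C₃ * (C₂ * l ^ (-y) * M * wt l T t) * (r - t) ^ ρ := by
        refine add_le_add (by gcongr; exact hs N) (h5.trans ?_)
        gcongr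
    _ = _ := by ring

theorem CP.Jseq (hT : 0 < T) {g : ℝ} (hg : g ∈ Ico 0 α) (hv : CP χ T γ v) :
    CP χ T (γ + g) (Jseq χ α ν T v) := by
  have hα := Stable.index (ν := ν)
  have hα0 : 0 < α := Stable.pos ν
  have hg5 : g ∈ Icc (0 : ℝ) 5 := ⟨hg.1, by linarith [hg.2, hα.2]⟩
  have hgα : g / α + 0 < 1 := by
    rw [add_zero, div_lt_one hα0]
    exact hg.2
  obtain ⟨C, hC⟩ := hv.bdd
  obtain ⟨K, hK0, hK⟩ := exists_PBW_Jseq (ν := ν) χ hT hg5 ⟨le_rfl, zero_le_one⟩ hgα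
  have hJ := hK 1 one_pos γ C v (PBW.of_PB zero_le_one hC)
  refine ⟨fun t ht => hv.blk_Jseq ht, fun n => ?_, K * 1 ^ (-0 : ℝ) * C * exp (1 * T),
    fun t ht => (hJ t ht).mono le_rfl (mul_le_mul_of_nonneg_left (wt_le zero_le_one ht.1)
      (hJ.nonneg hT.le))⟩
  set μ := min γ 0 - 2 with hμ
  have hm : min γ 0 ≤ γ := min_le_left _ _
  have hρ1 : 1 / (2 * α) ≤ 1 / 2 := by
    rw [div_le_div_iff₀ (by positivity) two_pos]
    linarith [hα.1]
  obtain ⟨K', _, hK'⟩ := exists_HOL_Jseq (ν := ν) χ hT (μ := μ) (ρ := 1 / (2 * α)) (γ := γ)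
    (x := 0) (g := 0) (y := 1 - 1 / (2 * α)) ⟨by positivity, by linarith⟩ (by positivity)
    ⟨le_rfl, by norm_num⟩ ⟨le_rfl, by norm_num⟩ ⟨by linarith, by
      have : (0 : ℝ) ≤ 1 / (2 * α) := by positivity
      linarith⟩ (by simp) (by rw [hμ]; linarith) (by
      have : (0 : ℝ) < 1 / (2 * α) := by positivity
      simp only [zero_div]
      linarith) (by
      have : α * (1 / (2 * α)) = 1 / 2 := by field_simp
      rw [this, hμ]
      linarith)
  exact (hK' 1 one_pos C γ v hv (PBW.of_PB zero_le_one hC)).continuousOn zero_le_one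
    (by positivity) n

theorem Jseq_sub {w : BPath d} (hv : CP χ T γ v) (hw : CP χ T γ' w) (ht : t ∈ Icc 0 T) :
    RoughKolmogorov.Jseq χ α ν T (v - w) t = RoughKolmogorov.Jseq χ α ν T v t -
      RoughKolmogorov.Jseq χ α ν T w t := by
  ext1 n
  rw [Pi.sub_apply, RoughKolmogorov.Jseq, RoughKolmogorov.Jseq, RoughKolmogorov.Jseq,
    ← intervalIntegral.integral_sub (hv.intervalIntegrable_Pseq ht n)
      (hw.intervalIntegrable_Pseq ht n)]
  simp only [Pseq, Pi.sub_apply, map_sub]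

end

section

variable {d : ℕ} {χ : DyadicPartition d}
variable {α : ℝ} {ν : Measure (Sphere d)} [IsFiniteMeasure ν]
  [Stable α ν]
variable {T g γ₁ γ₂ : ℝ}

/-! ### The commutator of the semigroup and the paraproduct -/

theorem exists_Pseq_paraSeq_sub_le (χ : DyadicPartition d) (T : ℝ) (h₁ : γ₁ < 1)
    (hg : g ∈ Icc (0 : ℝ) 5) : ∃ K, 0 ≤ K ∧ ∀ s ∈ Ioc 0 T, ∀ (f v : BSeq d) (M R : ℝ), Blk χ f →
    Blk χ v → PB γ₁ M f → PB γ₂ R v → PB (γ₁ + γ₂ + g) (K * (M * R) * s ^ (-(g / α)))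
    (Pseq χ α ν s (paraSeq χ f v) - paraSeq χ f (Pseq χ α ν s v)) := by
  obtain ⟨C, hC, hk⟩ := exists_ker_pc_expSymbol (ν := ν) χ T
  obtain ⟨C', hC', hk'⟩ := χ.exists_ker_pc
  obtain ⟨C'', hC'', hk''⟩ := exists_norm_Pseq_smoothing (ν := ν) χ T
  obtain ⟨D, hD, hkt⟩ := exists_ker_pt_expSymbol (ν := ν) χ T
  obtain ⟨L, hL, hl⟩ := exists_lip_sum_range χ h₁
  set N := paraN χ
  set P := pw |1 - γ₁ - γ₂| N with hP
  set P' := pw |1 - γ₁ + -(γ₂ + g)| N with hP'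
  have hP0 : 0 ≤ P := pw_nonneg _ _
  have hP0' : 0 ≤ P' := pw_nonneg _ _
  refine ⟨(2 * N + 1) * (P * C * L + P' * C' * L * C''), by positivity,
    fun s hs f v M R hf hv hM hR m => ?_⟩
  have hM0 := hM.nonneg
  have hR0 := hR.nonneg
  have hs0 : s ∈ Icc 0 T := ⟨hs.1.le, hs.2⟩
  set X : BSeq d := fun n => ∑ m ∈ Finset.range (n - 1), f m with hX
  set W : BSeq d := Pseq χ α ν s v with hW
  have hkm := hk m s g hs0 hg (Or.inl hs.1)
  have e1 : ∀ n, Op (χ.pt m * expSymbol α ν s) (Op (χ.pc m) (paraTerm f v n)) =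
      Op (χ.pc m * expSymbol α ν s) (X n * v n) := by
    intro n
    rw [← Op_mul (hkt m s g hs0 hg (Or.inl hs.1)) (hk' m),
      show χ.pt m * expSymbol α ν s * χ.pc m = (χ.pt m * χ.pc m) * expSymbol α ν s by ring,
      χ.pt_mul_pc]
    rfl
  have e2 : ∀ n, Op (χ.pc m) (W n) = Op (χ.pc m * expSymbol α ν s) (v n) := by
    intro n
    obtain ⟨_, _, hn⟩ := ker_pt χ n
    conv_rhs => rw [← hv.pt n, ← Op_mul hkm hn]
    rw [hW, Pseq, ← Op_mul (hk' m) (hkt n s g hs0 hg (Or.inl hs.1))]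
    congr 2
    ring
  have e : (Pseq χ α ν s (paraSeq χ f v) - paraSeq χ f (Pseq χ α ν s v)) m =
      ∑ n ∈ Finset.Icc (m - N) (m + N),
        ((Op (χ.pc m * expSymbol α ν s) (X n * v n) -
          X n * Op (χ.pc m * expSymbol α ν s) (v n)) -
        (Op (χ.pc m) (X n * W n) - X n * Op (χ.pc m) (W n))) := by
    rw [Pi.sub_apply, Pseq, paraSeq, map_sum, paraSeq, ← sum_sub_distrib]
    refine sum_congr rfl fun n _ => ?_
    rw [e1, e2, paraTerm]
    abel
  set A := s ^ (-(g / α)) with hA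
  have hA0 : 0 ≤ A := rpow_nonneg hs.1.le _
  have q2 := pw_nonneg (-1) m
  have q3 := pw_nonneg (-g) m
  have key1 : ∀ n, ‖Op (χ.pc m * expSymbol α ν s) (X n * v n) -
      X n * Op (χ.pc m * expSymbol α ν s) (v n)‖ ≤
      (pw (-1) m * (C * (A * pw (-g) m)) * L * M * R) * pw (1 - γ₁ - γ₂) n := by
    intro n
    have q := pw_nonneg (1 - γ₁) n
    refine (hkm.norm_Op_mul_sub_le (F := X n) (G := v n)
      (L := L * M * pw (1 - γ₁) n) (by positivity) (hl f M hf hM n)).trans ?_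
    rw [sub_eq_add_neg (1 - γ₁), pw_add]
    calc _ ≤ pw (-1) m * (C * (A * pw (-g) m)) * (L * M * pw (1 - γ₁) n) * (R * pw (-γ₂) n) := by
          gcongr
          exact hR n
      _ = _ := by ring
  have key2 : ∀ n, ‖Op (χ.pc m) (X n * W n) - X n * Op (χ.pc m) (W n)‖ ≤
      (C' * pw (-1) m * L * M * (C'' * R * A)) * pw (1 - γ₁ + -(γ₂ + g)) n := by
    intro n
    have q := pw_nonneg (1 - γ₁) n
    refine ((hk' m).norm_Op_mul_sub_le (F := X n) (G := W n)
      (L := L * M * pw (1 - γ₁) n) (by positivity) (hl f M hf hM n)).trans ?_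
    have e2 : ((2 : ℝ) ^ m)⁻¹ = pw (-1) m := by rw [pw_neg, pw_one]
    rw [e2, pw_add]
    calc _ ≤ C' * pw (-1) m * (L * M * pw (1 - γ₁) n) * (C'' * R * A * pw (-(γ₂ + g)) n) := by
          gcongr
          exact hk'' s hs g hg γ₂ R v hR n
      _ = _ := by ring
  have s1 := sum_window_le (N := N) (m := m) (by positivity) key1
  have s2 := sum_window_le (N := N) (m := m) (by positivity) key2
  have e3 : pw (-1) m * pw (-g) m * pw (1 - γ₁ - γ₂) m = pw (-(γ₁ + γ₂ + g)) m := by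
    rw [← pw_add, ← pw_add]
    ring_nf
  have e4 : pw (-1) m * pw (1 - γ₁ + -(γ₂ + g)) m = pw (-(γ₁ + γ₂ + g)) m := by
    rw [← pw_add]
    ring_nf
  rw [e]
  refine (norm_sum_le _ _).trans ?_
  refine (sum_le_sum fun n _ => norm_sub_le _ _).trans ?_
  rw [Finset.sum_add_distrib]
  refine (add_le_add s1 s2).trans (le_of_eq ?_)
  rw [← hP, ← hP']
  calc _ = (2 * N + 1) * P * C * L * (M * R) * A * (pw (-1) m * pw (-g) m * pw (1 - γ₁ - γ₂) m) +
        (2 * N + 1) * P' * C' * L * C'' * (M * R) * A * (pw (-1) m * pw (1 - γ₁ + -(γ₂ + g)) m) := by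
        ring
    _ = _ := by
        rw [e3, e4]
        ring

theorem paraSeq_integral {X : BSeq d} {F : BPath d} {a b : ℝ}
    (hi : ∀ n, IntervalIntegrable (fun r => F r n) volume a b) (m : ℕ) :
    paraSeq χ X (fun n => ∫ r in a..b, F r n) m = ∫ r in a..b, paraSeq χ X (F r) m := by
  simp only [paraSeq, paraTerm]
  have hi' : ∀ n, IntervalIntegrable
      (fun r => Op (χ.pc m) ((∑ m ∈ Finset.range (n - 1), X m) * F r n)) volume a b := fun n =>
    let L := (Op (χ.pc m)).comp (ContinuousLinearMap.mul ℂ (Bdd d) (∑ m ∈ Finset.range (n - 1), X m))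
    ⟨L.integrable_comp (hi n).1, L.integrable_comp (hi n).2⟩
  rw [intervalIntegral.integral_finsetSum fun n _ => hi' n]
  refine sum_congr rfl fun n _ => ?_
  exact (intervalIntegral_comp_comm ((Op (χ.pc m)).comp
    (ContinuousLinearMap.mul ℂ (Bdd d) (∑ m ∈ Finset.range (n - 1), X m))) (hi n)).symm

variable (χ α ν) in
/-- The commutator of `J` and the paraproduct with a path. -/
def commJ (T : ℝ) (f v : BPath d) (t : ℝ) : BSeq d :=
  Jseq χ α ν T (fun r => paraSeq χ (f r) (v r)) t - paraSeq χ (f t) (Jseq χ α ν T v t)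

theorem exists_PBW_commJ (χ : DyadicPartition d) (hT : 0 < T) (h₁ : γ₁ ∈ Ioo (0 : ℝ) 1)
    (hg : g ∈ Ico 0 α) : ∃ K, 0 ≤ K ∧ ∀ l ≥ 0, ∀ (f v : BPath d) (M R : ℝ), CP χ T γ₁ f →
    CP χ T γ₂ v → PBW T l γ₁ M f → HOL T l 0 (γ₁ / α) M f → (∀ t ∈ Icc 0 T, PB γ₂ R (v t)) →
    PBW T l (γ₁ + γ₂ + g) (K * (M * R)) (commJ χ α ν T f v) := by
  have hα := Stable.index (ν := ν)
  have hα0 : 0 < α := Stable.pos ν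
  have hg5 : g ∈ Icc (0 : ℝ) 5 := ⟨hg.1, by linarith [hg.2, hα.2]⟩
  have hg5' : g + γ₁ ∈ Icc (0 : ℝ) 5 := ⟨by linarith [hg.1, h₁.1], by linarith [hg.2, hα.2, h₁.2]⟩
  have hgα : g / α < 1 := by
    rw [div_lt_one hα0]
    exact hg.2
  obtain ⟨K₁, hK₁, k₁⟩ := exists_Pseq_paraSeq_sub_le (ν := ν) χ T (γ₂ := γ₂) h₁.2 hg5
  obtain ⟨K₂, hK₂, k₂⟩ := exists_paraSeq_le_of_sum χ (γ₁ + γ₂ + g)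
  obtain ⟨C, hC, hk⟩ := exists_norm_Pseq_smoothing (ν := ν) χ T
  have hb : 0 < 1 - g / α := by linarith
  refine ⟨(K₁ + K₂ * C) * (T ^ (1 - g / α) / (1 - g / α)), by positivity,
    fun l hl f v M R hf hv hM hH hR t ht m => ?_⟩
  have hM0 := hM.nonneg hT.le
  have hR0 := (hR t ht).nonneg
  have hw := wt_pos l T t
  have hp := pw_nonneg (-(γ₁ + γ₂ + g)) m
  have i1 := (hf.para_of_pos hv h₁.1).intervalIntegrable_Pseq (ν := ν) ht m
  have i2 := fun n => hv.intervalIntegrable_Pseq (ν := ν) ht n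
  have i3 : IntervalIntegrable (fun r => paraSeq χ (f t) (Pseq χ α ν (r - t) (v r)) m) volume t T := by
    refine ContinuousOn.intervalIntegrable ?_
    rw [uIcc_of_le ht.2]
    exact continuousOn_paraSeq (f := fun _ => f t) (g := fun r => Pseq χ α ν (r - t) (v r))
      (fun n => continuousOn_const) (fun n => hv.continuousOn_Pseq ht n) m
  have e : commJ χ α ν T f v t m = ∫ r in t..T, (Pseq χ α ν (r - t) (paraSeq χ (f r) (v r)) m -
      paraSeq χ (f t) (Pseq χ α ν (r - t) (v r)) m) := by
    rw [commJ, Pi.sub_apply, intervalIntegral.integral_sub i1 i3, ← paraSeq_integral i2]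
    rfl
  rw [e]
  have key : ∀ r ∈ Ioc t T, ‖Pseq χ α ν (r - t) (paraSeq χ (f r) (v r)) m -
      paraSeq χ (f t) (Pseq χ α ν (r - t) (v r)) m‖ ≤
      (K₁ + K₂ * C) * (M * wt l T t * R) * pw (-(γ₁ + γ₂ + g)) m * (r - t) ^ (-(g / α)) := by
    intro r hr
    have hr' : r ∈ Icc 0 T := ⟨ht.1.trans hr.1.le, hr.2⟩
    have hs : r - t ∈ Ioc 0 T := ⟨sub_pos.2 hr.1, by linarith [hr.2, ht.1]⟩
    have a1 := k₁ (r - t) hs (f r) (v r) _ R (hf.blk r hr') (hv.blk r hr') (hM r hr') (hR r hr') m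
    have a2 := k₂ (f r - f t) (Pseq χ α ν (r - t) (v r)) (M * wt l T t * (r - t) ^ (γ₁ / α))
      (C * R * (r - t) ^ (-((g + γ₁) / α)))
      (by have := rpow_nonneg hs.1.le (γ₁ / α); positivity)
      (fun n => by
        refine (norm_sum_le _ _).trans ?_
        have := hH t r ht.1 hr.1.le hr.2 n
        simpa only [pw_zero_left, one_mul, Pi.sub_apply, norm_sub_rev] using this)
      (by
        have := hk (r - t) hs (g + γ₁) hg5' γ₂ R (v r) (hR r hr')
        rwa [show γ₂ + (g + γ₁) = γ₁ + γ₂ + g by ring] at this) m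
    have e1 : (r - t) ^ (γ₁ / α) * (r - t) ^ (-((g + γ₁) / α)) = (r - t) ^ (-(g / α)) := by
      rw [← rpow_add hs.1]
      congr 1
      field_simp
      ring
    have e2 : Pseq χ α ν (r - t) (paraSeq χ (f r) (v r)) m -
        paraSeq χ (f t) (Pseq χ α ν (r - t) (v r)) m =
        (Pseq χ α ν (r - t) (paraSeq χ (f r) (v r)) -
          paraSeq χ (f r) (Pseq χ α ν (r - t) (v r))) m +
        paraSeq χ (f r - f t) (Pseq χ α ν (r - t) (v r)) m := by
      rw [paraSeq_sub_left, Pi.sub_apply, Pi.sub_apply]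
      abel
    rw [e2]
    have h6 := wt_anti (T := T) hl hr.1.le
    have h7 := rpow_nonneg hs.1.le (-(g / α))
    calc _ ≤ K₁ * (M * wt l T t * R) * (r - t) ^ (-(g / α)) * pw (-(γ₁ + γ₂ + g)) m +
          K₂ * ((M * wt l T t * (r - t) ^ (γ₁ / α)) * (C * R * (r - t) ^ (-((g + γ₁) / α)))) *
            pw (-(γ₁ + γ₂ + g)) m := by
          refine (norm_add_le _ _).trans (add_le_add (a1.trans ?_) a2)
          gcongr
      _ = K₁ * (M * wt l T t * R) * (r - t) ^ (-(g / α)) * pw (-(γ₁ + γ₂ + g)) m +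
          K₂ * C * (M * wt l T t * R) * ((r - t) ^ (γ₁ / α) * (r - t) ^ (-((g + γ₁) / α))) *
            pw (-(γ₁ + γ₂ + g)) m := by ring
      _ = _ := by
          rw [e1]
          ring
  have h1 : (T - t) ^ (1 - g / α) ≤ T ^ (1 - g / α) :=
    Real.rpow_le_rpow (by linarith [ht.2]) (by linarith [ht.1]) hb.le
  refine (norm_integral_le_rpow ht.2 hgα key).trans ?_
  · calc _ ≤ (K₁ + K₂ * C) * (M * wt l T t * R) * pw (-(γ₁ + γ₂ + g)) m *
          (T ^ (1 - g / α) / (1 - g / α)) := by gcongr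
      _ = _ := by ring

theorem commJ_sub (h₁ : 0 < γ₁) {f f' v v' : BPath d} (hf : CP χ T γ₁ f) (hf' : CP χ T γ₁ f')
    (hv : CP χ T γ₂ v) (hv' : CP χ T γ₂ v') {t : ℝ} (ht : t ∈ Icc 0 T) :
    commJ χ α ν T f v t - commJ χ α ν T f' v' t = commJ χ α ν T (f - f') v t + commJ χ α ν T f'
      (v - v') t := by
  have e1 : (fun r => paraSeq χ ((f - f') r) (v r)) =
      (fun r => paraSeq χ (f r) (v r)) - fun r => paraSeq χ (f' r) (v r) := by
    ext1 r
    exact paraSeq_sub_left _ _ _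
  have e2 : (fun r => paraSeq χ (f' r) ((v - v') r)) =
      (fun r => paraSeq χ (f' r) (v r)) - fun r => paraSeq χ (f' r) (v' r) := by
    ext1 r
    exact paraSeq_sub_right _ _ _
  simp only [commJ]
  rw [e1, e2, Jseq_sub (hf.para_of_pos hv h₁) (hf'.para_of_pos hv h₁) ht,
    Jseq_sub (hf'.para_of_pos hv h₁) (hf'.para_of_pos hv' h₁) ht, Jseq_sub hv hv' ht,
    Pi.sub_apply, paraSeq_sub_left, paraSeq_sub_right]
  abel

/-! ### Constants -/

variable (χ) in
/-- The blocks of the constant function with value `c`. -/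
def cst (c : ℂ) : BSeq d := blocks χ (BoundedContinuousFunction.const _ c)

theorem cst_succ (c : ℂ) (n : ℕ) : cst χ c (n + 1) = 0 := by
  obtain ⟨A, B, h⟩ := ker_pc χ (n + 1)
  rw [cst, blocks, Op_const h]
  have : χ.pc (n + 1) 0 = 0 := by simp [DyadicPartition.pc, χ.p_succ_zero]
  rw [this, zero_mul]
  rfl

theorem cst_zero (c : ℂ) : cst χ c 0 = BoundedContinuousFunction.const _ c := by
  obtain ⟨A, B, h⟩ := ker_pc χ 0
  rw [cst, blocks, Op_const h]
  have : χ.pc 0 0 = 1 := by simp [DyadicPartition.pc, DyadicPartition.p, χ.low_zero]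
  rw [this, one_mul]

theorem PB_cst (γ : ℝ) (c : ℂ) : PB γ ‖c‖ (cst χ c) := by
  intro n
  cases n with
  | zero =>
    rw [cst_zero, pw_zero_right, mul_one]
    exact BoundedContinuousFunction.norm_const_le c
  | succ n =>
    rw [cst_succ, norm_zero]
    exact mul_nonneg (norm_nonneg _) (pw_nonneg _ _)

theorem CP_cst (T γ : ℝ) (c : ℂ) : CP χ T γ fun _ => cst χ c :=
  ⟨fun _ _ => (rep_blocks _).blk, fun _ => continuousOn_const, _, fun _ _ => PB_cst γ c⟩

/-- The paraproduct with the constant `1` differs from the identity in low frequencies only. -/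
theorem exists_sub_paraSeq_one_le (χ : DyadicPartition d) (γ γ' : ℝ) :
    ∃ K, 0 ≤ K ∧ ∀ (g : BSeq d) (C : ℝ), Blk χ g → PB γ C g →
      PB γ' (K * C) (g - paraSeq χ (cst χ 1) g) := by
  obtain ⟨K, hK, h⟩ := exists_window_le χ (paraN χ) γ'
  refine ⟨K * (pw |γ| 1 * pw |γ'| 1), by
    have := pw_nonneg |γ| 1
    have := pw_nonneg |γ'| 1
    positivity, fun g C hg hC => ?_⟩
  have hC0 := hC.nonneg
  have hp1 := pw_nonneg |γ| 1
  have hp2 := pw_nonneg |γ'| 1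
  set X : BSeq d := fun n => if n ≤ 1 then g n else 0 with hX
  have hXb : PB γ' (pw |γ| 1 * pw |γ'| 1 * C) X := by
    intro n
    have hp := pw_nonneg (-γ') n
    rcases le_or_gt n 1 with hn | hn
    · simp only [hX, if_pos hn]
      have h1 : pw (-γ) n ≤ pw |γ| 1 * 1 := by
        have := pw_le_of_near (γ := -γ) (n := n) (m := 0) (k := 1) (by omega) (by omega)
        rwa [abs_neg, pw_zero_right] at this
      have h2 : 1 ≤ pw |γ'| 1 * pw (-γ') n := by
        have := pw_le_of_near (γ := -γ') (n := 0) (m := n) (k := 1) (by omega) (by omega)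
        rwa [abs_neg, pw_zero_right] at this
      calc ‖g n‖ ≤ C * pw (-γ) n := hC n
        _ ≤ C * (pw |γ| 1 * (pw |γ'| 1 * pw (-γ') n)) := by
            gcongr
            exact h1.trans (by gcongr)
        _ = _ := by ring
    · simp only [hX, if_neg (not_le.2 hn), norm_zero]
      positivity
  have := h X _ hXb
  rw [mul_assoc]
  convert this using 1
  ext1 m
  conv_lhs => rw [Pi.sub_apply, ← hg.sum_Op (one_le_paraN χ) m, paraSeq, ← sum_sub_distrib]
  refine sum_congr rfl fun n _ => ?_
  rw [← map_sub]
  congr 1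
  rw [paraTerm]
  rcases le_or_gt n 1 with hn | hn
  · have : n - 1 = 0 := by omega
    simp [hX, if_pos hn, this]
  · obtain ⟨k, hk⟩ : ∃ k, n - 1 = k + 1 := ⟨n - 2, by omega⟩
    have e : ∑ m ∈ Finset.range (n - 1), cst χ 1 m = 1 := by
      rw [hk, Finset.sum_range_succ', cst_zero]
      simp only [cst_succ, Finset.sum_const_zero, zero_add]
      rfl
    simp only [hX, if_neg (not_le.2 hn)]
    rw [e, one_mul, sub_self]

end

section

variable {d : ℕ} {χ : DyadicPartition d}
variable {T a t β γ γ₁ γ₂ θ : ℝ} {f f' : BSeq d}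

/-! ### Differences of products -/

theorem exists_para_diff_neg (χ : DyadicPartition d) (h₁ : γ₁ < 0) (γ₂ : ℝ) :
    ∃ K, 0 ≤ K ∧ ∀ (f f' g g' : BSeq d) (a a' R D : ℝ), PB γ₁ a (f - f') → PB γ₁ a' f' → PB γ₂ R g →
      PB γ₂ D (g - g') → PB (γ₁ + γ₂) (K * (a * R + a' * D)) (paraSeq χ f g - paraSeq χ f' g') := by
  obtain ⟨K, hK, h⟩ := exists_paraSeq_le_of_neg χ h₁ γ₂
  refine ⟨K, hK, fun f f' g g' a a' R D h1 h2 h3 h4 => ?_⟩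
  rw [paraSeq_sub_sub, mul_add]
  exact (h _ _ _ _ h1 h3).add (h _ _ _ _ h2 h4)

theorem exists_para_diff_pos (χ : DyadicPartition d) (h₁ : 0 < γ₁) (γ₂ : ℝ) :
    ∃ K, 0 ≤ K ∧ ∀ (f f' g g' : BSeq d) (a a' R D : ℝ), PB γ₁ a (f - f') → PB γ₁ a' f' → PB γ₂ R g →
      PB γ₂ D (g - g') → PB γ₂ (K * (a * R + a' * D)) (paraSeq χ f g - paraSeq χ f' g') := by
  obtain ⟨K, hK, h⟩ := exists_paraSeq_le_of_pos χ h₁ γ₂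
  refine ⟨K, hK, fun f f' g g' a a' R D h1 h2 h3 h4 => ?_⟩
  rw [paraSeq_sub_sub, mul_add]
  exact (h _ _ _ _ h1 h3).add (h _ _ _ _ h2 h4)

theorem exists_para_diff_neg' (χ : DyadicPartition d) (h₁ : γ₂ < 0) (γ₁ : ℝ) :
    ∃ K, 0 ≤ K ∧ ∀ (f f' g g' : BSeq d) (a a' R D : ℝ), PB γ₁ a (f - f') → PB γ₁ a' f' → PB γ₂ R g →
      PB γ₂ D (g - g') → PB (γ₂ + γ₁) (K * (a * R + a' * D)) (paraSeq χ g f - paraSeq χ g' f') := by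
  obtain ⟨K, hK, h⟩ := exists_paraSeq_le_of_neg χ h₁ γ₁
  refine ⟨K, hK, fun f f' g g' a a' R D h1 h2 h3 h4 => ?_⟩
  have e : paraSeq χ g f - paraSeq χ g' f' = paraSeq χ g (f - f') + paraSeq χ (g - g') f' := by
    rw [paraSeq_sub_left, paraSeq_sub_right, sub_add_sub_cancel]
  rw [e, mul_add, mul_comm a, mul_comm a']
  exact (h _ _ _ _ h3 h1).add (h _ _ _ _ h4 h2)

theorem PB.of_sub {a' : ℝ} (h : PB γ a (f - f')) (h' : PB γ a' f') : PB γ (a + a') f := by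
  have := h.add h'
  rwa [sub_add_cancel] at this

theorem PB.of_sub' {R : ℝ} (h : PB γ a (f - f')) (h' : PB γ R f) : PB γ (R + a) f' := by
  have := h'.sub h
  rwa [sub_sub_cancel] at this

theorem exists_reso_diff (χ : DyadicPartition d) (h : 0 < γ₁ + γ₂) :
    ∃ K, 0 ≤ K ∧ ∀ (f f' g g' : BSeq d) (a a' R D : ℝ), PB γ₁ a (f - f') → PB γ₁ a' f' → PB γ₂ R g →
      PB γ₂ D (g - g') → PB 0 (K * (a * R + a' * D)) (blocks χ (resoB f g) - blocks χ (resoB f' g')) := by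
  obtain ⟨K, hK, hk⟩ := exists_resoB_le (d := d) h
  obtain ⟨C, hC, hc⟩ := exists_PB_blocks χ
  refine ⟨C * K, by positivity, fun f f' g g' a a' R D h1 h2 h3 h4 => ?_⟩
  rw [← blocks_sub, resoB_sub_sub h (h1.of_sub h2) h2 h3 (h4.of_sub' h3)]
  refine (hc _).mono le_rfl ?_
  rw [mul_assoc, mul_add]
  gcongr
  exact (norm_add_le _ _).trans (add_le_add (hk _ _ _ _ h1 h3) (hk _ _ _ _ h2 h4))

theorem exists_comm_diff (χ : DyadicPartition d) {γ₃ : ℝ} (h₁ : γ₁ ∈ Ioo (0 : ℝ) 1)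
    (h : 0 < γ₁ + γ₂ + γ₃) : ∃ K, 0 ≤ K ∧ ∀ (f f' g g' k k' : BSeq d) (a a' R D : ℝ), Blk χ f →
    Blk χ f' → Blk χ g → Blk χ g' → PB γ₁ a (f - f') → PB γ₁ a' f' → PB γ₂ R g → PB γ₂ R g' →
    PB γ₂ D (g - g') → PB γ₃ R k → PB γ₃ D (k - k') → PB 0 (K * (a * R * R + 2 * a' * R * D))
    (blocks χ (commB χ (∑' n, f n) f g k) - blocks χ (commB χ (∑' n, f' n) f' g' k')) := by
  obtain ⟨K, hK, hk⟩ := exists_commB_le χ h₁ h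
  obtain ⟨C, hC, hc⟩ := exists_PB_blocks χ
  refine ⟨C * K, by positivity,
    fun f f' g g' k k' a a' R D bf bf' bg bg' h1 h2 h3 h3' h4 h5 h6 => ?_⟩
  rw [← blocks_sub, commB_sub_sub h₁ h bf bg bf' bg' (h1.of_sub h2) h3 h5 h2 (h4.of_sub' h3)
    (h6.of_sub' h5)]
  refine (hc _).mono le_rfl ?_
  have b1 := hk _ _ _ _ _ _ (bf.sub bf') bg h1 h3 h5
  have b2 := hk _ _ _ _ _ _ bf' (bg.sub bg') h2 h4 h5
  have b3 := hk _ _ _ _ _ _ bf' bg' h2 h3' h6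
  rw [mul_assoc]
  gcongr
  refine (norm_add₃_le).trans ((add_le_add (add_le_add b1 b2) b3).trans (le_of_eq ?_))
  ring

/-! ### Linearity of `J` -/

section Linear

variable {α : ℝ} {ν : Measure (Sphere d)} [IsFiniteMeasure ν]
  [Stable α ν]

theorem Jseq_zero (T t : ℝ) : Jseq χ α ν T 0 t = 0 := by
  ext1 n
  simp [Jseq, Pseq]

theorem Jseq_add {γ' : ℝ} {v w : BPath d} (hv : CP χ T γ v) (hw : CP χ T γ' w) (ht : t ∈ Icc 0 T) :
    Jseq χ α ν T (v + w) t = Jseq χ α ν T v t + Jseq χ α ν T w t := by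
  ext1 n
  rw [Pi.add_apply, Jseq, Jseq, Jseq,
    ← intervalIntegral.integral_add (hv.intervalIntegrable_Pseq ht n)
      (hw.intervalIntegrable_Pseq ht n)]
  simp only [Pseq, Pi.add_apply, map_add]

theorem Jseq_sum {ι : Type*} (s : Finset ι) {v : ι → BPath d} (hv : ∀ i ∈ s, CP χ T γ (v i))
    (ht : t ∈ Icc 0 T) : Jseq χ α ν T (∑ i ∈ s, v i) t = ∑ i ∈ s, Jseq χ α ν T (v i) t := by
  classical
  induction s using Finset.induction_on with
  | empty => simp [Jseq_zero]
  | insert i s hi ih =>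
    rw [sum_insert hi, sum_insert hi,
      Jseq_add (hv i (by simp)) (CP.sum s fun j hj => hv j (by simp [hj])) ht,
      ih fun j hj => hv j (by simp [hj])]

theorem Jseq_smul (c : ℂ) (T t : ℝ) (v : BPath d) :
    Jseq χ α ν T (c • v) t = c • Jseq χ α ν T v t := by
  ext1 n
  simp only [Jseq, Pseq, Pi.smul_apply, map_smul]
  exact intervalIntegral.integral_smul c _

end Linear

theorem PB.smul {C : ℝ} (h : PB γ C f) (c : ℂ) : PB γ (‖c‖ * C) (c • f) :=
  fun n => by
    rw [Pi.smul_apply, norm_smul, mul_assoc]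
    exact mul_le_mul_of_nonneg_left (h n) (norm_nonneg _)

theorem CP.smul {f : BPath d} (h : CP χ T γ f) (c : ℂ) : CP χ T γ (c • f) where
  blk t ht := (h.blk t ht).smul c
  cont n := (h.cont n).const_smul c
  bdd := let ⟨C, hC⟩ := h.bdd; ⟨‖c‖ * C, fun t ht => (hC t ht).smul c⟩

theorem cst_eq_smul (c : ℂ) : cst χ c = c • cst χ 1 := by
  ext1 n
  rw [cst, Pi.smul_apply, cst, blocks, blocks, ← map_smul]
  congr 1
  ext x
  simp

theorem paraSeq_smul_left (c : ℂ) (f g : BSeq d) : paraSeq χ (c • f) g = c • paraSeq χ f g := by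
  ext1 m
  simp only [paraSeq, paraTerm, Pi.smul_apply, ← Finset.smul_sum, smul_mul_assoc, map_smul]

/-! ### The exponents -/

/-- The range of the exponents. -/
structure Params (α β θ : ℝ) : Prop where
  alpha : α ∈ Ioc (1 : ℝ) 2
  beta : β ∈ Ioc ((2 - 2 * α) / 3) ((1 - α) / 2)
  theta : θ ∈ Ioo ((2 - β) / 2) (β + α)

/-- The regularity gained by `J` on the drift. -/
def gainJ (α β θ : ℝ) : ℝ := (α + 2 - θ - 2 * β) / 2

theorem Params.beta_neg (h : Params α β θ) : β < 0 := by linarith [h.alpha.1, h.beta.2]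

theorem Params.one_lt_theta (h : Params α β θ) : 1 < θ := by linarith [h.beta_neg, h.theta.1]

theorem Params.theta_lt_two (h : Params α β θ) : θ < 2 := by
  linarith [h.beta.2, h.theta.2, h.alpha.2]

theorem Params.gainJ_mem (h : Params α β θ) : gainJ α β θ ∈ Ico 0 α := by
  unfold gainJ
  constructor
  · linarith [h.alpha.2, h.beta_neg, h.theta.2, h.alpha.1]
  · linarith [h.beta.1, h.theta.1]

theorem Params.gainJ_pos (h : Params α β θ) : 0 < θ - 2 + 2 * β + gainJ α β θ := by
  unfold gainJ
  linarith [h.beta.1, h.theta.1]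

theorem Params.reso_pos (h : Params α β θ) : 0 < θ - 1 + (2 * β + α - 1) := by
  linarith [h.beta.1, h.theta.1]

theorem Params.exists_zeta (h : Params α β θ) : ∃ ζ ≤ 2 * θ - 2, ζ ≤ θ - 2 + (β + gainJ α β θ) ∧
    0 < ζ + β := by
  refine ⟨_, min_le_left _ _, min_le_right _ _, ?_⟩
  have := h.gainJ_pos
  rcases min_choice (2 * θ - 2) (θ - 2 + (β + gainJ α β θ)) with e | e <;> rw [e] <;>
    linarith [h.theta.1]

/-! ### The regular part of the product at a fixed time -/

/-- The drift at a fixed time, together with `J^T(V^i)` and `J^T(∂_j V^i)`. -/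
structure Drift (d : ℕ) where
  V : Fin d → BSeq d
  V₂ : Fin d → Fin d → BSeq d
  A : Fin d → BSeq d
  B : Fin d → Fin d → BSeq d

variable (χ) in
/-- The derivative `u'^i = ∂_i u - e_i`. -/
def derE (e : Fin d → ℂ) (x : BSeq d) (i : Fin d) : BSeq d := derSeq χ i x - cst χ (e i)

variable (χ) in
/-- The part `∂_j u^♯ + ∑_i ∂_j u'^i ≺ J^T(V^i)` of the gradient. -/
def sharpSeq (e : Fin d → ℂ) (D : Drift d) (x y : BSeq d) (j : Fin d) : BSeq d :=
  derSeq χ j y + ∑ i, paraSeq χ (derSeq χ j (derE χ e x i)) (D.A i)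

variable (χ) in
/-- The resonant product. -/
abbrev resoSeq (f g : BSeq d) : BSeq d := blocks χ (resoB f g)

variable (χ) in
/-- The product. -/
abbrev prodSeq (f g : BSeq d) : BSeq d := paraSeq χ f g + paraSeq χ g f + resoSeq χ f g

variable (χ) in
/-- The commutator of the paraproduct and the resonant product. -/
abbrev commSeq (f g h : BSeq d) : BSeq d := blocks χ (commB χ (∑' n, f n) f g h)

variable (χ) in
/-- The product `∇u · V` without its most irregular part `∑_j ∂_j u ≺ V^j`. -/
def regProd (e : Fin d → ℂ) (D : Drift d) (x y : BSeq d) : BSeq d :=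
  (∑ j, paraSeq χ (D.V j) (derSeq χ j x)) + ((∑ i, ∑ j, prodSeq χ (derE χ e x i) (D.V₂ i j)) +
    (∑ i, ∑ j, commSeq χ (derE χ e x i) (D.B i j) (D.V j)) +
    ∑ j, resoSeq χ (sharpSeq χ e D x y j) (D.V j))

variable (χ) in
/-- Bounds for the drift at a fixed time. -/
structure DriftBd (α β θ R : ℝ) (D : Drift d) : Prop where
  V : ∀ i, PB β R (D.V i)
  V₂ : ∀ i j, PB (2 * β + α - 1) R (D.V₂ i j)
  A : ∀ i, PB (β + gainJ α β θ) R (D.A i)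
  B : ∀ i j, PB (β - 1 + gainJ α β θ) R (D.B i j)
  blkB : ∀ i j, Blk χ (D.B i j)

/-- Bounds for the difference of two drifts at a fixed time. -/
structure DriftDist (α β θ R : ℝ) (D D' : Drift d) : Prop where
  nonneg : 0 ≤ R
  V : ∀ i, PB β R (D.V i - D'.V i)
  V₂ : ∀ i j, PB (2 * β + α - 1) R (D.V₂ i j - D'.V₂ i j)
  A : ∀ i, PB (β + gainJ α β θ) R (D.A i - D'.A i)
  B : ∀ i j, PB (β - 1 + gainJ α β θ) R (D.B i j - D'.B i j)

theorem derE_sub (e : Fin d → ℂ) (x x' : BSeq d) (i : Fin d) :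
    derE χ e x i - derE χ e x' i = derSeq χ i (x - x') := by
  rw [derE, derE, derSeq_sub]
  abel

theorem exists_derE_le (χ : DyadicPartition d) : ∃ K, 0 ≤ K ∧ ∀ (e : Fin d → ℂ), (∀ i, ‖e i‖ ≤ 1) →
    ∀ (x : BSeq d) (γ C : ℝ), PB γ C x → ∀ i, PB (γ - 1) (K * (1 + C)) (derE χ e x i) := by
  obtain ⟨K, hK, h⟩ := exists_PB_derSeq χ
  refine ⟨K + 1, by positivity, fun e he x γ C hx i => ?_⟩
  have hC := hx.nonneg
  refine ((h i x γ C hx).sub (PB_cst (γ - 1) (e i))).mono le_rfl ?_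
  have := he i
  nlinarith

theorem PB.sum_fin {C : ℝ} {f : Fin d → BSeq d} (h : ∀ i, PB γ C (f i)) :
    PB γ (d * C) (∑ i, f i) := by simpa using PB.sum Finset.univ fun i _ => h i

theorem exists_regProd_diff (χ : DyadicPartition d) (hp : Params α β θ) {R : ℝ} (hR : 0 ≤ R) :
    ∃ K, 0 ≤ K ∧ ∀ (e : Fin d → ℂ), (∀ i, ‖e i‖ ≤ 1) → ∀ (D D' : Drift d) (δ Z Z' : ℝ)
      (x x' y y' : BSeq d), DriftBd χ α β θ R D → DriftBd χ α β θ R D' → DriftDist α β θ δ D D' →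
      Blk χ x → Blk χ x' → PB θ Z (x - x') → PB (2 * θ - 1) Z (y - y') → PB θ Z' x' →
      PB (2 * θ - 1) Z' y' → PB (β + θ - 1) (K * (Z + (1 + Z') * δ))
      (regProd χ e D x y - regProd χ e D' x' y') := by
  have hβ := hp.beta_neg
  have hθ := hp.one_lt_theta
  have hθ2 := hp.theta_lt_two
  have hg := hp.gainJ_pos
  have hκ : β + θ - 1 ≤ 0 := by linarith [hp.theta.2, hp.beta.2]
  have hκ2 : β + θ - 1 ≤ 2 * β + α - 1 := by linarith [hp.theta.2]
  have hκ3 : β ≤ 2 * β + α - 1 := by linarith [hp.alpha.1, hp.beta.1]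
  set g := gainJ α β θ with hgdef
  obtain ⟨ζ, hζ1, hζ2, hζβ⟩ := hp.exists_zeta
  obtain ⟨Kd, hKd, kd⟩ := exists_PB_derSeq χ
  obtain ⟨Ke, hKe, ke⟩ := exists_derE_le χ
  obtain ⟨K₁, hK₁, k₁⟩ := exists_para_diff_neg' χ hβ (θ - 1)
  obtain ⟨K₂, hK₂, k₂⟩ := exists_para_diff_pos χ (show 0 < θ - 1 by linarith) (2 * β + α - 1)
  obtain ⟨K₃, hK₃, k₃⟩ := exists_reso_diff χ hp.reso_pos
  obtain ⟨K₄, hK₄, k₄⟩ := exists_comm_diff χ (γ₁ := θ - 1) (γ₂ := β - 1 + g) (γ₃ := β)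
    ⟨by linarith, by linarith⟩ (by linarith)
  obtain ⟨K₅, hK₅, k₅⟩ := exists_para_diff_neg χ (γ₁ := θ - 1 - 1) (by linarith) (β + g)
  obtain ⟨K₅', hK₅', k₅'⟩ := exists_paraSeq_le_of_neg χ (γ₁ := θ - 1 - 1) (by linarith) (β + g)
  obtain ⟨K₆, hK₆, k₆⟩ := exists_reso_diff χ hζβ
  set S := Kd + d * (K₅ * (Kd * Kd * R + Kd * Ke)) with hS
  set S' := Kd + d * (K₅' * (Kd * Ke * R)) with hS'
  have hS0' : 0 ≤ S' := by positivity
  refine ⟨d * (K₁ * (Kd * R + Kd)) + (d * (d * (K₂ * (Kd * R + Ke) + K₁ * (Kd * R + Ke) +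
    K₃ * (Kd * R + Ke))) + d * (d * (K₄ * (Kd * R * R + 2 * Ke * R))) + d * (K₆ * (S * R + S'))),
    by positivity, fun e he D D' δ Z Z' x x' y y' hD hD' hδ bx bx' hx hy hx' hy' => ?_⟩
  have hZ := hx.nonneg
  have hZ' := hx'.nonneg
  have hδ0 := hδ.nonneg
  set W := Z + (1 + Z') * δ with hW
  have hWδ : 0 ≤ (1 + Z') * δ := by positivity
  have bnd : ∀ {a p q c : ℝ}, 0 ≤ a → 0 ≤ p → 0 ≤ q → c ≤ p * Z + q * ((1 + Z') * δ) →
      a * c ≤ a * (p + q) * W := fun ha hp hq hc => by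
    rw [mul_assoc]
    refine mul_le_mul_of_nonneg_left (hc.trans ?_) ha
    rw [hW]
    linarith [mul_nonneg hp hWδ, mul_nonneg hq hZ]
  have dd : ∀ {γ C : ℝ} {f f' : BSeq d} (j : Fin d), PB γ C (f - f') →
      PB (γ - 1) (Kd * C) (derSeq χ j f - derSeq χ j f') := fun j h => by
    rw [← derSeq_sub]
    exact kd j _ _ _ h
  have dde : ∀ i, PB (θ - 1) (Kd * Z) (derE χ e x i - derE χ e x' i) := fun i => by
    rw [derE_sub]
    exact kd i _ _ _ hx
  have de' := ke e he x' θ Z' hx'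
  have be : ∀ {x : BSeq d} {c : ℝ}, Blk χ x → PB θ c x → ∀ i, Blk χ (derE χ e x i) :=
    fun bx hx i => (bx.der hx i).sub (rep_blocks _).blk
  have bnd' : ∀ {a : ℝ}, 0 ≤ a → a * (Kd * Z * R + Ke * (1 + Z') * δ) ≤ a * (Kd * R + Ke) * W :=
    fun ha => bnd ha (by positivity) hKe (by linarith)
  have t1 : ∀ j, PB (β + θ - 1) (K₁ * (Kd * R + Kd) * W)
      (paraSeq χ (D.V j) (derSeq χ j x) - paraSeq χ (D'.V j) (derSeq χ j x')) := fun j =>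
    (k₁ _ _ _ _ _ _ _ _ (dd j hx) (kd j _ _ _ hx') (hD.V j) (hδ.V j)).mono (by linarith)
      (bnd hK₁ (by positivity) hKd (by linarith [mul_nonneg hKd hδ0]))
  have t2 : ∀ i j, PB (β + θ - 1)
      ((K₂ * (Kd * R + Ke) + K₁ * (Kd * R + Ke) + K₃ * (Kd * R + Ke)) * W)
      (prodSeq χ (derE χ e x i) (D.V₂ i j) - prodSeq χ (derE χ e x' i) (D'.V₂ i j)) := by
    intro i j
    rw [add_sub_add_comm, add_sub_add_comm, add_mul, add_mul]
    exact (((k₂ _ _ _ _ _ _ _ _ (dde i) (de' i) (hD.V₂ i j) (hδ.V₂ i j)).mono hκ2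
      (bnd' hK₂)).add ((k₁ _ _ _ _ _ _ _ _ (dde i) (de' i) ((hD.V₂ i j).mono hκ3 le_rfl)
      ((hδ.V₂ i j).mono hκ3 le_rfl)).mono (by linarith) (bnd' hK₁))).add
      ((k₃ _ _ _ _ _ _ _ _ (dde i) (de' i) (hD.V₂ i j) (hδ.V₂ i j)).mono hκ (bnd' hK₃))
  have t3 : ∀ i j, PB (β + θ - 1) (K₄ * (Kd * R * R + 2 * Ke * R) * W)
      (commSeq χ (derE χ e x i) (D.B i j) (D.V j) -
        commSeq χ (derE χ e x' i) (D'.B i j) (D'.V j)) := fun i j =>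
    (k₄ _ _ _ _ _ _ _ _ R δ (be bx (hx.of_sub hx') i) (be bx' hx' i) (hD.blkB i j)
      (hD'.blkB i j) (dde i) (de' i) (hD.B i j) (hD'.B i j) (hδ.B i j) (hD.V j) (hδ.V j)).mono hκ
      (bnd hK₄ (by positivity) (by positivity) (by linarith))
  have s1 : ∀ j, PB ζ (S * W) (sharpSeq χ e D x y j - sharpSeq χ e D' x' y' j) := by
    intro j
    have a1 := (dd j hy).mono (γ' := ζ) (by linarith)
      (mul_le_mul_of_nonneg_left (show Z ≤ W by linarith) hKd)
    have a2 := PB.sum_fin fun i => (k₅ _ _ _ _ _ _ _ _ (dd j (dde i)) (kd j _ _ _ (de' i)) (hD.A i)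
      (hδ.A i)).mono (γ' := ζ) (by linarith) (bnd (p := Kd * Kd * R) (q := Kd * Ke) hK₅
        (by positivity) (by positivity) (by linarith))
    convert a1.add a2 using 1
    · ring
    · rw [sharpSeq, sharpSeq, add_sub_add_comm, sum_sub_distrib]
  have s2 : ∀ j, PB ζ (S' * (1 + Z')) (sharpSeq χ e D' x' y' j) := by
    intro j
    have a1 := (kd j _ _ _ hy').mono (γ' := ζ) (by linarith)
      (mul_le_mul_of_nonneg_left (show Z' ≤ 1 + Z' by linarith) hKd)
    have a2 := PB.sum_fin fun i =>
      (k₅' _ _ _ _ (kd j _ _ _ (de' i)) (hD'.A i)).mono (γ' := ζ) (by linarith) le_rfl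
    refine (a1.add a2).mono le_rfl (le_of_eq ?_)
    ring
  have t4 : ∀ j, PB (β + θ - 1) (K₆ * (S * R + S') * W)
      (resoSeq χ (sharpSeq χ e D x y j) (D.V j) - resoSeq χ (sharpSeq χ e D' x' y' j) (D'.V j)) := by
    intro j
    refine (k₆ _ _ _ _ _ _ _ _ (s1 j) (s2 j) (hD.V j) (hδ.V j)).mono hκ ?_
    rw [mul_assoc K₆]
    refine mul_le_mul_of_nonneg_left ?_ hK₆
    linarith [mul_nonneg hS0' hZ]
  convert (PB.sum_fin t1).add (((PB.sum_fin fun i => PB.sum_fin (t2 i)).add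
    (PB.sum_fin fun i => PB.sum_fin (t3 i))).add (PB.sum_fin t4)) using 1
  · ring
  · simp only [sum_sub_distrib, regProd]
    abel

end

section

variable {d : ℕ} {χ : DyadicPartition d}
variable {α : ℝ} {ν : Measure (Sphere d)} [IsFiniteMeasure ν]
  [Stable α ν]
variable {M l t γ μ ρ : ℝ} {f g : BPath d}

theorem PBW.congr {T : ℝ} (h : PBW T l γ M f) (e : ∀ t ∈ Icc 0 T, g t = f t) : PBW T l γ M g := fun t ht => by
  rw [e t ht]
  exact h t ht

theorem HOL.congr {T : ℝ} (h : HOL T l μ ρ M f) (e : ∀ t ∈ Icc 0 T, g t = f t) : HOL T l μ ρ M g := fun t r ht htr hr N => by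
  rw [e t ⟨ht, htr.trans hr⟩, e r ⟨ht.trans htr, hr⟩]
  exact h t r ht htr hr N

/-! ### The evolution of the terminal condition -/

theorem exists_HOL_Pseq (χ : DyadicPartition d) (T : ℝ) (hρ : ρ ∈ Icc (0 : ℝ) 1)
    (hγ : μ + α * ρ < γ) : ∃ C, 0 ≤ C ∧ ∀ l ≥ 0, ∀ f M, Blk χ f → PB γ M f →
    HOL T l μ ρ (C * M) fun t => Pseq χ α ν (T - t) f := by
  obtain ⟨C, hC, h⟩ := exists_Pseq_sub_sum_le (ν := ν) χ T hρ hγ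
  refine ⟨C, hC, fun l hl f M hf hM t r ht htr hr N => ?_⟩
  have := h (T - t) ⟨by linarith, by linarith⟩ (T - r) ⟨by linarith, by linarith⟩ f M hf hM N
  rw [show T - t - (T - r) = r - t by ring, abs_of_nonneg (sub_nonneg.2 htr)] at this
  refine this.trans ?_
  have h1 := one_le_wt (T := T) hl (htr.trans hr)
  have h2 := rpow_nonneg (sub_nonneg.2 htr) ρ
  have h3 := hM.nonneg
  exact mul_le_mul_of_nonneg_right (le_mul_of_one_le_right (by positivity) h1) h2

theorem exists_PB_Pseq (χ : DyadicPartition d) (T : ℝ) : ∃ C, 0 ≤ C ∧ ∀ γ f M, PB γ M f →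
    ∀ t ∈ Icc 0 T, PB γ (C * M) (Pseq χ α ν (T - t) f) := by
  obtain ⟨C, hC, h⟩ := exists_norm_Pseq_le (ν := ν) χ T
  refine ⟨C, hC, fun γ f M hM t ht n => ?_⟩
  refine (h (T - t) ⟨by linarith [ht.2], by linarith [ht.1]⟩ f n).trans ?_
  rw [mul_assoc]
  exact mul_le_mul_of_nonneg_left (hM n) hC

theorem CP_Pseq {T : ℝ} {f : BSeq d} (hf : Blk χ f) (hM : PB γ M f) :
    CP χ T γ fun t => Pseq χ α ν (T - t) f := by
  have hα := Stable.index (ν := ν)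
  obtain ⟨C, _, h⟩ := exists_PB_Pseq (ν := ν) χ T
  obtain ⟨C', _, h'⟩ := exists_HOL_Pseq (ν := ν) χ T (μ := γ - 3) (ρ := 1) (γ := γ)
    ⟨zero_le_one, le_rfl⟩ (by linarith [hα.2])
  exact ⟨fun t ht => hf.Pseq (sub_nonneg.2 ht.2),
    (h' 0 le_rfl f M hf hM).continuousOn le_rfl one_pos, _, fun t ht => h γ f M hM t ht⟩

/-! ### The data of the equation -/

/-- The data of the equation: the enhanced drift, the terminal condition, and a source term. -/
structure SD (d : ℕ) where
  V : Fin d → BPath d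
  V₂ : Fin d → Fin d → BPath d
  uT : BSeq d
  f₀ : BPath d

variable (χ α ν) in
/-- The drift of the data at a fixed time. -/
def SD.drift (T : ℝ) (S : SD d) (t : ℝ) : Drift d where
  V i := S.V i t
  V₂ i j := S.V₂ i j t
  A i := Jseq χ α ν T (S.V i) t
  B i j := Jseq χ α ν T (fun r => derSeq χ j (S.V i r)) t

variable (χ) in
/-- The data are of the given regularity, and bounded by `R`. -/
structure SD.Bd (α β θ T R : ℝ) (S : SD d) : Prop where
  cpV : ∀ i, CP χ T β (S.V i)
  cpV₂ : ∀ i j, CP χ T (2 * β + α - 1) (S.V₂ i j)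
  cpf : CP χ T (β + θ - 1) S.f₀
  blk : Blk χ S.uT
  V : ∀ i, ∀ t ∈ Icc 0 T, PB β R (S.V i t)
  V₂ : ∀ i j, ∀ t ∈ Icc 0 T, PB (2 * β + α - 1) R (S.V₂ i j t)
  uT : PB (2 * θ - 1) R S.uT
  f₀ : ∀ t ∈ Icc 0 T, PB (β + θ - 1) R (S.f₀ t)

/-- The data differ by at most `D`. -/
structure SD.Dist (α β θ T D : ℝ) (S S' : SD d) : Prop where
  V : ∀ i, ∀ t ∈ Icc 0 T, PB β D (S.V i t - S'.V i t)
  V₂ : ∀ i j, ∀ t ∈ Icc 0 T, PB (2 * β + α - 1) D (S.V₂ i j t - S'.V₂ i j t)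
  uT : PB (2 * θ - 1) D (S.uT - S'.uT)
  f₀ : ∀ t ∈ Icc 0 T, PB (β + θ - 1) D (S.f₀ t - S'.f₀ t)

theorem exists_PB_Jseq (χ : DyadicPartition d) {T : ℝ} (hT : 0 < T) {g : ℝ} (hg : g ∈ Ico 0 α) :
    ∃ C, 0 ≤ C ∧ ∀ γ M v, (∀ t ∈ Icc 0 T, PB γ M (v t)) → ∀ t ∈ Icc 0 T, PB (γ + g) (C * M)
      (Jseq χ α ν T v t) := by
  have hα := Stable.index (ν := ν)
  have hα0 : 0 < α := Stable.pos ν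
  obtain ⟨K, hK0, hK⟩ := exists_PBW_Jseq (ν := ν) χ hT (g := g) (y := 0)
    ⟨hg.1, by linarith [hg.2, hα.2]⟩ ⟨le_rfl, zero_le_one⟩ (by
      rw [add_zero, div_lt_one hα0]
      exact hg.2)
  refine ⟨K * exp (1 * T), by positivity, fun γ M v hv t ht => ?_⟩
  have hJ := hK 1 one_pos γ M v (PBW.of_PB zero_le_one hv)
  refine (hJ t ht).mono le_rfl ?_
  have hM := (hv t ht).nonneg
  have h1 := wt_le (T := T) zero_le_one ht.1
  rw [Real.one_rpow, mul_one]
  calc _ ≤ K * M * exp (1 * T) := by gcongr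
    _ = _ := by ring

theorem exists_driftBd (χ : DyadicPartition d) {β θ : ℝ} (hp : Params α β θ) {T : ℝ} (hT : 0 < T) :
    ∃ K, 1 ≤ K ∧ (∀ (R : ℝ) (S : SD d), S.Bd χ α β θ T R → ∀ t ∈ Icc 0 T, DriftBd χ α β θ (K * R)
      (S.drift χ α ν T t)) ∧ ∀ (R D : ℝ) (S S' : SD d), S.Bd χ α β θ T R → S'.Bd χ α β θ T R →
      SD.Dist α β θ T D S S' → ∀ t ∈ Icc 0 T, DriftDist α β θ (K * D) (S.drift χ α ν T t)
      (S'.drift χ α ν T t) := by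
  obtain ⟨C, hC, h⟩ := exists_PB_Jseq (ν := ν) χ hT hp.gainJ_mem
  obtain ⟨Kd, hKd, kd⟩ := exists_PB_derSeq χ
  have b1 : 1 ≤ 1 + C + C * Kd := by nlinarith
  have b2 : C ≤ 1 + C + C * Kd := by nlinarith
  have b3 : C * Kd ≤ 1 + C + C * Kd := by linarith
  refine ⟨1 + C + C * Kd, b1, fun R S hS t ht => ?_, fun R D S S' hS hS' hD t ht => ?_⟩
  · have hR := hS.uT.nonneg
    refine ⟨fun i => (hS.V i t ht).mono le_rfl (le_mul_of_one_le_left hR b1),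
      fun i j => (hS.V₂ i j t ht).mono le_rfl (le_mul_of_one_le_left hR b1),
      fun i => (h _ _ _ (hS.V i) t ht).mono le_rfl (by gcongr), fun i j => ?_,
      fun i j => ((hS.cpV i).der j).blk_Jseq ht⟩
    refine (h _ _ _ (fun r hr => kd j _ _ _ (hS.V i r hr)) t ht).mono le_rfl ?_
    rw [← mul_assoc]
    gcongr
  · have hR := hD.uT.nonneg
    refine ⟨by positivity, fun i => (hD.V i t ht).mono le_rfl (le_mul_of_one_le_left hR b1),
      fun i j => (hD.V₂ i j t ht).mono le_rfl (le_mul_of_one_le_left hR b1), fun i => ?_,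
      fun i j => ?_⟩
    · have := h _ _ (S.V i - S'.V i) (hD.V i) t ht
      rw [Jseq_sub (hS.cpV i) (hS'.cpV i) ht] at this
      exact this.mono le_rfl (by gcongr)
    · have := h _ (Kd * D) ((fun r => derSeq χ j (S.V i r)) - fun r => derSeq χ j (S'.V i r))
        (fun r hr => by
          rw [Pi.sub_apply, ← derSeq_sub]
          exact kd j _ _ _ (hD.V i r hr)) t ht
      rw [Jseq_sub ((hS.cpV i).der j) ((hS'.cpV i).der j) ht] at this
      refine this.mono le_rfl ?_
      rw [← mul_assoc]
      gcongr

/-! ### The fixed point map on sequences of blocks -/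

section Map

variable (χ α ν) (T : ℝ) (e : Fin d → ℂ) (S : SD d) (u s : BPath d)

/-- The regular part of the right-hand side. -/
def regPath (t : ℝ) : BSeq d := regProd χ e (S.drift χ α ν T t) (u t) (s t) - S.f₀ t

/-- The irregular part of the right-hand side. -/
def irrPath (t : ℝ) : BSeq d := ∑ i, (paraSeq χ (derSeq χ i (u t)) (S.V i t) - e i • S.V i t)

/-- The first component of the fixed point map. -/
def Phi (t : ℝ) : BSeq d :=
  Pseq χ α ν (T - t) S.uT + Jseq χ α ν T (irrPath χ e S u + regPath χ α ν T e S u s) t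

/-- The remainder of the first component of the fixed point map. -/
def PhiSharp (t : ℝ) : BSeq d :=
  Phi χ α ν T e S u s t - ∑ i, paraSeq χ (derE χ e (u t) i) (Jseq χ α ν T (S.V i) t)

end Map

variable {β θ T R : ℝ} {e : Fin d → ℂ} {S : SD d} {u s : BPath d}

theorem CP.derE (hu : CP χ T γ u) (e : Fin d → ℂ) (i : Fin d) :
    CP χ T (γ - 1) fun t => derE χ e (u t) i :=
  (hu.der i).sub (CP_cst T (γ - 1) (e i))

theorem CP_irrPath (hp : Params α β θ) (hS : S.Bd χ α β θ T R) (hu : CP χ T θ u) :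
    CP χ T β (irrPath χ e S u) := by
  have : irrPath χ e S u = ∑ i, ((fun t => paraSeq χ (derSeq χ i (u t)) (S.V i t)) - e i • S.V i) := by
    ext1 t
    simp [irrPath]
  rw [this]
  exact CP.sum _ fun i _ => ((hu.der i).para_of_pos (hS.cpV i) (by linarith [hp.one_lt_theta])).sub
    ((hS.cpV i).smul _)

theorem CP_sharpSeq (hp : Params α β θ) (hT : 0 < T) (hS : S.Bd χ α β θ T R) (hu : CP χ T θ u)
    (hs : CP χ T (2 * θ - 1) s) : ∃ ζ, 0 < ζ + β ∧ ∀ j, CP χ T ζ fun t =>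
    sharpSeq χ e (S.drift χ α ν T t) (u t) (s t) j := by
  have hθ2 := hp.theta_lt_two
  obtain ⟨ζ, hζ1, hζ2, hζβ⟩ := hp.exists_zeta
  refine ⟨ζ, hζβ, fun j => ?_⟩
  have : (fun t => sharpSeq χ e (S.drift χ α ν T t) (u t) (s t) j) = (fun t => derSeq χ j (s t)) +
      ∑ i, fun t => paraSeq χ (derSeq χ j (derE χ e (u t) i)) (Jseq χ α ν T (S.V i) t) := by
    ext1 t
    simp [sharpSeq, SD.drift]
  rw [this]
  refine ((hs.der j).mono (by linarith)).add (CP.sum _ fun i _ => ?_)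
  exact (((hu.derE (χ := χ) e i).der j).para_of_neg ((hS.cpV i).Jseq hT hp.gainJ_mem) (by linarith)).mono (by linarith)

theorem CP_regPath (hp : Params α β θ) (hT : 0 < T) (hS : S.Bd χ α β θ T R) (hu : CP χ T θ u)
    (hs : CP χ T (2 * θ - 1) s) : CP χ T (β + θ - 1) (regPath χ α ν T e S u s) := by
  have hβ := hp.beta_neg
  have hθ := hp.one_lt_theta
  have hθ2 := hp.theta_lt_two
  have hg := hp.gainJ_pos
  have hr := hp.reso_pos
  have hκ : β + θ - 1 ≤ 0 := by linarith [hp.theta.2, hp.beta.2]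
  have hκ2 : β + θ - 1 ≤ 2 * β + α - 1 := by linarith [hp.theta.2]
  have hκ3 : β ≤ 2 * β + α - 1 := by linarith [hp.alpha.1, hp.beta.1]
  set g := gainJ α β θ with hgdef
  have cB : ∀ i j, CP χ T (β - 1 + g) (Jseq χ α ν T (fun r => derSeq χ j (S.V i r))) := fun i j =>
    ((hS.cpV i).der j).Jseq hT hp.gainJ_mem
  have cE := fun i => hu.derE (χ := χ) e i
  obtain ⟨ζ, hζβ, cS⟩ := CP_sharpSeq (ν := ν) (e := e) hp hT hS hu hs
  have : regPath χ α ν T e S u s = ((∑ j, fun t => paraSeq χ (S.V j t) (derSeq χ j (u t))) +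
    ((∑ i, ∑ j, fun t => prodSeq χ (derE χ e (u t) i) (S.V₂ i j t)) + (∑ i, ∑ j, fun t =>
      commSeq χ (derE χ e (u t) i) (Jseq χ α ν T (fun r => derSeq χ j (S.V i r)) t) (S.V j t)) +
    ∑ j, fun t => resoSeq χ (sharpSeq χ e (S.drift χ α ν T t) (u t) (s t) j) (S.V j t))) - S.f₀ := by
    ext1 t
    simp [regPath, regProd, SD.drift]
  rw [this]
  refine CP.sub (CP.add (CP.sum _ fun j _ => ?_) (CP.add (CP.add (CP.sum _ fun i _ =>
    CP.sum _ fun j _ => CP.add (CP.add ?_ ?_) ?_) (CP.sum _ fun i _ => CP.sum _ fun j _ => ?_))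
    (CP.sum _ fun j _ => ?_))) hS.cpf
  · exact ((hS.cpV j).para_of_neg (hu.der j) hβ).mono (by linarith)
  · exact ((cE i).para_of_pos (hS.cpV₂ i j) (by linarith)).mono hκ2
  · exact (((hS.cpV₂ i j).mono hκ3).para_of_neg (cE i) hβ).mono (by linarith)
  · exact (CP.blocks (continuousOn_resoB (cE i) (hS.cpV₂ i j) hr)).mono hκ
  · exact (CP.blocks (continuousOn_commB (cE i) (cB i j) (hS.cpV j) ⟨by linarith, by linarith⟩
      (by linarith))).mono hκ
  · exact (CP.blocks (continuousOn_resoB (cS j) (hS.cpV j) hζβ)).mono hκ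

/-- The regularity gained by `J`, with some room. -/
def gainT (α β θ : ℝ) : ℝ := (θ - β + α) / 2

/-- The exponent of the small factor. -/
def smallT (α β θ : ℝ) : ℝ := (α + β - θ) / (4 * α)

theorem Params.gainT_mem (hp : Params α β θ) : gainT α β θ ∈ Ico 0 α := by
  unfold gainT
  constructor
  · linarith [hp.alpha.1, hp.one_lt_theta, hp.beta_neg]
  · linarith [hp.theta.2]

theorem Params.smallT_pos (hp : Params α β θ) : 0 < smallT α β θ := by
  have := hp.alpha.1
  have := hp.theta.2
  exact div_pos (by linarith) (by linarith)

theorem Params.smallT_mem (hp : Params α β θ) : smallT α β θ ∈ Icc (0 : ℝ) 1 := by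
  refine ⟨hp.smallT_pos.le, ?_⟩
  have := hp.alpha.1
  have := hp.beta_neg
  have := hp.one_lt_theta
  rw [smallT, div_le_one (by linarith)]
  linarith

theorem Params.gainT_add_smallT (hp : Params α β θ) : gainT α β θ / α + smallT α β θ < 1 := by
  have := hp.alpha.1
  have := hp.theta.2
  have hα : 0 < α := by linarith
  have : gainT α β θ / α + smallT α β θ = (3 * α + θ - β) / (4 * α) := by
    unfold gainT smallT
    field_simp
    ring
  rw [this, div_lt_one (by linarith)]
  linarith

theorem Params.le_beta_add_gainT (hp : Params α β θ) : θ < β + gainT α β θ := by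
  unfold gainT
  linarith [hp.theta.2]

theorem Phi_eq (hp : Params α β θ) (hT : 0 < T) (hS : S.Bd χ α β θ T R) (hu : CP χ T θ u)
    (hs : CP χ T (2 * θ - 1) s) (ht : t ∈ Icc 0 T) :
    Phi χ α ν T e S u s t = Pseq χ α ν (T - t) S.uT +
      ((∑ i, (Jseq χ α ν T (fun r => paraSeq χ (derSeq χ i (u r)) (S.V i r)) t - e i • Jseq χ α ν T
      (S.V i) t)) + Jseq χ α ν T (regPath χ α ν T e S u s) t) := by
  have hθ := hp.one_lt_theta
  have c1 := fun i => (hu.der i).para_of_pos (hS.cpV i) (by linarith)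
  have : irrPath χ e S u = ∑ i, ((fun t => paraSeq χ (derSeq χ i (u t)) (S.V i t)) - e i • S.V i) := by
    ext1 t
    simp [irrPath]
  rw [Phi, Jseq_add (CP_irrPath hp hS hu) (CP_regPath hp hT hS hu hs) ht, this,
    Jseq_sum _ (fun i _ => (c1 i).sub ((hS.cpV i).smul (e i))) ht]
  congr 2
  refine sum_congr rfl fun i _ => ?_
  rw [Jseq_sub (c1 i) ((hS.cpV i).smul (e i)) ht, Jseq_smul]

variable (χ α ν) in
/-- The commutator of `J^T` and `g ≺ ·`, with a correction by the low frequencies of `c J^T(v)`. -/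
def remJ (T : ℝ) (c : ℂ) (g v : BPath d) (t : ℝ) : BSeq d :=
  commJ χ α ν T g v t - c • (Jseq χ α ν T v t - paraSeq χ (cst χ 1) (Jseq χ α ν T v t))

theorem PhiSharp_eq (hp : Params α β θ) (hT : 0 < T) (hS : S.Bd χ α β θ T R) (hu : CP χ T θ u)
    (hs : CP χ T (2 * θ - 1) s) (ht : t ∈ Icc 0 T) :
    PhiSharp χ α ν T e S u s t = Pseq χ α ν (T - t) S.uT +
      ((∑ i, remJ χ α ν T (e i) (fun r => derSeq χ i (u r)) (S.V i) t) + Jseq χ α ν T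
      (regPath χ α ν T e S u s) t) := by
  rw [PhiSharp, Phi_eq hp hT hS hu hs ht, add_sub_assoc, add_sub_right_comm,
    ← sum_sub_distrib]
  congr 2
  refine sum_congr rfl fun i _ => ?_
  rw [derE, paraSeq_sub_left, cst_eq_smul, paraSeq_smul_left, remJ, commJ, smul_sub]
  abel

end

section

variable {d : ℕ} {χ : DyadicPartition d}
variable {α : ℝ} {ν : Measure (Sphere d)} [IsFiniteMeasure ν]
  [Stable α ν]
variable {β θ T : ℝ}
variable {s u : BPath d} {R : ℝ} {e : Fin d → ℂ} {S : SD d}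

/-! ### Estimates for the fixed point map -/

/-- The weighted bounds for a path `u` and its remainder `s`. -/
structure SB (T l α θ M N : ℝ) (u s : BPath d) : Prop where
  pb : PBW T l θ M u
  hol₀ : HOL T l 0 (θ / α) M u
  hol₁ : HOL T l 1 ((θ - 1) / α) M u
  pbs : PBW T l (2 * θ - 1) N s

theorem SB.mono {l M N M' N' : ℝ} (h : SB T l α θ M N u s) (hM : M ≤ M') (hN : N ≤ N') :
    SB T l α θ M' N' u s :=
  ⟨h.pb.mono le_rfl hM, h.hol₀.mono hM, h.hol₁.mono hM, h.pbs.mono le_rfl hN⟩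

theorem exists_irrPath_diff (χ : DyadicPartition d) (hp : Params α β θ) (T R : ℝ) :
    ∃ K, 0 ≤ K ∧ ∀ l ≥ 0, ∀ (e : Fin d → ℂ), (∀ i, ‖e i‖ ≤ 1) → ∀ (S S' : SD d) (D M M' : ℝ)
      (u u' : BPath d), 0 ≤ M → 0 ≤ M' → S.Bd χ α β θ T R → SD.Dist α β θ T D S S' →
      PBW T l θ M (u - u') → PBW T l θ M' u' → PBW T l β (K * (M + (1 + M') * D))
      (irrPath χ e S u - irrPath χ e S' u') := by
  obtain ⟨Kd, hKd, kd⟩ := exists_PB_derSeq χ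
  obtain ⟨K₂, hK₂, k₂⟩ := exists_para_diff_pos χ (show 0 < θ - 1 by linarith [hp.one_lt_theta]) β
  refine ⟨d * (K₂ * Kd * |R| + K₂ * Kd + 1), by positivity,
    fun l hl e he S S' D M M' u u' hM0 hM0' hS hD hM hM' t ht => ?_⟩
  have hR := hS.uT.nonneg
  have hD0 := hD.uT.nonneg
  have hw := wt_pos l T t
  have hw1 := one_le_wt (T := T) hl ht.2
  set w := wt l T t with hwdef
  have e1 : (irrPath χ e S u - irrPath χ e S' u') t = ∑ i,
      ((paraSeq χ (derSeq χ i (u t)) (S.V i t) - paraSeq χ (derSeq χ i (u' t)) (S'.V i t)) -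
        e i • (S.V i t - S'.V i t)) := by
    rw [Pi.sub_apply, irrPath, irrPath, ← sum_sub_distrib]
    refine sum_congr rfl fun i _ => ?_
    rw [smul_sub]
    abel
  rw [e1]
  have h : ∀ i, PB β ((K₂ * Kd * |R| + K₂ * Kd + 1) * (M + (1 + M') * D) * w)
      ((paraSeq χ (derSeq χ i (u t)) (S.V i t) - paraSeq χ (derSeq χ i (u' t)) (S'.V i t)) -
        e i • (S.V i t - S'.V i t)) := by
    intro i
    have a1 : PB (θ - 1) (Kd * (M * w)) (derSeq χ i (u t) - derSeq χ i (u' t)) := by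
      rw [← derSeq_sub]
      exact kd i _ _ _ (hM t ht)
    refine ((k₂ _ _ _ _ _ _ _ _ a1 (kd i _ _ _ (hM' t ht)) (hS.V i t ht) (hD.V i t ht)).sub
      ((hD.V i t ht).smul (e i))).mono le_rfl ?_
    rw [abs_of_nonneg hR]
    have b1 : ‖e i‖ * D ≤ 1 * (D * w) :=
      mul_le_mul (he i) (le_mul_of_one_le_right hD0 hw1) hD0 zero_le_one
    have b2 : 0 ≤ K₂ * Kd * R * ((1 + M') * D) * w := by positivity
    have b3 : 0 ≤ K₂ * Kd * (M + D) * w := by positivity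
    have b4 : 0 ≤ (M + M' * D) * w := by positivity
    nlinarith
  refine (PB.sum Finset.univ fun i _ => h i).mono le_rfl (le_of_eq ?_)
  rw [sum_const, Finset.card_univ, Fintype.card_fin, nsmul_eq_mul]
  ring

theorem exists_regPath_diff (χ : DyadicPartition d) (hp : Params α β θ) (hT : 0 < T) (R : ℝ) :
    ∃ K, 0 ≤ K ∧ ∀ l ≥ 0, ∀ (e : Fin d → ℂ), (∀ i, ‖e i‖ ≤ 1) → ∀ (S S' : SD d) (D Z Z' : ℝ)
      (u u' s s' : BPath d), S.Bd χ α β θ T R → S'.Bd χ α β θ T R → SD.Dist α β θ T D S S' →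
      CP χ T θ u → CP χ T θ u' → PBW T l θ Z (u - u') → PBW T l (2 * θ - 1) Z (s - s') →
      PBW T l θ Z' u' → PBW T l (2 * θ - 1) Z' s' → PBW T l (β + θ - 1) (K * (Z + (1 + Z') * D))
      (regPath χ α ν T e S u s - regPath χ α ν T e S' u' s') := by
  obtain ⟨K₁, hK₁, k₁, k₁'⟩ := exists_driftBd (ν := ν) χ hp hT
  obtain ⟨K, hK, k⟩ := exists_regProd_diff χ hp (R := K₁ * |R|) (by positivity)
  refine ⟨K * K₁ + 1, by positivity, fun l hl e he S S' D Z Z' u u' s s' hS hS' hD cu cu' hu hs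
    hu' hs' t ht => ?_⟩
  rw [abs_of_nonneg hS.uT.nonneg] at k
  have hZ := hu.nonneg hT.le
  have hZ' := hu'.nonneg hT.le
  have hD0 := hD.uT.nonneg
  have hw := wt_pos l T t
  have hw1 := one_le_wt (T := T) hl ht.2
  set w := wt l T t with hwdef
  have := (k e he _ _ _ _ _ _ _ _ _ (k₁ R S hS t ht) (k₁ R S' hS' t ht)
    (k₁' R D S S' hS hS' hD t ht) (cu.blk t ht) (cu'.blk t ht) (hu t ht) (hs t ht) (hu' t ht)
    (hs' t ht)).sub (hD.f₀ t ht)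
  rw [← sub_sub_sub_comm] at this
  refine this.mono le_rfl ?_
  have b1 : D ≤ D * w := le_mul_of_one_le_right hD0 hw1
  have b2 : Z * w + (1 + Z' * w) * (K₁ * D) ≤ K₁ * (Z + (1 + Z') * D) * w := by
    have c1 : Z * w ≤ K₁ * (Z * w) := le_mul_of_one_le_left (by positivity) hK₁
    have c2 : (1 + Z' * w) * (K₁ * D) ≤ (w + Z' * w) * (K₁ * D) := by gcongr
    linarith
  have b3 : 0 ≤ (Z + Z' * D) * w := by positivity
  have b4 := mul_le_mul_of_nonneg_left b2 hK
  linarith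

theorem CP_rhs (hp : Params α β θ) (hT : 0 < T) (hS : S.Bd χ α β θ T R) (hu : CP χ T θ u)
    (hs : CP χ T (2 * θ - 1) s) : CP χ T β (irrPath χ e S u + regPath χ α ν T e S u s) :=
  (CP_irrPath hp hS hu).add ((CP_regPath hp hT hS hu hs).mono (by linarith [hp.one_lt_theta]))

theorem exists_HOL_der (χ : DyadicPartition d) : ∃ K, 0 ≤ K ∧ ∀ (i : Fin d) (l ρ M : ℝ)
    (u : BPath d), HOL T l 1 ρ M u → HOL T l 0 ρ (K * M) fun t => derSeq χ i (u t) := by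
  obtain ⟨K, hK, k⟩ := exists_derSeq_le χ
  refine ⟨K, hK, fun i l ρ M u hu t r ht htr hr N => ?_⟩
  have := mul_le_mul_of_nonneg_left (hu t r ht htr hr N) hK
  rw [mul_sum] at this
  rw [mul_assoc, mul_assoc, ← mul_assoc M]
  refine le_trans (sum_le_sum fun n _ => ?_) this
  have h2 := k i (u t - u r) n
  rw [derSeq_sub] at h2
  simp only [Pi.sub_apply] at h2
  rw [← mul_assoc, pw_zero_left, one_mul]
  exact h2

theorem Pseq_sub (s : ℝ) (f g : BSeq d) : Pseq χ α ν s (f - g) = Pseq χ α ν s f - Pseq χ α ν s g := by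
  ext1 n
  simp only [Pseq, Pi.sub_apply, map_sub]

theorem PhiSharp_sub_eq (hp : Params α β θ) (hT : 0 < T) {S' : SD d} {u' s' : BPath d}
    (hS : S.Bd χ α β θ T R) (hS' : S'.Bd χ α β θ T R) (cu : CP χ T θ u) (cu' : CP χ T θ u')
    (cs : CP χ T (2 * θ - 1) s) (cs' : CP χ T (2 * θ - 1) s') {t : ℝ} (ht : t ∈ Icc 0 T) :
    (PhiSharp χ α ν T e S u s - PhiSharp χ α ν T e S' u' s') t =
      ((fun t => Pseq χ α ν (T - t) (S.uT - S'.uT)) +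
      ((∑ i, (commJ χ α ν T (fun r => derSeq χ i ((u - u') r)) (S.V i) + remJ χ α ν T (e i)
      (fun r => derSeq χ i (u' r)) (S.V i - S'.V i))) + Jseq χ α ν T (regPath χ α ν T e S u s -
      regPath χ α ν T e S' u' s'))) t := by
  have h : ∀ i, remJ χ α ν T (e i) (fun r => derSeq χ i (u r)) (S.V i) t -
      remJ χ α ν T (e i) (fun r => derSeq χ i (u' r)) (S'.V i) t =
      (commJ χ α ν T (fun r => derSeq χ i ((u - u') r)) (S.V i) +
        remJ χ α ν T (e i) (fun r => derSeq χ i (u' r)) (S.V i - S'.V i)) t := by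
    intro i
    have e3 : (fun r => derSeq χ i ((u - u') r)) =
        (fun r => derSeq χ i (u r)) - fun r => derSeq χ i (u' r) :=
      funext fun r => derSeq_sub _ _ _
    rw [Pi.add_apply, remJ, remJ, remJ, ← add_sub_assoc, e3, ← commJ_sub
      (show 0 < θ - 1 by linarith [hp.one_lt_theta]) (cu.der i) (cu'.der i) (hS.cpV i) (hS'.cpV i)
      ht, Jseq_sub (hS.cpV i) (hS'.cpV i) ht, paraSeq_sub_right, sub_sub_sub_comm, ← smul_sub,
      sub_sub_sub_comm]
  rw [Pi.sub_apply, PhiSharp_eq hp hT hS cu cs ht, PhiSharp_eq hp hT hS' cu' cs' ht,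
    add_sub_add_comm, add_sub_add_comm, ← Jseq_sub (CP_regPath hp hT hS cu cs)
    (CP_regPath hp hT hS' cu' cs') ht, Pi.add_apply, Pi.add_apply, ← Pseq_sub,
    ← sum_sub_distrib, Finset.sum_apply, sum_congr rfl fun i _ => h i]

theorem exists_PBW_remJ (χ : DyadicPartition d) (hp : Params α β θ) (hT : 0 < T) :
    ∃ K, 0 ≤ K ∧ ∀ l ≥ 0, ∀ (c : ℂ) (i : Fin d) (M R : ℝ) (u v : BPath d), CP χ T θ u → CP χ T β v →
      PBW T l θ M u → HOL T l 1 ((θ - 1) / α) M u → (∀ t ∈ Icc 0 T, PB β R (v t)) →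
      PBW T l (θ - 1 + β + gainT α β θ) (K * (M * R)) (commJ χ α ν T (fun r => derSeq χ i (u r)) v)
      ∧ PBW T l (θ - 1 + β + gainT α β θ) (K * ((M + ‖c‖) * R))
      (remJ χ α ν T c (fun r => derSeq χ i (u r)) v) := by
  have hθ := hp.one_lt_theta
  obtain ⟨Kc, hKc, kc⟩ := exists_PBW_commJ (ν := ν) χ hT (γ₁ := θ - 1) (γ₂ := β)
    ⟨by linarith, by linarith [hp.theta_lt_two]⟩ hp.gainT_mem
  obtain ⟨Kd, hKd, kd⟩ := exists_PB_derSeq χ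
  obtain ⟨Kh, hKh, kh⟩ := exists_HOL_der (T := T) χ
  obtain ⟨K₁, hK₁, k₁⟩ := exists_sub_paraSeq_one_le χ (β + gainT α β θ) (θ - 1 + β + gainT α β θ)
  obtain ⟨Kv, hKv, kv⟩ := exists_PB_Jseq (ν := ν) χ hT hp.gainT_mem
  refine ⟨Kc * (Kd + Kh) + K₁ * Kv, by positivity, fun l hl c i M R u v cu cv hu hh hv => ?_⟩
  have hM := hu.nonneg hT.le
  have hR := (hv 0 ⟨le_rfl, hT.le⟩).nonneg
  have a0 : PBW T l (θ - 1) (Kd * M) fun r => derSeq χ i (u r) := fun t ht => by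
    rw [mul_assoc]
    exact kd i _ _ _ (hu t ht)
  have a1 := kc l hl _ _ ((Kd + Kh) * M) R (cu.der i) cv (a0.mono le_rfl (by gcongr; linarith))
    ((kh i _ _ _ _ hh).mono (by gcongr; linarith)) hv
  have a2 := PBW.of_PB hl fun t ht => (k₁ _ _ (cv.blk_Jseq ht) (kv _ _ _ hv t ht)).smul c
  have p1 : 0 ≤ K₁ * Kv * (M * R) := by positivity
  have p2 : 0 ≤ Kc * (Kd + Kh) * (‖c‖ * R) := by positivity
  exact ⟨a1.mono le_rfl (by linarith), (a1.sub a2).mono le_rfl (by linarith)⟩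

theorem Params.rho_mem (hp : Params α β θ) :
    θ / α ∈ Icc (0 : ℝ) 1 ∧ (θ - 1) / α ∈ Icc (0 : ℝ) 1 ∧ α * (θ / α) = θ ∧ α * ((θ - 1) / α) =
      θ - 1 := by
  have hα0 : 0 < α := one_pos.trans hp.alpha.1
  have hθ := hp.one_lt_theta
  have hθα : θ < α := by linarith [hp.theta.2, hp.beta_neg]
  exact ⟨⟨by positivity, (div_le_one hα0).2 hθα.le⟩,
    ⟨div_nonneg (by linarith) hα0.le, (div_le_one hα0).2 (by linarith)⟩,
    mul_div_cancel₀ _ hα0.ne', mul_div_cancel₀ _ hα0.ne'⟩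

theorem exists_HOL_Pseq_theta (χ : DyadicPartition d) (hp : Params α β θ) (T : ℝ) :
    ∃ C, 0 ≤ C ∧ ∀ l ≥ 0, ∀ f M, Blk χ f → PB (2 * θ - 1) M f → HOL T l 0 (θ / α) (C * M)
      (fun t => Pseq χ α ν (T - t) f) ∧ HOL T l 1 ((θ - 1) / α) (C * M) fun t =>
      Pseq χ α ν (T - t) f := by
  obtain ⟨hρ₀, hρ₁, hαρ₀, hαρ₁⟩ := hp.rho_mem
  have hθ := hp.one_lt_theta
  obtain ⟨K₀, hK₀, k₀⟩ := exists_HOL_Pseq (ν := ν) χ T (μ := 0) (γ := 2 * θ - 1) hρ₀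
    (by linarith)
  obtain ⟨K₁, hK₁, k₁⟩ := exists_HOL_Pseq (ν := ν) χ T (μ := 1) (γ := 2 * θ - 1) hρ₁
    (by linarith)
  refine ⟨K₀ + K₁, by positivity, fun l hl f M hf hM => ?_⟩
  have h0 := hM.nonneg
  exact ⟨(k₀ l hl f M hf hM).mono (mul_le_mul_of_nonneg_right (by linarith) h0),
    (k₁ l hl f M hf hM).mono (mul_le_mul_of_nonneg_right (by linarith) h0)⟩

theorem exists_HOL_Jseq_theta (χ : DyadicPartition d) (hp : Params α β θ) (hT : 0 < T) :
    ∃ C, 0 ≤ C ∧ ∀ l > 0, ∀ M γ' v, CP χ T γ' v → PBW T l β M v →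
      HOL T l 0 (θ / α) (C * l ^ (-smallT α β θ) * M) (Jseq χ α ν T v) ∧
      HOL T l 1 ((θ - 1) / α) (C * l ^ (-smallT α β θ) * M) (Jseq χ α ν T v) := by
  have hα := hp.alpha
  have hα0 : 0 < α := one_pos.trans hα.1
  have hβ := hp.beta_neg
  have hθ := hp.one_lt_theta
  have hgT := hp.gainT_mem
  have hgT5 : gainT α β θ ∈ Icc (0 : ℝ) 5 := ⟨hgT.1, by linarith [hgT.2, hα.2]⟩
  have hβg := hp.le_beta_add_gainT
  obtain ⟨hρ₀, hρ₁, hαρ₀, hαρ₁⟩ := hp.rho_mem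
  have hx : (3 * α - 3 * θ - β) / 4 / α + smallT α β θ = 1 - θ / α := by
    unfold smallT
    field_simp
    ring
  obtain ⟨Kj₀, hKj₀, kj₀⟩ := exists_HOL_Jseq (ν := ν) χ hT (μ := 0) (γ := β)
    (x := (3 * α - 3 * θ - β) / 4) hρ₀ (by positivity)
    ⟨by linarith [hp.theta.2], by linarith [hα.2, hp.beta.1]⟩ hgT5 hp.smallT_mem hx (by linarith [hp.theta.2])
    hp.gainT_add_smallT (by linarith)
  obtain ⟨Kj₁, hKj₁, kj₁⟩ := exists_HOL_Jseq (ν := ν) χ hT (μ := 1) (γ := β)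
    (x := (3 * α - 3 * θ - β) / 4 + 1) hρ₁ (div_pos (by linarith) hα0)
    ⟨by linarith [hp.theta.2], by linarith [hα.2, hp.beta.1]⟩ hgT5 hp.smallT_mem
    (by rw [add_div, add_right_comm, hx]; ring) (by linarith [hp.theta.2])
    hp.gainT_add_smallT (by linarith)
  refine ⟨Kj₀ + Kj₁, by positivity, fun l hl M γ' v hv hM => ?_⟩
  have h0 := hM.nonneg hT.le
  have hL0 : 0 ≤ l ^ (-smallT α β θ) := rpow_nonneg hl.le _
  exact ⟨(kj₀ l hl M γ' v hv hM).mono (by gcongr; linarith),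
    (kj₁ l hl M γ' v hv hM).mono (by gcongr; linarith)⟩

theorem exists_Phi_diff (χ : DyadicPartition d) (hp : Params α β θ) (hT : 0 < T) (R : ℝ) :
    ∃ K, 0 ≤ K ∧ ∀ l > 0, ∀ (e : Fin d → ℂ), (∀ i, ‖e i‖ ≤ 1) → ∀ (S S' : SD d) (D M N M' N' : ℝ)
      (u u' s s' : BPath d), S.Bd χ α β θ T R → S'.Bd χ α β θ T R → SD.Dist α β θ T D S S' →
      CP χ T θ u → CP χ T θ u' → CP χ T (2 * θ - 1) s → CP χ T (2 * θ - 1) s' →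
      SB T l α θ M N (u - u') (s - s') → SB T l α θ M' N' u' s' →
      SB T l α θ (K * (D + l ^ (-smallT α β θ) * (M + N + (1 + M' + N') * D)))
      (K * (D + l ^ (-smallT α β θ) * (M + N + (1 + M' + N') * D) + M + M' * D))
      (Phi χ α ν T e S u s - Phi χ α ν T e S' u' s') (PhiSharp χ α ν T e S u s -
      PhiSharp χ α ν T e S' u' s') := by
  have hα := hp.alpha
  have hα0 : 0 < α := one_pos.trans hα.1
  have hβ := hp.beta_neg
  have hθ := hp.one_lt_theta
  have hθ2 := hp.theta_lt_two
  have hgT := hp.gainT_mem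
  have hgT5 : gainT α β θ ∈ Icc (0 : ℝ) 5 := ⟨hgT.1, by linarith [hgT.2, hα.2]⟩
  have hβg := hp.le_beta_add_gainT
  obtain ⟨Ki, hKi, ki⟩ := exists_irrPath_diff χ hp T R
  obtain ⟨Kr, hKr, kr⟩ := exists_regPath_diff (ν := ν) χ hp hT R
  obtain ⟨Kp, hKp, kp⟩ := exists_PB_Pseq (ν := ν) χ T
  obtain ⟨Kp₀, hKp₀, kp₀⟩ := exists_HOL_Pseq_theta (ν := ν) χ hp T
  obtain ⟨Kj, hKj, kj⟩ := exists_PBW_Jseq (ν := ν) χ hT hgT5 hp.smallT_mem hp.gainT_add_smallT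
  obtain ⟨Kj₀, hKj₀, kj₀⟩ := exists_HOL_Jseq_theta (ν := ν) χ hp hT
  obtain ⟨Kc, hKc, kc⟩ := exists_PBW_remJ (ν := ν) χ hp hT
  set Kg := Ki + Kr with hKg
  set K := Kp + Kp₀ + Kj * Kg + Kj₀ * Kg + Kj * Kr + d * (Kc * (|R| + 1)) with hK
  refine ⟨K, by positivity, fun l hl e he S S' D M N M' N' u u' s s' hS hS' hD cu cu' cs cs' hz
    hz' => ?_⟩
  have hR := hS.uT.nonneg
  have hD0 := hD.uT.nonneg
  have hM := hz.pb.nonneg hT.le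
  have hN := hz.pbs.nonneg hT.le
  have hM' := hz'.pb.nonneg hT.le
  have hN' := hz'.pbs.nonneg hT.le
  set L := l ^ (-smallT α β θ) with hL
  have hL0 : 0 ≤ L := rpow_nonneg hl.le _
  set Q := M + N + (1 + M' + N') * D with hQ
  have hQ0 : 0 ≤ Q := by positivity
  have hreg := kr l hl.le e he S S' D (M + N) (M' + N') u u' s s' hS hS' hD cu cu'
    (hz.pb.mono le_rfl (by linarith)) (hz.pbs.mono le_rfl (by linarith))
    (hz'.pb.mono le_rfl (by linarith)) (hz'.pbs.mono le_rfl (by linarith))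
  replace hreg : PBW T l (β + θ - 1) (Kr * Q) _ := hreg.mono le_rfl (by rw [hQ, ← add_assoc])
  have hirr := ki l hl.le e he S S' D M M' u u' hM hM' hS hD hz.pb hz'.pb
  replace hirr : PBW T l β (Ki * Q) _ := hirr.mono le_rfl (mul_le_mul_of_nonneg_left (by
    have : 0 ≤ N' * D := by positivity
    rw [hQ]
    nlinarith) hKi)
  have cR := CP_regPath (ν := ν) (e := e) hp hT hS cu cs
  have cR' := CP_regPath (ν := ν) (e := e) hp hT hS' cu' cs'
  have cG := CP_rhs (ν := ν) (e := e) hp hT hS cu cs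
  have cG' := CP_rhs (ν := ν) (e := e) hp hT hS' cu' cs'
  set G := irrPath χ e S u + regPath χ α ν T e S u s with hG
  set G' := irrPath χ e S' u' + regPath χ α ν T e S' u' s' with hG'
  have hGG : PBW T l β (Kg * Q) (G - G') := by
    rw [hG, hG', add_sub_add_comm, hKg, add_mul]
    exact hirr.add (hreg.mono (by linarith) le_rfl)
  have cGG : CP χ T β (G - G') := cG.sub cG'
  have ePhi : ∀ t ∈ Icc 0 T, (Phi χ α ν T e S u s - Phi χ α ν T e S' u' s') t =
      ((fun t => Pseq χ α ν (T - t) (S.uT - S'.uT)) + Jseq χ α ν T (G - G')) t := by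
    intro t ht
    rw [Pi.sub_apply, Pi.add_apply, Jseq_sub cG cG' ht, Phi, Phi, add_sub_add_comm, Pseq_sub]
  have bD := hS.blk.sub hS'.blk
  have hP : PBW T l (2 * θ - 1) (Kp * D) fun t => Pseq χ α ν (T - t) (S.uT - S'.uT) :=
    PBW.of_PB hl.le fun t ht => kp _ _ _ hD.uT t ht
  have p1 : 0 ≤ Kj * Kg := by positivity
  have p2 : 0 ≤ Kj₀ * Kg := by positivity
  have p4 : 0 ≤ Kj * Kr := by positivity
  have p5 : 0 ≤ d * (Kc * (|R| + 1)) := by positivity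
  have fin : ∀ a b, a ≤ K → b ≤ K → a * D + b * (L * Q) ≤ K * (D + L * Q) := fun a b ha hb => by
    exact (add_le_add (mul_le_mul_of_nonneg_right ha hD0) (mul_le_mul_of_nonneg_right hb
      (mul_nonneg hL0 hQ0))).trans_eq (mul_add _ _ _).symm
  refine ⟨(PBW.add (hP.mono (by linarith) le_rfl) ((kj l hl _ _ _ hGG).mono (by linarith)
    le_rfl)).congr ePhi |>.mono le_rfl ?_, (HOL.add (kp₀ l hl.le _ _ bD hD.uT).1
    (kj₀ l hl _ _ _ cGG hGG).1).congr ePhi |>.mono ?_, (HOL.add (kp₀ l hl.le _ _ bD hD.uT).2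
    (kj₀ l hl _ _ _ cGG hGG).2).congr ePhi |>.mono ?_, ?_⟩
  · exact le_trans (le_of_eq (by ring)) (fin Kp (Kj * Kg) (by linarith) (by linarith))
  · exact le_trans (le_of_eq (by ring)) (fin Kp₀ (Kj₀ * Kg) (by linarith) (by linarith))
  · exact le_trans (le_of_eq (by ring)) (fin Kp₀ (Kj₀ * Kg) (by linarith) (by linarith))
  have hcomm := fun i => (((kc l hl.le 0 i _ _ _ _ (cu.sub cu') (hS.cpV i) hz.pb hz.hol₁
    (hS.V i)).1.add (kc l hl.le (e i) i _ _ _ _ cu' ((hS.cpV i).sub (hS'.cpV i)) hz'.pb hz'.hol₁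
    (hD.V i)).2).mono (γ' := 2 * θ - 1) (M' := Kc * (R + 1) * (D + M + M' * D)) (by linarith) (by
      have c1 : Kc * ((M' + ‖e i‖) * D) ≤ Kc * ((M' + 1) * D) := by
        gcongr
        exact he i
      have c2 : 0 ≤ Kc * (R * (D + M' * D)) := by positivity
      have c3 : 0 ≤ Kc * M := by positivity
      linarith))
  have hsum := PBW.sum Finset.univ fun i _ => hcomm i
  refine ((hP.add (hsum.add ((kj l hl _ _ _ hreg).mono (by linarith) le_rfl))).congr
    fun t ht => PhiSharp_sub_eq hp hT hS hS' cu cu' cs cs' ht).mono le_rfl ?_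
  rw [sum_const, Finset.card_univ, Fintype.card_fin, nsmul_eq_mul]
  rw [abs_of_nonneg hR] at hK p5
  have c2 : (Kp + d * (Kc * (R + 1))) * D + d * (Kc * (R + 1)) * (M + M' * D) +
      Kj * Kr * (L * Q) ≤ K * D + K * (M + M' * D) + K * (L * Q) := by
    refine add_le_add (add_le_add (mul_le_mul_of_nonneg_right (by linarith) hD0)
      (mul_le_mul_of_nonneg_right (by linarith) (by positivity)))
      (mul_le_mul_of_nonneg_right (by linarith) (by positivity))
  linarith

theorem exists_contraction (χ : DyadicPartition d) (hp : Params α β θ) (hT : 0 < T) (R : ℝ) :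
    ∃ δ ∈ Ioc (0 : ℝ) 1, ∃ l > 0, ∃ C ≥ 0, ∀ (e : Fin d → ℂ), (∀ i, ‖e i‖ ≤ 1) →
      ∀ (S S' : SD d) (D M M' : ℝ) (u u' s s' : BPath d), S.Bd χ α β θ T R → S'.Bd χ α β θ T R →
      SD.Dist α β θ T D S S' → CP χ T θ u → CP χ T θ u' → CP χ T (2 * θ - 1) s →
      CP χ T (2 * θ - 1) s' → SB T l α θ M (M / δ) (u - u') (s - s') →
      SB T l α θ M' (M' / δ) u' s' → SB T l α θ (M / 2 + C * (1 + M') * D)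
      ((M / 2 + C * (1 + M') * D) / δ) (Phi χ α ν T e S u s - Phi χ α ν T e S' u' s')
      (PhiSharp χ α ν T e S u s - PhiSharp χ α ν T e S' u' s') := by
  obtain ⟨K, hK, k⟩ := exists_Phi_diff (ν := ν) χ hp hT R
  set δ := 1 / (4 * K + 1) with hδ
  have hδ0 : 0 < δ := by positivity
  have hδ1 : δ ≤ 1 := by
    rw [hδ, div_le_one (by positivity)]
    linarith
  have hδK : δ * K ≤ 1 / 4 := by
    rw [hδ, one_div_mul_eq_div, div_le_iff₀ (by positivity)]
    linarith
  obtain ⟨l, hl0, hl⟩ : ∃ l > 0, l ^ (-smallT α β θ) * (K * (1 + 1 / δ)) ≤ 1 / 4 := by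
    have h1 := (tendsto_rpow_neg_atTop hp.smallT_pos).mul_const (K * (1 + 1 / δ))
    rw [zero_mul] at h1
    obtain ⟨l, h2, h3⟩ := ((h1.eventually_le_const (show (0 : ℝ) < 1 / 4 by norm_num)).and
      (eventually_gt_atTop 0)).exists
    exact ⟨l, h3, h2⟩
  refine ⟨δ, ⟨hδ0, hδ1⟩, l, hl0, K + 1, by positivity, fun e he S S' D M M' u u' s s' hS hS' hD cu
    cu' cs cs' hz hz' => ?_⟩
  have hM := hz.pb.nonneg hT.le
  have hM' := hz'.pb.nonneg hT.le
  have hD0 := hD.uT.nonneg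
  have hL0 : 0 ≤ l ^ (-smallT α β θ) := rpow_nonneg hl0.le _
  set L := l ^ (-smallT α β θ) with hL
  have h := k l hl0 e he S S' D M (M / δ) M' (M' / δ) u u' s s' hS hS' hD cu cu' cs cs' hz hz'
  have key : K * (L * (M + M / δ + (1 + M' + M' / δ) * D)) ≤ M / 4 + (1 + M') * D / 4 := by
    have a1 : M + M / δ + (1 + M' + M' / δ) * D ≤ (1 + 1 / δ) * (M + (1 + M') * D) := by
      have : 0 ≤ 1 / δ * D := by positivity
      rw [div_eq_mul_one_div M, div_eq_mul_one_div M']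
      linarith
    calc _ ≤ K * (L * ((1 + 1 / δ) * (M + (1 + M') * D))) := by gcongr
      _ = L * (K * (1 + 1 / δ)) * (M + (1 + M') * D) := by ring
      _ ≤ 1 / 4 * (M + (1 + M') * D) := by gcongr
      _ = _ := by ring
  set X := K * (L * (M + M / δ + (1 + M' + M' / δ) * D)) with hX
  have hX0 : 0 ≤ X := by positivity
  have b0 : 0 ≤ M' * D := by positivity
  have b1 : 0 ≤ K * (M' * D) := by positivity
  have b2 : 0 ≤ K * D := by positivity
  refine h.mono ?_ ?_
  · rw [mul_add]
    linarith
  · rw [le_div_iff₀ hδ0]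
    have c1 : δ * X ≤ X := mul_le_of_le_one_left hX0 hδ1
    have c2 : δ * K * (D + M + M' * D) ≤ 1 / 4 * (D + M + M' * D) := by gcongr
    have c3 : K * (D + L * (M + M / δ + (1 + M' + M' / δ) * D) + M + M' * D) * δ =
      δ * X + δ * K * (D + M + M' * D) := by rw [hX]; ring
    rw [c3]
    linarith

end

section

variable {d : ℕ} {χ : DyadicPartition d}
variable {α : ℝ} {ν : Measure (Sphere d)} [IsFiniteMeasure ν]
  [Stable α ν]
variable {β θ T : ℝ}
variable {M N l δ : ℝ}

/-! ### The fixed point -/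

theorem SB.of_tendsto {a : ℕ → ℝ} {U W : ℕ → BPath d} {u s : BPath d}
    (h : ∀ k, SB T l α θ (a k) (a k / δ) (U k) (W k)) (ha : Tendsto a atTop (𝓝 M))
    (hU : ∀ t ∈ Icc 0 T, ∀ n, Tendsto (fun k => U k t n) atTop (𝓝 (u t n)))
    (hW : ∀ t ∈ Icc 0 T, ∀ n, Tendsto (fun k => W k t n) atTop (𝓝 (s t n))) :
    SB T l α θ M (M / δ) u s := by
  have hol : ∀ {μ ρ : ℝ}, (∀ k, HOL T l μ ρ (a k) (U k)) → HOL T l μ ρ M u :=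
    fun hk t r ht htr hr N => le_of_tendsto_of_tendsto'
      (tendsto_finsetSum _ fun n _ => (((hU t ⟨ht, htr.trans hr⟩ n).sub
        (hU r ⟨ht.trans htr, hr⟩ n)).norm).const_mul _)
      ((ha.mul_const _).mul_const _) fun k => hk k t r ht htr hr N
  exact ⟨fun t ht n => le_of_tendsto_of_tendsto' (hU t ht n).norm ((ha.mul_const _).mul_const _)
      fun k => (h k).pb t ht n, hol fun k => (h k).hol₀, hol fun k => (h k).hol₁,
    fun t ht n => le_of_tendsto_of_tendsto' (hW t ht n).norm
      (((ha.div_const _).mul_const _).mul_const _) fun k => (h k).pbs t ht n⟩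

theorem SB.of_half {E : ℝ} {u s : BPath d} (h : SB T l α θ M (M / δ) u s)
    (hs : ∀ M, SB T l α θ M (M / δ) u s → SB T l α θ (M / 2 + E) ((M / 2 + E) / δ) u s) :
    SB T l α θ (2 * E) (2 * E / δ) u s := by
  have hk : ∀ k : ℕ, SB T l α θ ((M - 2 * E) * (1 / 2) ^ k + 2 * E)
      (((M - 2 * E) * (1 / 2) ^ k + 2 * E) / δ) u s := by
    intro k
    induction k with
    | zero => simpa using h
    | succ k ih =>
      have := hs _ ih
      rwa [show ((M - 2 * E) * (1 / 2) ^ k + 2 * E) / 2 + E =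
        (M - 2 * E) * (1 / 2) ^ (k + 1) + 2 * E by ring] at this
  refine SB.of_tendsto hk ?_ (fun _ _ _ => tendsto_const_nhds) fun _ _ _ => tendsto_const_nhds
  have := (tendsto_pow_atTop_nhds_zero_of_lt_one (r := (1 / 2 : ℝ)) (by norm_num)
    (by norm_num)).const_mul (M - 2 * E) |>.add_const (2 * E)
  rwa [mul_zero, zero_add] at this

theorem SB.congr {u s u' s' : BPath d} (h : SB T l α θ M N u s) (hu : ∀ t ∈ Icc 0 T, u' t = u t)
    (hs : ∀ t ∈ Icc 0 T, s' t = s t) : SB T l α θ M N u' s' :=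
  ⟨h.pb.congr hu, h.hol₀.congr hu, h.hol₁.congr hu, h.pbs.congr hs⟩

instance : Zero (SD d) := ⟨⟨0, 0, 0, 0⟩⟩

theorem SD.Bd.zero {R : ℝ} (hR : 0 ≤ R) : (0 : SD d).Bd χ α β θ T R :=
  ⟨fun _ => CP.zero, fun _ _ => CP.zero, CP.zero, Blk.zero, fun _ _ _ => PB.zero.mono le_rfl hR,
    fun _ _ _ _ => PB.zero.mono le_rfl hR, PB.zero.mono le_rfl hR,
    fun _ _ => PB.zero.mono le_rfl hR⟩

theorem SD.Bd.dist_zero {R : ℝ} {S : SD d} (h : S.Bd χ α β θ T R) : SD.Dist α β θ T R S 0 := by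
  constructor
  · intro i t ht; exact (sub_zero (S.V i t)).symm ▸ h.V i t ht
  · intro i j t ht; exact (sub_zero (S.V₂ i j t)).symm ▸ h.V₂ i j t ht
  · exact (sub_zero S.uT).symm ▸ h.uT
  · intro t ht; exact (sub_zero (S.f₀ t)).symm ▸ h.f₀ t ht

theorem SD.Dist.refl (S : SD d) : SD.Dist α β θ T 0 S S := by
  constructor <;> intros <;> rw [sub_self] <;> exact PB.zero

theorem SB.zero (hM : 0 ≤ M) (hN : 0 ≤ N) : SB T l α θ M N (0 : BPath d) 0 := by
  have : SB T l α θ 0 0 (0 : BPath d) 0 :=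
    ⟨fun t _ => by simpa using PB.zero, fun t r _ _ _ N => by simp, fun t r _ _ _ N => by simp,
      fun t _ => by simpa using PB.zero⟩
  exact this.mono hM hN

theorem Phi_zero (e : Fin d → ℂ) : Phi χ α ν T e 0 0 0 = 0 ∧ PhiSharp χ α ν T e 0 0 0 = 0 := by
  have z1 : ∀ f : BSeq d, paraSeq χ f 0 = 0 := fun f => by
    ext1 n
    simp [paraSeq, paraTerm]
  have z2 : ∀ f : BSeq d, paraSeq χ 0 f = 0 := fun f => by
    ext1 n
    simp [paraSeq, paraTerm]
  have z3 : ∀ j, derSeq χ j 0 = 0 := fun j => by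
    ext1 n
    simp [derSeq]
  have z4 : ∀ f : BSeq d, resoB f 0 = 0 := fun f => by simp [resoB, resoTerm]
  have z5 : ∀ F (f g : BSeq d), commB χ F f g 0 = 0 := fun F f g => by simp [commB, commTerm]
  have z6 : blocks χ 0 = 0 := by
    ext1 n
    simp [blocks]
  have z7 : irrPath χ e 0 0 + regPath χ α ν T e 0 0 0 = 0 := by
    ext1 t
    have hV : ∀ i, (0 : SD d).V i t = 0 := fun i => rfl
    have hV₂ : ∀ i j, (0 : SD d).V₂ i j t = 0 := fun i j => rfl
    have hf : (0 : SD d).f₀ t = 0 := rfl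
    simp [irrPath, regPath, regProd, resoSeq, commSeq, SD.drift, hV, hV₂, hf, z1, z2, z3, z4, z5, z6]
  have z8 : ∀ t, Phi χ α ν T e 0 0 0 t = 0 := fun t => by
    rw [Phi, z7, Jseq_zero]
    ext1 n
    have : (0 : SD d).uT n = 0 := rfl
    simp [Pseq, this]
  refine ⟨funext z8, funext fun t => ?_⟩
  have hV : ∀ i, (0 : SD d).V i = 0 := fun i => rfl
  simp [PhiSharp, z8, hV, Jseq_zero, z1]

theorem CP.of_PBW {γ γ' : ℝ} {f : BPath d} (h : CP χ T γ f) (hl : 0 ≤ l) (hT : 0 ≤ T)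
    (hM : PBW T l γ' M f) : CP χ T γ' f :=
  ⟨h.blk, h.cont, M * exp (l * T), fun t ht => (hM t ht).mono le_rfl
    (mul_le_mul_of_nonneg_left (wt_le hl ht.1) (hM.nonneg hT))⟩

section Solve

variable {R : ℝ} {e : Fin d → ℂ} {S : SD d} {u s : BPath d}

/-- The regularity of the solution, with some room. -/
def regT (α β θ : ℝ) : ℝ := min (2 * θ - 1) (β + gainT α β θ)

theorem Params.lt_regT (hp : Params α β θ) : θ < regT α β θ :=
  lt_min (by linarith [hp.one_lt_theta]) hp.le_beta_add_gainT

theorem CP_Phi (hp : Params α β θ) (hT : 0 < T) (hS : S.Bd χ α β θ T R) (hu : CP χ T θ u)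
    (hs : CP χ T (2 * θ - 1) s) : CP χ T (regT α β θ) (Phi χ α ν T e S u s) :=
  ((CP_Pseq hS.blk hS.uT).mono (min_le_left _ _)).add
    (((CP_rhs hp hT hS hu hs).Jseq hT hp.gainT_mem).mono (min_le_right _ _))

theorem CP_PhiSharp (hp : Params α β θ) (hT : 0 < T) (hS : S.Bd χ α β θ T R) (hu : CP χ T θ u)
    (hs : CP χ T (2 * θ - 1) s) : CP χ T (min θ (β + gainJ α β θ)) (PhiSharp χ α ν T e S u s) := by
  have : PhiSharp χ α ν T e S u s = Phi χ α ν T e S u s -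
      ∑ i, fun t => paraSeq χ (derE χ e (u t) i) (Jseq χ α ν T (S.V i) t) := by
    ext1 t
    simp [PhiSharp]
  rw [this]
  exact (((CP_Phi hp hT hS hu hs).mono hp.lt_regT.le).mono (min_le_left _ _)).sub (CP.sum _ fun i _ =>
    ((hu.derE e i).para_of_pos ((hS.cpV i).Jseq hT hp.gainJ_mem)
      (by linarith [hp.one_lt_theta])).mono (min_le_right _ _))

/-- `(u, s)` is a fixed point. -/
structure IsFix (χ : DyadicPartition d) (α : ℝ) (ν : Measure (Sphere d))
    (θ T : ℝ) (e : Fin d → ℂ) (S : SD d) (u s : BPath d) : Prop where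
  cpu : CP χ T θ u
  cps : CP χ T (2 * θ - 1) s
  equ : ∀ t ∈ Icc 0 T, u t = Phi χ α ν T e S u s t
  eqs : ∀ t ∈ Icc 0 T, s t = PhiSharp χ α ν T e S u s t

theorem IsFix.exists_SB (h : IsFix χ α ν θ T e S u s) (hp : Params α β θ) (hT : 0 < T)
    (hS : S.Bd χ α β θ T R) (hl : 0 < l) (hδ : δ ∈ Ioc (0 : ℝ) 1) :
    ∃ M, SB T l α θ M (M / δ) u s := by
  obtain ⟨C₁, h₁⟩ := h.cpu.bdd
  obtain ⟨C₂, h₂⟩ := h.cps.bdd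
  have cG := CP_rhs (ν := ν) (e := e) hp hT hS h.cpu h.cps
  obtain ⟨C₃, h₃⟩ := cG.bdd
  obtain ⟨K₁, -, k₁⟩ := exists_HOL_Pseq_theta (ν := ν) χ hp T
  obtain ⟨K₂, -, k₂⟩ := exists_HOL_Jseq_theta (ν := ν) χ hp hT
  obtain ⟨p₀, p₁⟩ := k₁ l hl.le _ _ hS.blk hS.uT
  obtain ⟨j₀, j₁⟩ := k₂ l hl _ _ _ cG (PBW.of_PB hl.le h₃)
  set B := K₁ * R + K₂ * l ^ (-smallT α β θ) * C₃ with hB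
  have a1 := le_abs_self B
  have a2 := le_abs_self C₁
  have a3 := le_abs_self C₂
  have b1 := abs_nonneg B
  have b2 := abs_nonneg C₁
  have b3 := abs_nonneg C₂
  refine ⟨|B| + |C₁| + |C₂|, (PBW.of_PB hl.le h₁).mono le_rfl (by linarith),
    ((p₀.add j₀).congr h.equ).mono (by linarith), ((p₁.add j₁).congr h.equ).mono (by linarith),
    (PBW.of_PB hl.le h₂).mono le_rfl ?_⟩
  rw [le_div_iff₀ hδ.1]
  nlinarith [hδ.1, hδ.2]

theorem exists_stability (χ : DyadicPartition d) (hp : Params α β θ) (hT : 0 < T) (R : ℝ) :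
    ∃ l > 0, ∃ K ≥ 0, ∀ (e : Fin d → ℂ), (∀ i, ‖e i‖ ≤ 1) →
      ∀ (S S' : SD d) (D : ℝ) (u u' s s' : BPath d), S.Bd χ α β θ T R → S'.Bd χ α β θ T R →
      SD.Dist α β θ T D S S' → IsFix χ α ν θ T e S u s → IsFix χ α ν θ T e S' u' s' →
      PBW T l θ (K * D) (u - u') ∧ HOL T l 0 (θ / α) (K * D) (u - u') := by
  obtain ⟨δ, hδ, l, hl, C, hC, h⟩ := exists_contraction (ν := ν) χ hp hT R
  refine ⟨l, hl, 2 * (C * (1 + 2 * (C * |R|))), by positivity,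
    fun e he S S' D u u' s s' hS hS' hD hu hu' => ?_⟩
  have hR := hS.uT.nonneg
  obtain ⟨M₁, h₁⟩ := hu'.exists_SB hp hT hS' hl hδ
  have z : SB T l α θ (0 : ℝ) (0 / δ) (0 : BPath d) 0 := SB.zero le_rfl (by simp)
  have apr : SB T l α θ (2 * (C * R)) (2 * (C * R) / δ) u' s' := by
    refine h₁.of_half fun M hM => ?_
    have := h e he S' 0 R M 0 u' 0 s' 0 hS' (SD.Bd.zero hR) hS'.dist_zero hu'.cpu CP.zero hu'.cps
      CP.zero (by simpa using hM) z
    rw [(Phi_zero e).1, (Phi_zero e).2, sub_zero, sub_zero, add_zero, mul_one] at this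
    exact this.congr hu'.equ hu'.eqs
  obtain ⟨M₂, h₂⟩ := hu.exists_SB hp hT hS hl hδ
  have start : SB T l α θ (M₂ + M₁) ((M₂ + M₁) / δ) (u - u') (s - s') := by
    rw [add_div]
    exact ⟨h₂.pb.sub h₁.pb, h₂.hol₀.sub h₁.hol₀, h₂.hol₁.sub h₁.hol₁, h₂.pbs.sub h₁.pbs⟩
  have fin := start.of_half (E := C * (1 + 2 * (C * R)) * D) fun M hM =>
    (h e he S S' D M _ u u' s s' hS hS' hD hu.cpu hu'.cpu hu.cps hu'.cps hM apr).congr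
      (fun t ht => by rw [Pi.sub_apply, Pi.sub_apply, hu.equ t ht, hu'.equ t ht])
      fun t ht => by rw [Pi.sub_apply, Pi.sub_apply, hu.eqs t ht, hu'.eqs t ht]
  rw [abs_of_nonneg hR, mul_assoc 2]
  exact ⟨fin.pb, fin.hol₀⟩

theorem exists_limit_of_geometric {F : ℕ → ℝ → Bdd d} {A : Set ℝ} {C : ℝ}
    (hc : ∀ k, ContinuousOn (F k) A) (hF : ∀ k, ∀ t ∈ A, ‖F (k + 1) t - F k t‖ ≤ C * (1 / 2) ^ k) :
    ∃ f : ℝ → Bdd d, ContinuousOn f A ∧ ∀ t ∈ A, Tendsto (fun k => F k t) atTop (𝓝 (f t)) := by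
  have hs : Summable fun k : ℕ => C * (1 / 2 : ℝ) ^ k :=
    (summable_geometric_of_lt_one (by norm_num) (by norm_num)).mul_left C
  refine ⟨fun t => F 0 t + ∑' k, (F (k + 1) t - F k t),
    (hc 0).add (continuousOn_tsum (fun k => (hc (k + 1)).sub (hc k)) hs hF), fun t ht => ?_⟩
  have := (Summable.of_norm_bounded hs fun k => hF k t ht).hasSum.tendsto_sum_nat.const_add (F 0 t)
  refine this.congr fun k => ?_
  rw [Finset.sum_range_sub fun k => F k t, add_sub_cancel]

variable (χ α ν T) in
/-- The Picard iteration. -/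
def picard (e : Fin d → ℂ) (S : SD d) : ℕ → (BPath d) × (BPath d)
  | 0 => 0
  | k + 1 => (Phi χ α ν T e S (picard e S k).1 (picard e S k).2,
      PhiSharp χ α ν T e S (picard e S k).1 (picard e S k).2)

theorem exists_isFix (hp : Params α β θ) (hT : 0 < T) (he : ∀ i, ‖e i‖ ≤ 1)
    (hS : S.Bd χ α β θ T R) : ∃ u s, IsFix χ α ν θ T e S u s := by
  obtain ⟨δ, hδ, l, hl, C, hC, h⟩ := exists_contraction (ν := ν) χ hp hT R
  have hR := hS.uT.nonneg
  have z : SB T l α θ (0 : ℝ) (0 / δ) (0 : BPath d) 0 := SB.zero le_rfl (by simp)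
  set E := C * R with hE
  have hE0 : 0 ≤ E := by positivity
  set U := fun k => (picard χ α ν T e S k).1 with hU
  set W := fun k => (picard χ α ν T e S k).2 with hW
  have eU : ∀ k, U (k + 1) = Phi χ α ν T e S (U k) (W k) := fun k => rfl
  have eW : ∀ k, W (k + 1) = PhiSharp χ α ν T e S (U k) (W k) := fun k => rfl
  have eU0 : U 0 = 0 := rfl
  have eW0 : W 0 = 0 := rfl
  have hk : ∀ k, CP χ T θ (U k) ∧ CP χ T (2 * θ - 1) (W k) ∧
      SB T l α θ (2 * E) (2 * E / δ) (U k) (W k) := by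
    intro k
    induction k with
    | zero => exact ⟨CP.zero, CP.zero, SB.zero (by positivity) (div_nonneg (by positivity) hδ.1.le)⟩
    | succ k ih =>
      obtain ⟨c1, c2, c3⟩ := ih
      have := h e he S 0 R (2 * E) 0 (U k) 0 (W k) 0 hS (SD.Bd.zero hR) hS.dist_zero c1 CP.zero c2
        CP.zero (by simpa using c3) z
      rw [(Phi_zero e).1, (Phi_zero e).2, sub_zero, sub_zero, add_zero, mul_one, ← hE,
        show 2 * E / 2 + E = 2 * E by ring, ← eU, ← eW] at this
      exact ⟨(CP_Phi hp hT hS c1 c2).mono hp.lt_regT.le, (CP_PhiSharp hp hT hS c1 c2).of_PBW hl.le hT.le this.pbs,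
        this⟩
  have D0 : SD.Dist α β θ T 0 S S := SD.Dist.refl S
  have step : ∀ {u s u' s' : BPath d} {M : ℝ}, CP χ T θ u → CP χ T (2 * θ - 1) s →
      CP χ T θ u' → CP χ T (2 * θ - 1) s' → SB T l α θ (2 * E) (2 * E / δ) u' s' →
      SB T l α θ M (M / δ) (u - u') (s - s') → SB T l α θ (M / 2) (M / 2 / δ)
        (Phi χ α ν T e S u s - Phi χ α ν T e S u' s')
        (PhiSharp χ α ν T e S u s - PhiSharp χ α ν T e S u' s') := by
    intro u s u' s' M cu cs cu' cs' b hM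
    have := h e he S S 0 M _ u u' s s' hS hS D0 cu cu' cs cs' hM b
    rwa [mul_zero, add_zero] at this
  have hd : ∀ k m, SB T l α θ (2 * E * (1 / 2) ^ k) (2 * E * (1 / 2) ^ k / δ) (U (m + k) - U k)
      (W (m + k) - W k) := by
    intro k m
    induction k with
    | zero => simpa [eU0, eW0] using (hk m).2.2
    | succ k ih =>
      have := step (hk (m + k)).1 (hk (m + k)).2.1 (hk k).1 (hk k).2.1 (hk k).2.2 ih
      rwa [← eU, ← eU, ← eW, ← eW, show 2 * E * (1 / 2) ^ k / 2 = 2 * E * (1 / 2) ^ (k + 1) by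
        ring] at this
  have geo : ∀ {γ c a : ℝ} {f : BPath d}, 0 ≤ c → PBW T l γ (c * a) f → 0 ≤ a → ∀ n,
      ∀ t ∈ Icc 0 T, ‖f t n‖ ≤ c * exp (l * T) * pw (-γ) n * a := by
    intro γ c a f hc hf ha n t ht
    refine (hf t ht n).trans ?_
    have h1 := wt_le (T := T) hl.le ht.1
    have h2 := pw_nonneg (-γ) n
    calc c * a * wt l T t * pw (-γ) n ≤ c * a * exp (l * T) * pw (-γ) n := by gcongr
      _ = _ := by ring
  have hpow : ∀ k : ℕ, (0 : ℝ) ≤ (1 / 2) ^ k := fun k => by positivity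
  have lu := fun n => exists_limit_of_geometric (F := fun k t => U k t n)
    (fun k => (hk k).1.cont n) fun k t ht => by
      have := geo (by positivity) (hd k 1).pb (hpow k) n t ht
      rwa [add_comm 1 k] at this
  have ls := fun n => exists_limit_of_geometric (F := fun k t => W k t n)
    (fun k => (hk k).2.1.cont n) fun k t ht => by
      have h1 := (hd k 1).pbs
      rw [mul_div_right_comm] at h1
      have := geo (div_nonneg (by positivity) hδ.1.le) h1 (hpow k) n t ht
      rwa [add_comm 1 k] at this
  choose fu cu tu using lu
  choose fs cs ts using ls
  set u : BPath d := fun t n => fu n t with hu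
  set s : BPath d := fun t n => fs n t with hs
  have bz : SB T l α θ (2 * E) (2 * E / δ) u s :=
    SB.of_tendsto (fun k => (hk k).2.2) tendsto_const_nhds (fun t ht n => tu n t ht)
      fun t ht n => ts n t ht
  have cpu : CP χ T θ u := ⟨fun t ht => Blk.of_tendsto
    (.of_forall fun k => (hk k).1.blk t ht) fun n => tu n t ht, cu, _, fun t ht =>
    (bz.pb t ht).mono le_rfl (mul_le_mul_of_nonneg_left (wt_le hl.le ht.1) (by positivity))⟩
  have cps : CP χ T (2 * θ - 1) s := ⟨fun t ht => Blk.of_tendsto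
    (.of_forall fun k => (hk k).2.1.blk t ht) fun n => ts n t ht, cs, _, fun t ht =>
    (bz.pbs t ht).mono le_rfl (mul_le_mul_of_nonneg_left (wt_le hl.le ht.1)
      (div_nonneg (by positivity) hδ.1.le))⟩
  have hlim : ∀ k, SB T l α θ (2 * E * (1 / 2) ^ k) (2 * E * (1 / 2) ^ k / δ) (u - U k) (s - W k) :=
    fun k => SB.of_tendsto (fun m => hd k m) tendsto_const_nhds
      (fun t ht n => ((tendsto_add_atTop_iff_nat k).2 (tu n t ht)).sub_const _)
      fun t ht n => ((tendsto_add_atTop_iff_nat k).2 (ts n t ht)).sub_const _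
  have hfin : ∀ k, SB T l α θ (E * (1 / 2) ^ k) (E * (1 / 2) ^ k / δ)
      (Phi χ α ν T e S u s - U (k + 1)) (PhiSharp χ α ν T e S u s - W (k + 1)) := by
    intro k
    have := step cpu cps (hk k).1 (hk k).2.1 (hk k).2.2 (hlim k)
    rwa [← eU, ← eW, show 2 * E * (1 / 2) ^ k / 2 = E * (1 / 2) ^ k by ring] at this
  have conv : ∀ {γ c : ℝ} {f : BPath d} {V : ℕ → BPath d} {t : ℝ} {n : ℕ} {x : Bdd d},
      0 ≤ c → t ∈ Icc 0 T → (∀ k, PBW T l γ (c * (1 / 2) ^ k) (f - V (k + 1))) →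
      Tendsto (fun k => V k t n) atTop (𝓝 x) → x = f t n := by
    intro γ c f V t n x hc ht hV hx
    refine tendsto_nhds_unique ((tendsto_add_atTop_iff_nat 1).2 hx)
      (tendsto_iff_norm_sub_tendsto_zero.2 (squeeze_zero (fun _ => norm_nonneg _) (g := fun k =>
        c * exp (l * T) * pw (-γ) n * (1 / 2) ^ k) (fun k => ?_) ?_))
    · rw [norm_sub_rev]
      exact geo hc (hV k) (hpow k) n t ht
    · have := (tendsto_pow_atTop_nhds_zero_of_lt_one (r := (1 / 2 : ℝ)) (by norm_num)
        (by norm_num)).const_mul (c * exp (l * T) * pw (-γ) n)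
      rwa [mul_zero] at this
  refine ⟨u, s, cpu, cps, fun t ht => funext fun n => conv hE0 ht (fun k => (hfin k).pb) (tu n t ht),
    fun t ht => funext fun n => conv (γ := 2 * θ - 1) (c := E / δ) (div_nonneg hE0 hδ.1.le) ht (fun k => ?_)
      (ts n t ht)⟩
  have := (hfin k).pbs
  rwa [mul_div_right_comm] at this

end Solve

end

section

variable {d : ℕ} {χ : DyadicPartition d} {T γ : ℝ} {u : Distr d} {f : BSeq d}
  {w : ℝ → Distr d} {g : BPath d}
variable {C : ℝ}

/-! ### Norms of distributions and of sequences of blocks -/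

theorem weight_mul_enorm (γ : ℝ) (n : ℕ) (x : Bdd d) :
    weight γ n * ‖x‖ₑ = ENNReal.ofReal ((2 : ℝ) ^ (-γ) * (pw γ n * ‖x‖)) := by
  rw [weight, ← ofReal_norm, ← ENNReal.ofReal_mul (by positivity), ← mul_assoc, pw,
    ← rpow_add two_pos]
  congr 4
  ring

theorem PB_iff_pw : PB γ C f ↔ ∀ n, pw γ n * ‖f n‖ ≤ C :=
  forall_congr' fun n => by rw [pw_neg, ← div_eq_mul_inv, le_div_iff₀ (pw_pos γ n), mul_comm]

theorem Rep.besovNorm_le_iff (h : Rep χ u f) (hC : 0 ≤ C) :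
    besovNorm χ γ u ≤ ENNReal.ofReal C ↔ PB γ (2 ^ γ * C) f := by
  rw [h.besovNorm_eq, iSup_le_iff, PB_iff_pw]
  refine forall_congr' fun n => ?_
  rw [weight_mul_enorm, ENNReal.ofReal_le_ofReal_iff hC, rpow_neg two_pos.le,
    inv_mul_le_iff₀ (Real.rpow_pos_of_pos two_pos γ)]

theorem Rep.PB_of_le (h : Rep χ u f) {c : ℝ} (hC : 0 ≤ C) (hc : 2 ^ γ ≤ c)
    (hu : besovNorm χ γ u ≤ ENNReal.ofReal C) : PB γ (c * C) f :=
  ((h.besovNorm_le_iff hC).1 hu).mono le_rfl (mul_le_mul_of_nonneg_right hc hC)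

theorem Rep.besovNorm_le (h : Rep χ u f) (hf : PB γ C f) :
    besovNorm χ γ u ≤ ENNReal.ofReal (2 ^ (-γ) * C) := by
  rw [h.besovNorm_le_iff (mul_nonneg (by positivity) hf.nonneg), ← mul_assoc,
    ← rpow_add two_pos, add_neg_cancel, Real.rpow_zero, one_mul]
  exact hf

/-- A path in `C_T 𝒞^γ` is continuous on each block and bounded. -/
theorem MemCT.exists_CP (h : MemCT χ T γ w) : ∃ g, CP χ T γ g ∧ ∀ t ∈ Icc 0 T,
    Rep χ (w t) (g t) := by
  have h1 : ∀ t ∈ Icc 0 T, ∃ f, Rep χ (w t) f := fun t ht => exists_rep (h.1 t ht).1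
  choose! g hg using h1
  have near : ∀ t ∈ Icc 0 T, ∀ δ > 0, ∀ᶠ s in 𝓝[Icc 0 T] t, PB γ (2 ^ γ * δ) (g s - g t) := by
    intro t ht δ hδ
    filter_upwards [(h.2 t ht).eventually_le_const (ENNReal.ofReal_pos.2 hδ), self_mem_nhdsWithin]
      with s hs hs'
    exact (((hg s hs').sub (hg t ht)).besovNorm_le_iff hδ.le).1 hs
  refine ⟨g, ⟨fun t ht => (hg t ht).blk, fun n t ht => ?_, ?_⟩, hg⟩
  · rw [ContinuousWithinAt, Metric.tendsto_nhds]
    intro δ hδ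
    have hc : 0 < (2 : ℝ) ^ γ * pw (-γ) n := mul_pos (by positivity) (pw_pos _ _)
    filter_upwards [near t ht (δ / 2 / (2 ^ γ * pw (-γ) n)) (by positivity)] with s hs
    rw [dist_eq_norm]
    refine (hs n).trans_lt ?_
    rw [mul_right_comm, mul_div_cancel₀ _ hc.ne']
    linarith
  · refine isCompact_Icc.induction_on (p := fun A => ∃ C, ∀ t ∈ A, PB γ C (g t)) ⟨0, by simp⟩
      (fun A B hAB ⟨C, hC⟩ => ⟨C, fun t ht => hC t (hAB ht)⟩) ?_ fun t ht => ?_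
    · rintro A B ⟨C, hC⟩ ⟨C', hC'⟩
      refine ⟨max C C', fun t ht => ht.elim (fun h => (hC t h).mono le_rfl (le_max_left _ _))
        fun h => (hC' t h).mono le_rfl (le_max_right _ _)⟩
    · obtain ⟨C, hC⟩ : ∃ C, PB γ C (g t) := by
        obtain ⟨C, hC0, hC⟩ : ∃ C : ℝ, 0 ≤ C ∧ besovNorm χ γ (w t) ≤ ENNReal.ofReal C :=
          ⟨_, toReal_nonneg, (ENNReal.ofReal_toReal (h.1 t ht).1.ne).ge⟩
        exact ⟨_, ((hg t ht).besovNorm_le_iff hC0).1 hC⟩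
      exact ⟨_, near t ht 1 one_pos, _, fun s hs => PB.of_sub hs hC⟩

/-- Blocks that decay faster than `2^{-γn}`, uniformly in time. -/
def LO (T γ : ℝ) (g : BPath d) : Prop :=
  ∃ a : ℕ → ℝ, Tendsto a atTop (𝓝 0) ∧ ∀ t ∈ Icc 0 T, ∀ n, pw γ n * ‖g t n‖ ≤ a n

theorem LO.of_PB {γ' : ℝ} (h : γ < γ') (hg : ∀ t ∈ Icc 0 T, PB γ' C (g t)) : LO T γ g := by
  have := (summable_pw (sub_neg.2 h)).tendsto_atTop_zero.const_mul C
  rw [mul_zero] at this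
  refine ⟨_, this, fun t ht n => ?_⟩
  have := mul_le_mul_of_nonneg_left (hg t ht n) (pw_nonneg γ n)
  rwa [mul_left_comm, ← pw_add, ← sub_eq_add_neg] at this

theorem LO.add {g' : BPath d} : LO T γ g → LO T γ g' → LO T γ (g + g') := by
  rintro ⟨a, ha, h⟩ ⟨b, hb, h'⟩
  refine ⟨fun n => a n + b n, by simpa using ha.add hb, fun t ht n => ?_⟩
  have := mul_le_mul_of_nonneg_left (norm_add_le (g t n) (g' t n)) (pw_nonneg γ n)
  rw [mul_add] at this
  exact this.trans (add_le_add (h t ht n) (h' t ht n))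

theorem MemC.of_rep (h : Rep χ u f) {a : ℕ → ℝ} (ha : Tendsto a atTop (𝓝 0))
    (hf : ∀ n, pw γ n * ‖f n‖ ≤ a n) : MemC χ γ u := by
  obtain ⟨C, hC⟩ := ha.bddAbove_range
  refine ⟨(h.besovNorm_le (PB_iff_pw.2 fun n => (hf n).trans (hC ⟨n, rfl⟩))).trans_lt
    ENNReal.ofReal_lt_top, ?_⟩
  have h1 : ∀ n, weight γ n * linftyNorm (block χ n u) =
      ENNReal.ofReal (2 ^ (-γ) * (pw γ n * ‖f n‖)) := fun n => by
    rw [h n, linftyNorm_tf, weight_mul_enorm]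
  simp only [h1]
  have h2 := squeeze_zero (fun n => mul_nonneg (pw_nonneg γ n) (norm_nonneg _)) hf ha
  simpa using ENNReal.tendsto_ofReal (h2.const_mul ((2 : ℝ) ^ (-γ)))

theorem MemC.tendsto (h : MemC χ γ u) (hf : Rep χ u f) :
    Tendsto (fun n => pw γ n * ‖f n‖) atTop (𝓝 0) := by
  have h1 : ∀ n, (weight γ n * linftyNorm (block χ n u)).toReal =
      2 ^ (-γ) * (pw γ n * ‖f n‖) := fun n => by
    rw [hf n, linftyNorm_tf, weight_mul_enorm, toReal_ofReal]
    exact mul_nonneg (by positivity) (mul_nonneg (pw_nonneg γ n) (norm_nonneg _))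
  have h2 := ((ENNReal.tendsto_toReal ENNReal.zero_ne_top).comp h.2).const_mul ((2 : ℝ) ^ γ)
  simp only [Function.comp_def, h1, ENNReal.toReal_zero, mul_zero] at h2
  refine h2.congr fun n => ?_
  rw [← mul_assoc, ← rpow_add two_pos, add_neg_cancel, Real.rpow_zero, one_mul]

theorem LO.memCT (hg : LO T γ g) (hc : ∀ n, ContinuousOn (fun t => g t n) (Icc 0 T))
    (h : ∀ t ∈ Icc 0 T, Rep χ (w t) (g t)) : MemCT χ T γ w := by
  obtain ⟨a, ha, hga⟩ := hg
  refine ⟨fun t ht => MemC.of_rep (h t ht) ha (hga t ht), fun t ht => ?_⟩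
  rw [ENNReal.tendsto_nhds_zero]
  intro δ hδ
  obtain ⟨r, hr0, hr⟩ : ∃ r : ℝ, 0 < r ∧ ENNReal.ofReal r ≤ δ := by
    rcases eq_or_ne δ ⊤ with rfl | hne
    · exact ⟨1, one_pos, le_top⟩
    · exact ⟨δ.toReal, ENNReal.toReal_pos hδ.ne' hne, (ENNReal.ofReal_toReal hne).le⟩
  set ρ := (2 : ℝ) ^ γ * r with hρ
  have hρ0 : 0 < ρ := by positivity
  obtain ⟨N, hN⟩ := eventually_atTop.1 (ha.eventually_le_const (half_pos hρ0))
  have fin : ∀ᶠ s in 𝓝[Icc 0 T] t, ∀ n ∈ Finset.range N, pw γ n * ‖g s n - g t n‖ < ρ := by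
    rw [Finset.eventually_all]
    intro n _
    have := (tendsto_iff_norm_sub_tendsto_zero.1 (hc n t ht)).const_mul (pw γ n)
    rw [mul_zero] at this
    exact this.eventually_lt_const hρ0
  filter_upwards [fin, self_mem_nhdsWithin] with s hs hs'
  refine le_trans ?_ hr
  rw [((h s hs').sub (h t ht)).besovNorm_le_iff hr0.le, PB_iff_pw]
  intro n
  rcases lt_or_ge n N with hn | hn
  · exact (hs n (Finset.mem_range.2 hn)).le
  · have h1 := mul_le_mul_of_nonneg_left (norm_sub_le (g s n) (g t n)) (pw_nonneg γ n)
    rw [mul_add] at h1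
    rw [Pi.sub_apply]
    linarith [hga s hs' n, hga t ht n, hN n hn]

theorem Rep.eq_tf_tsum (h : Rep χ u f) (hf : PB γ C f) (hγ : 0 < γ) : u = tf (∑' n, f n) := by
  ext φ
  exact (h.hasSum hf φ).unique ((tfEval φ).hasSum (hf.summable hγ).hasSum)

theorem exists_solutionNorm_le (χ : DyadicPartition d) (α T l : ℝ) (hl : 0 ≤ l) {θ : ℝ}
    (hθ : 0 < θ) : ∃ K, 0 ≤ K ∧ ∀ (w : ℝ → Distr d) (g : BPath d) (M : ℝ), 0 ≤ M →
    (∀ t ∈ Icc 0 T, Rep χ (w t) (g t)) → PBW T l θ M g → HOL T l 0 (θ / α) M g →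
    solutionNorm χ α T θ w ≤ ENNReal.ofReal (K * M) := by
  set X := exp (l * T) with hX
  have hX0 : 0 < X := exp_pos _
  set Z := ∑' n, pw (-θ) n with hZ
  have hZ0 : 0 ≤ Z := tsum_nonneg fun n => pw_nonneg _ _
  refine ⟨2 ^ (-θ) * X + (X + X * Z), by positivity, fun w g M hM hw hp hh => ?_⟩
  have hp' : ∀ t ∈ Icc 0 T, PB θ (M * X) (g t) := fun t ht =>
    (hp t ht).mono le_rfl (mul_le_mul_of_nonneg_left (wt_le hl ht.1) hM)
  rw [add_mul, ENNReal.ofReal_add (by positivity) (by positivity), add_mul,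
    ENNReal.ofReal_add (by positivity) (by positivity)]
  refine add_le_add (iSup₂_le fun t ht => ?_) (add_le_add (iSup₂_le fun s hs =>
    iSup₂_le fun t ht => ?_) (iSup₂_le fun t ht => ?_))
  · refine ((hw t ht).besovNorm_le (hp' t ht)).trans (le_of_eq ?_)
    congr 1
    ring
  · have ht' : t ∈ Icc 0 T := ⟨hs.1.trans ht.1.le, ht.2⟩
    have h1 : 0 < t - s := sub_pos.2 ht.1
    have h2 : 0 < (t - s) ^ (θ / α) := Real.rpow_pos_of_pos h1 _
    rw [((hw t ht').sub (hw s hs)).eq_tf_tsum ((hp' t ht').sub (hp' s hs)) hθ, linftyNorm_tf]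
    refine ENNReal.div_le_of_le_mul ?_
    rw [← ENNReal.ofReal_mul (by positivity), ← ofReal_norm]
    refine ENNReal.ofReal_le_ofReal ?_
    have hs1 := ((hp' t ht').sub (hp' s hs)).summable hθ
    refine le_of_tendsto hs1.hasSum.tendsto_sum_nat.norm (.of_forall fun N => ?_)
    refine (norm_sum_le _ _).trans (le_trans (le_of_eq ?_) ((hh s t hs.1 ht.1.le ht.2 N).trans ?_))
    · refine sum_congr rfl fun n _ => ?_
      rw [pw_zero_left, one_mul, Pi.sub_apply, norm_sub_rev]
    · rw [mul_comm X M]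
      exact mul_le_mul_of_nonneg_right (mul_le_mul_of_nonneg_left (wt_le hl hs.1) hM) h2.le
  · rw [(hw t ht).eq_tf_tsum (hp' t ht) hθ, linftyNorm_tf, ← ofReal_norm]
    refine ENNReal.ofReal_le_ofReal (((hp' t ht).norm_tsum_le hθ).trans (le_of_eq ?_))
    rw [← hZ]
    ring

end

section

variable {d : ℕ} {χ : DyadicPartition d}
variable {α : ℝ} {ν : Measure (Sphere d)} [IsFiniteMeasure ν]
  [Stable α ν]
variable {β θ T R ε : ℝ} {uT vT : Distr d} {V W : DriftPair d} {F : Source d} {S S' : SD d}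
  {r r' : ℝ → Distr d} {u : ℝ → Distr d} {u' : Fin d → ℝ → Distr d} {f s : BPath d}
variable {t : ℝ}

/-! ### Solutions and fixed points -/

/-- The constant vector `e` with `u' = ∇u - e`. -/
def Source.dir : Source d → Fin d → ℂ
  | .field _ => 0
  | .drift j => Pi.single j 1

/-- The part of the right-hand side that is not a component of the drift. -/
def Source.reg : Source d → ℝ → Distr d
  | .field f => f
  | .drift _ => 0

theorem Source.norm_dir_le (F : Source d) (i : Fin d) : ‖F.dir i‖ ≤ 1 := by
  cases F with
  | field f => simp [Source.dir]
  | drift j =>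
    rw [Source.dir, Pi.single_apply]
    split_ifs <;> simp

/-- The sequences `S` are the blocks of the data `(uT, V, r)`. -/
structure Enc (χ : DyadicPartition d) (T : ℝ) (uT : Distr d) (V : DriftPair d) (r : ℝ → Distr d)
    (S : SD d) : Prop where
  terminal : Rep χ uT S.uT
  fst : ∀ i, ∀ t ∈ Icc 0 T, Rep χ (V.fst i t) (S.V i t)
  snd : ∀ i j, ∀ t ∈ Icc 0 T, Rep χ (V.snd i j t) (S.V₂ i j t)
  source : ∀ t ∈ Icc 0 T, Rep χ (r t) (S.f₀ t)

instance : Sub (SD d) := ⟨fun S S' => ⟨S.V - S'.V, S.V₂ - S'.V₂, S.uT - S'.uT, S.f₀ - S'.f₀⟩⟩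

theorem Enc.sub (h : Enc χ T uT V r S) (h' : Enc χ T vT W r' S') :
    Enc χ T (uT - vT) (V - W) (r - r') (S - S') :=
  ⟨h.terminal.sub h'.terminal, fun i t ht => (h.fst i t ht).sub (h'.fst i t ht),
    fun i j t ht => (h.snd i j t ht).sub (h'.snd i j t ht), fun t ht => (h.source t ht).sub (h'.source t ht)⟩

/-- The constant that compares the norms of distributions with those of sequences of blocks. -/
def encC (α β θ ε : ℝ) : ℝ := 2 ^ (2 * θ - 1) + 2 ^ β + 2 ^ (2 * β + α - 1) + 2 ^ ε

theorem Enc.bounds (h : Enc χ T uT V r S) (hp : Params α β θ) (hε : 0 < ε) (hR : 0 ≤ R)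
    (h₁ : besovNorm χ (2 * θ - 1) uT ≤ ENNReal.ofReal R)
    (h₂ : driftNorm χ α T β V ≤ ENNReal.ofReal R) (h₃ : normCT χ T ε r ≤ ENNReal.ofReal R) :
    (∀ i, ∀ t ∈ Icc 0 T, PB β (encC α β θ ε * R) (S.V i t)) ∧
      (∀ i j, ∀ t ∈ Icc 0 T, PB (2 * β + α - 1) (encC α β θ ε * R) (S.V₂ i j t)) ∧
      PB (2 * θ - 1) (encC α β θ ε * R) S.uT ∧ ∀ t ∈ Icc 0 T, PB (β + θ - 1) (encC α β θ ε * R)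
      (S.f₀ t) := by
  have p : ∀ x : ℝ, (0 : ℝ) < 2 ^ x := fun x => Real.rpow_pos_of_pos two_pos x
  have p1 := p (2 * θ - 1)
  have p2 := p β
  have p3 := p (2 * β + α - 1)
  have p4 := p ε
  unfold encC
  refine ⟨fun i t ht => (h.fst i t ht).PB_of_le hR (by linarith) (le_trans ?_ h₂),
    fun i j t ht => (h.snd i j t ht).PB_of_le hR (by linarith) (le_trans ?_ h₂),
    h.terminal.PB_of_le hR (by linarith) h₁, fun t ht => ((h.source t ht).PB_of_le hR (by linarith)
      (le_trans ?_ h₃)).mono (by linarith [hp.theta.2, hp.beta.2]) le_rfl⟩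
  · exact le_trans (le_trans (le_iSup₂ (f := fun t _ => besovNorm χ β (V.fst i t)) t ht)
      (le_iSup (fun i => normCT χ T β (V.fst i)) i)) le_self_add
  · exact le_trans (le_trans (le_trans (le_iSup₂ (f := fun t _ => besovNorm χ _ (V.snd i j t)) t ht)
      (le_iSup (fun j => normCT χ T _ (V.snd i j)) j))
      (le_iSup (fun i => ⨆ j, normCT χ T (2 * β + α - 1) (V.snd i j)) i)) le_add_self
  · exact le_iSup₂ (f := fun t _ => besovNorm χ ε (r t)) t ht

theorem exists_enc (hp : Params α β θ) (hε : 0 < ε) (hu : MemC χ (2 * θ - 1) uT)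
    (hV : MemX χ α ν T β V) (hr : MemCT χ T ε r) : ∃ S R, Enc χ T uT V r S ∧ S.Bd χ α β θ T R := by
  choose v cv rv using fun i => (hV.1 i).exists_CP
  choose v₂ cv₂ rv₂ using fun i j => (hV.2.1 i j).exists_CP
  obtain ⟨g, cg, rg⟩ := hr.exists_CP
  obtain ⟨k, rk⟩ := exists_rep hu.1
  choose C hC using fun i => (cv i).bdd
  choose C₂ hC₂ using fun i j => (cv₂ i j).bdd
  obtain ⟨C₃, hC₃⟩ := cg.bdd
  have hκ : β + θ - 1 ≤ ε := by linarith [hp.theta.2, hp.beta.2]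
  have b4 := (rk.besovNorm_le_iff toReal_nonneg).1 (ENNReal.ofReal_toReal hu.1.ne).ge
  set C₄ := 2 ^ (2 * θ - 1) * (besovNorm χ (2 * θ - 1) uT).toReal with hC₄
  have n1 : ∀ i, |C i| ≤ ∑ i, |C i| := fun i =>
    single_le_sum (f := fun i => |C i|) (fun _ _ => abs_nonneg _) (Finset.mem_univ i)
  have n2 : ∀ i j, |C₂ i j| ≤ ∑ i, ∑ j, |C₂ i j| := fun i j =>
    (single_le_sum (f := fun j => |C₂ i j|) (fun _ _ => abs_nonneg _)
      (Finset.mem_univ j)).trans (single_le_sum (f := fun i => ∑ j, |C₂ i j|)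
      (fun _ _ => sum_nonneg fun _ _ => abs_nonneg _) (Finset.mem_univ i))
  have m1 : 0 ≤ ∑ i, |C i| := sum_nonneg fun _ _ => abs_nonneg _
  have m2 : 0 ≤ ∑ i, ∑ j, |C₂ i j| := sum_nonneg fun _ _ => sum_nonneg fun _ _ => abs_nonneg _
  have m3 := abs_nonneg C₃
  have m4 := b4.nonneg
  refine ⟨⟨v, v₂, k, g⟩, (∑ i, |C i|) + (∑ i, ∑ j, |C₂ i j|) + |C₃| + C₄, ⟨rk, rv, rv₂, rg⟩,
    ⟨cv, cv₂, cg.mono hκ, rk.blk, fun i t ht => (hC i t ht).mono le_rfl ?_,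
    fun i j t ht => (hC₂ i j t ht).mono le_rfl ?_, b4.mono le_rfl (by linarith),
    fun t ht => (hC₃ t ht).mono hκ (by linarith [le_abs_self C₃])⟩⟩
  · linarith [n1 i, le_abs_self (C i)]
  · linarith [n2 i j, le_abs_self (C₂ i j)]

theorem Enc.path (h : Enc χ T uT V F.reg S) (ht : t ∈ Icc 0 T) :
    Rep χ (F.path V t) ((∑ i, F.dir i • S.V i t) + S.f₀ t) := by
  cases F with
  | field f => simpa [Source.dir] using! h.source t ht
  | drift j =>
    have h0 : S.f₀ t = 0 := (h.source t ht).unique Rep.zero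
    have h1 : ∑ i, (Source.drift j).dir i • S.V i t = S.V j t := by
      simp [Source.dir, Pi.single_apply]
    rw [h0, h1, add_zero]
    exact h.fst j t ht

theorem Rep.deriv {k : BSeq d} (h : Rep χ (u t) k) (F : Source d) (i : Fin d) :
    Rep χ (fixedPointMapDeriv F u i t) (derE χ F.dir k i) := by
  cases F with
  | field f =>
    have : derE χ (Source.field f).dir k i = derSeq χ i k := by
      rw [derE, cst_eq_smul, Source.dir, Pi.zero_apply, zero_smul, sub_zero]
    rw [this]
    exact h.partialD i
  | drift j =>
    refine (h.partialD i).sub ?_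
    rw [ofFun_const, Source.dir, Pi.single_apply]
    exact rep_blocks _

theorem CP.exists_PB {γ : ℝ} (h : CP χ T γ f) (ht : t ∈ Icc 0 T) : ∃ C, PB γ C (f t) :=
  let ⟨C, hC⟩ := h.bdd
  ⟨C, hC t ht⟩

theorem rep_sharp (hp : Params α β θ) (hT : 0 < T) (hS : S.Bd χ α β θ T R)
    (hE : Enc χ T uT V F.reg S) (cf : CP χ T θ f) (hu : ∀ t ∈ Icc 0 T, Rep χ (u t) (f t))
    (hu' : ∀ i, ∀ t ∈ Icc 0 T, Rep χ (u' i t) (derE χ F.dir (f t) i)) (ht : t ∈ Icc 0 T) :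
    Rep χ (sharp χ α ν T V.fst u u' t) (f t - ∑ i, paraSeq χ (derE χ F.dir (f t) i)
      (Jseq χ α ν T (S.V i) t)) := by
  refine (hu t ht).sub (Rep.sum _ fun i _ => ?_)
  obtain ⟨C₁, h₁⟩ := (cf.derE F.dir i).exists_PB ht
  obtain ⟨C₂, h₂⟩ := ((hS.cpV i).Jseq (ν := ν) hT hp.gainJ_mem).exists_PB ht
  exact (hu' i t ht).para (Rep.J (hS.cpV i) (hE.fst i) ht) h₁ h₂

theorem rep_gradProd (hp : Params α β θ) (hT : 0 < T) (hS : S.Bd χ α β θ T R)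
    (hE : Enc χ T uT V F.reg S) (cf : CP χ T θ f) (cs : CP χ T (2 * θ - 1) s)
    (hu : ∀ t ∈ Icc 0 T, Rep χ (u t) (f t))
    (hu' : ∀ i, ∀ t ∈ Icc 0 T, Rep χ (u' i t) (derE χ F.dir (f t) i))
    (hs : ∀ t ∈ Icc 0 T, Rep χ (sharp χ α ν T V.fst u u' t) (s t)) (ht : t ∈ Icc 0 T) :
    Rep χ (gradProd χ α ν T V u u' t) ((∑ j, paraSeq χ (derSeq χ j (f t)) (S.V j t)) +
      regProd χ F.dir (S.drift χ α ν T t) (f t) (s t)) := by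
  have hα := hp.alpha
  have hθ := hp.one_lt_theta
  have hθ2 := hp.theta_lt_two
  have hg := hp.gainJ_pos
  obtain ⟨ζ, hζ, cS⟩ := CP_sharpSeq (ν := ν) (e := F.dir) hp hT hS cf cs
  choose C₀ h₀ using fun j => (cf.der j).exists_PB ht
  choose C₁ h₁ using fun i => (cf.derE F.dir i).exists_PB ht
  choose C₂ h₂ using fun j => (cS j).exists_PB ht
  choose C₃ h₃ using fun i => ((hS.cpV i).Jseq (ν := ν) hT hp.gainJ_mem).exists_PB ht
  choose C₄ h₄ using fun i j => (((hS.cpV i).der j).Jseq (ν := ν) hT hp.gainJ_mem).exists_PB ht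
  choose C₅ h₅ using fun i j => ((cf.derE F.dir i).der j).exists_PB ht
  have eV : ∀ i, (S.drift χ α ν T t).V i = S.V i t := fun i => rfl
  have eV₂ : ∀ i j, (S.drift χ α ν T t).V₂ i j = S.V₂ i j t := fun i j => rfl
  have eB : ∀ i j, (S.drift χ α ν T t).B i j = Jseq χ α ν T (fun r => derSeq χ j (S.V i r)) t :=
    fun i j => rfl
  rw [gradProd, add_assoc, regProd]
  simp only [eV, eV₂, eB]
  refine Rep.add (Rep.sum _ fun j _ => ?_) (Rep.add (Rep.sum _ fun j _ => ?_) (Rep.add (Rep.add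
    (Rep.sum _ fun i _ => Rep.sum _ fun j _ => Rep.add (Rep.add ?_ ?_) ?_)
    (Rep.sum _ fun i _ => Rep.sum _ fun j _ => ?_)) (Rep.sum _ fun j _ => ?_)))
  · exact ((hu t ht).partialD j).para (hE.fst j t ht) (h₀ j) (hS.V j t ht)
  · exact (hE.fst j t ht).para ((hu t ht).partialD j) (hS.V j t ht) (h₀ j)
  · exact (hu' i t ht).para (hE.snd i j t ht) (h₁ i) (hS.V₂ i j t ht)
  · exact (hE.snd i j t ht).para (hu' i t ht) (hS.V₂ i j t ht) (h₁ i)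
  · rw [reso_eq (hu' i t ht) (hE.snd i j t ht)
      (summable_resoTerm hp.reso_pos (h₁ i) (hS.V₂ i j t ht))]
    exact rep_blocks _
  · have rJ := Rep.J (ν := ν) ((hS.cpV i).der j) (fun r hr => (hE.fst i r hr).partialD j) ht
    rw [comm_eq (hu' i t ht) ((hu' i t ht).eq_tf_tsum (h₁ i) (by linarith)) rJ (hE.fst j t ht) (h₁ i)
      (h₄ i j) (summable_commTerm χ ⟨by linarith, by linarith⟩ (by linarith) (hu' i t ht).blk rJ.blk
        (h₁ i) (h₄ i j) (hS.V j t ht))]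
    exact rep_blocks _
  · have rG : Rep χ (gradSharp χ α ν T V.fst u u' j t)
        (sharpSeq χ F.dir (S.drift χ α ν T t) (f t) (s t) j) :=
      ((hs t ht).partialD j).add (Rep.sum _ fun i _ => ((hu' i t ht).partialD j).para
        (Rep.J (hS.cpV i) (hE.fst i) ht) (h₅ i j) (h₃ i))
    rw [reso_eq rG (hE.fst j t ht) (summable_resoTerm hζ (h₂ j) (hS.V j t ht))]
    exact rep_blocks _

theorem rep_fixedPointMap (hp : Params α β θ) (hT : 0 < T) (hS : S.Bd χ α β θ T R)
    (hE : Enc χ T uT V F.reg S) (cf : CP χ T θ f) (cs : CP χ T (2 * θ - 1) s)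
    (hu : ∀ t ∈ Icc 0 T, Rep χ (u t) (f t))
    (hu' : ∀ i, ∀ t ∈ Icc 0 T, Rep χ (u' i t) (derE χ F.dir (f t) i))
    (hs : ∀ t ∈ Icc 0 T, Rep χ (sharp χ α ν T V.fst u u' t) (s t)) (ht : t ∈ Icc 0 T) :
    Rep χ (fixedPointMap χ α ν T uT V F u u' t) (Phi χ α ν T F.dir S f s t) := by
  set P : BPath d := fun t => (∑ i, F.dir i • S.V i t) + S.f₀ t with hP
  have cP : CP χ T β P := by
    have : P = (∑ i, F.dir i • S.V i) + S.f₀ := by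
      ext1 t
      simp [hP]
    rw [this]
    exact (CP.sum _ fun i _ => (hS.cpV i).smul _).add (hS.cpf.mono (by linarith [hp.one_lt_theta]))
  have cG := CP_rhs (ν := ν) (e := F.dir) hp hT hS cf cs
  set G := irrPath χ F.dir S f + regPath χ α ν T F.dir S f s with hG
  have eG : ∀ t, (G + P) t = (∑ j, paraSeq χ (derSeq χ j (f t)) (S.V j t)) +
      regProd χ F.dir (S.drift χ α ν T t) (f t) (s t) := by
    intro t
    simp only [hG, hP, Pi.add_apply, irrPath, regPath, sum_sub_distrib]
    abel
  have r1 := Rep.J (ν := ν) cP (fun t ht => hE.path ht) ht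
  have r2 := Rep.J (ν := ν) (cG.add cP) (fun t ht => by
    rw [eG]
    exact rep_gradProd hp hT hS hE cf cs hu hu' hs ht) ht
  have r3 := hE.terminal.semigroup (ν := ν) (sub_nonneg.2 ht.2) hS.uT
  refine ((r1.neg.add r2).add r3).congr ?_
  rw [Jseq_add cG cP ht, Phi]
  abel

theorem IsSolution.exists_isFix (h : IsSolution χ α ν T θ uT V F u) (hp : Params α β θ)
    (hT : 0 < T) (hS : S.Bd χ α β θ T R) (hE : Enc χ T uT V F.reg S) :
    ∃ f s, IsFix χ α ν θ T F.dir S f s ∧ ∀ t ∈ Icc 0 T, Rep χ (u t) (f t) := by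
  obtain ⟨u', hc, heq⟩ := h
  obtain ⟨f, cf, hf⟩ := hc.mem.exists_CP
  obtain ⟨s, cs, hs⟩ := hc.mem_sharp.exists_CP
  have hu' : ∀ i, ∀ t ∈ Icc 0 T, Rep χ (u' i t) (derE χ F.dir (f t) i) := fun i t ht => by
    rw [(heq t ht).2 i]
    exact (hf t ht).deriv F i
  have equ : ∀ t ∈ Icc 0 T, f t = Phi χ α ν T F.dir S f s t := fun t ht =>
    (hf t ht).unique ((heq t ht).1 ▸ rep_fixedPointMap hp hT hS hE cf cs hf hu' hs ht)
  refine ⟨f, s, ⟨cf, cs, equ, fun t ht => ?_⟩, hf⟩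
  rw [PhiSharp, ← equ t ht]
  exact (hs t ht).unique (rep_sharp hp hT hS hE cf hf hu' ht)

theorem IsFix.LO_sharp {e : Fin d → ℂ} (h : IsFix χ α ν θ T e S f s) (hp : Params α β θ)
    (hT : 0 < T) (hS : S.Bd χ α β θ T R)
    (hu : Tendsto (fun n => pw (2 * θ - 1) n * ‖S.uT n‖) atTop (𝓝 0)) : LO T (2 * θ - 1) s := by
  have hα := hp.alpha
  have hθ := hp.one_lt_theta
  have hβg := hp.le_beta_add_gainT
  obtain ⟨M, hM⟩ := h.exists_SB hp hT hS one_pos ⟨one_pos, le_rfl⟩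
  have hM0 := hM.pb.nonneg hT.le
  obtain ⟨Kp, _, kp⟩ := exists_norm_Pseq_le (ν := ν) χ T
  obtain ⟨Kc, hKc, kc⟩ := exists_PBW_remJ (ν := ν) χ hp hT
  obtain ⟨Cr, hCr⟩ := ((CP_regPath (ν := ν) (e := e) hp hT hS h.cpu h.cps).Jseq (ν := ν) hT
    hp.gainT_mem).bdd
  have hrest := (PBW.sum Finset.univ fun i _ => (kc 1 zero_le_one (e i) i _ _ _ _ h.cpu (hS.cpV i)
    hM.pb hM.hol₁ (hS.V i)).2).add (PBW.of_PB zero_le_one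
    (fun t ht => (hCr t ht).mono (γ' := θ - 1 + β + gainT α β θ) (by linarith) le_rfl))
  set rest := (∑ i, remJ χ α ν T (e i) (fun r => derSeq χ i (f r)) (S.V i)) +
    Jseq χ α ν T (regPath χ α ν T e S f s) with hrestdef
  have l1 : LO T (2 * θ - 1) rest := by
    refine LO.of_PB (γ' := θ - 1 + β + gainT α β θ) (by linarith) fun t ht => (hrest t ht).mono le_rfl
      (mul_le_mul_of_nonneg_left (wt_le zero_le_one ht.1) (hrest.nonneg hT.le))
  have l2 : LO T (2 * θ - 1) fun t => Pseq χ α ν (T - t) S.uT := by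
    have := hu.const_mul Kp
    rw [mul_zero] at this
    refine ⟨_, this, fun t ht n => ?_⟩
    have := mul_le_mul_of_nonneg_left (kp (T - t) ⟨by linarith [ht.2], by linarith [ht.1]⟩ S.uT n)
      (pw_nonneg (2 * θ - 1) n)
    rwa [mul_left_comm] at this
  obtain ⟨a, ha, hb⟩ := l2.add l1
  refine ⟨a, ha, fun t ht n => ?_⟩
  have e1 : s t = ((fun t => Pseq χ α ν (T - t) S.uT) + rest) t := by
    rw [h.eqs t ht, PhiSharp_eq hp hT hS h.cpu h.cps ht]
    simp [hrestdef]
  rw [e1]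
  exact hb t ht n

theorem exists_isSolution (hp : Params α β θ) (hT : 0 < T) (hS : S.Bd χ α β θ T R)
    (hE : Enc χ T uT V F.reg S) (hu : MemC χ (2 * θ - 1) uT) :
    ∃ u, IsSolution χ α ν T θ uT V F u ∧ MemCT χ T θ u ∧ normHolder T (θ / α) u < ⊤ := by
  obtain ⟨f, s, h⟩ := exists_isFix (ν := ν) (e := F.dir) hp hT F.norm_dir_le hS
  have h1 : ∀ t ∈ Icc 0 T, ∃ w, Rep χ w (f t) := fun t ht =>
    let ⟨_, hC⟩ := h.cpu.exists_PB ht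
    (h.cpu.blk t ht).exists_rep hC
  choose! u hf using h1
  have cf : CP χ T (regT α β θ) f := (CP_Phi hp hT hS h.cpu h.cps).congr h.equ
  obtain ⟨C, hC⟩ := cf.bdd
  have hu' : ∀ i, ∀ t ∈ Icc 0 T, Rep χ (fixedPointMapDeriv F u i t) (derE χ F.dir (f t) i) :=
    fun i t ht => (hf t ht).deriv F i
  have hs : ∀ t ∈ Icc 0 T, Rep χ (sharp χ α ν T V.fst u (fixedPointMapDeriv F u) t) (s t) := by
    intro t ht
    rw [h.eqs t ht, PhiSharp, ← h.equ t ht]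
    exact rep_sharp hp hT hS hE h.cpu hf hu' ht
  have mu : MemCT χ T θ u := (LO.of_PB hp.lt_regT hC).memCT h.cpu.cont hf
  obtain ⟨M, hM⟩ := h.exists_SB hp hT hS one_pos ⟨one_pos, le_rfl⟩
  have hh : normHolder T (θ / α) u < ⊤ := by
    obtain ⟨K, _, k⟩ := exists_solutionNorm_le χ α T 1 zero_le_one (θ := θ)
      (by linarith [hp.one_lt_theta])
    exact (le_add_self.trans (k u f M (hM.pb.nonneg hT.le) hf hM.pb hM.hol₀)).trans_lt
      ENNReal.ofReal_lt_top
  refine ⟨u, ⟨fixedPointMapDeriv F u, ⟨mu, hh, fun i => ?_, ?_⟩, fun t ht => ⟨?_, fun i => rfl⟩⟩,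
    mu, hh⟩
  · have ci := cf.derE F.dir i
    obtain ⟨C', hC'⟩ := ci.bdd
    exact (LO.of_PB (by linarith [hp.lt_regT]) hC').memCT ci.cont (hu' i)
  · exact (h.LO_sharp hp hT hS (hu.tendsto hE.terminal)).memCT h.cps.cont hs
  · refine (hf t ht).ext ?_
    rw [h.equ t ht]
    exact rep_fixedPointMap hp hT hS hE h.cpu h.cps hf hu' hs ht

theorem exists_lipschitz (χ : DyadicPartition d) (hp : Params α β θ) (hT : 0 < T) (hε : 0 < ε)
    (R : ℝ≥0) : ∃ K : ℝ≥0, ∀ (uT vT : Distr d) (V W : DriftPair d) (F G : Source d) (u v : ℝ →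
    Distr d), F.dir = G.dir → MemC χ (2 * θ - 1) uT → MemC χ (2 * θ - 1) vT → MemX χ α ν T β V →
    MemX χ α ν T β W → MemCT χ T ε F.reg → MemCT χ T ε G.reg → besovNorm χ (2 * θ - 1) uT ≤ R →
    besovNorm χ (2 * θ - 1) vT ≤ R → driftNorm χ α T β V ≤ R → driftNorm χ α T β W ≤ R →
    normCT χ T ε F.reg ≤ R → normCT χ T ε G.reg ≤ R → IsSolution χ α ν T θ uT V F u →
    IsSolution χ α ν T θ vT W G v → solutionNorm χ α T θ (u - v) ≤
    K * (besovNorm χ (2 * θ - 1) (uT - vT) + driftNorm χ α T β (V - W) + normCT χ T ε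
    (F.reg - G.reg)) := by
  set c := encC α β θ ε with hc
  have hc0 : 0 ≤ c := by
    rw [hc]
    unfold encC
    positivity
  obtain ⟨l, hl, K₁, hK₁, k₁⟩ := exists_stability (ν := ν) χ hp hT (c * R)
  obtain ⟨K₂, hK₂, k₂⟩ := exists_solutionNorm_le χ α T l hl.le (θ := θ)
    (by linarith [hp.one_lt_theta])
  set K := K₂ * (K₁ * c) + 1 with hK
  have hK0 : 0 < K := by positivity
  refine ⟨K.toNNReal, fun uT vT V W F G u v hFG muT mvT mV mW mF mG b1 b2 b3 b4 b5 b6 hu hv => ?_⟩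
  change _ ≤ ENNReal.ofReal K * _
  set X := besovNorm χ (2 * θ - 1) (uT - vT) + driftNorm χ α T β (V - W) +
    normCT χ T ε (F.reg - G.reg) with hX
  rcases eq_or_ne X ⊤ with hXt | hXt
  · rw [hXt, ENNReal.mul_top (ENNReal.ofReal_pos.2 hK0).ne']
    exact le_top
  rw [← ENNReal.ofReal_coe_nnreal] at b1 b2 b3 b4 b5 b6
  obtain ⟨S, R₁, hE, hS⟩ := exists_enc hp hε muT mV mF
  obtain ⟨S', R₂, hE', hS'⟩ := exists_enc hp hε mvT mW mG
  obtain ⟨B₁, B₂, B₃, B₄⟩ := hE.bounds hp hε R.coe_nonneg b1 b3 b5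
  obtain ⟨B₁', B₂', B₃', B₄'⟩ := hE'.bounds hp hε R.coe_nonneg b2 b4 b6
  have hS1 : S.Bd χ α β θ T (c * R) := ⟨hS.cpV, hS.cpV₂, hS.cpf, hS.blk, B₁, B₂, B₃, B₄⟩
  have hS1' : S'.Bd χ α β θ T (c * R) := ⟨hS'.cpV, hS'.cpV₂, hS'.cpf, hS'.blk, B₁', B₂', B₃', B₄'⟩
  have hXr : ENNReal.ofReal X.toReal = X := ENNReal.ofReal_toReal hXt
  obtain ⟨D₁, D₂, D₃, D₄⟩ := (hE.sub hE').bounds hp hε (R := X.toReal) toReal_nonneg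
    (by rw [hXr]; exact le_self_add.trans le_self_add)
    (by rw [hXr]; exact le_add_self.trans le_self_add) (by rw [hXr]; exact le_add_self)
  obtain ⟨f, s, h, hf⟩ := hu.exists_isFix hp hT hS1 hE
  obtain ⟨g, s', h', hg⟩ := hv.exists_isFix hp hT hS1' hE'
  rw [← hFG] at h'
  obtain ⟨a1, a2⟩ := k₁ F.dir F.norm_dir_le S S' (c * X.toReal) f g s s' hS1 hS1'
    ⟨D₁, D₂, D₃, D₄⟩ h h'
  have hX0 : 0 ≤ X.toReal := toReal_nonneg
  refine (k₂ (u - v) (f - g) _ (by positivity) (fun t ht => (hf t ht).sub (hg t ht)) a1 a2).trans ?_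
  rw [← hXr, ← ENNReal.ofReal_mul hK0.le, hXr]
  refine ENNReal.ofReal_le_ofReal ?_
  rw [hK, add_mul, one_mul]
  linarith

end

end RoughKolmogorov

end

theorem mainTheorem4 {d : ℕ} (χ : DyadicPartition d)
    (α : ℝ) (hα : α ∈ Ioc 1 2)
    (ν : Measure (Metric.sphere (0 : Space d) 1)) [IsFiniteMeasure ν] (hν : ν ≠ 0)
    (hν_symm : ν.map (fun ξ => -ξ) = ν)
    (hν_span : Submodule.span ℝ (Subtype.val '' ν.support) = ⊤)
    (T : ℝ) (hT : 0 < T)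
    (β : ℝ) (hβ : β ∈ Ioc ((2 - 2 * α) / 3) ((1 - α) / 2))
    (θ : ℝ) (hθ : θ ∈ Ioo ((2 - β) / 2) (β + α))
    (ε : ℝ) (hε : 0 < ε) :
    -- the solution map is well defined, with values in `C_T 𝒞^θ ∩ C_T^{θ/α} L^∞`
    (∀ (uT : Distr d) (V : DriftPair d) (F : Source d),
      MemC χ (2 * θ - 1) uT → MemX χ α ν T β V → F.Admissible χ T ε →
      ∃ u : ℝ → Distr d, IsSolution χ α ν T θ uT V F u ∧
        MemCT χ T θ u ∧ normHolder T (θ / α) u < ⊤ ∧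
        ∀ v : ℝ → Distr d, IsSolution χ α ν T θ uT V F v → EqOn v u (Icc 0 T)) ∧
    -- it is Lipschitz on bounded sets of data `(u^T, 𝒱, f)` with `f ∈ C_T 𝒞^ε`
    (∀ R : ℝ≥0, ∃ K : ℝ≥0, ∀ (uT vT : Distr d) (V W : DriftPair d) (f g u v : ℝ → Distr d),
      MemC χ (2 * θ - 1) uT → MemC χ (2 * θ - 1) vT →
      MemX χ α ν T β V → MemX χ α ν T β W → MemCT χ T ε f → MemCT χ T ε g →
      besovNorm χ (2 * θ - 1) uT ≤ R → besovNorm χ (2 * θ - 1) vT ≤ R →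
      driftNorm χ α T β V ≤ R → driftNorm χ α T β W ≤ R →
      normCT χ T ε f ≤ R → normCT χ T ε g ≤ R →
      IsSolution χ α ν T θ uT V (.field f) u → IsSolution χ α ν T θ vT W (.field g) v →
      solutionNorm χ α T θ (u - v) ≤
        K * (besovNorm χ (2 * θ - 1) (uT - vT) + driftNorm χ α T β (V - W) +
          normCT χ T ε (f - g))) ∧
    -- it is Lipschitz on bounded sets of data `(u^T, 𝒱)` with `f = 𝒱₁^j`
    (∀ j : Fin d, ∀ R : ℝ≥0, ∃ K : ℝ≥0, ∀ (uT vT : Distr d) (V W : DriftPair d)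
      (u v : ℝ → Distr d),
      MemC χ (2 * θ - 1) uT → MemC χ (2 * θ - 1) vT →
      MemX χ α ν T β V → MemX χ α ν T β W →
      besovNorm χ (2 * θ - 1) uT ≤ R → besovNorm χ (2 * θ - 1) vT ≤ R →
      driftNorm χ α T β V ≤ R → driftNorm χ α T β W ≤ R →
      IsSolution χ α ν T θ uT V (.drift j) u → IsSolution χ α ν T θ vT W (.drift j) v →
      solutionNorm χ α T θ (u - v) ≤
        K * (besovNorm χ (2 * θ - 1) (uT - vT) + driftNorm χ α T β (V - W))) := by
  have hp : Params α β θ := ⟨hα, hβ, hθ⟩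
  have : Stable α ν := ⟨hα, hν_span⟩
  have zr : ∀ t ∈ Icc 0 T, Rep χ ((0 : ℝ → Distr d) t) ((0 : ℝ → ℕ → Bdd d) t) :=
    fun _ _ => Rep.zero
  have m0 : MemCT χ T ε (0 : ℝ → Distr d) :=
    (LO.of_PB (lt_add_one ε) fun t _ => PB.zero).memCT (fun n => continuousOn_const) zr
  have n0 : normCT χ T ε (0 : ℝ → Distr d) = 0 := by
    refine nonpos_iff_eq_zero.1 (iSup₂_le fun t ht => ?_)
    simpa using (zr t ht).besovNorm_le (γ := ε) PB.zero
  refine ⟨fun uT V F muT mV mF => ?_, fun R => ?_, fun j R => ?_⟩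
  · have mr : MemCT χ T ε F.reg := by
      cases F with
      | field f => exact mF
      | drift j => exact m0
    obtain ⟨S, R, hE, hS⟩ := exists_enc hp hε muT mV mr
    obtain ⟨u, hu, mu, hh⟩ := exists_isSolution (ν := ν) hp hT hS hE muT
    refine ⟨u, hu, mu, hh, fun v hv t ht => ?_⟩
    obtain ⟨l, -, K, -, k⟩ := exists_stability (ν := ν) χ hp hT R
    obtain ⟨f, s, h, hf⟩ := hu.exists_isFix hp hT hS hE
    obtain ⟨g, s', h', hg⟩ := hv.exists_isFix hp hT hS hE
    have h0 := (k F.dir F.norm_dir_le S S 0 g f s' s hS hS (SD.Dist.refl S) h' h).1 t ht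
    have e : g t = f t := funext fun n => by
      have := h0 n
      rw [mul_zero, zero_mul, zero_mul, norm_le_zero_iff] at this
      exact sub_eq_zero.1 this
    exact (hg t ht).ext (e ▸ hf t ht)
  · obtain ⟨K, k⟩ := exists_lipschitz (ν := ν) χ hp hT hε R
    exact ⟨K, fun uT vT V W f g u v m1 m2 m3 m4 m5 m6 b1 b2 b3 b4 b5 b6 h1 h2 =>
      k uT vT V W (.field f) (.field g) u v rfl m1 m2 m3 m4 m5 m6 b1 b2 b3 b4 b5 b6 h1 h2⟩
  · obtain ⟨K, k⟩ := exists_lipschitz (ν := ν) χ hp hT hε R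
    refine ⟨K, fun uT vT V W u v m1 m2 m3 m4 b1 b2 b3 b4 h1 h2 => ?_⟩
    have := k uT vT V W (.drift j) (.drift j) u v rfl m1 m2 m3 m4 m0 m0 b1 b2 b3 b4
      (n0.trans_le zero_le) (n0.trans_le zero_le) h1 h2
    rwa [sub_self, n0, add_zero] at this
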